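/- Let $\mathfrak g$ be a finite dimensional complex simple Lie algebra, $(\cdot,\cdot)$ its invariant bilinear form with $(\alpha,\alpha)=2$ for long roots $\alpha$, and $h^\vee=1+\langle\rho,\theta^\vee\rangle$ its dual Coxeter number ($\theta$ the highest root). Let $\hat{\mathfrak g}=\mathfrak g[t,t^{-1}]\oplus\mathbb C K$ be the affine Kac--Moody algebra, with $K$ central and $[xt^n,yt^m]=[x,y]t^{n+m}+n\,\delta_{n,-m}(x,y)K$. Let $\mathfrak f\subseteq\mathfrak g$ be a subalgebra which is reductive in $\mathfrak g$ (that is, $\mathfrak g$ is completely reducible as an $\mathfrak f$-module under the adjoint action). For a $\mathfrak g[t]$-module $M$ and $\kappa\in\mathbb C$ put $$I(M)_\kappa=U(\hat{\mathfrak g})\otimes_{U(\mathfrak g[t]\oplus\mathbb C K)}M,$$ where $K$ acts on $M$ by the scalar $\kappa-h^\vee$. For a $\hat{\mathfrak g}$-module $V$ and $N\ge1$ let $V(N)$ be the subspace of vectors annihilated by the degree $N$ component $U(t\mathfrak g[t])^N$ of $U(t\mathfrak g[t])$ (where $\deg xt^n=n$), and let $V(\infty)=\bigcup_{N\ge1}V(N)$,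 a $\hat{\mathfrak g}$-submodule of $V$. Let $V^d$ be the space of $\eta$ in the full dual $V^*$ with $\dim U(\mathfrak f)\eta<\infty$, a $\hat{\mathfrak g}$-submodule of $V^*$; for a $\hat{\mathfrak g}$-module $W$ let $W^\sharp$ be the twist of $W$ by the automorphism $(xt^k)^\sharp=x(-t)^{-k}$, $K^\sharp=-K$; and put $D(V)=(V^d)^\sharp(\infty)$. **Proposition.** Let $M$ be a $\mathfrak g[t]$-module which, as a $\mathfrak g$-module via $\mathfrak g\hookrightarrow\mathfrak g[t]$, has finite length and is $(\mathfrak g,\mathfrak f)$-admissible: as an $\mathfrak f$-module it is a direct sum of finite dimensional irreducible $\mathfrak f$-modules, each occurring with finite multiplicity. Let $\kappa\in\mathbb C\setminus\mathbb R_{\ge0}$. Then the $\hat{\mathfrak g}$-module $D(I(M)_\kappa)$ has finite length. -/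

import Mathlib

open scoped TensorProduct

noncomputable section

namespace AffineKM

section General

variable {L L' : Type*} [LieRing L] [LieAlgebra ℂ L] [LieRing L'] [LieAlgebra ℂ L']

/-- A module over a Lie algebra `L` has finite length: it has a composition series
`0 = N₀ ⋖ N₁ ⋖ ⋯ ⋖ Nₙ = V` of `L`-submodules. -/
def HasFiniteLength (L V : Type*) [LieRing L] [LieAlgebra ℂ L] [AddCommGroup V] [Module ℂ V]
    [LieRingModule L V] [LieModule ℂ L V] : Prop :=
  ∃ (n : ℕ) (N : Fin (n + 1) → LieSubmodule ℂ L V),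
    N 0 = ⊥ ∧ N (Fin.last n) = ⊤ ∧ ∀ i : Fin n, N i.castSucc ⋖ N i.succ

/-- The pull-back of an `L'`-module `V` along a Lie algebra homomorphism `φ : L → L'`: the same
space, on which `x : L` acts as `φ x`. -/
def Pullback (_φ : L →ₗ⁅ℂ⁆ L') (V : Type*) : Type _ := V

section Pullback

variable (φ : L →ₗ⁅ℂ⁆ L') (V : Type*) [AddCommGroup V] [Module ℂ V] [LieRingModule L' V]
  [LieModule ℂ L' V]

instance : AddCommGroup (Pullback φ V) := inferInstanceAs (AddCommGroup V)
instance : Module ℂ (Pullback φ V) := inferInstanceAs (Module ℂ V)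
instance : LieRingModule L (Pullback φ V) := LieRingModule.compLieHom V φ
instance : LieModule ℂ L (Pullback φ V) := LieModule.compLieHom V φ

end Pullback

end General

variable {𝔤 : Type*} [LieRing 𝔤] [LieAlgebra ℂ 𝔤]

/-- A subalgebra `𝔣` of `𝔤` is reductive in `𝔤`: as an `𝔣`-module under the adjoint action `𝔤` is
completely reducible. -/
def IsReductiveIn (𝔣 : LieSubalgebra ℂ 𝔤) : Prop :=
  ComplementedLattice (LieSubmodule ℂ 𝔣 𝔤)

/-- The finite length admissible `(𝔤, 𝔣)`-modules: `𝔤`-modules of finite length which, restricted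
to `𝔣`, are direct sums of finite dimensional irreducible `𝔣`-modules (the members of `S`), each
of which occurs with finite multiplicity. -/
def IsAdmissible (𝔣 : LieSubalgebra ℂ 𝔤) (M : Type*) [AddCommGroup M] [Module ℂ M]
    [LieRingModule 𝔤 M] [LieModule ℂ 𝔤 M] : Prop :=
  HasFiniteLength 𝔤 M ∧
  ∃ S : Set (LieSubmodule ℂ 𝔣 M),
    sSupIndep S ∧ sSup S = ⊤ ∧
    (∀ N ∈ S, LieModule.IsIrreducible ℂ 𝔣 N ∧ FiniteDimensional ℂ N) ∧
    ∀ N ∈ S, {N' ∈ S | Nonempty (N' ≃ₗ⁅ℂ,𝔣⁆ N)}.Finite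

/-! ### The normalized invariant form and the dual Coxeter number -/

/-- A symmetric invariant bilinear form on `𝔤`. -/
structure InvForm (𝔤 : Type*) [LieRing 𝔤] [LieAlgebra ℂ 𝔤] where
  /-- the form -/
  form : LinearMap.BilinForm ℂ 𝔤
  invariant : form.lieInvariant 𝔤
  symm : form.IsSymm

section Normalization

open LieAlgebra LieAlgebra.IsKilling

variable [FiniteDimensional ℂ 𝔤] [IsKilling ℂ 𝔤] (H : LieSubalgebra ℂ 𝔤) [H.IsCartanSubalgebra]

/-- The squared length `(α, α) = α (t_α)` of a root with respect to the form on the dual of the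
Cartan subalgebra `H` induced by the Killing form; it is a positive rational number. -/
def killingNormSq (α : H.root) : ℝ :=
  ((α : LieModule.Weight ℂ H 𝔤) ((cartanEquivDual H).symm (α : LieModule.Weight ℂ H 𝔤))).re

/-- The squared length of the long roots with respect to the Killing form. -/
def killingLongNormSq : ℝ := ⨆ α : H.root, killingNormSq H α

/-- The invariant form on `𝔤` with `(α, α) = 2` for long roots `α`. (Multiplying a form on `𝔤` by
`c` multiplies the induced form on the dual of `H` by `c⁻¹`.) -/
def normalizedForm : InvForm 𝔤 where
  form := ((killingLongNormSq H / 2 : ℝ) : ℂ) • killingForm ℂ 𝔤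
  invariant := fun x y z ↦ by
    simp only [LinearMap.smul_apply, LieModule.traceForm_lieInvariant ℂ 𝔤 𝔤 x y z, smul_neg]
  symm := ⟨fun x y ↦ by
    simp [LieModule.traceForm_comm ℂ 𝔤 𝔤 x y]⟩

variable {H}

/-- `θ` is the highest root with respect to the base `b`. -/
def IsHighestRoot (b : (rootSystem H).Base) (θ : H.root) : Prop :=
  ∀ α : H.root, b.height α ≤ b.height θ

/-- The dual Coxeter number `h^∨ = 1 + ⟨ρ, θ^∨⟩`, where `θ` is the highest root: one plus the sum of
the coefficients of the coroot `θ^∨` with respect to the simple coroots. -/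
def dualCoxeterNumber (b : (rootSystem H).Base) (θ : H.root) : ℤ :=
  1 + b.flip.height θ

end Normalization

/-! ### The affine Kac-Moody algebra -/

variable (B : InvForm 𝔤)

/-- The cocycle `(x tⁿ, y tᵐ) ↦ n δ_{n,-m} (x, y)` on the loop algebra `𝔤[t, t⁻¹]`. (Mathlib's
cocycle attached to a form is `(x tⁿ, y tᵐ) ↦ m δ_{m,-n} (x, y)`, whence the sign.) -/
def affineCocycle : LieModule.Cohomology.twoCocycle ℂ (LieAlgebra.loopAlgebra ℂ ℤ 𝔤)
    (TrivialLieModule ℂ (LieAlgebra.loopAlgebra ℂ ℤ 𝔤) ℂ) :=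
  LieAlgebra.LoopAlgebra.twoCocycleOfBilinear ℂ ℤ 𝔤 (-B.form)
    (fun x y z ↦ by
      simp only [LinearMap.neg_apply, B.invariant x y z])
    ⟨fun x y ↦ by simpa using B.symm.eq x y⟩

/-- The affine Kac-Moody algebra: the central extension of the loop algebra `𝔤[t, t⁻¹]` by `ℂ K`
given by the above cocycle. -/
abbrev Affine : Type _ := LieAlgebra.ofTwoCocycle (affineCocycle B)

namespace Affine

/-- The linear embedding of the loop algebra. -/
def ofLoop : LieAlgebra.loopAlgebra ℂ ℤ 𝔤 →ₗ[ℂ] Affine B where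
  toFun f := LieAlgebra.ofProd _ (f, 0)
  map_add' f g := by simp [← LieAlgebra.of_add]
  map_smul' c f := by simp [← LieAlgebra.of_smul]

/-- The element `x tⁿ`. -/
def cur (n : ℤ) : 𝔤 →ₗ[ℂ] Affine B :=
  ofLoop B ∘ₗ TensorProduct.mk ℂ (AddMonoidAlgebra ℂ ℤ) 𝔤 (AddMonoidAlgebra.single n 1)

/-- The central element `K`. -/
def K : Affine B := LieAlgebra.ofProd _ (0, (TrivialLieModule.equiv ℂ _ ℂ).symm 1)

theorem lie_cur_cur (n m : ℤ) (x y : 𝔤) :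
    ⁅cur B n x, cur B m y⁆ =
      cur B (n + m) ⁅x, y⁆ + (if n = -m then (n : ℂ) * B.form x y else 0) • K B := by
  rw [LieAlgebra.bracket_ofTwoCocycle]
  apply (LieAlgebra.ofProd (affineCocycle B)).symm.injective
  refine Prod.ext ?_ ?_
  · change ⁅(AddMonoidAlgebra.single n 1 ⊗ₜ[ℂ] x : LieAlgebra.loopAlgebra ℂ ℤ 𝔤),
        (AddMonoidAlgebra.single m 1 ⊗ₜ[ℂ] y : LieAlgebra.loopAlgebra ℂ ℤ 𝔤)⁆ =
      AddMonoidAlgebra.single (n + m) 1 ⊗ₜ[ℂ] ⁅x, y⁆ +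
        (if n = -m then (n : ℂ) * B.form x y else 0) • 0
    rw [LieAlgebra.ExtendScalars.bracket_tmul, AddMonoidAlgebra.single_mul_single, smul_zero,
      add_zero, mul_one]
  · change LieAlgebra.LoopAlgebra.residuePairing ℂ ℤ 𝔤 (-B.form)
        (AddMonoidAlgebra.single n 1 ⊗ₜ[ℂ] x) (AddMonoidAlgebra.single m 1 ⊗ₜ[ℂ] y) + 0 - 0 =
      (0 : ℂ) + (if n = -m then (n : ℂ) * B.form x y else 0) * 1
    rw [LieAlgebra.LoopAlgebra.residuePairing_apply_apply,
      LieAlgebra.LoopAlgebra.toFinsupp_single_tmul, LieAlgebra.LoopAlgebra.toFinsupp_single_tmul,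
      Finsupp.sum_single_index (by simp)]
    by_cases h : n = -m
    · subst h
      simp
    · simp [h]

theorem lie_K (y : Affine B) : ⁅y, K B⁆ = 0 := by
  rw [LieAlgebra.bracket_ofTwoCocycle]
  apply (LieAlgebra.ofProd (affineCocycle B)).symm.injective
  refine Prod.ext ?_ ?_
  · simp [K]
  · simp [K, trivial_lie_zero]

/-- Every element of the affine algebra is a combination of the `x tⁿ` and `K`. -/
theorem induction {P : Affine B → Prop} (hcur : ∀ n x, P (cur B n x)) (hK : ∀ c : ℂ, P (c • K B))
    (hadd : ∀ y z, P y → P z → P (y + z)) (y : Affine B) : P y := by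
  have h0 : P 0 := by simpa using hK 0
  obtain ⟨f, c⟩ := y
  have h : (⟨(f, c)⟩ : Affine B) = ofLoop B f + (TrivialLieModule.equiv ℂ _ ℂ c) • K B := by
    apply (LieAlgebra.ofProd (affineCocycle B)).symm.injective
    refine Prod.ext ?_ ?_
    · simp [ofLoop, K]; rfl
    · exact ((zero_add _).trans (mul_one (TrivialLieModule.equiv ℂ _ ℂ c))).symm
  rw [h]
  clear h
  refine hadd _ _ ?_ (hK _)
  induction f using TensorProduct.induction_on with
  | zero => simpa using h0
  | add f g hf hg => rw [map_add]; exact hadd _ _ hf hg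
  | tmul p x =>
    induction p using AddMonoidAlgebra.induction_linear with
    | zero => simpa using h0
    | add p q hp hq => rw [TensorProduct.add_tmul, map_add]; exact hadd _ _ hp hq
    | single n a =>
      have : (AddMonoidAlgebra.single n a : AddMonoidAlgebra ℂ ℤ) ⊗ₜ[ℂ] x =
          AddMonoidAlgebra.single n (1 : ℂ) ⊗ₜ[ℂ] (a • x) := by
        rw [← TensorProduct.smul_tmul, AddMonoidAlgebra.smul_single, smul_eq_mul, mul_one]
      rw [this]
      exact hcur n (a • x)

/-- The automorphism `x tᵏ ↦ x (-t)^{-k}` of the loop algebra. -/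
def sharpLoop : LieAlgebra.loopAlgebra ℂ ℤ 𝔤 →ₗ⁅ℂ⁆ LieAlgebra.loopAlgebra ℂ ℤ 𝔤 :=
  LieAlgebra.ExtendScalars.map
    (AddMonoidAlgebra.lift ℂ (AddMonoidAlgebra ℂ ℤ) ℤ
      { toFun := fun n ↦ AddMonoidAlgebra.single (-n.toAdd) ((-1 : ℂ) ^ n.toAdd)
        map_one' := by simp
        map_mul' := fun n m ↦ by
          rw [AddMonoidAlgebra.single_mul_single, toAdd_mul, zpow_add₀ (by norm_num), neg_add] })
    LieHom.id

theorem sharpLoop_single (n : ℤ) (x : 𝔤) :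
    sharpLoop (AddMonoidAlgebra.single n (1 : ℂ) ⊗ₜ[ℂ] x) =
      (-1 : ℂ) ^ n • (AddMonoidAlgebra.single (-n) (1 : ℂ) ⊗ₜ[ℂ] x) := by
  rw [sharpLoop, LieAlgebra.ExtendScalars.map_apply_tmul, AddMonoidAlgebra.lift_single,
    TensorProduct.smul_tmul', AddMonoidAlgebra.smul_single, smul_eq_mul, mul_one, one_smul]
  rfl

/-- The underlying linear map of `sharp`. -/
def sharpLin : Affine B →ₗ[ℂ] Affine B where
  toFun y := LieAlgebra.ofProd _
    (sharpLoop ((LieAlgebra.ofProd _).symm y).1, -((LieAlgebra.ofProd _).symm y).2)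
  map_add' y z := by simp [← LieAlgebra.of_add, add_comm]
  map_smul' c y := by simp [← LieAlgebra.of_smul]

theorem sharpLin_cur (n : ℤ) (x : 𝔤) :
    sharpLin B (cur B n x) = (-1 : ℂ) ^ n • cur B (-n) x := by
  apply (LieAlgebra.ofProd (affineCocycle B)).symm.injective
  refine Prod.ext ?_ ?_
  · exact sharpLoop_single n x
  · change -(0 : ℂ) = (-1 : ℂ) ^ n * 0
    simp

theorem sharpLin_K : sharpLin B (K B) = -K B := by
  rw [← neg_one_smul ℂ (K B)]
  apply (LieAlgebra.ofProd (affineCocycle B)).symm.injective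
  refine Prod.ext ?_ ?_
  · change sharpLoop 0 = (-1 : ℂ) • 0
    simp
  · change -(1 : ℂ) = (-1 : ℂ) * 1
    simp

/-- The automorphism `♯` of the affine algebra: `(x tᵏ)^♯ = x (-t)^{-k}`, `K^♯ = -K`. -/
def sharp : Affine B →ₗ⁅ℂ⁆ Affine B where
  __ := sharpLin B
  map_lie' := by
    intro y z
    change sharpLin B ⁅y, z⁆ = ⁅sharpLin B y, sharpLin B z⁆
    induction y using induction with
    | hK c => 
      rw [← lie_skew, lie_smul, lie_K, map_smul, sharpLin_K, ← lie_skew, lie_smul, lie_neg, lie_K]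
      simp
    | hadd y y' hy hy' => simp only [add_lie, map_add, hy, hy']
    | hcur n x =>
      induction z using induction with
      | hK c => 
        rw [lie_smul, lie_K, map_smul (sharpLin B) c (K B), sharpLin_K, lie_smul, lie_neg, lie_K]
        simp
      | hadd y y' hy hy' => simp only [lie_add, map_add, hy, hy']
      | hcur m y =>
        rw [lie_cur_cur, map_add, map_smul, sharpLin_K, sharpLin_cur, sharpLin_cur, sharpLin_cur,
          lie_smul, smul_lie, lie_cur_cur, neg_add, smul_smul, zpow_add₀ (by norm_num), smul_add,
          mul_comm]
        congr 1
        by_cases h : n = -m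
        · subst h
          have : (-1 : ℂ) ^ m * ((-1 : ℂ) ^ m)⁻¹ = 1 :=
            mul_inv_cancel₀ (zpow_ne_zero _ (by norm_num))
          simp [smul_smul, this]
        · rw [if_neg h, if_neg (by omega)]
          simp

theorem sharp_cur (n : ℤ) (x : 𝔤) : sharp B (cur B n x) = (-1 : ℂ) ^ n • cur B (-n) x :=
  sharpLin_cur B n x

theorem sharp_K : sharp B (K B) = -K B := sharpLin_K B

/-- The embedding of `𝔤` as the constant loops `x t⁰`. -/
def const : 𝔤 →ₗ⁅ℂ⁆ Affine B where
  __ := cur B 0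
  map_lie' := by
    intro x y
    change cur B 0 ⁅x, y⁆ = ⁅cur B 0 x, cur B 0 y⁆
    simp [lie_cur_cur]

end Affine

/-! ### The current algebra and induced modules -/

/-- The current algebra `𝔤[t] = ℂ[t] ⊗ 𝔤`. -/
abbrev Current (𝔤 : Type*) [LieRing 𝔤] [LieAlgebra ℂ 𝔤] : Type _ := Polynomial ℂ ⊗[ℂ] 𝔤

namespace Current

/-- The embedding of `𝔤` in `𝔤[t]` as the constant polynomials. -/
def const (𝔤 : Type*) [LieRing 𝔤] [LieAlgebra ℂ 𝔤] : 𝔤 →ₗ⁅ℂ⁆ Current 𝔤 where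
  __ := TensorProduct.mk ℂ (Polynomial ℂ) 𝔤 1
  map_lie' := by
    intro x y
    simp

/-- The embedding of `𝔤[t]` in the affine algebra, as a linear map: `x tⁿ ↦ x tⁿ`. -/
def toAffine : Current 𝔤 →ₗ[ℂ] Affine B :=
  Affine.ofLoop B ∘ₗ
    LinearMap.rTensor 𝔤 (Polynomial.toLaurentAlg (R := ℂ)).toLinearMap

theorem toAffine_monomial (n : ℕ) (x : 𝔤) :
    toAffine B (Polynomial.monomial n (1 : ℂ) ⊗ₜ[ℂ] x) = Affine.cur B n x := by
  change Affine.ofLoop B (Polynomial.toLaurent (Polynomial.monomial n (1 : ℂ)) ⊗ₜ[ℂ] x) = _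
  rw [Polynomial.toLaurent_C_mul_T, map_one, one_mul]
  rfl

end Current

/-- The universal enveloping algebra of the affine algebra. -/
abbrev UAffine : Type _ := UniversalEnvelopingAlgebra ℂ (Affine B)

section Induced

variable (M : Type*) [AddCommGroup M] [Module ℂ M] [LieRingModule (Current 𝔤) M]
  [LieModule ℂ (Current 𝔤) M] (k : ℂ)

/-- The relations `u (y + z K) ⊗ m = u ⊗ (y + z K) m` for `y ∈ 𝔤[t]`, `z ∈ ℂ`, where `K` acts on
`M` by the scalar `k`. -/
def inducedRelations : Submodule (UAffine B) (UAffine B ⊗[ℂ] M) :=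
  Submodule.span (UAffine B)
    {w | ∃ (u : UAffine B) (y : Current 𝔤) (z : ℂ) (m : M),
      w = (u * UniversalEnvelopingAlgebra.ι ℂ (Current.toAffine B y + z • Affine.K B)) ⊗ₜ[ℂ] m
        - u ⊗ₜ[ℂ] (⁅y, m⁆ + (z * k) • m)}

/-- The induced module `I(M) = U(𝔤̂) ⊗_{U(𝔤[t] ⊕ ℂ K)} M`, where `K` acts on `M` by `k`: the
quotient of `U(𝔤̂) ⊗_ℂ M` which makes the tensor product balanced over `𝔤[t] ⊕ ℂ K`, and hence
over its enveloping algebra. -/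
def Induced : Type _ := (UAffine B ⊗[ℂ] M) ⧸ inducedRelations B M k

instance : AddCommGroup (Induced B M k) :=
  inferInstanceAs (AddCommGroup ((UAffine B ⊗[ℂ] M) ⧸ inducedRelations B M k))

instance : Module (UAffine B) (Induced B M k) :=
  inferInstanceAs (Module (UAffine B) ((UAffine B ⊗[ℂ] M) ⧸ inducedRelations B M k))

instance : Module ℂ (Induced B M k) :=
  inferInstanceAs (Module ℂ ((UAffine B ⊗[ℂ] M) ⧸ inducedRelations B M k))

instance : IsScalarTower ℂ (UAffine B) (Induced B M k) :=
  inferInstanceAs (IsScalarTower ℂ (UAffine B) ((UAffine B ⊗[ℂ] M) ⧸ inducedRelations B M k))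

/-- The affine algebra acts on the induced module through its enveloping algebra. -/
instance : LieRingModule (Affine B) (Induced B M k) where
  bracket y v := UniversalEnvelopingAlgebra.ι ℂ y • v
  add_lie y z v := by simp only [map_add, add_smul]
  lie_add y v w := by simp only [smul_add]
  leibniz_lie y z v := by
    simp only [LieHom.map_lie, LieRing.of_associative_ring_bracket, sub_smul, mul_smul]
    abel

instance : LieModule ℂ (Affine B) (Induced B M k) where
  smul_lie c y v := by
    change UniversalEnvelopingAlgebra.ι ℂ (c • y) • v = c • UniversalEnvelopingAlgebra.ι ℂ y • v
    rw [map_smul, smul_assoc]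
  lie_smul c y v := by
    change UniversalEnvelopingAlgebra.ι ℂ y • c • v = c • UniversalEnvelopingAlgebra.ι ℂ y • v
    rw [← algebraMap_smul (UAffine B) c v, ← algebraMap_smul (UAffine B) c, smul_smul, smul_smul,
      Algebra.commutes]

end Induced

/-! ### The strictly smooth part -/

section Smooth

/-- The degree `N` component `U(t 𝔤[t])^N` of the enveloping algebra of `t 𝔤[t]`, inside the
enveloping algebra of the affine algebra: the span of the products `(x₁ t^{n₁}) ⋯ (x_r t^{n_r})`
with all `nᵢ ≥ 1` and `n₁ + ⋯ + n_r = N`. -/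
def posPart (N : ℕ) : Submodule ℂ (UAffine B) :=
  Submodule.span ℂ
    {u | ∃ l : List (ℕ × 𝔤), (∀ p ∈ l, 1 ≤ p.1) ∧ (l.map Prod.fst).sum = N ∧
      u = (l.map fun p ↦ UniversalEnvelopingAlgebra.ι ℂ (Affine.cur B p.1 p.2)).prod}

variable (V : Type*) [AddCommGroup V] [Module ℂ V] [LieRingModule (Affine B) V]
  [LieModule ℂ (Affine B) V]

/-- The action of the enveloping algebra on a module over the affine algebra. -/
def envAction : UAffine B →ₐ[ℂ] Module.End ℂ V :=
  UniversalEnvelopingAlgebra.lift ℂ (LieModule.toEnd ℂ (Affine B) V)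

/-- `V(N)`: the vectors annihilated by `U(t 𝔤[t])^N`. -/
def annih (N : ℕ) : Submodule ℂ V where
  carrier := {v | ∀ u ∈ posPart B N, envAction B V u v = 0}
  add_mem' hv hw u hu := by rw [map_add, hv u hu, hw u hu, add_zero]
  zero_mem' u _ := map_zero _
  smul_mem' c v hv u hu := by rw [map_smul, hv u hu, smul_zero]

variable {V}

theorem envAction_ι (y : Affine B) (v : V) :
    envAction B V (UniversalEnvelopingAlgebra.ι ℂ y) v = ⁅y, v⁆ := by
  rw [envAction, UniversalEnvelopingAlgebra.lift_ι_apply]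
  rfl

theorem mem_annih_iff {N : ℕ} {v : V} :
    v ∈ annih B V N ↔ ∀ l : List (ℕ × 𝔤), (∀ p ∈ l, 1 ≤ p.1) → (l.map Prod.fst).sum = N →
      envAction B V
        (l.map fun p ↦ UniversalEnvelopingAlgebra.ι ℂ (Affine.cur B p.1 p.2)).prod v = 0 := by
  constructor
  · intro h l h1 h2
    exact h _ (Submodule.subset_span ⟨l, h1, h2, rfl⟩)
  · intro h u hu
    induction hu using Submodule.span_induction with
    | mem u hu => obtain ⟨l, h1, h2, rfl⟩ := hu; exact h l h1 h2
    | zero => simp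
    | add u w _ _ hu hw => rw [map_add, LinearMap.add_apply, hu, hw, add_zero]
    | smul c u _ hu => rw [map_smul, LinearMap.smul_apply, hu, smul_zero]

theorem lie_mem_annih {N n : ℕ} (hn : 1 ≤ n) (x : 𝔤) {v : V} (hv : v ∈ annih B V (N + n)) :
    ⁅Affine.cur B n x, v⁆ ∈ annih B V N := by
  rw [mem_annih_iff] at hv ⊢
  intro l h1 h2
  have := hv (l ++ [(n, x)]) (by
    intro p hp
    rcases List.mem_append.1 hp with hp | hp
    · exact h1 p hp
    · rw [List.mem_singleton.1 hp]; exact hn) (by simp [h2])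
  rw [List.map_append, List.prod_append, map_mul, Module.End.mul_apply, List.map_singleton,
    List.prod_singleton, envAction_ι] at this
  exact this

theorem annih_zero : annih B V 0 = ⊥ := by
  rw [eq_bot_iff]
  intro v hv
  simpa using (mem_annih_iff B).1 hv [] (by simp) (by simp)

theorem span_lie_eq_top [LieAlgebra.IsSimple ℂ 𝔤] :
    Submodule.span ℂ {m : 𝔤 | ∃ y z : 𝔤, ⁅y, z⁆ = m} = ⊤ := by
  have h : ⁅(⊤ : LieIdeal ℂ 𝔤), (⊤ : LieIdeal ℂ 𝔤)⁆ = ⊤ := by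
    rcases LieAlgebra.IsSimple.eq_bot_or_eq_top (R := ℂ) ⁅(⊤ : LieIdeal ℂ 𝔤), (⊤ : LieIdeal ℂ 𝔤)⁆
      with h | h
    · exfalso
      refine LieAlgebra.IsSimple.non_abelian (R := ℂ) (L := 𝔤) ⟨fun x y ↦ ?_⟩
      have := LieSubmodule.lie_mem_lie (LieSubmodule.mem_top (R := ℂ) (L := 𝔤) x)
        (LieSubmodule.mem_top (R := ℂ) (L := 𝔤) y)
      rw [h] at this
      simpa using this
    · exact h
  have h2 := LieSubmodule.lieIdeal_oper_eq_linear_span' (⊤ : LieIdeal ℂ 𝔤) (⊤ : LieIdeal ℂ 𝔤)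
  rw [h, LieSubmodule.top_toSubmodule] at h2
  rw [h2]
  simp

/-- As `𝔤` is perfect, `v ∈ V(N + 1)` as soon as `(x t) v ∈ V(N)` for all `x`. -/
theorem mem_annih_succ [LieAlgebra.IsSimple ℂ 𝔤] {N : ℕ} {v : V}
    (h : ∀ x : 𝔤, ⁅Affine.cur B 1 x, v⁆ ∈ annih B V N) : v ∈ annih B V (N + 1) := by
  have key : ∀ (n : ℕ) (l : List (ℕ × 𝔤)) (x : 𝔤), (∀ p ∈ l, 1 ≤ p.1) →
      (l.map Prod.fst).sum + (n + 1) = N + 1 →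
      envAction B V (l.map fun p ↦ UniversalEnvelopingAlgebra.ι ℂ (Affine.cur B p.1 p.2)).prod
        ⁅Affine.cur B ((n + 1 : ℕ) : ℤ) x, v⁆ = 0 := by
    intro n
    induction n with
    | zero =>
      intro l x h1 h2
      refine (mem_annih_iff B).1 ?_ l h1 (by omega : _ = N)
      simpa using h x
    | succ n ih =>
      intro l x h1 h2
      have hx : x ∈ Submodule.span ℂ {m : 𝔤 | ∃ y z : 𝔤, ⁅y, z⁆ = m} := by
        rw [span_lie_eq_top]; trivial
      induction hx using Submodule.span_induction with
      | zero => simp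
      | add y z _ _ hy hz => rw [map_add, add_lie, map_add, hy, hz, add_zero]
      | smul c y _ hy => rw [map_smul, smul_lie, map_smul, hy, smul_zero]
      | mem x hx =>
        obtain ⟨y, z, rfl⟩ := hx
        have e : Affine.cur B ((n + 1 + 1 : ℕ) : ℤ) ⁅y, z⁆ =
            ⁅Affine.cur B ((n + 1 : ℕ) : ℤ) y, Affine.cur B ((1 : ℕ) : ℤ) z⁆ := by
          rw [Affine.lie_cur_cur, if_neg (by omega), zero_smul, add_zero]
          norm_cast
        rw [e, lie_lie, map_sub]
        have e1 := (mem_annih_iff B).1 (h z) (l ++ [(n + 1, y)]) (by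
          intro p hp
          rcases List.mem_append.1 hp with hp | hp
          · exact h1 p hp
          · rw [List.mem_singleton.1 hp]; simp) (by simp; omega)
        have e2 := ih (l ++ [(1, z)]) y (by
          intro p hp
          rcases List.mem_append.1 hp with hp | hp
          · exact h1 p hp
          · rw [List.mem_singleton.1 hp]) (by simp; omega)
        rw [List.map_append, List.prod_append, map_mul, Module.End.mul_apply, List.map_singleton,
          List.prod_singleton, envAction_ι] at e1 e2
        rw [Nat.cast_one] at e2 ⊢
        rw [e1, e2, sub_zero]
  rw [mem_annih_iff]
  intro l h1 h2
  rcases List.eq_nil_or_concat l with rfl | ⟨l', ⟨n, x⟩, rfl⟩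
  · simp at h2
  · have hn : 1 ≤ n := h1 (n, x) (by simp)
    obtain ⟨n, rfl⟩ : ∃ m, n = m + 1 := ⟨n - 1, by omega⟩
    rw [List.concat_eq_append] at *
    rw [List.map_append, List.prod_append, map_mul, Module.End.mul_apply, List.map_singleton,
      List.prod_singleton, envAction_ι]
    refine key n l' x (fun p hp ↦ h1 p (by simp [hp])) ?_
    simpa using h2

theorem annih_mono [LieAlgebra.IsSimple ℂ 𝔤] : Monotone (annih B V) := by
  refine monotone_nat_of_le_succ fun N ↦ ?_
  induction N with
  | zero => rw [annih_zero]; exact bot_le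
  | succ N ih =>
    intro v hv
    exact mem_annih_succ B fun x ↦ ih (lie_mem_annih B le_rfl x hv)

theorem lie_K_mem_annih [LieAlgebra.IsSimple ℂ 𝔤] (N : ℕ) {v : V} (hv : v ∈ annih B V N) :
    ⁅Affine.K B, v⁆ ∈ annih B V N := by
  induction N generalizing v with
  | zero =>
    rw [annih_zero, Submodule.mem_bot] at hv ⊢
    rw [hv, lie_zero]
  | succ N ih =>
    refine mem_annih_succ B fun x ↦ ?_
    rw [leibniz_lie, Affine.lie_K, zero_lie, zero_add]
    exact ih (lie_mem_annih B le_rfl x hv)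

theorem exists_cur_mem_annih [LieAlgebra.IsSimple ℂ 𝔤] (n : ℤ) (N : ℕ) :
    ∃ N' : ℕ, ∀ (x : 𝔤) (v : V), v ∈ annih B V N → ⁅Affine.cur B n x, v⁆ ∈ annih B V N' := by
  have key : ∀ (k N : ℕ), ∃ N' : ℕ, ∀ (x : 𝔤) (v : V), v ∈ annih B V N →
      ⁅Affine.cur B (1 - k) x, v⁆ ∈ annih B V N' := by
    intro k
    induction k with
    | zero =>
      refine fun N ↦ ⟨N, fun x v hv ↦ ?_⟩
      have := lie_mem_annih B le_rfl x (annih_mono B (Nat.le_succ N) hv)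
      simpa using this
    | succ k ihk =>
      intro N
      induction N with
      | zero =>
        refine ⟨0, fun x v hv ↦ ?_⟩
        rw [annih_zero, Submodule.mem_bot] at hv ⊢
        rw [hv, lie_zero]
      | succ N ihN =>
        obtain ⟨N₁, h₁⟩ := ihN
        obtain ⟨N₂, h₂⟩ := ihk (N + 1)
        refine ⟨max (max N₁ N₂) (N + 1) + 1, fun x v hv ↦ mem_annih_succ B fun a ↦ ?_⟩
        rw [leibniz_lie, Affine.lie_cur_cur, add_lie, smul_lie]
        refine add_mem (add_mem ?_ (Submodule.smul_mem _ _ ?_)) ?_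
        · have e : (1 : ℤ) + (1 - ((k + 1 : ℕ) : ℤ)) = 1 - (k : ℤ) := by push_cast; ring
          rw [e]
          exact annih_mono B (by omega) (h₂ _ v hv)
        · exact annih_mono B (by omega) (lie_K_mem_annih B _ hv)
        · exact annih_mono B (by omega) (h₁ x _ (lie_mem_annih B le_rfl a hv))
  by_cases hn : 1 ≤ n
  · refine ⟨N, fun x v hv ↦ ?_⟩
    obtain ⟨m, rfl⟩ := Int.eq_ofNat_of_zero_le (show 0 ≤ n by omega)
    exact lie_mem_annih B (by omega) x (annih_mono B (Nat.le_add_right _ _) hv)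
  · obtain ⟨N', h⟩ := key (1 - n).toNat N
    refine ⟨N', fun x v hv ↦ ?_⟩
    have := h x v hv
    rwa [Int.toNat_of_nonneg (by omega), sub_sub_cancel] at this

variable (V)

/-- The strictly smooth part `V(∞) = ⋃_{N ≥ 1} V(N)` of a module over the affine algebra. -/
def smoothPart [LieAlgebra.IsSimple ℂ 𝔤] : LieSubmodule ℂ (Affine B) V where
  carrier := {v | ∃ N : ℕ, 1 ≤ N ∧ v ∈ annih B V N}
  add_mem' := by
    rintro v w ⟨N, hN, hv⟩ ⟨N', _, hw⟩
    exact ⟨max N N', le_max_of_le_left hN, add_mem (annih_mono B (le_max_left _ _) hv)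
      (annih_mono B (le_max_right _ _) hw)⟩
  zero_mem' := ⟨1, le_rfl, zero_mem _⟩
  smul_mem' := by
    rintro c v ⟨N, hN, hv⟩
    exact ⟨N, hN, Submodule.smul_mem _ c hv⟩
  lie_mem := by
    rintro y v ⟨N, hN, hv⟩
    change ∃ N : ℕ, 1 ≤ N ∧ ⁅y, v⁆ ∈ annih B V N
    induction y using Affine.induction with
    | hcur n x =>
      obtain ⟨N', h⟩ := exists_cur_mem_annih (V := V) B n N
      exact ⟨N' + 1, by omega, annih_mono B (Nat.le_succ _) (h x v hv)⟩
    | hK c =>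
      refine ⟨N, hN, ?_⟩
      rw [smul_lie]
      exact Submodule.smul_mem _ _ (lie_K_mem_annih B N hv)
    | hadd y z hy hz =>
      obtain ⟨N₁, h₁, hy⟩ := hy
      obtain ⟨N₂, h₂, hz⟩ := hz
      refine ⟨max N₁ N₂, by omega, ?_⟩
      rw [add_lie]
      exact add_mem (annih_mono B (le_max_left _ _) hy) (annih_mono B (le_max_right _ _) hz)

end Smooth

/-! ### The restricted dual and the duality functor -/

section Dual

variable (𝔣 : LieSubalgebra ℂ 𝔤) (V : Type*) [AddCommGroup V] [Module ℂ V]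
  [LieRingModule (Affine B) V] [LieModule ℂ (Affine B) V]

/-- The restricted dual `V^d`: the `U(𝔣)`-finite vectors of the full dual of `V`, that is, those
contained in a finite dimensional subspace stable under `𝔣 ⊆ 𝔤 ⊆ 𝔤̂`. On the dual, `y ∈ 𝔤̂` acts by
`(y η)(v) = -η(y v)`. -/
def restrictedDual [FiniteDimensional ℂ 𝔤] : LieSubmodule ℂ (Affine B) (Module.Dual ℂ V) where
  carrier := {η | ∃ W : Submodule ℂ (Module.Dual ℂ V), FiniteDimensional ℂ W ∧ η ∈ W ∧
    ∀ x ∈ 𝔣, ∀ w ∈ W, ⁅Affine.const B x, w⁆ ∈ W}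
  add_mem' := by
    rintro η ξ ⟨W, _, hη, hW⟩ ⟨W', _, hξ, hW'⟩
    refine ⟨W ⊔ W', inferInstance, Submodule.add_mem_sup hη hξ, fun x hx w hw ↦ ?_⟩
    obtain ⟨a, ha, b, hb, rfl⟩ := Submodule.mem_sup.1 hw
    rw [lie_add]
    exact Submodule.add_mem_sup (hW x hx a ha) (hW' x hx b hb)
  zero_mem' := ⟨⊥, inferInstance, zero_mem _, fun x _ w hw ↦ by
    rw [Submodule.mem_bot] at hw ⊢
    rw [hw, lie_zero]⟩
  smul_mem' := by
    rintro c η ⟨W, hfin, hη, hW⟩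
    exact ⟨W, hfin, Submodule.smul_mem _ c hη, hW⟩
  lie_mem := by
    rintro y η ⟨W, hfin, hη, hW⟩
    change ∃ W : Submodule ℂ (Module.Dual ℂ V), FiniteDimensional ℂ W ∧ ⁅y, η⁆ ∈ W ∧
      ∀ x ∈ 𝔣, ∀ w ∈ W, ⁅Affine.const B x, w⁆ ∈ W
    induction y using Affine.induction with
    | hcur n x =>
      let f : 𝔤 →ₗ[ℂ] Module.Dual ℂ V →ₗ[ℂ] Module.Dual ℂ V :=
        (LieModule.toEnd ℂ (Affine B) (Module.Dual ℂ V) : Affine B →ₗ[ℂ] _) ∘ₗ Affine.cur B n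
      refine ⟨Submodule.map₂ f ⊤ W, ?_, Submodule.apply_mem_map₂ f Submodule.mem_top hη, ?_⟩
      · exact Module.Finite.iff_fg.2
          ((Module.finite_def.1 inferInstance).map₂ f (Module.Finite.iff_fg.1 hfin))
      · intro a ha w hw
        refine (Submodule.map₂_le (r := (Submodule.map₂ f ⊤ W).comap
          (LieModule.toEnd ℂ (Affine B) (Module.Dual ℂ V) (Affine.const B a)))).2 ?_ hw
        intro z _ w hw
        change ⁅Affine.cur B 0 a, ⁅Affine.cur B n z, w⁆⁆ ∈ Submodule.map₂ f ⊤ W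
        rw [leibniz_lie, Affine.lie_cur_cur, Int.cast_zero, zero_mul, ite_self, zero_smul,
          add_zero, zero_add]
        exact add_mem (Submodule.apply_mem_map₂ f (Submodule.mem_top (x := ⁅a, z⁆)) hw)
          (Submodule.apply_mem_map₂ f (Submodule.mem_top (x := z)) (hW a ha w hw))
    | hK c =>
      refine ⟨W.map (LieModule.toEnd ℂ (Affine B) (Module.Dual ℂ V) (c • Affine.K B)),
        inferInstance, Submodule.mem_map_of_mem hη, ?_⟩
      rintro a ha _ ⟨w, hw, rfl⟩
      refine ⟨⁅Affine.const B a, w⁆, hW a ha w hw, ?_⟩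
      change ⁅c • Affine.K B, ⁅Affine.const B a, w⁆⁆ = ⁅Affine.const B a, ⁅c • Affine.K B, w⁆⁆
      rw [leibniz_lie (Affine.const B a), lie_smul, Affine.lie_K, smul_zero, zero_lie, zero_add]
    | hadd y z hy hz =>
      obtain ⟨W₁, _, hy, h₁⟩ := hy
      obtain ⟨W₂, _, hz, h₂⟩ := hz
      refine ⟨W₁ ⊔ W₂, inferInstance, ?_, fun x hx w hw ↦ ?_⟩
      · rw [add_lie]
        exact Submodule.add_mem_sup hy hz
      · obtain ⟨a, ha, b, hb, rfl⟩ := Submodule.mem_sup.1 hw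
        rw [lie_add]
        exact Submodule.add_mem_sup (h₁ x hx a ha) (h₂ x hx b hb)

/-- The dual module `D(V) = (V^d)^♯(∞)`. -/
abbrev DualModule [FiniteDimensional ℂ 𝔤] [LieAlgebra.IsSimple ℂ 𝔤] :
    LieSubmodule ℂ (Affine B) (Pullback (Affine.sharp B) (restrictedDual B 𝔣 V)) :=
  smoothPart B (Pullback (Affine.sharp B) (restrictedDual B 𝔣 V))

end Dual

end AffineKM

end

open AffineKM

open scoped TensorProduct

noncomputable section

set_option linter.unusedSectionVars false

namespace AffineKM

/-! ### Finitely generated modules over finite dimensional Lie algebras are Noetherian -/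

section Noetherian

open MvPolynomial

variable {L Y : Type*} [LieRing L] [LieAlgebra ℂ L] [AddCommGroup Y] [Module ℂ Y]
  [LieRingModule L Y] [LieModule ℂ L Y] {J : Type*} [Fintype J]

/-! Put `k = κ - h^∨` and let `V` be the twisted restricted dual of the induced module, filtered by
the subspaces `V(n)`. The sign changes of duality and of `♯` cancel, so `K` acts on `V` by `k`.

Layers. Applying `n` operators `x t` to a vector of `V(n + 1)` and restricting the resulting
functional to `M` gives its jet of order `n`. This is a `𝔤`-equivariant embedding of `V(n + 1) /
V(n)` into the `𝔣`-finite dual of `E ⊗ M`, where `E` is the `n`-th tensor power of `𝔤` (`IsJet`,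
`exists_isJet`). Such a dual satisfies both chain conditions (`wellFounded_finDual_tensor`): since
the `𝔣`-multiplicities are finite, modules of `𝔣`-finite functionals are determined by their
annihilators (`mem_of_vanish`, `orth_strictAnti`). It remains to see that a submodule of `V(∞)` is
determined by finitely many of its layers.

Sugawara operators. The truncated operator `sugSum` commutes with `x t` up to `s = 2 c k + 1` times
`x t` and a remainder that dies on vectors of bounded order (`curEnd_sugSum`). On jets of order `n`
it therefore becomes the Casimir operator of `M` plus `n s`, while its zero mode becomes the Casimir
operator of `E ⊗ M`. The operator `jetOp`, zero mode minus Sugawara operator plus `n s`, is thus the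
transpose of `casDiff`, the Casimir operator of `E ⊗ M` minus that of `M`. But the nonzero modes of
the Sugawara operator begin with a positive mode, which lowers the order; so modulo a submodule
containing the vectors of lower order, `jetOp` is the scalar `n s` (`aeval_jetOp_sub_mem`). For the
normalized form `s` is a positive multiple of `κ`, because the Casimir operator of the adjoint
representation is the identity (`killingLongNormSq_mul_dualCoxeterNumber`). Hence `s` is not a
nonnegative real number.

Spectrum. If `M` had highest weight `ν`, the eigenvalues of `casDiff` would be `(μ, μ) + 2 (μ, ν +
ρ)` for the weights `μ` of `E`. These lie in the root lattice, so every eigenvalue is within `C |μ|`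
of the square `|μ|²`, with `C` independent of `E`. For general `M` the role of `ν` is taken by
central elements `zc` of the enveloping algebra, which act by scalars on the composition factors
(`IsFinMult.exists_central_scalar`). The eigenvalue equation becomes a polynomial identity over
these central elements, because the coordinates of `ν` are integral over the central characters
(`exists_char_matrices`). It is checked on finite dimensional modules and carried over by the
faithfulness of the enveloping algebra on them (`eq_zero_of_uact_eq_zero`,
`exists_casDiff_relation`). The result is a nonzero polynomial `q` with `q(casDiff) = 0` and roots
near squares (`exists_nearSquares_aeval`).

Conclusion. For large `n` the number `n s` is too far from the nonnegative reals to be a root of `q`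
(`NearSquares.exists_eval_ne_zero`). Then `q(jetOp)` lowers the order, and it is the nonzero scalar
`q(n s)` modulo lower order; so a submodule containing the vectors of order `n` of a larger one
contains those of order `n + 1` (`hasFiniteLength_smoothPart`). -/

/-- The action of a word in the vectors `x i` on a vector. -/
def wordAct {d : ℕ} (x : Fin d → L) (l : List (Fin d)) (v : Y) : Y :=
  l.foldr (fun i w ↦ ⁅x i, w⁆) v

/-- The span of the words of length less than `n` applied to the vectors `e j`. -/
def wordSpan {d : ℕ} (x : Fin d → L) (e : J → Y) (n : ℕ) : Submodule ℂ Y :=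
  Submodule.span ℂ {w | ∃ l j, l.length < n ∧ w = wordAct x l (e j)}

theorem wordAct_mem {d : ℕ} (x : Fin d → L) (e : J → Y) {n : ℕ} (l : List (Fin d)) (j : J)
    (h : l.length < n) : wordAct x l (e j) ∈ wordSpan x e n :=
  Submodule.subset_span ⟨l, j, h, rfl⟩

theorem wordSpan_mono {d : ℕ} (x : Fin d → L) (e : J → Y) {m n : ℕ} (h : m ≤ n) :
    wordSpan x e m ≤ wordSpan x e n :=
  Submodule.span_mono fun _ ⟨l, j, hl, hw⟩ ↦ ⟨l, j, hl.trans_le h, hw⟩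

theorem lie_mem_wordSpan {d : ℕ} (x : Module.Basis (Fin d) ℂ L) (e : J → Y) {n : ℕ} (y : L) {w : Y}
    (hw : w ∈ wordSpan x e n) : ⁅y, w⁆ ∈ wordSpan x e (n + 1) := by
  induction hw using Submodule.span_induction with
  | zero => simp
  | add u v _ _ hu hv => rw [lie_add]; exact add_mem hu hv
  | smul c u _ hu => rw [lie_smul]; exact Submodule.smul_mem _ _ hu
  | mem w hw =>
    obtain ⟨l, j, hl, rfl⟩ := hw
    rw [← x.sum_repr y, sum_lie]
    refine Submodule.sum_mem _ fun i _ ↦ ?_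
    rw [smul_lie]
    exact Submodule.smul_mem _ _ (wordAct_mem x e (i :: l) j (by simpa using hl))

/-- Exchanging two adjacent letters costs the action of one bracket, hence a word shorter by one.
This is the easy half of the Poincaré–Birkhoff–Witt theorem: modulo shorter words only the multiset
of letters matters. -/
theorem wordAct_perm {d : ℕ} (x : Module.Basis (Fin d) ℂ L) (e : J → Y) (j : J)
    {l l' : List (Fin d)} (h : l.Perm l') :
    wordAct x l (e j) - wordAct x l' (e j) ∈ wordSpan x e l.length := by
  induction h with
  | nil => simp
  | @cons a l l' _ ih =>
    have := lie_mem_wordSpan x e (x a) ih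
    rw [lie_sub] at this
    exact this
  | swap a b l =>
    have : wordAct x (b :: a :: l) (e j) - wordAct x (a :: b :: l) (e j) =
        ⁅⁅x b, x a⁆, wordAct x l (e j)⁆ := by
      simp [wordAct, lie_lie]
    rw [this]
    exact lie_mem_wordSpan x e _ (wordAct_mem x e l j (Nat.lt_succ_self _))
  | @trans l₁ l₂ l₃ h₁ h₂ ih₁ ih₂ =>
    rw [← h₁.length_eq] at ih₂
    simpa using add_mem ih₁ ih₂

/-- The linear map sending a monomial in the `j`-th copy of the polynomial ring to the
corresponding ordered word applied to `e j`. -/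
def orderedEval {d : ℕ} (x : Fin d → L) (v : Y) : MvPolynomial (Fin d) ℂ →ₗ[ℂ] Y :=
  (basisMonomials (Fin d) ℂ).constr ℂ fun m ↦ wordAct x (m.toMultiset.sort (· ≤ ·)) v

theorem orderedEval_monomial {d : ℕ} (x : Fin d → L) (v : Y) (m : Fin d →₀ ℕ) :
    orderedEval x v (monomial m 1) = wordAct x (m.toMultiset.sort (· ≤ ·)) v := by
  have : (monomial m 1 : MvPolynomial (Fin d) ℂ) = basisMonomials (Fin d) ℂ m := by simp
  rw [orderedEval, this, Module.Basis.constr_basis]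

/-- Acting by `x i` multiplies leading symbols by `X i`; this is what makes the symbols of a
submodule a module over the polynomial ring. -/
theorem orderedEval_X_mul {d : ℕ} (x : Module.Basis (Fin d) ℂ L) (e : J → Y) (j : J) (i : Fin d)
    {n : ℕ} {p : MvPolynomial (Fin d) ℂ} (hp : p.IsHomogeneous n) :
    orderedEval x (e j) (X i * p) - ⁅x i, orderedEval x (e j) p⁆ ∈ wordSpan x e (n + 1) := by
  have key : ∀ m : Fin d →₀ ℕ, m.degree = n →
      orderedEval x (e j) (X i * monomial m 1) - ⁅x i, orderedEval x (e j) (monomial m 1)⁆ ∈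
        wordSpan x e (n + 1) := by
    intro m hm
    have e1 : (X i * monomial m 1 : MvPolynomial (Fin d) ℂ) =
        monomial (Finsupp.single i 1 + m) 1 := by
      rw [X, monomial_mul, one_mul]
    rw [e1, orderedEval_monomial, orderedEval_monomial]
    have h := wordAct_perm x e j (l := i :: m.toMultiset.sort (· ≤ ·))
      (l' := (Finsupp.single i 1 + m).toMultiset.sort (· ≤ ·)) (by
        rw [← Multiset.coe_eq_coe, Multiset.sort_eq, map_add, Finsupp.toMultiset_single, one_smul,
          Multiset.singleton_add, ← Multiset.cons_coe, Multiset.sort_eq])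
    rw [← neg_sub, Submodule.neg_mem_iff]
    have hl : (i :: m.toMultiset.sort (· ≤ ·)).length = n + 1 := by
      simp [← hm, Finsupp.card_toMultiset, Finsupp.degree_eq_sum, Finsupp.sum_fintype]
    rw [hl] at h
    exact h
  rw [p.as_sum, Finset.mul_sum, map_sum, map_sum, lie_sum, ← Finset.sum_sub_distrib]
  refine Submodule.sum_mem _ fun m hm ↦ ?_
  have hc : (monomial m (p.coeff m) : MvPolynomial (Fin d) ℂ) = p.coeff m • monomial m 1 := by
    rw [smul_monomial, smul_eq_mul, mul_one]
  rw [hc, mul_smul_comm, map_smul, map_smul, lie_smul, ← smul_sub]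
  refine Submodule.smul_mem _ _ (key m ?_)
  have := hp (mem_support_iff.1 hm)
  rwa [Finsupp.degree_eq_weight_one]

theorem homogeneousComponent_X_mul {d : ℕ} (i : Fin d) (n : ℕ) (p : MvPolynomial (Fin d) ℂ) :
    homogeneousComponent (n + 1) (X i * p) = X i * homogeneousComponent n p := by
  ext m
  rw [coeff_homogeneousComponent, coeff_X_mul', coeff_X_mul', coeff_homogeneousComponent]
  by_cases hm : i ∈ m.support
  · rw [if_pos hm, if_pos hm]
    have h1 : Finsupp.single i 1 ≤ m := by
      rw [Finsupp.single_le_iff]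
      exact Nat.one_le_iff_ne_zero.2 (Finsupp.mem_support_iff.1 hm)
    have h2 : m.degree = (m - Finsupp.single i 1).degree + 1 := by
      conv_lhs => rw [← tsub_add_cancel_of_le h1]
      simp
    rw [h2]
    simp
  · simp [hm]

theorem homogeneousComponent_zero_X_mul {d : ℕ} (i : Fin d) (p : MvPolynomial (Fin d) ℂ) :
    homogeneousComponent 0 (X i * p) = 0 := by
  rw [homogeneousComponent_zero, ← constantCoeff_eq, map_mul, constantCoeff_X, zero_mul, map_zero]

/-- The module of leading symbols of a submodule. -/
def symbols {d : ℕ} (x : Module.Basis (Fin d) ℂ L) (e : J → Y) (W : LieSubmodule ℂ L Y) :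
    Submodule (MvPolynomial (Fin d) ℂ) (J → MvPolynomial (Fin d) ℂ) where
  -- Each homogeneous component is tested separately, the one of degree `n` modulo words of length
  -- less than `n`.
  carrier := {p | ∀ n, ∑ j, orderedEval x (e j) (homogeneousComponent n (p j)) ∈
    W.toSubmodule ⊔ wordSpan x e n}
  add_mem' {p q} hp hq n := by
    simp only [Pi.add_apply, map_add, Finset.sum_add_distrib]
    exact add_mem (hp n) (hq n)
  zero_mem' n := by simp
  smul_mem' q p hp := by
    change ∀ n, ∑ j, orderedEval x (e j) (homogeneousComponent n ((q • p) j)) ∈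
      W.toSubmodule ⊔ wordSpan x e n
    induction q using MvPolynomial.induction_on with
    | C c =>
      intro n
      have : ∀ j, homogeneousComponent n (((C c : MvPolynomial (Fin d) ℂ) • p) j) = c • homogeneousComponent n (p j) := by
        intro j
        rw [Pi.smul_apply, smul_eq_mul, C_mul', map_smul]
      simp only [this, map_smul, ← Finset.smul_sum]
      exact Submodule.smul_mem _ _ (hp n)
    | add q r hq hr =>
      intro n
      simp only [add_smul, Pi.add_apply, map_add, Finset.sum_add_distrib]
      exact add_mem (hq n) (hr n)
    | mul_X q i hq =>
      intro n
      have e1 : ((q * X i) • p) = fun j ↦ X i * (q • p) j := by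
        ext1 j
        simp only [Pi.smul_apply, smul_eq_mul]
        ring
      rw [e1]
      rcases n with _ | n
      · simp only [homogeneousComponent_zero_X_mul, map_zero, Finset.sum_const_zero]
        exact zero_mem _
      simp only [homogeneousComponent_X_mul]
      have h1 : ∑ j, ⁅x i, orderedEval x (e j) (homogeneousComponent n ((q • p) j))⁆ ∈
          W.toSubmodule ⊔ wordSpan x e (n + 1) := by
        rw [← lie_sum]
        obtain ⟨w, hw, u, hu, h⟩ := Submodule.mem_sup.1 (hq n)
        rw [← h, lie_add]
        exact Submodule.add_mem_sup (W.lie_mem hw) (lie_mem_wordSpan x e _ hu)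
      have h2 : ∑ j, (orderedEval x (e j) (X i * homogeneousComponent n ((q • p) j)) -
          ⁅x i, orderedEval x (e j) (homogeneousComponent n ((q • p) j))⁆) ∈
          W.toSubmodule ⊔ wordSpan x e (n + 1) :=
        Submodule.sum_mem _ fun j _ ↦ Submodule.mem_sup_right
          (orderedEval_X_mul x e j i (homogeneousComponent_isHomogeneous n _))
      simpa using add_mem h1 h2

theorem symbols_mono {d : ℕ} (x : Module.Basis (Fin d) ℂ L) (e : J → Y) :
    Monotone (symbols x e) := fun _ _ h _ hp n ↦
  sup_le_sup_right (LieSubmodule.toSubmodule_le_toSubmodule _ _ |>.2 h) _ (hp n)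

/-- Sorting the letters of the longest words changes them only by shorter words, and a sorted word
is the value of a monomial. -/
theorem exists_symbol {d : ℕ} (x : Module.Basis (Fin d) ℂ L) (e : J → Y) {n : ℕ} {w : Y}
    (hw : w ∈ wordSpan x e (n + 1)) :
    ∃ p : J → MvPolynomial (Fin d) ℂ, (∀ j, (p j).IsHomogeneous n) ∧
      w - ∑ j, orderedEval x (e j) (p j) ∈ wordSpan x e n := by
  classical
  induction hw using Submodule.span_induction with
  | zero => exact ⟨0, fun j ↦ isHomogeneous_zero _ _ _, by simp⟩
  | add u v _ _ hu hv =>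
    obtain ⟨p, hp, h⟩ := hu
    obtain ⟨q, hq, h'⟩ := hv
    refine ⟨p + q, fun j ↦ (hp j).add (hq j), ?_⟩
    have := add_mem h h'
    simp only [Pi.add_apply, map_add, Finset.sum_add_distrib]
    convert this using 1
    abel
  | smul c u _ hu =>
    obtain ⟨p, hp, h⟩ := hu
    refine ⟨c • p, fun j ↦ ?_, ?_⟩
    · rw [Pi.smul_apply, ← C_mul']
      simpa using (isHomogeneous_C (Fin d) c).mul (hp j)
    · simp only [Pi.smul_apply, map_smul, ← Finset.smul_sum, ← smul_sub]
      exact Submodule.smul_mem _ _ h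
  | mem w hw =>
    obtain ⟨l, j, hl, rfl⟩ := hw
    rcases Nat.lt_succ_iff_lt_or_eq.1 hl with hl | hl
    · exact ⟨0, fun j ↦ isHomogeneous_zero _ _ _, by simpa using wordAct_mem x e l j hl⟩
    · refine ⟨Pi.single j (monomial (Multiset.toFinsupp (l : Multiset (Fin d))) 1),
        fun k ↦ ?_, ?_⟩
      · by_cases hk : k = j
        · subst hk
          rw [Pi.single_eq_same]
          refine isHomogeneous_monomial _ ?_
          have h1 := Finsupp.card_toMultiset (Multiset.toFinsupp (l : Multiset (Fin d)))
          rw [Multiset.toFinsupp_toMultiset, Finsupp.sum_fintype _ _ (by simp)] at h1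
          rw [Finsupp.degree_eq_sum, ← hl]
          exact h1.symm
        · rw [Pi.single_eq_of_ne hk]
          exact isHomogeneous_zero _ _ _
      · rw [Finset.sum_eq_single j (fun k _ hk ↦ by rw [Pi.single_eq_of_ne hk, map_zero])
          (by simp), Pi.single_eq_same, orderedEval_monomial, ← hl]
        refine wordAct_perm x e j ?_
        rw [← Multiset.coe_eq_coe, Multiset.sort_eq, Multiset.toFinsupp_toMultiset]

/-- Induction on the length of words: an element of `W'` has the leading symbol of some element of
`W`, and the difference is in `W'` and involves only shorter words. Thus symbols detect strict
inclusions. -/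
theorem le_of_symbols_le {d : ℕ} (x : Module.Basis (Fin d) ℂ L) (e : J → Y)
    (he : LieSubmodule.lieSpan ℂ L (Set.range e) = ⊤) {W W' : LieSubmodule ℂ L Y} (h : W ≤ W')
    (hs : symbols x e W' ≤ symbols x e W) : W' ≤ W := by
  classical
  have key : ∀ n, ∀ w ∈ W', w ∈ wordSpan x e n → w ∈ W := by
    intro n
    induction n with
    | zero =>
      intro w _ hw
      have : w = 0 := by simpa [wordSpan] using hw
      rw [this]
      exact zero_mem _
    | succ n ih =>
      intro w hw hwn
      obtain ⟨p, hp, hpw⟩ := exists_symbol x e hwn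
      have hcomp : ∀ m j, homogeneousComponent m (p j) = if n = m then p j else 0 := by
        intro m j
        rw [homogeneousComponent_of_mem ((mem_homogeneousSubmodule _ _).2 (hp j))]
        simp [eq_comm]
      have hp' : p ∈ symbols x e W' := by
        intro m
        simp only [hcomp]
        by_cases hm : n = m
        · subst hm
          simp only [if_true]
          have : ∑ j, orderedEval x (e j) (p j) = w - (w - ∑ j, orderedEval x (e j) (p j)) := by
            abel
          rw [this]
          exact sub_mem (Submodule.mem_sup_left hw) (Submodule.mem_sup_right hpw)
        · simp [hm]
      have h1 := hs hp' n
      simp only [hcomp, if_true] at h1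
      obtain ⟨w₀, hw₀, u, hu, hsum⟩ := Submodule.mem_sup.1 h1
      have h2 : w - w₀ ∈ wordSpan x e n := by
        have : w - w₀ = (w - ∑ j, orderedEval x (e j) (p j)) + u := by
          rw [← hsum]; abel
        rw [this]
        exact add_mem hpw hu
      have h3 := ih (w - w₀) (sub_mem hw (h hw₀)) h2
      have : w = (w - w₀) + w₀ := by abel
      rw [this]
      exact add_mem h3 hw₀
  have htop : ∀ w : Y, ∃ n, w ∈ wordSpan x e n := by
    intro w
    have hw : w ∈ LieSubmodule.lieSpan ℂ L (Set.range e) := by rw [he]; trivial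
    induction hw using LieSubmodule.lieSpan_induction with
    | mem w hw =>
      obtain ⟨j, rfl⟩ := hw
      exact ⟨1, wordAct_mem x e [] j (by simp)⟩
    | zero => exact ⟨0, zero_mem _⟩
    | add u v _ _ hu hv =>
      obtain ⟨m, hu⟩ := hu
      obtain ⟨n, hv⟩ := hv
      exact ⟨max m n, add_mem (wordSpan_mono x e (le_max_left _ _) hu)
        (wordSpan_mono x e (le_max_right _ _) hv)⟩
    | smul c u _ hu =>
      obtain ⟨m, hu⟩ := hu
      exact ⟨m, Submodule.smul_mem _ _ hu⟩
    | lie y u _ hu =>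
      obtain ⟨m, hu⟩ := hu
      exact ⟨m + 1, lie_mem_wordSpan x e y hu⟩
  intro w hw
  obtain ⟨n, hn⟩ := htop w
  exact key n w hw hn

/-- A finitely generated module over a finite dimensional Lie algebra is Noetherian. -/
theorem wellFoundedGT_of_lieSpan_eq_top [FiniteDimensional ℂ L] {s : Set Y} (hs : s.Finite)
    (h : LieSubmodule.lieSpan ℂ L s = ⊤) : WellFoundedGT (LieSubmodule ℂ L Y) := by
  have := hs.fintype
  let x := Module.finBasis ℂ L
  let e : s → Y := Subtype.val
  have he : LieSubmodule.lieSpan ℂ L (Set.range e) = ⊤ := by simpa [e] using h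
  -- The target consists of submodules of a finite free module over a polynomial ring, so Hilbert's
  -- basis theorem gives the chain condition there.
  refine StrictMono.wellFoundedGT (f := symbols x e) ?_
  intro W W' h
  refine lt_of_le_not_ge (symbols_mono x e h.le) fun hs ↦ ?_
  exact h.not_ge (le_of_symbols_le x e he h.le hs)

theorem exists_finite_lieSpan_eq_top [h : WellFoundedGT (LieSubmodule ℂ L Y)] :
    ∃ s : Set Y, s.Finite ∧ LieSubmodule.lieSpan ℂ L s = ⊤ := by
  obtain ⟨N, ⟨s, hs, rfl⟩, hmax⟩ := h.wf.has_min
    {N : LieSubmodule ℂ L Y | ∃ s : Set Y, s.Finite ∧ LieSubmodule.lieSpan ℂ L s = N}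
    ⟨_, ∅, Set.finite_empty, rfl⟩
  refine ⟨s, hs, ?_⟩
  by_contra hne
  obtain ⟨v, hv⟩ : ∃ v, v ∉ LieSubmodule.lieSpan ℂ L s := by
    by_contra hcon
    push Not at hcon
    exact hne (eq_top_iff.2 fun v _ ↦ hcon v)
  refine hmax _ ⟨insert v s, hs.insert v, rfl⟩ ?_
  refine lt_of_le_of_ne (LieSubmodule.lieSpan_mono (Set.subset_insert _ _)) fun heq ↦ hv ?_
  rw [heq]
  exact LieSubmodule.subset_lieSpan (Set.mem_insert _ _)

/-- The tensor product of a finite dimensional module and a Noetherian module is Noetherian. -/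
theorem wellFoundedGT_tensor [FiniteDimensional ℂ L] (E : Type*) [AddCommGroup E] [Module ℂ E]
    [LieRingModule L E] [LieModule ℂ L E] [FiniteDimensional ℂ E]
    [WellFoundedGT (LieSubmodule ℂ L Y)] : WellFoundedGT (LieSubmodule ℂ L (E ⊗[ℂ] Y)) := by
  obtain ⟨s, hs, hspan⟩ := exists_finite_lieSpan_eq_top (L := L) (Y := Y)
  let b := Module.finBasis ℂ E
  refine wellFoundedGT_of_lieSpan_eq_top
    (s := Set.image2 (fun i v ↦ b i ⊗ₜ[ℂ] v) Set.univ s) (Set.finite_univ.image2 _ hs) ?_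
  set N := LieSubmodule.lieSpan ℂ L (Set.image2 (fun i v ↦ b i ⊗ₜ[ℂ] v) Set.univ s)
  -- The vectors `v` with `E ⊗ v` inside `N` are stable under `L`, because `y ⊗ ⁅z, u⁆ = ⁅z, y ⊗ u⁆
  -- - ⁅z, y⁆ ⊗ u`.
  have hN : ∀ v : Y, ∀ y : E, y ⊗ₜ[ℂ] v ∈ N := by
    intro v
    have hv : v ∈ LieSubmodule.lieSpan ℂ L s := by rw [hspan]; trivial
    induction hv using LieSubmodule.lieSpan_induction with
    | mem v hv =>
      intro y
      rw [← b.sum_repr y, TensorProduct.sum_tmul]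
      refine sum_mem fun i _ ↦ ?_
      rw [← TensorProduct.smul_tmul']
      exact N.smul_mem _ (LieSubmodule.subset_lieSpan ⟨i, trivial, v, hv, rfl⟩)
    | zero => intro y; simp
    | add u v _ _ hu hv => intro y; rw [TensorProduct.tmul_add]; exact add_mem (hu y) (hv y)
    | smul c u _ hu =>
      intro y
      rw [TensorProduct.tmul_smul]
      exact N.smul_mem _ (hu y)
    | lie z u _ hu =>
      intro y
      have := N.lie_mem (x := z) (hu y)
      rw [TensorProduct.LieModule.lie_tmul_right] at this
      simpa using sub_mem this (hu ⁅z, y⁆)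
  rw [eq_top_iff]
  intro t _
  induction t using TensorProduct.induction_on with
  | zero => exact zero_mem _
  | tmul y v => exact hN v y
  | add a b ha hb => exact add_mem (ha trivial) (hb trivial)

end Noetherian

end AffineKM

namespace AffineKM

attribute [local instance] LieRing.ofAssociativeRing LieAlgebra.ofAssociativeAlgebra

/-! ### Enveloping algebras acting on tensor products -/

section Enveloping

open UniversalEnvelopingAlgebra

variable {L : Type*} [LieRing L] [LieAlgebra ℂ L]
  (E Y : Type*) [AddCommGroup E] [Module ℂ E] [LieRingModule L E] [LieModule ℂ L E]
  [AddCommGroup Y] [Module ℂ Y] [LieRingModule L Y] [LieModule ℂ L Y]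

/-- The elements with the property form a subalgebra containing the Lie algebra, and by the
universal property the identity factors through it. -/
theorem env_induction {P : UniversalEnvelopingAlgebra ℂ L → Prop}
    (algebraMap : ∀ r : ℂ, P (algebraMap ℂ _ r)) (ι : ∀ x : L, P (ι ℂ x))
    (mul : ∀ a b, P a → P b → P (a * b)) (add : ∀ a b, P a → P b → P (a + b))
    (u : UniversalEnvelopingAlgebra ℂ L) : P u := by
  let S : Subalgebra ℂ (UniversalEnvelopingAlgebra ℂ L) :=
    { carrier := {u | P u}
      mul_mem' := mul _ _
      add_mem' := add _ _
      algebraMap_mem' := algebraMap }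
  let f : L →ₗ⁅ℂ⁆ S :=
    { toFun := fun x ↦ ⟨UniversalEnvelopingAlgebra.ι ℂ x, ι x⟩
      map_add' := fun x y ↦ Subtype.ext (map_add _ _ _)
      map_smul' := fun c x ↦ Subtype.ext (map_smul _ _ _)
      map_lie' := fun {x y} ↦ Subtype.ext (LieHom.map_lie _ _ _) }
  have h : S.val.comp (UniversalEnvelopingAlgebra.lift ℂ f) = AlgHom.id ℂ _ := by
    refine UniversalEnvelopingAlgebra.hom_ext (R := ℂ) (L := L) (LieHom.ext fun x ↦ ?_)
    change S.val (UniversalEnvelopingAlgebra.lift ℂ f (UniversalEnvelopingAlgebra.ι ℂ x)) =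
      UniversalEnvelopingAlgebra.ι ℂ x
    rw [lift_ι_apply]
    rfl
  have h' : S.val (UniversalEnvelopingAlgebra.lift ℂ f u) = u := congr($h u)
  rw [← h']
  exact (UniversalEnvelopingAlgebra.lift ℂ f u).2

/-- The action of the enveloping algebra on a Lie module. -/
def uact : UniversalEnvelopingAlgebra ℂ L →ₐ[ℂ] Module.End ℂ Y :=
  UniversalEnvelopingAlgebra.lift ℂ (LieModule.toEnd ℂ L Y)

variable {Y} in
@[simp] theorem uact_ι (x : L) (y : Y) : uact Y (ι ℂ x) y = ⁅x, y⁆ := by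
  rw [uact, lift_ι_apply]
  rfl

variable {Y} in
theorem uact_mem (u : UniversalEnvelopingAlgebra ℂ L) (N : LieSubmodule ℂ L Y) {y : Y}
    (hy : y ∈ N) : uact Y u y ∈ N := by
  have : uact Y u y = uact N u ⟨y, hy⟩ := by
    have h : ∀ z : N, N.incl (uact N u z) = uact Y u (N.incl z) := by
      induction u using env_induction with
      | algebraMap r => intro z; simp [Algebra.algebraMap_eq_smul_one]
      | ι x => intro z; rw [uact_ι, uact_ι]; rfl
      | mul a b ha hb => intro z; simp [ha, hb]
      | add a b ha hb =>
        intro z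
        rw [map_add, map_add, LinearMap.add_apply, LinearMap.add_apply, ← ha, ← hb]
        rfl
    exact (h ⟨y, hy⟩).symm
  rw [this]
  exact Subtype.coe_prop _

/-- The coproduct of `x ∈ L`, acting on `E` in the first factor. -/
def coactHom : L →ₗ⁅ℂ⁆ Module.End ℂ E ⊗[ℂ] UniversalEnvelopingAlgebra ℂ L where
  toFun x := (LieModule.toEnd ℂ L E x) ⊗ₜ[ℂ] (1 : UniversalEnvelopingAlgebra ℂ L) +
    (1 : Module.End ℂ E) ⊗ₜ[ℂ] ι ℂ x
  map_add' x y := by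
    simp only [map_add, TensorProduct.add_tmul, TensorProduct.tmul_add]; abel
  map_smul' c x := by
    rw [map_smul (LieModule.toEnd ℂ L E), map_smul (ι ℂ),
      TensorProduct.tmul_smul, ← TensorProduct.smul_tmul', smul_add, RingHom.id_apply]
  map_lie' {x y} := by
    simp only [LieHom.map_lie, LieRing.of_associative_ring_bracket, add_mul, mul_add,
      Algebra.TensorProduct.tmul_mul_tmul, one_mul, mul_one, TensorProduct.sub_tmul,
      TensorProduct.tmul_sub]
    abel

/-- The coproduct of the enveloping algebra, followed by the action on `E` in the first factor. -/
def coact : UniversalEnvelopingAlgebra ℂ L →ₐ[ℂ]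
    Module.End ℂ E ⊗[ℂ] UniversalEnvelopingAlgebra ℂ L :=
  UniversalEnvelopingAlgebra.lift ℂ (coactHom E)

theorem coact_one : coact E (1 : UniversalEnvelopingAlgebra ℂ L) = 1 ⊗ₜ 1 :=
  (coact (L := L) E).map_one'

theorem coact_ι (x : L) :
    coact E (ι ℂ x) = (LieModule.toEnd ℂ L E x) ⊗ₜ[ℂ] (1 : UniversalEnvelopingAlgebra ℂ L) +
      (1 : Module.End ℂ E) ⊗ₜ[ℂ] ι ℂ x := by
  rw [coact, lift_ι_apply]
  rfl

/-- The action of `End E ⊗ U` on `E ⊗ Y`. -/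
def tact : Module.End ℂ E ⊗[ℂ] UniversalEnvelopingAlgebra ℂ L →ₐ[ℂ] Module.End ℂ (E ⊗[ℂ] Y) :=
  (Module.endTensorEndAlgHom (R := ℂ) (A := ℂ) (M := E) (N := Y) (S := ℂ)).comp
    (Algebra.TensorProduct.map (AlgHom.id ℂ (Module.End ℂ E)) (uact Y))

variable {E Y}

@[simp] theorem tact_tmul (T : Module.End ℂ E) (u : UniversalEnvelopingAlgebra ℂ L) (e : E)
    (y : Y) : tact E Y (T ⊗ₜ u) (e ⊗ₜ y) = T e ⊗ₜ uact Y u y := by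
  rfl

theorem tact_coact (u : UniversalEnvelopingAlgebra ℂ L) :
    tact E Y (coact E u) = uact (E ⊗[ℂ] Y) u := by
  have : (tact (L := L) E Y).comp (coact (L := L) E) = uact (E ⊗[ℂ] Y) := by
    refine UniversalEnvelopingAlgebra.hom_ext (R := ℂ) (L := L) (LieHom.ext fun x ↦ ?_)
    change tact E Y (coact E (ι ℂ x)) = uact (E ⊗[ℂ] Y) (ι ℂ x)
    refine TensorProduct.ext' fun e y ↦ ?_
    rw [coact_ι, map_add, LinearMap.add_apply, tact_tmul, tact_tmul, uact_ι, uact_ι,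
      TensorProduct.LieModule.lie_tmul_right]
    simp
  exact congr($this u)

/-- Evaluation of a functional on the first tensor factor. -/
def slice (θ : Module.Dual ℂ (Module.End ℂ E)) :
    Module.End ℂ E ⊗[ℂ] UniversalEnvelopingAlgebra ℂ L →ₗ[ℂ] UniversalEnvelopingAlgebra ℂ L :=
  (TensorProduct.lid ℂ _).toLinearMap ∘ₗ θ.rTensor _

@[simp] theorem slice_tmul (θ : Module.Dual ℂ (Module.End ℂ E)) (T : Module.End ℂ E)
    (u : UniversalEnvelopingAlgebra ℂ L) : slice θ (T ⊗ₜ u) = θ T • u := by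
  simp [slice]

theorem slice_mul_left (θ : Module.Dual ℂ (Module.End ℂ E)) (T : Module.End ℂ E)
    (t : Module.End ℂ E ⊗[ℂ] UniversalEnvelopingAlgebra ℂ L) :
    slice θ (T ⊗ₜ 1 * t) = slice (θ ∘ₗ LinearMap.mulLeft ℂ T) t := by
  induction t using TensorProduct.induction_on with
  | zero => simp
  | tmul S u => simp
  | add a b ha hb => rw [mul_add, map_add, map_add, ha, hb]

theorem slice_mul_right (θ : Module.Dual ℂ (Module.End ℂ E)) (v : UniversalEnvelopingAlgebra ℂ L)
    (t : Module.End ℂ E ⊗[ℂ] UniversalEnvelopingAlgebra ℂ L) :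
    slice θ (1 ⊗ₜ v * t) = v * slice θ t := by
  induction t using TensorProduct.induction_on with
  | zero => simp
  | tmul S u => simp
  | add a b ha hb => rw [mul_add, map_add, map_add, ha, hb, mul_add]

theorem sum_tmul_slice {κ : Type*} [Fintype κ] (b : Module.Basis κ ℂ (Module.End ℂ E))
    (t : Module.End ℂ E ⊗[ℂ] UniversalEnvelopingAlgebra ℂ L) :
    t = ∑ i, b i ⊗ₜ slice (b.coord i) t := by
  induction t using TensorProduct.induction_on with
  | zero => simp
  | tmul S u =>
    conv_lhs => rw [← b.sum_repr S, TensorProduct.sum_tmul]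
    simp [TensorProduct.smul_tmul]
  | add a b ha hb =>
    conv_lhs => rw [ha, hb]
    simp [TensorProduct.tmul_add, Finset.sum_add_distrib]

theorem eq_zero_of_slice_eq_zero [FiniteDimensional ℂ E]
    {t : Module.End ℂ E ⊗[ℂ] UniversalEnvelopingAlgebra ℂ L} (h : ∀ θ, slice θ t = 0) : t = 0 := by
  rw [sum_tmul_slice (Module.finBasis ℂ _) t]
  simp [h]

/-- If an element of `End E ⊗ U` acts by zero on `E ⊗ Y` then its slices act by zero on `Y`. -/
theorem uact_slice_eq_zero [FiniteDimensional ℂ E]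
    {t : Module.End ℂ E ⊗[ℂ] UniversalEnvelopingAlgebra ℂ L} (h : tact E Y t = 0)
    (θ : Module.Dual ℂ (Module.End ℂ E)) : uact Y (slice θ t) = 0 := by
  let b := Module.finBasis ℂ E
  -- The slice along a matrix coefficient is obtained by applying `t` to `b j ⊗ y` and taking the
  -- coordinate `i` of the first factor; matrix coefficients span all functionals.
  have key : ∀ (t : Module.End ℂ E ⊗[ℂ] UniversalEnvelopingAlgebra ℂ L) i j (y : Y),
      uact Y (slice (b.end.coord (i, j)) t) y =
        TensorProduct.lid ℂ Y ((b.coord i).rTensor Y (tact E Y t (b j ⊗ₜ y))) := by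
    intro t i j y
    induction t using TensorProduct.induction_on with
    | zero => simp
    | tmul S u =>
      have : b.end.coord (i, j) S = b.coord i (S (b j)) := by
        have h : b.end.coord (i, j) = b.coord i ∘ₗ LinearMap.applyₗ (b j) := by
          refine b.end.ext fun p ↦ ?_
          obtain ⟨k, l⟩ := p
          simp [Module.Basis.end_apply_apply, Finsupp.single_apply, Prod.ext_iff, ite_and]
          split_ifs <;> simp_all
        rw [h]
        rfl
      rw [slice_tmul, tact_tmul, map_smul, LinearMap.smul_apply, this]
      simp
    | add a b ha hb => simp [ha, hb]
  have hθS : ∀ S, ∑ p, θ (b.end p) * b.end.coord p S = θ S := by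
    intro S
    conv_rhs => rw [← b.end.sum_repr S, map_sum]
    refine Finset.sum_congr rfl fun p _ ↦ ?_
    rw [map_smul, smul_eq_mul, mul_comm]
    rfl
  have hs : slice θ t = ∑ p, θ (b.end p) • slice (b.end.coord p) t := by
    clear h
    induction t using TensorProduct.induction_on with
    | zero => simp
    | tmul S u =>
      simp only [slice_tmul, smul_smul, ← Finset.sum_smul]
      rw [hθS S]
    | add a b ha hb => rw [map_add, ha, hb]; simp [Finset.sum_add_distrib]
  ext y
  rw [hs, map_sum, LinearMap.sum_apply, LinearMap.zero_apply]
  refine Finset.sum_eq_zero fun p _ ↦ ?_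
  rw [map_smul, LinearMap.smul_apply, key t p.1 p.2 y, h]
  simp

end Enveloping

/-! ### Weight modules -/

section WeightModule

variable {L : Type*} [LieRing L] [LieAlgebra ℂ L] (H : LieSubalgebra ℂ L)
  (E Y : Type*) [AddCommGroup E] [Module ℂ E] [LieRingModule L E] [LieModule ℂ L E]
  [AddCommGroup Y] [Module ℂ Y] [LieRingModule L Y] [LieModule ℂ L Y]

variable {E} in
/-- `e` is a vector of weight `μ` (possibly zero). -/
def IsWeightVector (μ : Module.Dual ℂ H) (e : E) : Prop := ∀ h : H, ⁅(h : L), e⁆ = μ h • e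

/-- The module `E` is spanned by weight vectors with weights in `Λ`. -/
def IsWeightModule (Λ : Set (Module.Dual ℂ H)) : Prop :=
  Submodule.span ℂ {e : E | ∃ μ ∈ Λ, IsWeightVector H μ e} = ⊤

variable {H E Y}

theorem IsWeightVector.tmul {μ ν : Module.Dual ℂ H} {e : E} {y : Y} (he : IsWeightVector H μ e)
    (hy : IsWeightVector H ν y) : IsWeightVector H (μ + ν) (e ⊗ₜ[ℂ] y) := by
  intro h
  rw [TensorProduct.LieModule.lie_tmul_right, he, hy]
  simp [add_smul, TensorProduct.smul_tmul']

theorem IsWeightModule.tensor {Λ : AddSubgroup (Module.Dual ℂ H)}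
    (hE : IsWeightModule H E Λ) (hY : IsWeightModule H Y Λ) :
    IsWeightModule H (E ⊗[ℂ] Y) (Λ : Set (Module.Dual ℂ H)) := by
  rw [IsWeightModule, eq_top_iff, ← TensorProduct.map₂_mk_top_top_eq_top, ← hE, ← hY,
    Submodule.map₂_span_span]
  refine Submodule.span_mono ?_
  rintro _ ⟨e, ⟨μ, hμ, he⟩, y, ⟨ν, hν, hy⟩, rfl⟩
  exact ⟨μ + ν, Λ.add_mem hμ hν, he.tmul hy⟩

/-- A weight module has a basis of weight vectors. -/
theorem IsWeightModule.exists_basis [FiniteDimensional ℂ E] {Λ : Set (Module.Dual ℂ H)}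
    (hE : IsWeightModule H E Λ) : ∃ (d : ℕ) (b : Module.Basis (Fin d) ℂ E)
      (μ : Fin d → Module.Dual ℂ H), ∀ i, μ i ∈ Λ ∧ IsWeightVector H (μ i) (b i) := by
  obtain ⟨t, ht, hspan, hli⟩ := exists_linearIndependent ℂ
    {e : E | ∃ μ ∈ Λ, IsWeightVector H μ e}
  have htop : ⊤ ≤ Submodule.span ℂ (Set.range ((↑) : t → E)) := by
    rw [Subtype.range_coe, hspan, hE]
  let b₀ := Module.Basis.mk hli htop
  have : Finite t := Module.Finite.finite_basis b₀
  have := Fintype.ofFinite t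
  let b := b₀.reindex (Fintype.equivFin t)
  have hb : ∀ i, b i ∈ {e : E | ∃ μ ∈ Λ, IsWeightVector H μ e} := by
    intro i
    have : b i = ((Fintype.equivFin t).symm i : E) := by simp [b, b₀]
    rw [this]
    exact ht (Subtype.coe_prop _)
  choose μ h1 h2 using hb
  exact ⟨_, b, μ, fun i ↦ ⟨h1 i, h2 i⟩⟩

end WeightModule

/-! ### The enveloping algebra acts faithfully -/

section Faithful

open UniversalEnvelopingAlgebra LieAlgebra.IsKilling

universe u
variable {L : Type u} [LieRing L] [LieAlgebra ℂ L]

/-- The span of the products of less than `n` elements of the Lie algebra. -/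
def envFilt (L : Type*) [LieRing L] [LieAlgebra ℂ L] (n : ℕ) :
    Submodule ℂ (UniversalEnvelopingAlgebra ℂ L) :=
  Submodule.span ℂ {u | ∃ l : List L, l.length < n ∧ u = (l.map (ι ℂ)).prod}

theorem prod_mem_envFilt {n : ℕ} {l : List L} (h : l.length < n) :
    (l.map (ι ℂ)).prod ∈ envFilt L n := Submodule.subset_span ⟨l, h, rfl⟩

theorem envFilt_mono {m n : ℕ} (h : m ≤ n) : envFilt L m ≤ envFilt L n :=
  Submodule.span_mono fun _ ⟨l, hl, hu⟩ ↦ ⟨l, hl.trans_le h, hu⟩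

theorem ι_mul_mem_envFilt {n : ℕ} (x : L) {u : UniversalEnvelopingAlgebra ℂ L}
    (hu : u ∈ envFilt L n) : ι ℂ x * u ∈ envFilt L (n + 1) := by
  induction hu using Submodule.span_induction with
  | zero => simp
  | add u v _ _ hu hv => rw [mul_add]; exact add_mem hu hv
  | smul c u _ hu => rw [mul_smul_comm]; exact Submodule.smul_mem _ _ hu
  | mem u hu =>
    obtain ⟨l, hl, rfl⟩ := hu
    exact prod_mem_envFilt (l := x :: l) (by simpa using hl)

theorem exists_mem_envFilt (u : UniversalEnvelopingAlgebra ℂ L) : ∃ n, u ∈ envFilt L n := by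
  have hmul : ∀ (l : List L) (n : ℕ) (v : UniversalEnvelopingAlgebra ℂ L), v ∈ envFilt L n →
      (l.map (ι ℂ)).prod * v ∈ envFilt L (l.length + n) := by
    intro l n v hv
    induction l with
    | nil => simpa using hv
    | cons x l ih =>
      rw [List.map_cons, List.prod_cons, mul_assoc, List.length_cons, add_right_comm]
      exact ι_mul_mem_envFilt x ih
  induction u using env_induction with
  | algebraMap r =>
    refine ⟨1, ?_⟩
    rw [Algebra.algebraMap_eq_smul_one]
    exact Submodule.smul_mem _ _ (prod_mem_envFilt (l := []) (by simp))
  | ι x => exact ⟨2, by simpa using prod_mem_envFilt (l := [x]) (n := 2) (by simp)⟩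
  | mul a b ha hb =>
    obtain ⟨m, ha⟩ := ha
    obtain ⟨n, hb⟩ := hb
    refine ⟨m + n, ?_⟩
    induction ha using Submodule.span_induction with
    | zero => simp
    | add u v _ _ hu hv => rw [add_mul]; exact add_mem hu hv
    | smul c u _ hu => rw [smul_mul_assoc]; exact Submodule.smul_mem _ _ hu
    | mem u hu =>
      obtain ⟨l, hl, rfl⟩ := hu
      exact envFilt_mono (by omega) (hmul l n b hb)
  | add a b ha hb =>
    obtain ⟨m, ha⟩ := ha
    obtain ⟨n, hb⟩ := hb
    exact ⟨max m n, add_mem (envFilt_mono (le_max_left _ _) ha)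
      (envFilt_mono (le_max_right _ _) hb)⟩

/-- The derivative of a word along a functional. -/
def wordDeriv (τ : Module.Dual ℂ L) : List L → UniversalEnvelopingAlgebra ℂ L
  | [] => 0
  | x :: l => τ x • (l.map (ι ℂ)).prod + ι ℂ x * wordDeriv τ l

theorem wordDeriv_mem (τ : Module.Dual ℂ L) (l : List L) : wordDeriv τ l ∈ envFilt L l.length := by
  induction l with
  | nil => exact zero_mem _
  | cons x l ih =>
    refine add_mem (Submodule.smul_mem _ _ (prod_mem_envFilt (by simp))) ?_
    exact ι_mul_mem_envFilt x ih

/-- The coproduct distributes the letters over the two factors. No letter in the first factor gives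
`θ 1` times the word, one letter gives the derivative along `θ ∘ ad`, and two or more leave a word
shorter by at least two. -/
theorem slice_coact_word (θ : Module.Dual ℂ (Module.End ℂ L)) (l : List L) :
    slice θ (coact L (l.map (ι ℂ)).prod) - θ 1 • (l.map (ι ℂ)).prod -
      wordDeriv (θ ∘ₗ (LieAlgebra.ad ℂ L).toLinearMap) l ∈ envFilt L (l.length - 1) := by
  induction l generalizing θ with
  | nil =>
    rw [List.map_nil, List.prod_nil, coact_one, slice_tmul]
    simp [wordDeriv]
  | cons x l ih =>
    rw [List.map_cons, List.prod_cons, map_mul, coact_ι, add_mul, map_add, slice_mul_left,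
      slice_mul_right, wordDeriv]
    have h1 := ih θ
    have h2 := ih (θ ∘ₗ LinearMap.mulLeft ℂ (LieModule.toEnd ℂ L L x))
    have e1 : (θ ∘ₗ LinearMap.mulLeft ℂ (LieModule.toEnd ℂ L L x)) 1 =
      (θ ∘ₗ (LieAlgebra.ad ℂ L).toLinearMap) x := by simp; rfl
    rw [e1] at h2
    have h3 := wordDeriv_mem ((θ ∘ₗ LinearMap.mulLeft ℂ (LieModule.toEnd ℂ L L x)) ∘ₗ
      (LieAlgebra.ad ℂ L).toLinearMap) l
    have h2' := add_mem (envFilt_mono (Nat.sub_le _ 1) h2) h3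
    have h1' : ι ℂ x * (slice θ (coact L (l.map (ι ℂ)).prod) - θ 1 • (l.map (ι ℂ)).prod -
      wordDeriv (θ ∘ₗ (LieAlgebra.ad ℂ L).toLinearMap) l) ∈ envFilt L l.length := by
      rcases l with _ | ⟨y, l⟩
      · rw [List.map_nil, List.prod_nil, coact_one, slice_tmul]
        simp [wordDeriv]
      · exact ι_mul_mem_envFilt x h1
    simp only [List.length_cons, Nat.add_sub_cancel]
    convert add_mem h2' h1' using 1
    simp only [mul_sub, mul_smul_comm]
    abel

/-- Euler's identity `∑ xᵢ ∂ᵢ = degree`, valid modulo shorter words since moving `x i` to its place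
only produces brackets. -/
theorem euler_word {d : ℕ} (x : Module.Basis (Fin d) ℂ L) (l : List L) :
    ∑ i, ι ℂ (x i) * wordDeriv (x.coord i) l - l.length • (l.map (ι ℂ)).prod ∈
      envFilt L l.length := by
  induction l with
  | nil => simp [wordDeriv]
  | cons y l ih =>
    have h1 := ι_mul_mem_envFilt y ih
    have h2 : ∑ i, ι ℂ ⁅x i, y⁆ * wordDeriv (x.coord i) l ∈ envFilt L (l.length + 1) :=
      Submodule.sum_mem _ fun i _ ↦ ι_mul_mem_envFilt _ (wordDeriv_mem _ l)
    have h3 : ∑ i, ι ℂ (x i) * (x.coord i y • (l.map (ι ℂ)).prod) =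
        ι ℂ y * (l.map (ι ℂ)).prod := by
      conv_rhs => rw [← x.sum_repr y, map_sum, Finset.sum_mul]
      refine Finset.sum_congr rfl fun i _ ↦ ?_
      rw [map_smul, smul_mul_assoc, mul_smul_comm]
      rfl
    have h4 : ∀ i, ι ℂ (x i) * (ι ℂ y * wordDeriv (x.coord i) l) =
        ι ℂ y * (ι ℂ (x i) * wordDeriv (x.coord i) l) +
          ι ℂ ⁅x i, y⁆ * wordDeriv (x.coord i) l := by
      intro i
      rw [LieHom.map_lie, LieRing.of_associative_ring_bracket]
      noncomm_ring
    simp only [wordDeriv, mul_add, Finset.sum_add_distrib, h3, h4, List.length_cons]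
    convert add_mem h1 h2 using 1
    rw [mul_sub, Finset.mul_sum, List.map_cons, List.prod_cons, add_smul, one_smul,
      mul_smul_comm]
    abel

variable [FiniteDimensional ℂ L] [LieAlgebra.IsKilling ℂ L]

/-- The functional `tr ∘ ad` is represented by some `y` through the Killing form. It vanishes on
brackets, so invariance makes `y` central, hence zero. The vanishing removes the top order term from
the slices used below. -/
theorem trace_ad_eq_zero (x : L) : LinearMap.trace ℂ L (LieAlgebra.ad ℂ L x) = 0 := by
  have hnd := LieAlgebra.IsKilling.killingForm_nondegenerate ℂ L
  let φ : Module.Dual ℂ L := LinearMap.trace ℂ L ∘ₗ (LieAlgebra.ad ℂ L).toLinearMap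
  let y := (LinearMap.BilinForm.toDual (killingForm ℂ L) hnd).symm φ
  have hy : ∀ z, killingForm ℂ L y z = φ z := fun z ↦
    LinearMap.BilinForm.apply_toDual_symm_apply ..
  have h0 : ∀ a : L, ⁅y, a⁆ = 0 := by
    intro a
    refine hnd.1 _ fun (b : L) ↦ ?_
    rw [LieModule.traceForm_apply_lie_apply, hy]
    change LinearMap.trace ℂ L (LieAlgebra.ad ℂ L ⁅a, b⁆) = 0
    rw [LieHom.map_lie, LieRing.of_associative_ring_bracket, map_sub, LinearMap.trace_mul_comm,
      sub_self]
  have hy0 : y = 0 := by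
    have : y ∈ LieAlgebra.center ℂ L := by
      rw [LieModule.mem_maxTrivSubmodule]
      intro a
      rw [← lie_skew, h0, neg_zero]
    simpa using this
  have := hy x
  rw [hy0] at this
  simpa [φ] using this.symm

/-- An element of the enveloping algebra which acts by zero on all finite dimensional modules
spanned by vectors with weights in the root lattice is zero. -/
theorem eq_zero_of_uact_eq_zero (H : LieSubalgebra ℂ L) (Λ : AddSubgroup (Module.Dual ℂ H))
    (hL : IsWeightModule H L (Λ : Set (Module.Dual ℂ H))) [Nontrivial L]
    (u : UniversalEnvelopingAlgebra ℂ L)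
    (hu : ∀ (Y : Type u) [AddCommGroup Y] [Module ℂ Y] [LieRingModule L Y] [LieModule ℂ L Y]
      [FiniteDimensional ℂ Y], IsWeightModule H Y (Λ : Set (Module.Dual ℂ H)) → uact Y u = 0) :
    u = 0 := by
  have hnd := LieAlgebra.IsKilling.killingForm_nondegenerate ℂ L
  let x := Module.finBasis ℂ L
  let x' := LinearMap.BilinForm.dualBasis (killingForm ℂ L) hnd x
  -- These functionals vanish at `1` and restrict on `ad L` to the coordinates. Slicing the
  -- coproduct along `θ i` is therefore the partial derivative in direction `i`, up to lower order.
  let θ : Fin _ → Module.Dual ℂ (Module.End ℂ L) := fun i ↦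
    LinearMap.trace ℂ L ∘ₗ LinearMap.mulRight ℂ (LieAlgebra.ad ℂ L (x' i))
  have hθ1 : ∀ i, θ i 1 = 0 := fun i ↦ by
    simp only [θ, LinearMap.comp_apply, LinearMap.mulRight_apply, one_mul]
    exact trace_ad_eq_zero _
  have hθ : ∀ i, θ i ∘ₗ (LieAlgebra.ad ℂ L).toLinearMap = x.coord i := by
    intro i
    refine x.ext fun j ↦ ?_
    have : killingForm ℂ L (x j) (x' i) = if j = i then 1 else 0 := by
      rw [LieModule.traceForm_comm]
      exact LinearMap.BilinForm.apply_dualBasis_left ..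
    rw [LieModule.traceForm_apply_apply] at this
    simp only [LinearMap.comp_apply, Module.Basis.coord_apply, Module.Basis.repr_self,
      Finsupp.single_apply]
    exact this
  have hfilt : ∀ (i) (k : ℕ), ∀ v ∈ envFilt L (k + 1), slice (θ i) (coact L v) ∈ envFilt L k := by
    intro i k v hv
    induction hv using Submodule.span_induction with
    | zero => simp
    | add u v _ _ hu hv => rw [map_add, map_add]; exact add_mem hu hv
    | smul c u _ hu => rw [map_smul, map_smul]; exact Submodule.smul_mem _ _ hu
    | mem v hv =>
      obtain ⟨l, hl, rfl⟩ := hv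
      have h := slice_coact_word (θ i) l
      rw [hθ1, zero_smul, sub_zero] at h
      have h' := add_mem (envFilt_mono (Nat.sub_le _ _) h)
        (wordDeriv_mem (θ i ∘ₗ (LieAlgebra.ad ℂ L).toLinearMap) l)
      rw [sub_add_cancel] at h'
      exact envFilt_mono (by omega) h'
  -- By Euler's identity an element of degree `k` is recovered, up to the factor `k` and lower
  -- order, from its partial derivatives.
  have heuler : ∀ (k : ℕ), ∀ v ∈ envFilt L (k + 1),
      ∑ i, ι ℂ (x i) * slice (θ i) (coact L v) - k • v ∈ envFilt L k := by
    intro k v hv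
    induction hv using Submodule.span_induction with
    | zero => simp
    | add u v _ _ hu hv =>
      convert add_mem hu hv using 1
      simp only [map_add, mul_add, Finset.sum_add_distrib, smul_add]
      abel
    | smul c u _ hu =>
      convert Submodule.smul_mem _ c hu using 1
      simp only [map_smul, mul_smul_comm, ← Finset.smul_sum, smul_sub]
      rw [smul_comm]
    | mem v hv =>
      obtain ⟨l, hl, rfl⟩ := hv
      rcases Nat.lt_succ_iff_lt_or_eq.1 hl with hl | hl
      · refine sub_mem (Submodule.sum_mem _ fun i _ ↦ ?_)
          (Submodule.smul_of_tower_mem _ _ (prod_mem_envFilt hl))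
        obtain ⟨k, rfl⟩ : ∃ m, k = m + 1 := ⟨k - 1, by omega⟩
        exact ι_mul_mem_envFilt _ (hfilt i k _ (prod_mem_envFilt hl))
      · subst hl
        have h1 := euler_word x l
        have h2 : ∑ i, ι ℂ (x i) * (slice (θ i) (coact L (l.map (ι ℂ)).prod) -
            wordDeriv (x.coord i) l) ∈ envFilt L l.length := by
          refine Submodule.sum_mem _ fun i _ ↦ ?_
          have h := slice_coact_word (θ i) l
          rw [hθ1, zero_smul, sub_zero, hθ] at h
          rcases l with _ | ⟨y, l⟩
          · rw [List.map_nil, List.prod_nil, coact_one, slice_tmul,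
              hθ1]
            simp [wordDeriv]
          · exact ι_mul_mem_envFilt _ h
        convert add_mem h1 h2 using 1
        simp only [mul_sub, Finset.sum_sub_distrib]
        abel
  -- Induction on the filtration. The slices of `v` act by zero on `Y` because `v` does so on `L ⊗
  -- Y`; being of lower order they vanish. Then `k • v` has lower order, hence so has `v` when `k ≠
  -- 0`. A constant is detected by the nonzero module `L`.
  have key : ∀ (k : ℕ), ∀ v ∈ envFilt L k,
      (∀ (Y : Type u) [AddCommGroup Y] [Module ℂ Y] [LieRingModule L Y] [LieModule ℂ L Y]
      [FiniteDimensional ℂ Y], IsWeightModule H Y (Λ : Set (Module.Dual ℂ H)) → uact Y v = 0) →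
      v = 0 := by
    intro k
    induction k with
    | zero => intro v hv _; simpa [envFilt] using hv
    | succ k ih =>
      intro v hv hv0
      have h1 : ∀ i, slice (θ i) (coact L v) = 0 := by
        refine fun i ↦ ih _ (hfilt i k v hv) ?_
        intro Y _ _ _ _ _ hY
        refine uact_slice_eq_zero ?_ (θ i)
        rw [tact_coact]
        exact hv0 _ (hL.tensor hY)
      have h2 := heuler k v hv
      simp only [h1, mul_zero, Finset.sum_const_zero, zero_sub, neg_mem_iff] at h2
      rcases k with _ | k
      · have h3 : v ∈ Submodule.span ℂ {(1 : UniversalEnvelopingAlgebra ℂ L)} := by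
          refine Submodule.span_mono ?_ hv
          rintro _ ⟨l, hl, rfl⟩
          have : l = [] := by simpa using hl
          simp [this]
        obtain ⟨c, rfl⟩ := Submodule.mem_span_singleton.1 h3
        have h4 := hv0 L hL
        rw [map_smul, map_one] at h4
        obtain ⟨y, hy⟩ := exists_ne (0 : L)
        have h5 : c • y = 0 := congr($h4 y)
        rw [(smul_eq_zero.1 h5).resolve_right hy, zero_smul]
      · refine ih v ?_ hv0
        have := Submodule.smul_mem _ ((k + 1 : ℕ) : ℂ)⁻¹ h2
        rwa [← Nat.cast_smul_eq_nsmul ℂ, smul_smul, inv_mul_cancel₀ (Nat.cast_ne_zero.2 (Nat.succ_ne_zero k)), one_smul]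
          at this
  obtain ⟨n, hn⟩ := exists_mem_envFilt u
  exact key n u hn hu

end Faithful

end AffineKM

namespace AffineKM

/-! ### The canonical tensor of the Killing form -/

section KillSum

open LieAlgebra

variable {L : Type*} [LieRing L] [LieAlgebra ℂ L] [FiniteDimensional ℂ L] [IsKilling ℂ L]
  {A A' : Type*} [AddCommGroup A] [Module ℂ A] [AddCommGroup A'] [Module ℂ A']

/-- The contraction of a bilinear map with the inverse of the Killing form. -/
def killSum (β : L →ₗ[ℂ] L →ₗ[ℂ] A) : A :=
  ∑ i, β (Module.finBasis ℂ L i) (LinearMap.BilinForm.dualBasis (killingForm ℂ L)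
    (IsKilling.killingForm_nondegenerate ℂ L) (Module.finBasis ℂ L) i)

theorem killSum_basis (v : L) : ∑ i, killingForm ℂ L v (Module.finBasis ℂ L i) •
    LinearMap.BilinForm.dualBasis (killingForm ℂ L)
    (IsKilling.killingForm_nondegenerate ℂ L) (Module.finBasis ℂ L) i = v := by
  set x := Module.finBasis ℂ L
  set x' := LinearMap.BilinForm.dualBasis (killingForm ℂ L)
    (IsKilling.killingForm_nondegenerate ℂ L) x
  have h : ∀ i j, killingForm ℂ L (x' i) (x j) = if j = i then 1 else 0 := fun i j ↦
    LinearMap.BilinForm.apply_dualBasis_left ..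
  have : ∀ w, ∑ i, killingForm ℂ L w (x i) • x' i = w := by
    intro w
    conv_rhs => rw [← x'.sum_repr w]
    refine Finset.sum_congr rfl fun i _ ↦ ?_
    conv_lhs => rw [← x'.sum_repr w]
    rw [map_sum, LinearMap.sum_apply]
    simp [h]
  exact this v

theorem killSum_dualBasis (v : L) : ∑ i, killingForm ℂ L v
    (LinearMap.BilinForm.dualBasis (killingForm ℂ L)
    (IsKilling.killingForm_nondegenerate ℂ L) (Module.finBasis ℂ L) i) •
      Module.finBasis ℂ L i = v := by
  set x := Module.finBasis ℂ L
  set x' := LinearMap.BilinForm.dualBasis (killingForm ℂ L)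
    (IsKilling.killingForm_nondegenerate ℂ L) x
  have h : ∀ i j, killingForm ℂ L (x' i) (x j) = if j = i then 1 else 0 := fun i j ↦
    LinearMap.BilinForm.apply_dualBasis_left ..
  have : ∀ w, ∑ i, killingForm ℂ L w (x' i) • x i = w := by
    intro w
    conv_rhs => rw [← x.sum_repr w]
    refine Finset.sum_congr rfl fun i _ ↦ ?_
    conv_lhs => rw [← x.sum_repr w]
    rw [map_sum, LinearMap.sum_apply]
    simp [LieModule.traceForm_comm ℂ L L (x _) (x' i), h]
  exact this v

/-- The canonical tensor does not depend on the pair of dual families that represents it; below it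
is evaluated on root vectors. -/
theorem killSum_eq {ι : Type*} [Fintype ι] {y z : ι → L}
    (h : ∀ v, ∑ i, killingForm ℂ L v (y i) • z i = v) (β : L →ₗ[ℂ] L →ₗ[ℂ] A) :
    killSum β = ∑ i, β (y i) (z i) := by
  have hy : ∀ i, y i = ∑ j, killingForm ℂ L (y i) _ • _ := fun i ↦ (killSum_dualBasis (y i)).symm
  have : ∀ i, β (y i) (z i) = ∑ j, killingForm ℂ L (y i)
    (LinearMap.BilinForm.dualBasis (killingForm ℂ L)
    (IsKilling.killingForm_nondegenerate ℂ L) (Module.finBasis ℂ L) j) •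
      β (Module.finBasis ℂ L j) (z i) := by
    intro i
    conv_lhs => rw [hy i]
    simp [LinearMap.sum_apply]
  simp only [this]
  rw [Finset.sum_comm]
  refine Finset.sum_congr rfl fun j _ ↦ ?_
  conv_lhs => rw [← h (LinearMap.BilinForm.dualBasis (killingForm ℂ L)
    (IsKilling.killingForm_nondegenerate ℂ L) (Module.finBasis ℂ L) j)]
  simp [LieModule.traceForm_comm ℂ L L (y _)]

theorem killSum_flip (β : L →ₗ[ℂ] L →ₗ[ℂ] A) : killSum β.flip = killSum β :=
  (killSum_eq killSum_dualBasis β).symm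

theorem map_killSum (f : A →ₗ[ℂ] A') (β : L →ₗ[ℂ] L →ₗ[ℂ] A) :
    f (killSum β) = killSum (β.compr₂ f) := by
  simp [killSum]

theorem killSum_add (β γ : L →ₗ[ℂ] L →ₗ[ℂ] A) : killSum (β + γ) = killSum β + killSum γ := by
  simp [killSum, Finset.sum_add_distrib]

theorem killSum_smul (c : ℂ) (β : L →ₗ[ℂ] L →ₗ[ℂ] A) : killSum (c • β) = c • killSum β := by
  simp [killSum, Finset.smul_sum]

theorem killSum_mem (β : L →ₗ[ℂ] L →ₗ[ℂ] A) (S : Submodule ℂ A) (h : ∀ x y, β x y ∈ S) :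
    killSum β ∈ S :=
  Submodule.sum_mem _ fun _ _ ↦ h _ _

/-- The canonical tensor is invariant. -/
theorem killSum_lie (y : L) (β : L →ₗ[ℂ] L →ₗ[ℂ] A) :
    killSum (β ∘ₗ (ad ℂ L y)) + killSum (β.compl₂ (ad ℂ L y)) = 0 := by
  have hK : ∀ x z : L, killingForm ℂ L ⁅y, x⁆ z = -killingForm ℂ L x ⁅y, z⁆ := fun x z ↦
    LieModule.traceForm_lieInvariant ℂ L L y x z
  set x := Module.finBasis ℂ L
  set x' := LinearMap.BilinForm.dualBasis (killingForm ℂ L)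
    (IsKilling.killingForm_nondegenerate ℂ L) x
  have e1 : killSum (β ∘ₗ (ad ℂ L y)) =
      ∑ i, ∑ j, killingForm ℂ L ⁅y, x i⁆ (x' j) • β (x j) (x' i) := by
    refine Finset.sum_congr rfl fun i _ ↦ ?_
    rw [LinearMap.comp_apply, ad_apply]
    conv_lhs => rw [← killSum_dualBasis ⁅y, x i⁆]
    simp [LinearMap.sum_apply, x, x']
  have e2 : killSum (β.compl₂ (ad ℂ L y)) =
      ∑ j, ∑ i, killingForm ℂ L ⁅y, x' j⁆ (x i) • β (x j) (x' i) := by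
    refine Finset.sum_congr rfl fun j _ ↦ ?_
    rw [LinearMap.compl₂_apply, ad_apply]
    conv_lhs => rw [← killSum_basis ⁅y, x' j⁆]
    simp [x, x']
  rw [e1, e2, Finset.sum_comm, ← Finset.sum_add_distrib]
  refine Finset.sum_eq_zero fun i _ ↦ ?_
  rw [← Finset.sum_add_distrib]
  refine Finset.sum_eq_zero fun j _ ↦ ?_
  rw [hK, LieModule.traceForm_comm ℂ L L (x j), neg_smul, neg_add_cancel]

end KillSum

/-! ### Root vectors -/

section RootVectors

open LieAlgebra LieAlgebra.IsKilling LieModule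

variable {L : Type*} [LieRing L] [LieAlgebra ℂ L] [FiniteDimensional ℂ L] [IsKilling ℂ L]
  {H : LieSubalgebra ℂ L} [H.IsCartanSubalgebra]

/-- A root as a linear form. -/
abbrev wt (α : H.root) : Module.Dual ℂ H := Weight.toLinear ℂ H L (α : Weight ℂ H L)

/-- An `sl₂`-triple with one vector rescaled. With this normalization root vectors of `α` and `-α`
are dual to each other, so they enter the canonical tensor with coefficient one. -/
theorem exists_root_pair (α : H.root) : ∃ p : L × L, p.1 ∈ rootSpace H (α : Weight ℂ H L) ∧
    p.2 ∈ rootSpace H (-(α : Weight ℂ H L)) ∧ killingForm ℂ L p.1 p.2 = 1 := by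
  obtain ⟨h, e, f, ht, he, hf⟩ := exists_isSl2Triple_of_weight_isNonZero (LieSubalgebra.isNonZero_coe_root α)
  have hef := lie_eq_killingForm_smul_of_mem_rootSpace_of_mem_rootSpace_neg he hf
  have h0 : killingForm ℂ L e f ≠ 0 := by
    intro h0
    rw [ht.lie_e_f, h0, zero_smul] at hef
    exact ht.h_ne_zero hef
  refine ⟨⟨e, (killingForm ℂ L e f)⁻¹ • f⟩, he, (rootSpace H _).smul_mem _ hf, ?_⟩
  rw [map_smul, smul_eq_mul, inv_mul_cancel₀ h0]

/-- A chosen vector in the root space of `α`. -/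
def rootE (α : H.root) : L := (exists_root_pair α).choose.1

/-- The vector in the root space of `-α` dual to `rootE α`. -/
def rootF (α : H.root) : L := (exists_root_pair α).choose.2

theorem rootE_mem (α : H.root) : rootE α ∈ rootSpace H (α : Weight ℂ H L) :=
  (exists_root_pair α).choose_spec.1

theorem rootF_mem (α : H.root) : rootF α ∈ rootSpace H (-(α : Weight ℂ H L)) :=
  (exists_root_pair α).choose_spec.2.1

theorem killingForm_rootE_rootF (α : H.root) : killingForm ℂ L (rootE α) (rootF α) = 1 :=
  (exists_root_pair α).choose_spec.2.2

theorem rootE_ne_zero (α : H.root) : rootE α ≠ 0 := by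
  intro h
  have := killingForm_rootE_rootF α
  rw [h, map_zero, LinearMap.zero_apply] at this
  exact zero_ne_one this

theorem lie_rootE (α : H.root) (h : H) : ⁅(h : L), rootE α⁆ = wt α h • rootE α :=
  lie_eq_smul_of_mem_rootSpace (rootE_mem α) h

theorem lie_rootF (α : H.root) (h : H) : ⁅(h : L), rootF α⁆ = (-wt α h) • rootF α :=
  lie_eq_smul_of_mem_rootSpace (rootF_mem α) h

theorem lie_rootE_rootF (α : H.root) :
    ⁅rootE α, rootF α⁆ = ((cartanEquivDual H).symm (wt α) : L) := by
  rw [lie_eq_killingForm_smul_of_mem_rootSpace_of_mem_rootSpace_neg (rootE_mem α) (rootF_mem α),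
    killingForm_rootE_rootF, one_smul]

theorem exists_eq_smul_rootE {α : H.root} {x : L} (hx : x ∈ rootSpace H (α : Weight ℂ H L)) :
    ∃ c : ℂ, x = c • rootE α := by
  have h1 := finrank_rootSpace_eq_one (α : Weight ℂ H L) (LieSubalgebra.isNonZero_coe_root α)
  obtain ⟨c, hc⟩ := (finrank_eq_one_iff_of_nonzero' (⟨rootE α, rootE_mem α⟩ : rootSpace H _)
    (fun h ↦ rootE_ne_zero α (congrArg Subtype.val h))).1 h1 ⟨x, hx⟩
  exact ⟨c, (congrArg Subtype.val hc).symm⟩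

theorem exists_neg_root (α : H.root) : ∃ β : H.root, ((β : Weight ℂ H L) : H → ℂ) = -(α : Weight ℂ H L) := by
  refine ⟨⟨-(α : Weight ℂ H L), ?_⟩, ?_⟩
  · simpa using (LieSubalgebra.isNonZero_coe_root α).neg
  · simp

theorem exists_eq_smul_rootF {α : H.root} {x : L} (hx : x ∈ rootSpace H (-(α : Weight ℂ H L))) :
    ∃ c : ℂ, x = c • rootF α := by
  obtain ⟨β, hβ⟩ := exists_neg_root α
  have hF := rootF_mem α
  rw [← hβ] at hx hF
  obtain ⟨c, rfl⟩ := exists_eq_smul_rootE hx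
  obtain ⟨d, hd⟩ := exists_eq_smul_rootE hF
  have hd0 : d ≠ 0 := by
    rintro rfl
    have := killingForm_rootE_rootF α
    rw [hd, zero_smul, map_zero] at this
    exact zero_ne_one this
  exact ⟨c * d⁻¹, by rw [hd, smul_smul, mul_assoc, inv_mul_cancel₀ hd0, mul_one]⟩

variable (b : (rootSystem H).Base)

/-- The functional with value `1` on all simple roots is evaluation at an element of `H`. Evaluating
there turns comparisons of weights into comparisons of integers. -/
theorem exists_height_eq : ∃ h₀ : H, ∀ α : H.root, wt α h₀ = (b.height α : ℂ) := by
  let φ : Module.Dual ℂ (Module.Dual ℂ H) := b.toWeightBasis.constr ℂ fun _ ↦ (1 : ℂ)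
  obtain ⟨h₀, hh⟩ := (Module.evalEquiv ℂ H).surjective φ
  refine ⟨h₀, fun α ↦ ?_⟩
  have h1 : wt α h₀ = φ (wt α) := by rw [← hh]; rfl
  obtain ⟨f, -, -, hf⟩ := b.exists_root_eq_sum_int α
  have hφ : ∀ j ∈ b.support, φ ((rootSystem H).root j) = 1 := by
    intro j hj
    have := b.toWeightBasis.constr_basis ℂ (fun _ ↦ (1 : ℂ)) ⟨j, hj⟩
    rwa [RootPairing.Base.toWeightBasis_apply] at this
  rw [h1, RootPairing.Base.height_eq_sum hf]
  change φ ((rootSystem H).root α) = _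
  rw [hf, map_sum, Int.cast_sum]
  refine Finset.sum_congr rfl fun j hj ↦ ?_
  rw [map_zsmul, hφ j hj, zsmul_one]

/-- The element of the Cartan subalgebra on which every root takes its height as value. -/
def htElt : H := (exists_height_eq b).choose

theorem wt_htElt (α : H.root) : wt α (htElt b) = (b.height α : ℂ) :=
  (exists_height_eq b).choose_spec α

/-- The positive roots. -/
abbrev PosRoot := {α : H.root // b.IsPos α}

instance : Fintype (PosRoot b) := Fintype.ofFinite _

variable {b}

theorem PosRoot.height_pos (α : PosRoot b) : 0 < b.height α.1 := α.2

/-- The triangular decomposition, as an induction principle. -/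
theorem triangular_le (b : (rootSystem H).Base) {S : Submodule ℂ L} (hH : ∀ h : H, (h : L) ∈ S)
    (hE : ∀ α : PosRoot b, rootE α.1 ∈ S) (hF : ∀ α : PosRoot b, rootF α.1 ∈ S) (x : L) :
    x ∈ S := by
  have h := iSup_genWeightSpace_eq_top' ℂ H L
  rw [← LieSubmodule.toSubmodule_inj, LieSubmodule.iSup_toSubmodule,
    LieSubmodule.top_toSubmodule] at h
  have hx : x ∈ (⊤ : Submodule ℂ L) := trivial
  rw [← h] at hx
  refine (iSup_le fun χ ↦ ?_ : _ ≤ S) hx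
  intro y hy
  by_cases hχ : χ.IsZero
  · have : y ∈ rootSpace H (0 : H → ℂ) := by
      rw [← show (χ : H → ℂ) = 0 from hχ]; exact hy
    rw [rootSpace_zero_eq] at this
    exact hH ⟨y, this⟩
  · let α : H.root := ⟨χ, by simpa using hχ⟩
    rcases RootPairing.Base.IsPos.or_neg b α with hp | hp
    · obtain ⟨c, rfl⟩ := exists_eq_smul_rootE (α := α) hy
      exact S.smul_mem _ (hE ⟨α, hp⟩)
    · have hroot := (rootSystem H).root_reflectionPerm α α
      rw [RootPairing.reflection_apply_self] at hroot
      set β := (rootSystem H).reflectionPerm α α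
      have e : (χ : H → ℂ) = -((β : Weight ℂ H L) : H → ℂ) := by
        have : wt β = -wt α := hroot
        funext z
        have := LinearMap.congr_fun this z
        simp only [LinearMap.neg_apply] at this
        change wt α z = -wt β z
        rw [this, neg_neg]
      have hy' : y ∈ rootSpace H (-((β : Weight ℂ H L) : H → ℂ)) := by rw [← e]; exact hy
      obtain ⟨c, rfl⟩ := exists_eq_smul_rootF hy'
      exact S.smul_mem _ (hF ⟨β, hp⟩)

theorem killingForm_coe_rootE (h : H) (α : H.root) : killingForm ℂ L h (rootE α) = 0 := by
  refine killingForm_apply_eq_zero_of_mem_rootSpace_of_add_ne_zero ℂ L H (α := 0)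
    (by rw [rootSpace_zero_eq]; exact h.2) (rootE_mem α) ?_
  rw [zero_add]
  exact (LieSubalgebra.isNonZero_coe_root α)

theorem killingForm_coe_rootF (h : H) (α : H.root) : killingForm ℂ L h (rootF α) = 0 := by
  refine killingForm_apply_eq_zero_of_mem_rootSpace_of_add_ne_zero ℂ L H (α := 0)
    (by rw [rootSpace_zero_eq]; exact h.2) (rootF_mem α) ?_
  rw [zero_add, ne_eq, neg_eq_zero]
  exact (LieSubalgebra.isNonZero_coe_root α)

theorem killingForm_rootE_rootE (α β : PosRoot b) :
    killingForm ℂ L (rootE α.1) (rootE β.1) = 0 := by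
  refine killingForm_apply_eq_zero_of_mem_rootSpace_of_add_ne_zero ℂ L H (rootE_mem α.1)
    (rootE_mem β.1) fun h ↦ ?_
  have := congrFun h (htElt b)
  change wt α.1 (htElt b) + wt β.1 (htElt b) = 0 at this
  rw [wt_htElt, wt_htElt] at this
  have h1 := α.height_pos
  have h2 := β.height_pos
  norm_cast at this
  omega

theorem killingForm_rootF_rootF (α β : PosRoot b) :
    killingForm ℂ L (rootF α.1) (rootF β.1) = 0 := by
  refine killingForm_apply_eq_zero_of_mem_rootSpace_of_add_ne_zero ℂ L H (rootF_mem α.1)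
    (rootF_mem β.1) fun h ↦ ?_
  have := congrFun h (htElt b)
  change -wt α.1 (htElt b) + -wt β.1 (htElt b) = 0 at this
  rw [wt_htElt, wt_htElt] at this
  have h1 := α.height_pos
  have h2 := β.height_pos
  norm_cast at this
  omega

theorem killingForm_rootE_rootF_of_ne {α β : H.root} (h : α ≠ β) :
    killingForm ℂ L (rootE α) (rootF β) = 0 := by
  refine killingForm_apply_eq_zero_of_mem_rootSpace_of_add_ne_zero ℂ L H (rootE_mem α)
    (rootF_mem β) fun h' ↦ h ?_
  refine Subtype.ext (DFunLike.coe_injective ?_)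
  rwa [add_neg_eq_zero] at h'

/-- The contraction of a bilinear map with the inverse of the Killing form on the Cartan
subalgebra. -/
def cartanSum {A : Type*} [AddCommGroup A] [Module ℂ A] (β : L →ₗ[ℂ] L →ₗ[ℂ] A) : A :=
  ∑ j, β (Module.finBasis ℂ H j : H) (LinearMap.BilinForm.dualBasis (traceForm ℂ H L)
    (traceForm_cartan_nondegenerate ℂ L H) (Module.finBasis ℂ H) j : H)

theorem sum_dualBasis_cartan (v : H) : ∑ j, killingForm ℂ L v (Module.finBasis ℂ H j : H) •
    LinearMap.BilinForm.dualBasis (traceForm ℂ H L)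
    (traceForm_cartan_nondegenerate ℂ L H) (Module.finBasis ℂ H) j = v := by
  set x := Module.finBasis ℂ H
  set x' := LinearMap.BilinForm.dualBasis (traceForm ℂ H L)
    (traceForm_cartan_nondegenerate ℂ L H) x
  have h : ∀ i j, killingForm ℂ L (x' i) (x j) = if j = i then 1 else 0 := fun i j ↦
    LinearMap.BilinForm.apply_dualBasis_left (B := traceForm ℂ H L) ..
  have : ∀ w : H, ∑ i, killingForm ℂ L w (x i) • x' i = w := by
    intro w
    conv_rhs => rw [← x'.sum_repr w]
    refine Finset.sum_congr rfl fun i _ ↦ ?_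
    have e : (w : L) = ∑ j, x'.repr w j • (x' j : L) := by
      conv_lhs => rw [← x'.sum_repr w]
      exact map_sum H.toSubmodule.subtype _ _
    rw [e, map_sum, LinearMap.sum_apply]
    simp [h]
  exact this v

/-- Root spaces pair nontrivially only with their opposites, so dual bases of `H` together with the
pairs of root vectors form dual families of `L`. -/
theorem killSum_root (b : (rootSystem H).Base) {A : Type*} [AddCommGroup A] [Module ℂ A]
    (β : L →ₗ[ℂ] L →ₗ[ℂ] A) :
    killSum β = cartanSum (H := H) β +
      ∑ α : PosRoot b, (β (rootE α.1) (rootF α.1) + β (rootF α.1) (rootE α.1)) := by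
  classical
  let x := Module.finBasis ℂ H
  let x' := LinearMap.BilinForm.dualBasis (traceForm ℂ H L)
    (traceForm_cartan_nondegenerate ℂ L H) x
  let y : _ ⊕ PosRoot b ⊕ PosRoot b → L :=
    Sum.elim (fun j ↦ (x j : L)) (Sum.elim (fun α ↦ rootE α.1) (fun α ↦ rootF α.1))
  let z : _ ⊕ PosRoot b ⊕ PosRoot b → L :=
    Sum.elim (fun j ↦ (x' j : L)) (Sum.elim (fun α ↦ rootF α.1) (fun α ↦ rootE α.1))
  have hyz : ∀ v, ∑ i, killingForm ℂ L v (y i) • z i = v := by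
    intro v
    have := triangular_le b (S := LinearMap.eqLocus
      (∑ i, (LinearMap.toSpanSingleton ℂ L (z i)) ∘ₗ ((killingForm ℂ L).flip (y i)))
      LinearMap.id) ?_ ?_ ?_ v
    · simpa [LinearMap.mem_eqLocus, LinearMap.sum_apply] using this
    · intro h
      rw [LinearMap.mem_eqLocus, LinearMap.sum_apply, Fintype.sum_sum_type, Fintype.sum_sum_type]
      have := congrArg Subtype.val (sum_dualBasis_cartan (L := L) h)
      simpa [y, z, killingForm_coe_rootE, killingForm_coe_rootF] using this
    · intro α
      rw [LinearMap.mem_eqLocus, LinearMap.sum_apply, Fintype.sum_sum_type, Fintype.sum_sum_type,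
        Finset.sum_eq_zero, Finset.sum_eq_zero, Finset.sum_eq_single α]
      · simp [y, z, killingForm_rootE_rootF]
      · intro γ _ hγ
        have : killingForm ℂ L (rootE α.1) (rootF γ.1) = 0 :=
          killingForm_rootE_rootF_of_ne fun h ↦ hγ (Subtype.ext h.symm)
        simp [y, this]
      · simp
      · intro γ _
        simp [y, killingForm_rootE_rootE]
      · intro j _
        simp [y, traceForm_comm ℂ L L (rootE _), killingForm_coe_rootE]
    · intro α
      rw [LinearMap.mem_eqLocus, LinearMap.sum_apply, Fintype.sum_sum_type, Fintype.sum_sum_type,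
        Finset.sum_eq_zero, Finset.sum_eq_single α, Finset.sum_eq_zero]
      · simp [y, z, traceForm_comm ℂ L L (rootF _), killingForm_rootE_rootF]
      · intro γ _
        simp [y, killingForm_rootF_rootF]
      · intro γ _ hγ
        have : killingForm ℂ L (rootE γ.1) (rootF α.1) = 0 :=
          killingForm_rootE_rootF_of_ne fun h ↦ hγ (Subtype.ext h)
        simp [y, traceForm_comm ℂ L L (rootF _), this]
      · simp
      · intro j _
        simp [y, traceForm_comm ℂ L L (rootF _), killingForm_coe_rootF]
  rw [killSum_eq hyz, Fintype.sum_sum_type, Fintype.sum_sum_type, Finset.sum_add_distrib]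
  rfl

end RootVectors

end AffineKM

namespace AffineKM


/-! ### The Casimir operator -/

section Casimir

open LieAlgebra LieAlgebra.IsKilling LieModule

variable {L : Type*} [LieRing L] [LieAlgebra ℂ L]
  {A : Type*} [Ring A] [Algebra ℂ A]

/-- The bilinear map `(x, y) ↦ f x * g y`. -/
def mulMap (f g : L →ₗ[ℂ] A) : L →ₗ[ℂ] L →ₗ[ℂ] A := (LinearMap.mul ℂ A).compl₁₂ f g

@[simp] theorem mulMap_apply (f g : L →ₗ[ℂ] A) (x y : L) : mulMap f g x y = f x * g y := rfl

variable [FiniteDimensional ℂ L] [IsKilling ℂ L]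

/-- The equivariant parts of the two commutators cancel by invariance of the canonical tensor, and
only the defects `f'` and `g'` survive. Without defects this yields the centrality of Casimir
elements; with them, the commutators of the Sugawara operators. -/
theorem killSum_mulMap_commutator (f g : L →ₗ[ℂ] A) (a : A) (y : L) (f' g' : L →ₗ[ℂ] A)
    (hf : ∀ x, a * f x = f x * a + f ⁅y, x⁆ + f' x) (hg : ∀ x, a * g x = g x * a + g ⁅y, x⁆ + g' x) :
    a * killSum (mulMap f g) = killSum (mulMap f g) * a + killSum (mulMap f' g) +
      killSum (mulMap f g') := by
  have h1 : a * killSum (mulMap f g) = killSum ((mulMap f g).compr₂ (LinearMap.mulLeft ℂ a)) :=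
    map_killSum (LinearMap.mulLeft ℂ a) _
  have h2 : killSum (mulMap f g) * a = killSum ((mulMap f g).compr₂ (LinearMap.mulRight ℂ a)) :=
    map_killSum (LinearMap.mulRight ℂ a) _
  have h3 := killSum_lie y (mulMap f g)
  rw [h1, h2, ← add_zero (killSum _ + _ + _), ← h3, ← killSum_add, ← killSum_add, ← killSum_add,
    ← killSum_add]
  congr 1
  ext x z
  simp only [LinearMap.compr₂_apply, LinearMap.mulLeft_apply, LinearMap.mulRight_apply,
    LinearMap.add_apply, mulMap_apply, LinearMap.comp_apply, LinearMap.compl₂_apply, ad_apply]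
  rw [← mul_assoc, hf, add_mul, add_mul, mul_assoc (f x), hg]
  noncomm_ring

theorem commute_killSum_mulMap {f g : L →ₗ[ℂ] A} {a : A} {y : L}
    (hf : ∀ x, a * f x = f x * a + f ⁅y, x⁆) (hg : ∀ x, a * g x = g x * a + g ⁅y, x⁆) :
    Commute a (killSum (mulMap f g)) := by
  have := killSum_mulMap_commutator f g a y 0 0 (by simpa using hf) (by simpa using hg)
  have h1 : mulMap (0 : L →ₗ[ℂ] A) g = 0 := by ext; simp
  have h2 : mulMap f (0 : L →ₗ[ℂ] A) = 0 := by ext; simp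
  have h3 : killSum (0 : L →ₗ[ℂ] L →ₗ[ℂ] A) = 0 := by simp [killSum]
  rw [h1, h2, h3, add_zero, add_zero] at this
  exact this

attribute [local instance] LieRing.ofAssociativeRing LieAlgebra.ofAssociativeAlgebra

variable (L) in
/-- The embedding of a Lie algebra in its enveloping algebra, as a linear map. -/
def ιL : L →ₗ[ℂ] UniversalEnvelopingAlgebra ℂ L :=
  ((UniversalEnvelopingAlgebra.ι ℂ : L →ₗ⁅ℂ⁆ UniversalEnvelopingAlgebra ℂ L) : L →ₗ[ℂ] _)

theorem ιL_apply (x : L) : ιL L x = UniversalEnvelopingAlgebra.ι ℂ x := rfl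

variable (L) in
/-- The Casimir element of the enveloping algebra. -/
def casU : UniversalEnvelopingAlgebra ℂ L :=
  killSum (mulMap (ιL L) (ιL L))

theorem commute_ι_casU (x : L) : Commute (UniversalEnvelopingAlgebra.ι ℂ x) (casU L) := by
  refine commute_killSum_mulMap (y := x) ?_ ?_ <;>
  · intro z
    rw [ιL_apply, ιL_apply, LieHom.map_lie, LieRing.of_associative_ring_bracket,
      add_sub_cancel]

variable (Y : Type*) [AddCommGroup Y] [Module ℂ Y] [LieRingModule L Y] [LieModule ℂ L Y]

/-- The Casimir operator of a module. -/
def casimir : Module.End ℂ Y :=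
  killSum (mulMap (toEnd ℂ L Y : L →ₗ[ℂ] Module.End ℂ Y) (toEnd ℂ L Y : L →ₗ[ℂ] Module.End ℂ Y))

theorem uact_casU : uact Y (casU L) = casimir (L := L) Y := by
  rw [casU, casimir]
  refine (map_killSum (uact Y).toLinearMap _).trans ?_
  congr 1
  ext x z y
  simp [ιL_apply, -UniversalEnvelopingAlgebra.ι_apply]

variable {Y}

theorem casimir_lie (x : L) (y : Y) :
    casimir (L := L) Y ⁅x, y⁆ = ⁅x, casimir (L := L) Y y⁆ := by
  have := congrArg (uact Y) (commute_ι_casU x).eq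
  rw [map_mul, map_mul] at this
  have := congr($this y)
  simpa [uact_casU, -UniversalEnvelopingAlgebra.ι_apply] using this.symm

theorem casimir_mem (N : LieSubmodule ℂ L Y) {y : Y} (hy : y ∈ N) : casimir (L := L) Y y ∈ N := by
  rw [← uact_casU]
  exact uact_mem _ N hy

/-- The kernel of a polynomial in the Casimir operator. -/
def casKer (c : ℂ) (m : ℕ) : LieSubmodule ℂ L Y :=
  { LinearMap.ker ((casimir (L := L) Y - algebraMap ℂ (Module.End ℂ Y) c) ^ m) with
    lie_mem := by
      intro x y hy
      have h : ∀ m (y : Y), ((casimir (L := L) Y - algebraMap ℂ (Module.End ℂ Y) c) ^ m) ⁅x, y⁆ =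
          ⁅x, ((casimir (L := L) Y - algebraMap ℂ (Module.End ℂ Y) c) ^ m) y⁆ := by
        intro m
        induction m with
        | zero => intro y; simp
        | succ m ih =>
          intro y
          rw [pow_succ, Module.End.mul_apply, Module.End.mul_apply, ← ih]
          congr 1
          simp [casimir_lie]
      change ((casimir (L := L) Y - algebraMap ℂ (Module.End ℂ Y) c) ^ m) ⁅x, y⁆ = 0
      have hy : ((casimir (L := L) Y - algebraMap ℂ (Module.End ℂ Y) c) ^ m) y = 0 := hy
      rw [h, hy, lie_zero] }

theorem mem_casKer {c : ℂ} {m : ℕ} {y : Y} :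
    y ∈ casKer (L := L) c m ↔ ((casimir (L := L) Y - algebraMap ℂ (Module.End ℂ Y) c) ^ m) y = 0 := Iff.rfl

end Casimir

/-! ### Modules generated by a subspace stable under half of a Lie algebra -/

section Triangular

variable {L Y : Type*} [LieRing L] [LieAlgebra ℂ L] [AddCommGroup Y] [Module ℂ Y]
  [LieRingModule L Y] [LieModule ℂ L Y]

/-- Let `Q` be the least `n`-stable subspace containing `M₀`. The vectors of `Q` sent into `Q` by
`p` contain `M₀` and are again `n`-stable, since a bracket of elements of `p` and `n` splits along
`n ⊔ p`. So `Q` is stable under `L`. Neither summand has to be a subalgebra. -/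
theorem lieSpan_le_of_triangular {n p : Submodule ℂ L} (hnp : n ⊔ p = ⊤) {M₀ S : Submodule ℂ Y}
    (hp : ∀ x ∈ p, ∀ m ∈ M₀, ⁅x, m⁆ ∈ M₀) (hM₀ : M₀ ≤ S) (hn : ∀ x ∈ n, ∀ m ∈ S, ⁅x, m⁆ ∈ S) :
    (LieSubmodule.lieSpan ℂ L (M₀ : Set Y)).toSubmodule ≤ S := by
  let C : Set (Submodule ℂ Y) := {T | M₀ ≤ T ∧ ∀ x ∈ n, ∀ m ∈ T, ⁅x, m⁆ ∈ T}
  let Q : Submodule ℂ Y := sInf C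
  have hQ : Q ∈ C := by
    refine ⟨le_sInf fun T hT ↦ hT.1, fun x hx m hm ↦ ?_⟩
    rw [Submodule.mem_sInf] at hm ⊢
    exact fun T hT ↦ hT.2 x hx m (hm T hT)
  let R : Submodule ℂ Y :=
    { carrier := {q | q ∈ Q ∧ ∀ x ∈ p, ⁅x, q⁆ ∈ Q}
      add_mem' := fun ha hb ↦ ⟨add_mem ha.1 hb.1, fun x hx ↦ by
        rw [lie_add]; exact add_mem (ha.2 x hx) (hb.2 x hx)⟩
      zero_mem' := ⟨zero_mem _, fun x _ ↦ by rw [lie_zero]; exact zero_mem _⟩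
      smul_mem' := fun c a ha ↦ ⟨Q.smul_mem c ha.1, fun x hx ↦ by
        rw [lie_smul]; exact Q.smul_mem c (ha.2 x hx)⟩ }
  have hR : Q ≤ R := by
    refine sInf_le ⟨fun m hm ↦ ⟨hQ.1 hm, fun x hx ↦ hQ.1 (hp x hx m hm)⟩, fun y hy q hq ↦ ?_⟩
    refine ⟨hQ.2 y hy q hq.1, fun x hx ↦ ?_⟩
    rw [leibniz_lie]
    refine add_mem ?_ (hQ.2 y hy _ (hq.2 x hx))
    have : ⁅x, y⁆ ∈ n ⊔ p := by rw [hnp]; trivial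
    obtain ⟨a, ha, c, hc, h⟩ := Submodule.mem_sup.1 this
    rw [← h, add_lie]
    exact add_mem (hQ.2 a ha q hq.1) (hq.2 c hc)
  let Q' : LieSubmodule ℂ L Y :=
    { Q with
      lie_mem := by
        intro x q hq
        have : x ∈ n ⊔ p := by rw [hnp]; trivial
        obtain ⟨a, ha, c, hc, rfl⟩ := Submodule.mem_sup.1 this
        rw [add_lie]
        exact add_mem (hQ.2 a ha q hq) ((hR hq).2 c hc) }
  have h1 : LieSubmodule.lieSpan ℂ L (M₀ : Set Y) ≤ Q' := LieSubmodule.lieSpan_le.2 hQ.1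
  exact fun y hy ↦ (sInf_le (show S ∈ C from ⟨hM₀, hn⟩) : Q ≤ S) (h1 hy)

end Triangular

/-! ### Weights -/

section Weights

variable {L : Type*} [LieRing L] [LieAlgebra ℂ L] {H : LieSubalgebra ℂ L}
  {Y : Type*} [AddCommGroup Y] [Module ℂ Y] [LieRingModule L Y] [LieModule ℂ L Y]

theorem IsWeightVector.add {μ : Module.Dual ℂ H} {x y : Y} (hx : IsWeightVector H μ x)
    (hy : IsWeightVector H μ y) : IsWeightVector H μ (x + y) := fun h ↦ by
  rw [lie_add, hx, hy, smul_add]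

theorem IsWeightVector.smul {μ : Module.Dual ℂ H} {x : Y} (hx : IsWeightVector H μ x) (c : ℂ) :
    IsWeightVector H μ (c • x) := fun h ↦ by
  rw [lie_smul, hx, smul_comm]

theorem IsWeightVector.zero {μ : Module.Dual ℂ H} : IsWeightVector H μ (0 : Y) := fun h ↦ by
  rw [lie_zero, smul_zero]

/-- The components of an element of an `H`-stable subspace belong to it. -/
theorem weight_component_mem {N : Submodule ℂ Y} (hN : ∀ h : H, ∀ y ∈ N, ⁅(h : L), y⁆ ∈ N)
    (s : Finset (Module.Dual ℂ H)) (x : Module.Dual ℂ H → Y)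
    (hx : ∀ μ ∈ s, IsWeightVector H μ (x μ)) (h : ∑ μ ∈ s, x μ ∈ N) : ∀ μ ∈ s, x μ ∈ N := by
  classical
  induction s using Finset.induction_on generalizing x with
  | empty => simp
  | insert ν s hν ih =>
    rw [Finset.sum_insert hν] at h
    have hs : ∀ μ ∈ s, x μ ∈ N := by
      intro μ hμ
      have hne : μ ≠ ν := fun e ↦ hν (e ▸ hμ)
      obtain ⟨t, ht⟩ : ∃ t : H, μ t ≠ ν t := by
        by_contra! hc
        exact hne (LinearMap.ext hc)
      have h1 : ∑ μ ∈ s, (μ t - ν t) • x μ ∈ N := by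
        have := sub_mem (hN t _ h) (N.smul_mem (ν t) h)
        rw [lie_add, lie_sum, hx ν (Finset.mem_insert_self _ _), smul_add, add_sub_add_left_eq_sub,
          Finset.smul_sum, ← Finset.sum_sub_distrib] at this
        convert this using 1
        refine Finset.sum_congr rfl fun μ hμ ↦ ?_
        rw [hx μ (Finset.mem_insert_of_mem hμ), sub_smul]
      have h2 := ih (fun μ ↦ (μ t - ν t) • x μ)
        (fun μ hμ ↦ (hx μ (Finset.mem_insert_of_mem hμ)).smul _) h1 μ hμ
      exact (N.smul_mem_iff (sub_ne_zero.2 ht)).1 h2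
    intro μ hμ
    rcases Finset.mem_insert.1 hμ with rfl | hμ
    · exact (N.add_mem_iff_left (Submodule.sum_mem _ hs)).1 h
    · exact hs μ hμ

theorem exists_weight_sum {Λ : Set (Module.Dual ℂ H)} {y : Y}
    (hy : y ∈ Submodule.span ℂ {e : Y | ∃ μ ∈ Λ, IsWeightVector H μ e}) :
    ∃ (s : Finset (Module.Dual ℂ H)) (x : Module.Dual ℂ H → Y), (∀ μ ∈ s, μ ∈ Λ) ∧
      (∀ μ, IsWeightVector H μ (x μ)) ∧ y = ∑ μ ∈ s, x μ := by
  classical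
  induction hy using Submodule.span_induction with
  | zero => exact ⟨∅, 0, by simp, fun μ ↦ IsWeightVector.zero, by simp⟩
  | mem y hy =>
    obtain ⟨μ, hμ, hy⟩ := hy
    refine ⟨{μ}, fun ν ↦ if ν = μ then y else 0, by simpa, fun ν ↦ ?_, by simp⟩
    beta_reduce
    split_ifs with h
    · rwa [h]
    · exact IsWeightVector.zero
  | smul c y _ hy =>
    obtain ⟨s, x, h1, h2, rfl⟩ := hy
    exact ⟨s, fun μ ↦ c • x μ, h1, fun μ ↦ (h2 μ).smul c, Finset.smul_sum⟩
  | add y z _ _ hy hz =>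
    obtain ⟨s, x, h1, h2, rfl⟩ := hy
    obtain ⟨t, x', h1', h2', rfl⟩ := hz
    refine ⟨s ∪ t, fun μ ↦ (if μ ∈ s then x μ else 0) + (if μ ∈ t then x' μ else 0), ?_, ?_, ?_⟩
    · intro μ hμ
      rcases Finset.mem_union.1 hμ with h | h
      · exact h1 μ h
      · exact h1' μ h
    · intro μ
      refine IsWeightVector.add ?_ ?_ <;> split_ifs
      · exact h2 μ
      · exact IsWeightVector.zero
      · exact h2' μ
      · exact IsWeightVector.zero
    · rw [Finset.sum_add_distrib, Finset.sum_ite_mem, Finset.sum_ite_mem,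
        Finset.union_inter_cancel_left, Finset.union_inter_cancel_right]

/-- Weight vectors of distinct weights are independent: subtracting `y` from its own expansion gives
a vanishing sum with a component of weight `ν`. -/
theorem IsWeightVector.eq_zero_of_notMem {Λ : Set (Module.Dual ℂ H)} {ν : Module.Dual ℂ H} {y : Y}
    (hν : IsWeightVector H ν y) (hy : y ∈ Submodule.span ℂ {e : Y | ∃ μ ∈ Λ, IsWeightVector H μ e})
    (h : ν ∉ Λ) : y = 0 := by
  classical
  obtain ⟨s, x, h1, h2, rfl⟩ := exists_weight_sum hy
  have hs : ν ∉ s := fun h' ↦ h (h1 ν h')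
  have := weight_component_mem (H := H) (N := (⊥ : Submodule ℂ Y)) (by simp) (insert ν s)
    (fun μ ↦ if μ = ν then -∑ μ ∈ s, x μ else x μ) ?_ ?_ ν (Finset.mem_insert_self _ _)
  · simpa using this
  · intro μ _
    beta_reduce
    split_ifs with e
    · rw [e, ← neg_one_smul ℂ]
      exact hν.smul _
    · exact h2 μ
  · have : ∑ μ ∈ s, (if μ = ν then -∑ μ ∈ s, x μ else x μ) = ∑ μ ∈ s, x μ := by
      refine Finset.sum_congr rfl fun μ hμ ↦ if_neg ?_
      rintro rfl
      exact hs hμ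
    rw [Finset.sum_insert hs, if_pos rfl, this, neg_add_cancel]
    exact zero_mem _

theorem finite_weights [FiniteDimensional ℂ Y] :
    {μ : Module.Dual ℂ H | ∃ y : Y, y ≠ 0 ∧ IsWeightVector H μ y}.Finite := by
  classical
  choose! x hx using fun μ (h : μ ∈ {μ : Module.Dual ℂ H | ∃ y : Y, y ≠ 0 ∧ IsWeightVector H μ y}) ↦ h
  have hli : LinearIndependent ℂ
      (fun μ : {μ : Module.Dual ℂ H | ∃ y : Y, y ≠ 0 ∧ IsWeightVector H μ y} ↦ x μ) := by
    change LinearIndepOn ℂ x _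
    rw [linearIndepOn_iff']
    intro t g ht h0 μ hμ
    have := weight_component_mem (H := H) (N := (⊥ : Submodule ℂ Y)) (by simp) t
      (fun μ ↦ g μ • x μ) (fun μ hμ ↦ (hx μ (ht hμ)).2.smul _) (by simpa using h0) μ hμ
    simp only [Submodule.mem_bot, smul_eq_zero] at this
    exact this.resolve_right (hx μ (ht hμ)).1
  exact Set.finite_coe_iff.1 hli.finite

end Weights

end AffineKM

namespace AffineKM

attribute [local instance] LieRing.ofAssociativeRing LieAlgebra.ofAssociativeAlgebra

/-! ### Singular vectors and highest weight modules -/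

section HighestWeight

open LieAlgebra LieAlgebra.IsKilling LieModule

variable {L : Type*} [LieRing L] [LieAlgebra ℂ L] [FiniteDimensional ℂ L] [IsKilling ℂ L]
  {H : LieSubalgebra ℂ L} [H.IsCartanSubalgebra] (b : (rootSystem H).Base)
  {Y : Type*} [AddCommGroup Y] [Module ℂ Y] [LieRingModule L Y] [LieModule ℂ L Y]

/-- The monoid generated by the simple roots. -/
def posCone : AddSubmonoid (Module.Dual ℂ H) :=
  AddSubmonoid.closure ((rootSystem H).root '' b.support)

/-- Heights on the cone are natural numbers and vanish only at the origin, which makes inductions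
along the cone possible. -/
theorem posCone_height {β : Module.Dual ℂ H} (hβ : β ∈ posCone b) :
    ∃ n : ℕ, β (htElt b) = n ∧ (n = 0 → β = 0) := by
  induction hβ using AddSubmonoid.closure_induction with
  | zero => exact ⟨0, by simp⟩
  | mem x hx =>
    obtain ⟨α, hα, rfl⟩ := hx
    refine ⟨1, ?_, by simp⟩
    have := wt_htElt b α
    rw [RootPairing.Base.height_one_of_mem_support hα] at this
    simpa using this
  | add x y _ _ hx hy =>
    obtain ⟨m, hm, hm0⟩ := hx
    obtain ⟨n, hn, hn0⟩ := hy
    refine ⟨m + n, by rw [LinearMap.add_apply, hm, hn, Nat.cast_add], fun h ↦ ?_⟩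
    rw [hm0 (by omega), hn0 (by omega), add_zero]

variable {b}

theorem wt_mem_posCone (α : PosRoot b) : wt α.1 ∈ posCone b := by
  rcases b.root_mem_or_neg_mem α.1 with h | h
  · exact h
  · exfalso
    obtain ⟨n, hn, -⟩ := posCone_height b h
    have h1 := wt_htElt b α.1
    have h2 := α.height_pos
    change (-wt α.1) (htElt b) = _ at hn
    rw [LinearMap.neg_apply, h1] at hn
    norm_cast at hn
    omega

theorem wt_ne_zero (α : H.root) : wt α ≠ 0 := by
  intro h
  refine LieSubalgebra.isNonZero_coe_root α ?_
  funext x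
  exact congr($h x)

theorem IsWeightVector.lie_rootE {ν : Module.Dual ℂ H} {w : Y} (hw : IsWeightVector H ν w)
    (α : H.root) : IsWeightVector H (ν + wt α) ⁅rootE α, w⁆ := fun h ↦ by
  rw [leibniz_lie, AffineKM.lie_rootE, smul_lie, hw, lie_smul, ← add_smul, add_comm]
  rfl

theorem IsWeightVector.lie_rootF {ν : Module.Dual ℂ H} {w : Y} (hw : IsWeightVector H ν w)
    (α : H.root) : IsWeightVector H (ν - wt α) ⁅rootF α, w⁆ := fun h ↦ by
  rw [leibniz_lie, AffineKM.lie_rootF, smul_lie, hw, lie_smul, ← add_smul, add_comm,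
    ← sub_eq_add_neg]
  rfl

variable (b) in
/-- A vector killed by the positive root vectors. -/
def IsSingular (v : Y) : Prop := ∀ α : PosRoot b, ⁅rootE α.1, v⁆ = 0

variable (b) in
/-- The value of the Casimir operator on singular vectors of weight `ν`. -/
def casVal (ν : Module.Dual ℂ H) : ℂ :=
  ν ((cartanEquivDual H).symm ν) + ∑ α : PosRoot b, ν ((cartanEquivDual H).symm (wt α.1))

theorem traceForm_cartanEquivDual_symm (μ : Module.Dual ℂ H) (x : H) :
    traceForm ℂ H L ((cartanEquivDual H).symm μ) x = μ x :=
  LinearMap.BilinForm.apply_toDual_symm_apply (hB := traceForm_cartan_nondegenerate ℂ L H) μ x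

theorem cartanEquivDual_symm_comm (μ ν : Module.Dual ℂ H) :
    μ ((cartanEquivDual H).symm ν) = ν ((cartanEquivDual H).symm μ) := by
  rw [← traceForm_cartanEquivDual_symm μ, ← traceForm_cartanEquivDual_symm ν, traceForm_comm]

theorem sum_weight_dual (ν : Module.Dual ℂ H) :
    ∑ j, ν (Module.finBasis ℂ H j) * ν (LinearMap.BilinForm.dualBasis (traceForm ℂ H L)
    (traceForm_cartan_nondegenerate ℂ L H) (Module.finBasis ℂ H) j) =
      ν ((cartanEquivDual H).symm ν) := by
  have h := sum_dualBasis_cartan (L := L) ((cartanEquivDual H).symm ν)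
  conv_rhs => rw [← h]
  rw [map_sum]
  refine Finset.sum_congr rfl fun j _ ↦ ?_
  rw [map_smul, smul_eq_mul]
  congr 1
  exact (traceForm_cartanEquivDual_symm ν _).symm

/-- Each `e f + f e` is rewritten as `2 f e + ⁅e, f⁆`, and `⁅e, f⁆` acts on weight `ν` by `(ν, α)`;
the sum over positive roots is the shift by `2ρ` in `casVal`. -/
theorem casimir_weight (b : (rootSystem H).Base) {ν : Module.Dual ℂ H} {w : Y}
    (hw : IsWeightVector H ν w) : casimir (L := L) Y w = casVal b ν • w +
      2 • ∑ α : PosRoot b, ⁅rootF α.1, ⁅rootE α.1, w⁆⁆ := by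
  rw [casimir, killSum_root b, cartanSum, LinearMap.add_apply, LinearMap.sum_apply,
    LinearMap.sum_apply, casVal, add_smul, add_assoc]
  congr 1
  · rw [← sum_weight_dual, Finset.sum_smul]
    refine Finset.sum_congr rfl fun j _ ↦ ?_
    simp only [mulMap_apply, Module.End.mul_apply]
    change ⁅((_ : H) : L), ⁅((_ : H) : L), w⁆⁆ = _
    rw [hw, lie_smul, hw, smul_smul, mul_comm]
  · rw [Finset.sum_smul, Finset.smul_sum, ← Finset.sum_add_distrib]
    refine Finset.sum_congr rfl fun α _ ↦ ?_
    simp only [mulMap_apply, Module.End.mul_apply, LinearMap.add_apply]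
    change ⁅rootE α.1, ⁅rootF α.1, w⁆⁆ + ⁅rootF α.1, ⁅rootE α.1, w⁆⁆ = _
    rw [leibniz_lie, lie_rootE_rootF, hw, two_nsmul, add_assoc]

theorem casimir_sub_mem (N : LieSubmodule ℂ L Y) {ν : Module.Dual ℂ H} {w : Y}
    (hw : IsWeightVector H ν w) (hN : ∀ α : PosRoot b, ⁅rootE α.1, w⁆ ∈ N) :
    casimir (L := L) Y w - casVal b ν • w ∈ N := by
  rw [casimir_weight b hw, add_sub_cancel_left]
  exact nsmul_mem (sum_mem fun α _ ↦ N.lie_mem (hN α)) 2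

theorem IsSingular.casimir {ν : Module.Dual ℂ H} {w : Y} (hs : IsSingular b w)
    (hw : IsWeightVector H ν w) : casimir (L := L) Y w = casVal b ν • w := by
  have := casimir_sub_mem (b := b) ⊥ hw fun α ↦ by rw [hs α]; exact zero_mem _
  simpa [sub_eq_zero] using this

/-- The span of the vectors whose weight is `ν - β` for some nonzero `β` in the positive cone. -/
def lowerSpan (b : (rootSystem H).Base) (Y : Type*) [AddCommGroup Y] [Module ℂ Y]
    [LieRingModule L Y] [LieModule ℂ L Y] (ν : Module.Dual ℂ H) : Submodule ℂ Y :=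
  Submodule.span ℂ {w | ∃ μ ∈ {μ | ∃ β ∈ posCone b, β ≠ 0 ∧ μ = ν - β}, IsWeightVector H μ w}

/-- The image of a submodule under the negative root vectors. -/
def negImage (b : (rootSystem H).Base) (N : LieSubmodule ℂ L Y) : Submodule ℂ Y :=
  Submodule.span ℂ {w | ∃ α : PosRoot b, ∃ q ∈ N, w = ⁅rootF α.1, q⁆}

variable (b) in
theorem triangular_sup : Submodule.span ℂ (Set.range fun α : PosRoot b ↦ rootF α.1) ⊔
    (H.toSubmodule ⊔ Submodule.span ℂ (Set.range fun α : PosRoot b ↦ rootE α.1)) = ⊤ := by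
  rw [eq_top_iff]
  intro x _
  refine triangular_le b (fun h ↦ ?_) (fun α ↦ ?_) (fun α ↦ ?_) x
  · exact Submodule.mem_sup_right (Submodule.mem_sup_left h.2)
  · exact Submodule.mem_sup_right (Submodule.mem_sup_right (Submodule.subset_span ⟨α, rfl⟩))
  · exact Submodule.mem_sup_left (Submodule.subset_span ⟨α, rfl⟩)

theorem IsSingular.borel_stable {ν : Module.Dual ℂ H} {v : Y} (hs : IsSingular b v)
    (hv : IsWeightVector H ν v) : ∀ x ∈ H.toSubmodule ⊔
      Submodule.span ℂ (Set.range fun α : PosRoot b ↦ rootE α.1), ∀ m ∈ ℂ ∙ v, ⁅x, m⁆ ∈ ℂ ∙ v := by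
  intro x hx m hm
  obtain ⟨c, rfl⟩ := Submodule.mem_span_singleton.1 hm
  obtain ⟨h, hh, e, he, rfl⟩ := Submodule.mem_sup.1 hx
  have he0 : ⁅e, v⁆ = 0 := by
    clear hx
    induction he using Submodule.span_induction with
    | zero => simp
    | mem e he => obtain ⟨α, rfl⟩ := he; exact hs α
    | add x y _ _ hx hy => rw [add_lie, hx, hy, add_zero]
    | smul c x _ hx => rw [smul_lie, hx, smul_zero]
  rw [lie_smul, add_lie, he0, add_zero, hv ⟨h, hh⟩]
  exact Submodule.smul_mem _ _ (Submodule.smul_mem _ _ (Submodule.mem_span_singleton_self v))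

theorem lowerSpan_lie {ν : Module.Dual ℂ H} (α : PosRoot b) {w : Y}
    (hν : IsWeightVector H ν w ∨ w ∈ lowerSpan b Y ν) :
    ⁅rootF α.1, w⁆ ∈ lowerSpan b Y ν := by
  rcases hν with h | h
  · exact Submodule.subset_span ⟨_, ⟨wt α.1, wt_mem_posCone α, wt_ne_zero _, rfl⟩, h.lie_rootF α.1⟩
  · induction h using Submodule.span_induction with
    | zero => simp
    | add x y _ _ hx hy => rw [lie_add]; exact add_mem hx hy
    | smul c x _ hx => rw [lie_smul]; exact Submodule.smul_mem _ _ hx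
    | mem x hx =>
      obtain ⟨_, ⟨β, hβ, hβ0, rfl⟩, hx⟩ := hx
      refine Submodule.subset_span ⟨_, ⟨β + wt α.1, add_mem hβ (wt_mem_posCone α), fun h0 ↦ ?_, rfl⟩,
        ?_⟩
      · obtain ⟨m, hm, hm0⟩ := posCone_height b hβ
        obtain ⟨n, hn, hn0⟩ := posCone_height b (wt_mem_posCone α)
        have := congr($h0 (htElt b))
        rw [LinearMap.add_apply, hm, hn, LinearMap.zero_apply] at this
        norm_cast at this
        exact hβ0 (hm0 (by omega))
      · rw [← sub_sub]
        exact hx.lie_rootF α.1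

theorem IsSingular.lieSpan_le_lower {ν : Module.Dual ℂ H} {v : Y} (hs : IsSingular b v)
    (hv : IsWeightVector H ν v) :
    (LieSubmodule.lieSpan ℂ L {v}).toSubmodule ≤ (ℂ ∙ v) ⊔ lowerSpan b Y ν := by
  have h : LieSubmodule.lieSpan ℂ L {v} = LieSubmodule.lieSpan ℂ L ((ℂ ∙ v : Submodule ℂ Y) : Set Y) := by
    refine le_antisymm (LieSubmodule.lieSpan_mono
      (by simp)) (LieSubmodule.lieSpan_le.2 ?_)
    exact Submodule.span_le.2 LieSubmodule.subset_lieSpan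
  rw [h]
  refine lieSpan_le_of_triangular (triangular_sup b) (hs.borel_stable hv) le_sup_left ?_
  intro x hx m hm
  obtain ⟨m₁, h1, m₂, h2, rfl⟩ := Submodule.mem_sup.1 hm
  obtain ⟨c, rfl⟩ := Submodule.mem_span_singleton.1 h1
  refine Submodule.mem_sup_right ?_
  induction hx using Submodule.span_induction with
  | zero => simp
  | add x y _ _ hx hy => rw [add_lie]; exact add_mem hx hy
  | smul c x _ hx => rw [smul_lie]; exact Submodule.smul_mem _ _ hx
  | mem x hx =>
    obtain ⟨α, rfl⟩ := hx
    rw [lie_add]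
    exact add_mem
      (lowerSpan_lie α (Or.inl (hv.smul c))) (lowerSpan_lie α (Or.inr h2))

theorem IsSingular.negImage_le {ν : Module.Dual ℂ H} {v : Y} (hs : IsSingular b v)
    (hv : IsWeightVector H ν v) :
    negImage b (LieSubmodule.lieSpan ℂ L {v}) ≤ lowerSpan b Y ν := by
  refine Submodule.span_le.2 ?_
  rintro _ ⟨α, q, hq, rfl⟩
  obtain ⟨m₁, h1, m₂, h2, rfl⟩ := Submodule.mem_sup.1 (hs.lieSpan_le_lower hv hq)
  obtain ⟨c, rfl⟩ := Submodule.mem_span_singleton.1 h1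
  rw [lie_add]
  exact add_mem
    (lowerSpan_lie α (Or.inl (hv.smul c))) (lowerSpan_lie α (Or.inr h2))

theorem IsWeightVector.eq_zero_of_mem_lowerSpan {ν : Module.Dual ℂ H} {v : Y}
    (hv : IsWeightVector H ν v) (h : v ∈ lowerSpan b Y ν) : v = 0 := by
  refine hv.eq_zero_of_notMem h ?_
  rintro ⟨β, -, hβ0, h⟩
  exact hβ0 (by simpa using h.symm)

/-- A vector of highest weight in a highest weight module is a multiple of the generator. -/
theorem IsSingular.mem_span_of_isWeightVector {ν : Module.Dual ℂ H} {v : Y} (hs : IsSingular b v)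
    (hv : IsWeightVector H ν v) {u : Y} (hu : u ∈ LieSubmodule.lieSpan ℂ L {v})
    (huw : IsWeightVector H ν u) : u ∈ ℂ ∙ v := by
  obtain ⟨m₁, h1, m₂, h2, rfl⟩ := Submodule.mem_sup.1 (hs.lieSpan_le_lower hv hu)
  obtain ⟨c, rfl⟩ := Submodule.mem_span_singleton.1 h1
  have h3 : IsWeightVector H ν m₂ := by
    have := huw.add (hv.smul (-c))
    rw [neg_smul, add_neg_eq_iff_eq_add.2 (add_comm _ _)] at this
    exact this
  rw [h3.eq_zero_of_mem_lowerSpan h2, add_zero]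
  exact h1

theorem IsSingular.lieSpan_le_weights {ν : Module.Dual ℂ H} {v : Y} (hs : IsSingular b v)
    (hv : IsWeightVector H ν v) : (LieSubmodule.lieSpan ℂ L {v}).toSubmodule ≤
      Submodule.span ℂ {w | ∃ μ ∈ {μ | ∃ β ∈ posCone b, μ = ν - β}, IsWeightVector H μ w} := by
  refine (hs.lieSpan_le_lower hv).trans (sup_le ?_ (Submodule.span_mono ?_))
  · rw [Submodule.span_le, Set.singleton_subset_iff]
    exact Submodule.subset_span ⟨ν, ⟨0, zero_mem _, (sub_zero _).symm⟩, hv⟩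
  · rintro w ⟨_, ⟨β, hβ, -, rfl⟩, hw⟩
    exact ⟨_, ⟨β, hβ, rfl⟩, hw⟩

/-- Among the weight vectors outside a submodule there is one which is singular modulo it. -/
theorem exists_singular_mod [FiniteDimensional ℂ Y] (b : (rootSystem H).Base)
    (N T : LieSubmodule ℂ L Y) {μ : Module.Dual ℂ H} {w : Y}
    (hw : IsWeightVector H μ w) (hwT : w ∈ T) (hwN : w ∉ N) :
    ∃ β ∈ posCone b, ∃ v ∈ T, v ∉ N ∧ IsWeightVector H (μ + β) v ∧
      ∀ α : PosRoot b, ⁅rootE α.1, v⁆ ∈ N := by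
  classical
  -- `P n` says that some weight vector outside `N` sits `n` steps above `μ`. Finitely many weights
  -- bound `n`, and at the maximum every raising operator must fall into `N`.
  let P : ℕ → Prop := fun n ↦ ∃ β ∈ posCone b, β (htElt b) = n ∧ ∃ v ∈ T, v ∉ N ∧
    IsWeightVector H (μ + β) v
  have hP0 : P 0 := ⟨0, zero_mem _, by simp, w, hwT, hwN, by simpa using hw⟩
  have hfin : {n | P n}.Finite := by
    have h1 := (finite_weights (H := H) (L := L) (Y := Y)).image fun ν ↦ (ν - μ) (htElt b)
    have h2 := h1.preimage (f := fun n : ℕ ↦ (n : ℂ)) (Nat.cast_injective.injOn)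
    refine h2.subset ?_
    rintro n ⟨β, -, hβ, v, -, hvN, hv⟩
    exact ⟨μ + β, ⟨v, fun h ↦ hvN (h ▸ zero_mem N), hv⟩, by simpa using hβ⟩
  obtain ⟨n, hn, hmax⟩ := hfin.exists_maximal ⟨0, hP0⟩
  obtain ⟨β, hβ, hβn, v, hvT, hvN, hv⟩ := hn
  refine ⟨β, hβ, v, hvT, hvN, hv, fun α ↦ ?_⟩
  by_contra hc
  obtain ⟨m, hm, hm0⟩ := posCone_height b (wt_mem_posCone α)
  have hPm : P (n + m) := ⟨β + wt α.1, add_mem hβ (wt_mem_posCone α), by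
    rw [LinearMap.add_apply, hβn, hm, Nat.cast_add], _, T.lie_mem hvT, hc, by
    rw [← add_assoc]; exact hv.lie_rootE α.1⟩
  have h1 : n + m ≤ n := hmax hPm (Nat.le_add_right _ _)
  exact wt_ne_zero _ (hm0 (by omega))

theorem exists_singular [FiniteDimensional ℂ Y] (b : (rootSystem H).Base)
    (T : LieSubmodule ℂ L Y) {μ : Module.Dual ℂ H} {w : Y}
    (hw : IsWeightVector H μ w) (hwT : w ∈ T) (hw0 : w ≠ 0) :
    ∃ β ∈ posCone b, ∃ v ∈ T, v ≠ 0 ∧ IsWeightVector H (μ + β) v ∧ IsSingular b v := by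
  obtain ⟨β, hβ, v, hv, h1, h2, h3⟩ := exists_singular_mod b ⊥ T hw hwT (by simpa using hw0)
  exact ⟨β, hβ, v, hv, by simpa using h1, h2, fun α ↦ by simpa using h3 α⟩

end HighestWeight

end AffineKM

namespace AffineKM

attribute [local instance] LieRing.ofAssociativeRing LieAlgebra.ofAssociativeAlgebra

/-! ### Dominant weights and complete reducibility -/

section Dominant

open LieAlgebra LieAlgebra.IsKilling LieModule
open scoped ComplexOrder

variable {L : Type*} [LieRing L] [LieAlgebra ℂ L] [FiniteDimensional ℂ L] [IsKilling ℂ L]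
  {H : LieSubalgebra ℂ L} [H.IsCartanSubalgebra] (b : (rootSystem H).Base)

/-- A weight whose values on the simple coroots are nonnegative. -/
def IsDominant (ν : Module.Dual ℂ H) : Prop :=
  ∀ α ∈ b.support, 0 ≤ ν ((rootSystem H).coroot α)

-- For each simple root the vector is primitive for an `sl₂`-triple, and in finite dimension the
-- eigenvalue of a primitive vector is a natural number.
variable {b} in
theorem IsSingular.isDominant {Y : Type*} [AddCommGroup Y] [Module ℂ Y] [LieRingModule L Y]
    [LieModule ℂ L Y] [FiniteDimensional ℂ Y] {ν : Module.Dual ℂ H} {v : Y} (hs : IsSingular b v)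
    (hv : IsWeightVector H ν v) (h0 : v ≠ 0) : IsDominant b ν := by
  intro α hα
  obtain ⟨h, e, f, ht, he, hf⟩ :=
    exists_isSl2Triple_of_weight_isNonZero (LieSubalgebra.isNonZero_coe_root α)
  have hh := ht.h_eq_coroot (LieSubalgebra.isNonZero_coe_root α) he hf
  obtain ⟨c, rfl⟩ := exists_eq_smul_rootE he
  have P : ht.HasPrimitiveVectorWith v (ν ((rootSystem H).coroot α)) :=
    { ne_zero := h0
      lie_h := by rw [hh]; exact hv _
      lie_e := by
        rw [smul_lie, hs ⟨α, RootPairing.Base.isPos_of_mem_support hα⟩, smul_zero] }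
  obtain ⟨n, hn⟩ := P.exists_nat
  rw [hn]
  exact Nat.cast_nonneg n

/-- `(α, α)` is four divided by the Killing norm of the coroot, and the latter is a sum over the
weights of squares of integers, the root `α` itself contributing `4`. -/
theorem normSq_pos (α : H.root) : 0 < wt α ((cartanEquivDual H).symm (wt α)) := by
  set t := (cartanEquivDual H).symm (wt α) with ht
  have hα := LieSubalgebra.isNonZero_coe_root α
  have hne : wt α t ≠ 0 := root_apply_cartanEquivDual_symm_ne_zero hα
  have hcor : coroot (α : Weight ℂ H L) = (2 * (wt α t)⁻¹) • t := by
    rw [coroot, two_mul, add_smul, two_nsmul]; rfl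
  have h1 : killingForm ℂ L (coroot (α : Weight ℂ H L)) (coroot (α : Weight ℂ H L)) =
      4 * (wt α t)⁻¹ := by
    change traceForm ℂ H L _ _ = _
    rw [hcor, map_smul (traceForm ℂ H L), LinearMap.smul_apply, traceForm_cartanEquivDual_symm,
      map_smul, smul_eq_mul, smul_eq_mul]
    field_simp
    norm_num
  have h2 : 0 < killingForm ℂ L (coroot (α : Weight ℂ H L)) (coroot (α : Weight ℂ H L)) := by
    have := congr($(restrict_killingForm_eq_sum (K := ℂ) (L := L) (H := H))
      (coroot (α : Weight ℂ H L)) (coroot (α : Weight ℂ H L)))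
    rw [LinearMap.BilinForm.restrict_apply] at this
    change killingForm ℂ L (coroot (α : Weight ℂ H L)) (coroot (α : Weight ℂ H L)) = _ at this
    rw [this, LinearMap.sum_apply, LinearMap.sum_apply]
    have hsq : ∀ β : Weight ℂ H L, ∃ n : ℤ, β (coroot (α : Weight ℂ H L)) = n := fun β ↦
      ⟨_, apply_coroot_eq_cast _ _⟩
    refine Finset.sum_pos' (fun β _ ↦ ?_) ⟨α, α.2, ?_⟩
    · obtain ⟨n, hn⟩ := hsq β
      simp only [LinearMap.smulRight_apply, LinearMap.smul_apply, Weight.toLinear_apply, hn,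
        smul_eq_mul]
      exact_mod_cast mul_self_nonneg n
    · simp only [LinearMap.smulRight_apply, LinearMap.smul_apply, Weight.toLinear_apply,
        root_apply_coroot hα, smul_eq_mul]
      norm_num
  rw [h1] at h2
  have h3 : wt α t = 4 * (4 * (wt α t)⁻¹)⁻¹ := by field_simp
  rw [h3]
  exact mul_pos (by norm_num) (inv_pos.2 h2)

theorem cartanEquivDual_symm_wt (α : H.root) : (cartanEquivDual H).symm (wt α) =
    (wt α ((cartanEquivDual H).symm (wt α)) / 2) • (rootSystem H).coroot α := by
  set t := (cartanEquivDual H).symm (wt α) with ht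
  have hne : wt α t ≠ 0 :=
    root_apply_cartanEquivDual_symm_ne_zero (LieSubalgebra.isNonZero_coe_root α)
  have hcor : coroot (α : Weight ℂ H L) = (2 * (wt α t)⁻¹) • t := by
    rw [coroot, two_mul, add_smul, two_nsmul]; rfl
  have h1 : wt α t / 2 * (2 * (wt α t)⁻¹) = 1 := by field_simp
  rw [rootSystem_coroot_apply, hcor, smul_smul, h1, one_smul]

variable {b} in
theorem IsDominant.nonneg {ν β : Module.Dual ℂ H} (hν : IsDominant b ν) (hβ : β ∈ posCone b) :
    0 ≤ ν ((cartanEquivDual H).symm β) := by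
  induction hβ using AddSubmonoid.closure_induction with
  | zero => simp
  | add x y _ _ hx hy => rw [map_add, map_add]; exact add_nonneg hx hy
  | mem x hx =>
    obtain ⟨α, hα, rfl⟩ := hx
    change 0 ≤ ν ((cartanEquivDual H).symm (wt α))
    rw [cartanEquivDual_symm_wt, map_smul, smul_eq_mul]
    exact mul_nonneg (div_nonneg (normSq_pos α).le (by norm_num)) (hν α hα)

/-- The sum of the positive roots. -/
def twoRho : Module.Dual ℂ H := ∑ α : PosRoot b, wt α.1

theorem casVal_eq (ν : Module.Dual ℂ H) : casVal b ν =
    ν ((cartanEquivDual H).symm ν) + twoRho b ((cartanEquivDual H).symm ν) := by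
  rw [casVal, twoRho, LinearMap.sum_apply]
  congr 1
  exact Finset.sum_congr rfl fun α _ ↦ cartanEquivDual_symm_comm _ _

/-- A simple reflection permutes the positive roots other than `α` and changes the sign of their
values on the coroot of `α`; these values cancel, and `α` contributes `2`. -/
theorem twoRho_coroot {α : H.root} (hα : α ∈ b.support) :
    twoRho b ((rootSystem H).coroot α) = 2 := by
  classical
  let i : PosRoot b := ⟨α, RootPairing.Base.isPos_of_mem_support hα⟩
  have hne : ∀ β : {β : PosRoot b // β ≠ i}, β.1.1 ≠ α := fun β h ↦ β.2 (Subtype.ext h)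
  have hinj : ∀ β : H.root, β ≠ α → b.IsPos β → (rootSystem H).reflectionPerm α β ≠ α := by
    intro β hβ hp h
    have h1 : (rootSystem H).reflectionPerm α α = β := by
      have := (rootSystem H).reflectionPerm_self α β
      rwa [h] at this
    have h2 := (rootSystem H).root_reflectionPerm α α
    rw [RootPairing.reflection_apply_self, h1] at h2
    have h3 := wt_htElt b β
    have h4 := wt_htElt b α
    have h5 : wt β = -wt α := h2
    rw [h5, LinearMap.neg_apply, h4, RootPairing.Base.height_one_of_mem_support hα] at h3
    have : 0 < b.height β := hp
    norm_cast at h3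
    omega
  let σ : {β : PosRoot b // β ≠ i} ≃ {β : PosRoot b // β ≠ i} :=
    { toFun := fun β ↦ ⟨⟨(rootSystem H).reflectionPerm α β.1.1,
        RootPairing.Base.IsPos.reflectionPerm β.1.2 hα (hne β)⟩,
        fun h ↦ hinj _ (hne β) β.1.2 (congrArg Subtype.val h)⟩
      invFun := fun β ↦ ⟨⟨(rootSystem H).reflectionPerm α β.1.1,
        RootPairing.Base.IsPos.reflectionPerm β.1.2 hα (hne β)⟩,
        fun h ↦ hinj _ (hne β) β.1.2 (congrArg Subtype.val h)⟩
      left_inv := fun β ↦ Subtype.ext (Subtype.ext (by simp))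
      right_inv := fun β ↦ Subtype.ext (Subtype.ext (by simp)) }
  have h0 : ∑ β : {β : PosRoot b // β ≠ i}, wt β.1.1 ((rootSystem H).coroot α) = 0 := by
    have h1 := Equiv.sum_comp σ fun β ↦ wt β.1.1 ((rootSystem H).coroot α)
    have h2 : ∀ β, wt (σ β).1.1 ((rootSystem H).coroot α) =
        -wt β.1.1 ((rootSystem H).coroot α) := by
      intro β
      have := (rootSystem H).pairing_reflectionPerm α β.1.1 α
      change (rootSystem H).pairing ((rootSystem H).reflectionPerm α β.1.1) α =
        -(rootSystem H).pairing β.1.1 α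
      rw [← this]
      simp
    simp only [h2, Finset.sum_neg_distrib] at h1
    exact self_eq_neg.1 h1.symm
  have h3 : ∑ β ∈ Finset.univ.erase i, wt β.1 ((rootSystem H).coroot α) =
      ∑ β : {β : PosRoot b // β ≠ i}, wt β.1.1 ((rootSystem H).coroot α) :=
    Finset.sum_subtype (Finset.univ.erase i) (by simp)
      (fun β : PosRoot b ↦ wt β.1 ((rootSystem H).coroot α))
  rw [twoRho, LinearMap.sum_apply, ← Finset.add_sum_erase _ _ (Finset.mem_univ i), h3, h0, add_zero]
  exact root_apply_coroot (LieSubalgebra.isNonZero_coe_root α)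

theorem twoRho_pos {β : Module.Dual ℂ H} (hβ : β ∈ posCone b) :
    0 ≤ twoRho b ((cartanEquivDual H).symm β) ∧
      (twoRho b ((cartanEquivDual H).symm β) = 0 → β = 0) := by
  have hsimple : ∀ α ∈ b.support, 0 < twoRho b ((cartanEquivDual H).symm (wt α)) := by
    intro α hα
    rw [cartanEquivDual_symm_wt, map_smul, twoRho_coroot b hα, smul_eq_mul]
    exact mul_pos (div_pos (normSq_pos α) (by norm_num)) (by norm_num)
  induction hβ using AddSubmonoid.closure_induction with
  | zero => simp
  | mem x hx =>
    obtain ⟨α, hα, rfl⟩ := hx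
    exact ⟨(hsimple α hα).le, fun h ↦ absurd h (hsimple α hα).ne'⟩
  | add x y _ _ hx hy =>
    rw [map_add, map_add]
    refine ⟨add_nonneg hx.1 hy.1, fun h ↦ ?_⟩
    obtain ⟨h1, h2⟩ := (add_eq_zero_iff_of_nonneg hx.1 hy.1).1 h
    rw [hx.2 h1, hy.2 h2, add_zero]

-- The two Casimir values differ by `(μ + β, β) + (μ, β) + (2ρ, β)`, a sum of nonnegative numbers
-- whose last term vanishes only for `β = 0`. So Casimir values separate comparable dominant
-- weights.
variable {b} in
theorem IsDominant.eq_zero_of_casVal_eq {μ β : Module.Dual ℂ H} (hμ : IsDominant b μ)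
    (hl : IsDominant b (μ + β)) (hβ : β ∈ posCone b) (h : casVal b (μ + β) = casVal b μ) :
    β = 0 := by
  have h1 : casVal b (μ + β) - casVal b μ = (μ + β) ((cartanEquivDual H).symm β) +
      μ ((cartanEquivDual H).symm β) + twoRho b ((cartanEquivDual H).symm β) := by
    rw [casVal_eq, casVal_eq, cartanEquivDual_symm_comm μ β]
    simp only [map_add, LinearMap.add_apply]
    rw [cartanEquivDual_symm_comm μ β]
    ring
  rw [h, sub_self] at h1
  have h2 := add_nonneg (hl.nonneg hβ) (hμ.nonneg hβ)
  have h3 := (twoRho_pos b hβ)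
  exact h3.2 ((add_eq_zero_iff_of_nonneg h2 h3.1).1 h1.symm).2

end Dominant

/-! ### Complete reducibility of finite dimensional weight modules, by means of the Casimir
operator. -/

section Reducible

open LieAlgebra LieAlgebra.IsKilling LieModule

variable {L : Type*} [LieRing L] [LieAlgebra ℂ L] [FiniteDimensional ℂ L] [IsKilling ℂ L]
  {H : LieSubalgebra ℂ L} [H.IsCartanSubalgebra] {b : (rootSystem H).Base}
  {Y : Type*} [AddCommGroup Y] [Module ℂ Y] [LieRingModule L Y] [LieModule ℂ L Y]
  [FiniteDimensional ℂ Y]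

/-- Highest weight modules of finite dimension are simple. -/
theorem IsSingular.isAtom_lieSpan {ν : Module.Dual ℂ H} {v : Y} (hs : IsSingular b v)
    (hv : IsWeightVector H ν v) (h0 : v ≠ 0) : IsAtom (LieSubmodule.lieSpan ℂ L {v}) := by
  have hvs : v ∈ LieSubmodule.lieSpan ℂ L {v} := LieSubmodule.subset_lieSpan rfl
  refine ⟨fun h ↦ h0 ((LieSubmodule.mem_bot v).1 (h ▸ hvs)), fun N hN ↦ ?_⟩
  by_contra hNbot
  obtain ⟨x, hx, hx0⟩ : ∃ x ∈ N, x ≠ 0 := by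
    by_contra! hc
    exact hNbot ((LieSubmodule.eq_bot_iff N).2 hc)
  obtain ⟨s, y, h1, h2, rfl⟩ := exists_weight_sum (hs.lieSpan_le_weights hv (hN.le hx))
  have hmem := weight_component_mem (H := H) (N := N.toSubmodule)
    (fun h y hy ↦ N.lie_mem hy) s y (fun μ _ ↦ h2 μ) hx
  obtain ⟨μ, hμ, hμ0⟩ : ∃ μ ∈ s, y μ ≠ 0 := by
    by_contra! hc
    exact hx0 (Finset.sum_eq_zero hc)
  -- A nonzero submodule contains a singular vector `u`, of some dominant weight `ν - γ`. The
  -- Casimir operator is the scalar `casVal b ν` on the whole module, which forces `γ = 0`; then `u`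
  -- is a multiple of the generator.
  obtain ⟨β, hβ, u, hu, hu0, huw, hus⟩ := exists_singular b N (h2 μ) (hmem μ hμ) hμ0
  obtain ⟨γ, hγ, hγe⟩ : ∃ γ ∈ posCone b, μ + β = ν - γ := by
    by_contra hc
    exact hu0 (huw.eq_zero_of_notMem (hs.lieSpan_le_weights hv (hN.le hu)) fun h ↦ hc h)
  have hcas : ∀ z ∈ LieSubmodule.lieSpan ℂ L {v},
      AffineKM.casimir (L := L) Y z = casVal b ν • z := by
    intro z hz
    have : LieSubmodule.lieSpan ℂ L {v} ≤ casKer (L := L) (casVal b ν) 1 := by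
      rw [LieSubmodule.lieSpan_le, Set.singleton_subset_iff]
      change _ = _
      rw [pow_one, LinearMap.sub_apply, hs.casimir hv]
      exact sub_self _
    have h3 := mem_casKer.1 (this hz)
    rw [pow_one, LinearMap.sub_apply] at h3
    exact sub_eq_zero.1 h3
  rw [hγe] at huw
  have h4 : casVal b (ν - γ) = casVal b ν := by
    have := (hus.casimir huw).symm.trans (hcas u (hN.le hu))
    exact smul_left_injective ℂ hu0 this
  have h5 := hus.isDominant huw hu0
  have h6 : γ = 0 := h5.eq_zero_of_casVal_eq (by rw [sub_add_cancel]; exact hs.isDominant hv h0) hγ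
    (by rw [sub_add_cancel, h4])
  rw [h6, sub_zero] at huw
  obtain ⟨c, rfl⟩ := Submodule.mem_span_singleton.1 (hs.mem_span_of_isWeightVector hv (hN.le hu) huw)
  refine hN.not_ge (LieSubmodule.lieSpan_le.2 (Set.singleton_subset_iff.2 ?_))
  exact (N.toSubmodule.smul_mem_iff (fun hc ↦ hu0 (by rw [hc, zero_smul]))).1 hu

/-- Finite dimensional weight modules are generated by their singular weight vectors. -/
theorem lieSpan_singular_eq_top (b : (rootSystem H).Base) {Λ : Set (Module.Dual ℂ H)}
    (hY : IsWeightModule H Y Λ) :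
    LieSubmodule.lieSpan ℂ L {v : Y | ∃ ν, IsSingular b v ∧ IsWeightVector H ν v} = ⊤ := by
  set N := LieSubmodule.lieSpan ℂ L {v : Y | ∃ ν, IsSingular b v ∧ IsWeightVector H ν v}
  -- In a generalized eigenspace for `c` outside `N` take a weight vector `w` singular modulo `N`;
  -- its Casimir value is `c`. If `w` is not singular, raising it leads to a singular vector of
  -- strictly higher weight with the same value `c`, which dominance forbids.
  have key : ∀ (c : ℂ) (m : ℕ), casKer (L := L) (Y := Y) c m ≤ N := by
    intro c m
    by_contra hc
    obtain ⟨x, hx, hxN⟩ := SetLike.not_le_iff_exists.1 hc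
    obtain ⟨s, y, -, h2, rfl⟩ := exists_weight_sum
      (show x ∈ Submodule.span ℂ {e : Y | ∃ μ ∈ Λ, IsWeightVector H μ e} by
        rw [hY]; trivial)
    have hmem := weight_component_mem (H := H) (N := (casKer (L := L) (Y := Y) c m).toSubmodule)
      (fun h y hy ↦ (casKer (L := L) (Y := Y) c m).lie_mem hy) s y (fun μ _ ↦ h2 μ) hx
    obtain ⟨μ, hμ, hμ0⟩ : ∃ μ ∈ s, y μ ∉ N := by
      by_contra! hc
      exact hxN (sum_mem hc)
    obtain ⟨β, hβ, w, hw, hwN, hwt, hws⟩ := exists_singular_mod b N _ (h2 μ) (hmem μ hμ) hμ0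
    have hcw := casimir_sub_mem N hwt hws
    set ν := μ + β
    have hcν : casVal b ν = c := by
      by_contra hne
      have h3 : ∀ k, ((casimir (L := L) Y - algebraMap ℂ (Module.End ℂ Y) c) ^ k) w -
          (casVal b ν - c) ^ k • w ∈ N := by
        intro k
        induction k with
        | zero => simp
        | succ k ih =>
          have h4 : (casimir (L := L) Y - algebraMap ℂ (Module.End ℂ Y) c)
            (((casimir (L := L) Y - algebraMap ℂ (Module.End ℂ Y) c) ^ k) w -
              (casVal b ν - c) ^ k • w) ∈ N := by
            rw [LinearMap.sub_apply]
            exact sub_mem (casimir_mem N ih) (N.smul_mem c ih)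
          have h5 := add_mem h4 (N.smul_mem ((casVal b ν - c) ^ k) hcw)
          convert h5 using 1
          rw [pow_succ', Module.End.mul_apply, map_sub, LinearMap.map_smul, LinearMap.sub_apply,
            LinearMap.sub_apply, Module.algebraMap_end_apply, Module.algebraMap_end_apply]
          module
      have h4 := h3 m
      rw [mem_casKer.1 hw, zero_sub, neg_mem_iff] at h4
      exact hwN ((N.toSubmodule.smul_mem_iff (pow_ne_zero _ (sub_ne_zero.2 hne))).1 h4)
    obtain ⟨α, hα⟩ : ∃ α : PosRoot b, ⁅rootE α.1, w⁆ ≠ 0 := by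
      by_contra! hc
      exact hwN (LieSubmodule.subset_lieSpan ⟨ν, hc, hwt⟩)
    obtain ⟨γ, hγ, u, hu, hu0, huw, hus⟩ := exists_singular b _ (hwt.lie_rootE α.1)
      ((casKer (L := L) (Y := Y) c m).lie_mem hw) hα
    have hcu : casVal b (ν + wt α.1 + γ) = c := by
      have h3 : ∀ k, ((casimir (L := L) Y - algebraMap ℂ (Module.End ℂ Y) c) ^ k) u =
          (casVal b (ν + wt α.1 + γ) - c) ^ k • u := by
        intro k
        induction k with
        | zero => simp
        | succ k ih =>
          rw [pow_succ', Module.End.mul_apply, ih, LinearMap.map_smul, LinearMap.sub_apply,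
            hus.casimir huw, Module.algebraMap_end_apply, ← sub_smul, smul_smul, ← pow_succ]
      have h4 := h3 m
      rw [mem_casKer.1 hu] at h4
      have := (smul_eq_zero.1 h4.symm).resolve_right hu0
      by_contra hne
      exact pow_ne_zero m (sub_ne_zero.2 hne) this
    -- The image of `w` in `Y ⧸ N` is a nonzero singular vector, so its weight is dominant although
    -- `w` itself is not known to be singular.
    have hdomν : IsDominant b ν := by
      refine IsSingular.isDominant (Y := Y ⧸ N) (v := LieSubmodule.Quotient.mk w) (b := b) ?_ ?_ ?_
      · intro α
        exact (LieSubmodule.Quotient.mk_eq_zero').2 (hws α)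
      · intro h
        have := congrArg (LieSubmodule.Quotient.mk (N := N)) (hwt h)
        exact this
      · exact fun h ↦ hwN (LieSubmodule.Quotient.mk_eq_zero'.1 h)
    have h7 : wt α.1 + γ = 0 := hdomν.eq_zero_of_casVal_eq
      (by rw [← add_assoc]; exact hus.isDominant huw hu0)
      (add_mem (wt_mem_posCone α) hγ) (by rw [← add_assoc, hcu, hcν])
    obtain ⟨m₁, hm₁, -⟩ := posCone_height b hγ
    have h8 := congr($h7 (htElt b))
    rw [LinearMap.add_apply, wt_htElt, hm₁, LinearMap.zero_apply] at h8
    have := α.height_pos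
    norm_cast at h8
    omega
  rw [← LieSubmodule.toSubmodule_inj, LieSubmodule.top_toSubmodule, eq_top_iff,
    ← Module.End.iSup_maxGenEigenspace_eq_top (casimir (L := L) Y)]
  refine iSup_le fun c x hx ↦ ?_
  rw [Module.End.mem_maxGenEigenspace] at hx
  obtain ⟨m, hm⟩ := hx
  exact key c m hm

theorem IsWeightModule.sSup_atoms_eq_top (b : (rootSystem H).Base) {Λ : Set (Module.Dual ℂ H)}
    (hY : IsWeightModule H Y Λ) : sSup {N : LieSubmodule ℂ L Y | IsAtom N} = ⊤ := by
  rw [eq_top_iff, ← lieSpan_singular_eq_top b hY, LieSubmodule.lieSpan_le]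
  rintro v ⟨ν, hs, hv⟩
  by_cases h0 : v = 0
  · rw [h0]; exact zero_mem _
  · exact (le_sSup (hs.isAtom_lieSpan hv h0) : _ ≤ sSup {N : LieSubmodule ℂ L Y | IsAtom N})
      (LieSubmodule.subset_lieSpan rfl)

end Reducible

end AffineKM

namespace AffineKM

/-! ### Polynomial rings are finite over perturbed power sums -/

section PowerSums

open MvPolynomial

variable {σ : Type*}

variable (σ) in
/-- The polynomials of degree less than `n`. -/
def degLT (n : ℕ) : Submodule ℂ (MvPolynomial σ ℂ) := restrictSupport ℂ {m | m.degree < n}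

theorem mem_degLT {n : ℕ} {p : MvPolynomial σ ℂ} :
    p ∈ degLT σ n ↔ ∀ m ∈ p.support, m.degree < n := mem_restrictSupport_iff ℂ

theorem degLT_mono {m n : ℕ} (h : m ≤ n) : degLT σ m ≤ degLT σ n :=
  restrictSupport_mono ℂ fun _ hm ↦ lt_of_lt_of_le hm h

theorem monomial_mem_degLT {n : ℕ} {m : σ →₀ ℕ} (h : m.degree < n) (c : ℂ) :
    monomial m c ∈ degLT σ n := (monomial_mem_restrictSupport ℂ).2 (Or.inl h)

/-- The shift comes from the strict inequality in `degLT`: a factor in `degLT σ (n + 1)` has degree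
at most `n`. -/
theorem mul_mem_degLT {m n : ℕ} {p q : MvPolynomial σ ℂ} (hp : p ∈ degLT σ m)
    (hq : q ∈ degLT σ (n + 1)) : p * q ∈ degLT σ (m + n) := by
  classical
  rw [mem_degLT] at *
  intro a ha
  obtain ⟨u, hu, v, hv, rfl⟩ := Finset.mem_add.1 (support_mul p q ha)
  have h1 := hp u hu
  have h2 := hq v hv
  rw [map_add]
  omega

theorem one_mem_degLT (n : ℕ) : (1 : MvPolynomial σ ℂ) ∈ degLT σ (n + 1) :=
  monomial_mem_degLT (by simp) 1

theorem C_mul_mem_degLT {n : ℕ} (c : ℂ) {p : MvPolynomial σ ℂ} (hp : p ∈ degLT σ n) :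
    C c * p ∈ degLT σ n := by
  rw [C_mul']
  exact Submodule.smul_mem _ _ hp

theorem prod_mem_degLT {ι : Type*} (s : Finset ι) (f : ι → MvPolynomial σ ℂ)
    (hf : ∀ i, f i ∈ degLT σ 2) : ∏ i ∈ s, f i ∈ degLT σ (s.card + 1) := by
  classical
  induction s using Finset.induction_on with
  | empty => exact one_mem_degLT 0
  | insert a s ha ih =>
    rw [Finset.prod_insert ha, Finset.card_insert_of_notMem ha, mul_comm]
    exact mul_mem_degLT ih (hf a)

theorem pow_mem_degLT {p : MvPolynomial σ ℂ} (hp : p ∈ degLT σ 2) (n : ℕ) :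
    p ^ n ∈ degLT σ (n + 1) := by
  simpa using prod_mem_degLT (Finset.range n) (fun _ ↦ p) fun _ ↦ hp

variable {d : ℕ} {l : Fin d → MvPolynomial σ ℂ} (hl : ∀ i, l i ∈ degLT σ 2)
  {ζ : ℕ → MvPolynomial σ ℂ} (hζ : ∀ k, ζ k - ∑ i, l i ^ k ∈ degLT σ k)

include hl

theorem aeval_esymm_mem (j : ℕ) : aeval l (esymm (Fin d) ℂ j) ∈ degLT σ (j + 1) := by
  rw [esymm, map_sum]
  refine Submodule.sum_mem _ fun s hs ↦ ?_
  rw [map_prod]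
  simp only [aeval_X]
  have := prod_mem_degLT s l hl
  rwa [(Finset.mem_powersetCard.1 hs).2] at this

include hζ

/-- Newton's identities compute elementary symmetric functions from power sums. Replacing the power
sums of the `l i` by the `ζ k` changes every term in lower degree only, and over `ℂ` one may divide
by `k`. -/
theorem exists_perturbed_esymm (S : Subalgebra ℂ (MvPolynomial σ ℂ)) (hS : ∀ k, ζ k ∈ S) (j : ℕ) :
    ∃ e ∈ S, e - aeval l (esymm (Fin d) ℂ j) ∈ degLT σ j := by
  induction j using Nat.strong_induction_on with
  | _ k ih =>
  rcases Nat.eq_zero_or_pos k with rfl | hk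
  · exact ⟨1, S.one_mem, by simp⟩
  choose! e he hed using ih
  have hN := congrArg (aeval l) (mul_esymm_eq_sum (Fin d) ℂ k)
  rw [map_mul, map_natCast, map_mul, map_pow, map_neg, map_one, map_sum] at hN
  simp only [map_mul, map_pow, map_neg, map_one] at hN
  have hp : ∀ n, aeval l (psum (Fin d) ℂ n) = ∑ i, l i ^ n := fun n ↦ by simp [psum]
  simp only [hp] at hN
  let E : MvPolynomial σ ℂ := (-1) ^ (k + 1) *
    ∑ a ∈ Finset.HasAntidiagonal.antidiagonal k with a.1 < k, (-1) ^ a.1 * e a.1 * ζ a.2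
  have hk0 : (k : ℂ) ≠ 0 := Nat.cast_ne_zero.2 hk.ne'
  have hE : E ∈ S := by
    refine S.mul_mem (S.pow_mem (S.neg_mem S.one_mem) _) (S.sum_mem fun a ha ↦ ?_)
    exact S.mul_mem (S.mul_mem (S.pow_mem (S.neg_mem S.one_mem) _)
      (he _ (Finset.mem_filter.1 ha).2)) (hS _)
  have hdiff : E - (k : MvPolynomial σ ℂ) * aeval l (esymm (Fin d) ℂ k) ∈ degLT σ k := by
    have hneg : ∀ (n m : ℕ) (p : MvPolynomial σ ℂ), p ∈ degLT σ m → (-1) ^ n * p ∈ degLT σ m := by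
      intro n m p hp
      rcases neg_one_pow_eq_or (MvPolynomial σ ℂ) n with h | h <;> rw [h]
      · rwa [one_mul]
      · rw [neg_one_mul]; exact neg_mem hp
    rw [hN, ← mul_sub, ← Finset.sum_sub_distrib]
    refine hneg _ _ _ (Submodule.sum_mem _ fun a ha ↦ ?_)
    obtain ⟨h1, h2⟩ := Finset.mem_filter.1 ha
    replace h1 : a.1 + a.2 = k := Finset.HasAntidiagonal.mem_antidiagonal.1 h1
    have e1 : (-1) ^ a.1 * e a.1 * ζ a.2 -
        (-1) ^ a.1 * aeval l (esymm (Fin d) ℂ a.1) * ∑ i, l i ^ a.2 =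
        (-1) ^ a.1 * ((e a.1 - aeval l (esymm (Fin d) ℂ a.1)) * ζ a.2 +
          (ζ a.2 - ∑ i, l i ^ a.2) * aeval l (esymm (Fin d) ℂ a.1)) := by ring
    rw [e1]
    have hζ2 : ζ a.2 ∈ degLT σ (a.2 + 1) := by
      have := add_mem (degLT_mono (Nat.le_succ _) (hζ a.2))
        (Submodule.sum_mem (degLT σ (a.2 + 1)) (t := Finset.univ)
          fun i _ ↦ pow_mem_degLT (hl i) a.2)
      simpa using this
    refine hneg _ _ _ (add_mem ?_ ?_)
    · rw [← h1]
      exact mul_mem_degLT (hed _ h2) hζ2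
    · rw [← h1, add_comm]
      exact mul_mem_degLT (hζ _) (aeval_esymm_mem hl _)
  refine ⟨C (k : ℂ)⁻¹ * E, S.mul_mem (S.algebraMap_mem _) hE, ?_⟩
  have := C_mul_mem_degLT (k : ℂ)⁻¹ hdiff
  have e2 : C (k : ℂ)⁻¹ * ((k : MvPolynomial σ ℂ) * aeval l (esymm (Fin d) ℂ k)) =
      aeval l (esymm (Fin d) ℂ k) := by
    rw [← map_natCast (C (σ := σ) (R := ℂ)), ← mul_assoc, ← C_mul, inv_mul_cancel₀ hk0, C_1, one_mul]
  rwa [mul_sub, e2] at this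

/-- The polynomial `∏ (T + l j)` vanishes at `T = -l i`. This expresses `l i ^ d` through lower
powers with elementary symmetric coefficients, and those lie in `S` up to terms of lower degree. -/
theorem pow_mem_span_degLT (S : Subalgebra ℂ (MvPolynomial σ ℂ)) (hS : ∀ k, ζ k ∈ S) (i : Fin d) :
    l i ^ d ∈ Submodule.span S (degLT σ d : Set (MvPolynomial σ ℂ)) := by
  choose e he hed using exists_perturbed_esymm hl hζ S hS
  have h := congrArg (fun p ↦ Polynomial.eval₂ (aeval l).toRingHom (-l i) p)
    (prod_C_add_X_eq_sum_esymm ℂ (Fin d))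
  simp only [Polynomial.eval₂_finsetProd, Polynomial.eval₂_add, Polynomial.eval₂_X,
    Polynomial.eval₂_C, Polynomial.eval₂_finsetSum, Polynomial.eval₂_mul,
    Polynomial.eval₂_pow] at h
  rw [Finset.prod_eq_zero (Finset.mem_univ i) (by simp), Fintype.card_fin,
    Finset.sum_range_succ'] at h
  simp only [AlgHom.toRingHom_eq_coe, RingHom.coe_coe, esymm_zero, map_one, one_mul,
    Nat.sub_zero] at h
  have hneg : ∀ (n : ℕ) (p : MvPolynomial σ ℂ),
      p ∈ Submodule.span S (degLT σ d : Set (MvPolynomial σ ℂ)) →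
      (-1) ^ n * p ∈ Submodule.span S (degLT σ d : Set (MvPolynomial σ ℂ)) := by
    intro n m hp
    rcases neg_one_pow_eq_or (MvPolynomial σ ℂ) n with h | h <;> rw [h]
    · rwa [one_mul]
    · rw [neg_one_mul]; exact neg_mem hp
  have hsum : ∑ k ∈ Finset.range d, aeval l (esymm (Fin d) ℂ (k + 1)) * (-l i) ^ (d - (k + 1)) ∈
      Submodule.span S (degLT σ d : Set (MvPolynomial σ ℂ)) := by
    refine Submodule.sum_mem _ fun k hk ↦ ?_
    have hk := Finset.mem_range.1 hk
    rw [neg_pow, mul_left_comm]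
    refine hneg _ _ ?_
    have e1 : aeval l (esymm (Fin d) ℂ (k + 1)) * l i ^ (d - (k + 1)) =
      (⟨e (k + 1), he _⟩ : S) • l i ^ (d - (k + 1)) -
        (e (k + 1) - aeval l (esymm (Fin d) ℂ (k + 1))) * l i ^ (d - (k + 1)) := by
      rw [Subalgebra.smul_def, smul_eq_mul]
      ring
    rw [e1]
    refine sub_mem (Submodule.smul_mem _ _ (Submodule.subset_span ?_)) (Submodule.subset_span ?_)
    · exact degLT_mono (by omega) (pow_mem_degLT (hl i) _)
    · have := mul_mem_degLT (hed (k + 1)) (pow_mem_degLT (hl i) (d - (k + 1)))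
      rwa [show k + 1 + (d - (k + 1)) = d by omega] at this
  have h2 : (-1) ^ d * l i ^ d =
      -∑ k ∈ Finset.range d, aeval l (esymm (Fin d) ℂ (k + 1)) * (-l i) ^ (d - (k + 1)) := by
    rw [← neg_pow, eq_neg_iff_add_eq_zero, add_comm]
    exact h.symm
  have h3 := hneg d _ (h2 ▸ neg_mem hsum)
  rwa [← mul_assoc, ← pow_add, Even.neg_one_pow ⟨d, rfl⟩, one_mul] at h3

/-- A monomial of degree exceeding `d` times the number of variables contains some `X j ^ d`, which
can be traded, over `S`, for terms of smaller total degree. So polynomials of bounded degree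
generate everything over `S`. -/
theorem span_degLT_eq_top [Fintype σ] (S : Subalgebra ℂ (MvPolynomial σ ℂ)) (hS : ∀ k, ζ k ∈ S)
    (hX : ∀ j, ∃ i, l i = X j) : Submodule.span S
      (degLT σ (Fintype.card σ * d + 1) : Set (MvPolynomial σ ℂ)) = ⊤ := by
  set D := Fintype.card σ * d + 1
  have hstep : ∀ n, D ≤ n → ∀ m : σ →₀ ℕ, m.degree = n → monomial m (1 : ℂ) ∈
      Submodule.span S (degLT σ n : Set (MvPolynomial σ ℂ)) := by
    intro n hn m hm
    obtain ⟨j, hj⟩ : ∃ j, d ≤ m j := by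
      by_contra! hc
      have : m.degree ≤ Fintype.card σ * d := by
        rw [Finsupp.degree_eq_sum]
        calc ∑ j, m j ≤ ∑ _j : σ, d := Finset.sum_le_sum fun j _ ↦ (hc j).le
          _ = _ := by simp
      omega
    obtain ⟨i, hi⟩ := hX j
    have h1 := pow_mem_span_degLT hl hζ S hS i
    rw [hi] at h1
    have hle : Finsupp.single j d ≤ m := by simpa using hj
    have e1 : monomial m (1 : ℂ) = X j ^ d * monomial (m - Finsupp.single j d) 1 := by
      rw [X_pow_eq_monomial, monomial_mul, one_mul, add_tsub_cancel_of_le hle]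
    have hdeg : (m - Finsupp.single j d).degree + d = n := by
      have := congrArg Finsupp.degree (add_tsub_cancel_of_le hle)
      rw [map_add, Finsupp.degree_single, hm] at this
      omega
    rw [e1]
    have hm' : monomial (m - Finsupp.single j d) (1 : ℂ) ∈
        degLT σ ((m - Finsupp.single j d).degree + 1) := monomial_mem_degLT (Nat.lt_succ_self _) 1
    generalize monomial (m - Finsupp.single j d) (1 : ℂ) = q at hm'
    generalize (m - Finsupp.single j d).degree = r at hm' hdeg
    generalize (X j : MvPolynomial σ ℂ) ^ d = p at h1
    induction h1 using Submodule.span_induction with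
    | zero => simp
    | add a b _ _ ha hb => rw [add_mul]; exact add_mem ha hb
    | smul c a _ ha => rw [smul_mul_assoc]; exact Submodule.smul_mem _ _ ha
    | mem a ha =>
      refine Submodule.subset_span ?_
      rw [← hdeg, add_comm r]
      exact mul_mem_degLT ha hm'
  have hle : ∀ n, (degLT σ n : Set (MvPolynomial σ ℂ)) ⊆
      Submodule.span S (degLT σ D : Set (MvPolynomial σ ℂ)) := by
    intro n
    induction n with
    | zero => exact fun p hp ↦ Submodule.subset_span (degLT_mono (Nat.zero_le _) hp)
    | succ n ih =>
      rcases Nat.lt_or_ge n D with h | h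
      · exact fun p hp ↦ Submodule.subset_span (degLT_mono h hp)
      · have ih' := Submodule.span_le.2 ih
        intro p hp
        rw [p.as_sum]
        refine Submodule.sum_mem _ fun m hm ↦ ih' ?_
        have hmd := mem_degLT.1 hp m hm
        rw [← mul_one (coeff m p), ← C_mul_monomial, C_mul', ← algebraMap_smul S]
        refine Submodule.smul_mem _ _ ?_
        rcases Nat.lt_succ_iff_lt_or_eq.1 hmd with h' | h'
        · exact Submodule.subset_span (monomial_mem_degLT h' 1)
        · exact hstep n h m h'
  rw [eq_top_iff]
  intro p _
  refine hle (p.support.sup Finsupp.degree + 1) (mem_degLT.2 fun m hm ↦ ?_)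
  exact Nat.lt_succ_of_le (Finset.le_sup (f := Finsupp.degree) hm)

/-- The variables act on finitely many polynomials through matrices over the perturbed
power sums. -/
theorem exists_matrix_of_powerSums [Fintype σ] (hX : ∀ j, ∃ i, l i = X j) :
    ∃ (n : ℕ) (r : Fin (n + 1) → MvPolynomial σ ℂ)
      (T : σ → Matrix (Fin (n + 1)) (Fin (n + 1)) (MvPolynomial ℕ ℂ)), r 0 = 1 ∧
        ∀ i j, X i * r j = ∑ k, aeval ζ (T i j k) * r k := by
  classical
  let S : Subalgebra ℂ (MvPolynomial σ ℂ) := (aeval (R := ℂ) ζ).range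
  have hS : ∀ k, ζ k ∈ S := fun k ↦ ⟨X k, aeval_X _ _⟩
  have htop := span_degLT_eq_top hl hζ S hS hX
  set D := Fintype.card σ * d + 1
  have hfin : Finite {m : σ →₀ ℕ | m.degree < D} := by
    let f : {m : σ →₀ ℕ | m.degree < D} → (σ → Fin D) := fun m j ↦
      ⟨m.1 j, (Finsupp.le_degree j m.1).trans_lt m.2⟩
    refine Finite.of_injective f fun a b h ↦ Subtype.ext (Finsupp.ext fun j ↦ ?_)
    simpa [f] using congrArg Fin.val (congrFun h j)
  obtain ⟨n, ⟨g'⟩⟩ := Finite.exists_equiv_fin {m : σ →₀ ℕ | m.degree < D}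
  let g := g'.symm
  -- The generator `1` is put in front once more, so that every specialization of `r` has a
  -- coordinate equal to `1` and is nonzero as an eigenvector.
  let r : Fin (n + 1) → MvPolynomial σ ℂ := Fin.cons 1 fun i ↦ monomial (g i).1 1
  have hspan : Submodule.span S (Set.range r) = ⊤ := by
    rw [eq_top_iff, ← htop]
    refine Submodule.span_le.2 fun p hp ↦ ?_
    rw [p.as_sum]
    refine Submodule.sum_mem _ fun m hm ↦ ?_
    rw [← mul_one (coeff m p), ← C_mul_monomial, C_mul', ← algebraMap_smul S]
    refine Submodule.smul_mem _ _ (Submodule.subset_span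
      ⟨(g.symm ⟨m, mem_degLT.1 hp m hm⟩).succ, ?_⟩)
    simp [r]
  have hex : ∀ p : MvPolynomial σ ℂ, ∃ c : Fin (n + 1) → MvPolynomial ℕ ℂ,
      p = ∑ k, aeval ζ (c k) * r k := by
    intro p
    have hp : p ∈ Submodule.span S (Set.range r) := by rw [hspan]; trivial
    obtain ⟨c, hc⟩ := (Submodule.mem_span_range_iff_exists_fun S).1 hp
    choose c' hc' using fun k ↦ (c k).2
    refine ⟨c', hc.symm.trans (Finset.sum_congr rfl fun k _ ↦ ?_)⟩
    rw [Subalgebra.smul_def, smul_eq_mul, ← hc' k]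
    rfl
  choose T hT using fun i j ↦ hex (X i * r j)
  exact ⟨n, r, T, rfl, hT⟩

end PowerSums

end AffineKM

namespace AffineKM


attribute [local instance] LieRing.ofAssociativeRing LieAlgebra.ofAssociativeAlgebra

/-! ### Central elements of the enveloping algebra -/

section CentralElements

open LieAlgebra LieAlgebra.IsKilling LieModule

variable {L : Type*} [LieRing L] [LieAlgebra ℂ L]

variable (L) in
/-- `x ↦ ad x ⊗ 1`. -/
def adU : L →ₗ[ℂ] Module.End ℂ L ⊗[ℂ] UniversalEnvelopingAlgebra ℂ L :=
  ((TensorProduct.mk ℂ _ _).flip 1) ∘ₗ (toEnd ℂ L L : L →ₗ[ℂ] Module.End ℂ L)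

variable (L) in
/-- `x ↦ 1 ⊗ x`. -/
def ιU : L →ₗ[ℂ] Module.End ℂ L ⊗[ℂ] UniversalEnvelopingAlgebra ℂ L :=
  (TensorProduct.mk ℂ _ _ 1) ∘ₗ ιL L

theorem adU_apply (x : L) : adU L x = (toEnd ℂ L L x) ⊗ₜ[ℂ] (1 : UniversalEnvelopingAlgebra ℂ L) :=
  rfl

theorem ιU_apply (x : L) :
    ιU L x = (1 : Module.End ℂ L) ⊗ₜ[ℂ] UniversalEnvelopingAlgebra.ι ℂ x := rfl

theorem coact_ι_eq (x : L) : coact L (UniversalEnvelopingAlgebra.ι ℂ x) = adU L x + ιU L x :=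
  coact_ι L x

theorem adU_mul (x y : L) : adU L x * adU L y = adU L y * adU L x + adU L ⁅x, y⁆ := by
  rw [adU_apply, adU_apply, adU_apply, LieHom.map_lie, LieRing.of_associative_ring_bracket,
    Algebra.TensorProduct.tmul_mul_tmul, Algebra.TensorProduct.tmul_mul_tmul, one_mul,
    ← TensorProduct.add_tmul]
  congr 1
  abel

theorem ιU_mul (x y : L) : ιU L x * ιU L y = ιU L y * ιU L x + ιU L ⁅x, y⁆ := by
  rw [ιU_apply, ιU_apply, ιU_apply, LieHom.map_lie, LieRing.of_associative_ring_bracket,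
    Algebra.TensorProduct.tmul_mul_tmul, Algebra.TensorProduct.tmul_mul_tmul, one_mul,
    ← TensorProduct.tmul_add]
  congr 1
  abel

theorem adU_mul_ιU (x y : L) : adU L x * ιU L y = ιU L y * adU L x := by
  rw [adU_apply, ιU_apply, Algebra.TensorProduct.tmul_mul_tmul,
    Algebra.TensorProduct.tmul_mul_tmul, one_mul, one_mul, mul_one, mul_one]

variable [FiniteDimensional ℂ L] [IsKilling ℂ L]

variable (L) in
/-- The split Casimir element. -/
def splitCas : Module.End ℂ L ⊗[ℂ] UniversalEnvelopingAlgebra ℂ L :=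
  killSum (mulMap (A := Module.End ℂ L ⊗[ℂ] UniversalEnvelopingAlgebra ℂ L) (adU L) (ιU L))

/-- Both legs of the split Casimir element are equivariant for the coproduct, so the invariance of
the canonical tensor makes it commute with the image of the coproduct. -/
theorem coact_splitCas (y : L) : coact L (UniversalEnvelopingAlgebra.ι ℂ y) * splitCas L =
    splitCas L * coact L (UniversalEnvelopingAlgebra.ι ℂ y) := by
  have hf (x : L) : coact L (UniversalEnvelopingAlgebra.ι ℂ y) * adU L x =
      adU L x * coact L (UniversalEnvelopingAlgebra.ι ℂ y) + adU L ⁅y, x⁆ := by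
    rw [coact_ι_eq, add_mul, mul_add, adU_mul, ← adU_mul_ιU]
    abel
  have hg (x : L) : coact L (UniversalEnvelopingAlgebra.ι ℂ y) * ιU L x =
      ιU L x * coact L (UniversalEnvelopingAlgebra.ι ℂ y) + ιU L ⁅y, x⁆ := by
    rw [coact_ι_eq, add_mul, mul_add, ιU_mul, adU_mul_ιU]
    abel
  generalize coact L (UniversalEnvelopingAlgebra.ι ℂ y) = a at hf hg ⊢
  have := commute_killSum_mulMap (A := Module.End ℂ L ⊗[ℂ] UniversalEnvelopingAlgebra ℂ L)
    (f := adU L) (g := ιU L) hf hg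
  exact this

theorem coact_splitCas_pow (y : L) (k : ℕ) :
    coact L (UniversalEnvelopingAlgebra.ι ℂ y) * splitCas L ^ k =
      splitCas L ^ k * coact L (UniversalEnvelopingAlgebra.ι ℂ y) := by
  induction k with
  | zero => rw [pow_zero, one_mul, mul_one]
  | succ k ih => rw [pow_succ, ← mul_assoc, ih, mul_assoc, coact_splitCas, mul_assoc]

variable (L) in
/-- The central elements obtained as partial traces of the powers of the split Casimir element. -/
def zc (k : ℕ) : UniversalEnvelopingAlgebra ℂ L :=
  slice (LinearMap.trace ℂ L) (splitCas L ^ k)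

theorem slice_trace_adU (x : L) (t : Module.End ℂ L ⊗[ℂ] UniversalEnvelopingAlgebra ℂ L) :
    slice (LinearMap.trace ℂ L) (adU L x * t) = slice (LinearMap.trace ℂ L) (t * adU L x) := by
  induction t using TensorProduct.induction_on with
  | zero => simp
  | tmul S u =>
    rw [adU_apply, Algebra.TensorProduct.tmul_mul_tmul, Algebra.TensorProduct.tmul_mul_tmul,
      slice_tmul, slice_tmul, LinearMap.trace_mul_comm, one_mul, mul_one]
  | add a b ha hb => rw [mul_add, add_mul, map_add, map_add, ha, hb]

theorem slice_ιU (θ : Module.Dual ℂ (Module.End ℂ L)) (x : L)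
    (t : Module.End ℂ L ⊗[ℂ] UniversalEnvelopingAlgebra ℂ L) :
    slice θ (t * ιU L x) = slice θ t * UniversalEnvelopingAlgebra.ι ℂ x := by
  induction t using TensorProduct.induction_on with
  | zero => simp
  | tmul S u =>
    rw [ιU_apply, Algebra.TensorProduct.tmul_mul_tmul, slice_tmul, slice_tmul, mul_one,
      smul_mul_assoc]
  | add a b ha hb => rw [add_mul, map_add, map_add, ha, hb, add_mul]

/-- Take the trace over the first factor of the commutation with the coproduct of `y`: the part `ad
y ⊗ 1` drops out because a trace kills commutators, leaving the part `1 ⊗ y`. -/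
theorem commute_ι_zc (k : ℕ) (y : L) : Commute (UniversalEnvelopingAlgebra.ι ℂ y) (zc L k) := by
  have h := coact_splitCas_pow y k
  rw [coact_ι_eq, add_mul, mul_add] at h
  have h2 := congrArg (slice (LinearMap.trace ℂ L)) h
  rw [map_add, map_add, slice_trace_adU, slice_ιU] at h2
  have h3 := add_left_cancel h2
  rw [ιU_apply, slice_mul_right] at h3
  exact h3

theorem commute_zc (k : ℕ) (u : UniversalEnvelopingAlgebra ℂ L) : Commute u (zc L k) := by
  induction u using env_induction with
  | algebraMap r => exact Algebra.commutes r _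
  | ι x => exact commute_ι_zc k x
  | mul a b ha hb => exact ha.mul_left hb
  | add a b ha hb => exact ha.add_left hb

variable {Y : Type*} [AddCommGroup Y] [Module ℂ Y] [LieRingModule L Y] [LieModule ℂ L Y]

theorem uact_zc_lie (k : ℕ) (x : L) (y : Y) : uact Y (zc L k) ⁅x, y⁆ = ⁅x, uact Y (zc L k) y⁆ := by
  have := congrArg (uact Y) (commute_ι_zc k x).eq
  rw [map_mul, map_mul] at this
  have := congr($this y)
  simpa [-UniversalEnvelopingAlgebra.ι_apply] using this.symm

variable (Y) in
/-- The action of `End L ⊗ U` on `End L ⊗ Y` by left multiplication in the first factor. -/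
def lact : Module.End ℂ L ⊗[ℂ] UniversalEnvelopingAlgebra ℂ L →ₐ[ℂ]
    Module.End ℂ (Module.End ℂ L ⊗[ℂ] Y) :=
  (Module.endTensorEndAlgHom (R := ℂ) (A := ℂ) (M := Module.End ℂ L) (N := Y) (S := ℂ)).comp
    (Algebra.TensorProduct.map (Algebra.lmul ℂ (Module.End ℂ L)) (uact Y))

@[simp] theorem lact_tmul (T S : Module.End ℂ L) (u : UniversalEnvelopingAlgebra ℂ L) (y : Y) :
    lact Y (T ⊗ₜ u) (S ⊗ₜ y) = (T * S) ⊗ₜ uact Y u y := rfl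

variable (Y) in
/-- Right multiplication in the first factor. -/
def ract (T : Module.End ℂ L) : Module.End ℂ (Module.End ℂ L ⊗[ℂ] Y) :=
  (LinearMap.mulRight ℂ T).rTensor Y

@[simp] theorem ract_tmul (T S : Module.End ℂ L) (y : Y) :
    ract Y T (S ⊗ₜ y) = (S * T) ⊗ₜ y := rfl

theorem lact_ract (t : Module.End ℂ L ⊗[ℂ] UniversalEnvelopingAlgebra ℂ L) (T : Module.End ℂ L)
    (w : Module.End ℂ L ⊗[ℂ] Y) : lact Y t (ract Y T w) = ract Y T (lact Y t w) := by
  induction w using TensorProduct.induction_on with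
  | zero => simp
  | add a b ha hb => simp only [map_add, ha, hb]
  | tmul S y =>
    induction t using TensorProduct.induction_on with
    | zero => simp
    | add a b ha hb => simp only [map_add, LinearMap.add_apply, ha, hb]
    | tmul S u => rw [ract_tmul, lact_tmul, lact_tmul, ract_tmul, mul_assoc]

/-- Partial evaluation of `End L ⊗ Y`. -/
def slab (θ : Module.Dual ℂ (Module.End ℂ L)) : Module.End ℂ L ⊗[ℂ] Y →ₗ[ℂ] Y :=
  (TensorProduct.lid ℂ Y).toLinearMap ∘ₗ θ.rTensor Y

@[simp] theorem slab_tmul (θ : Module.Dual ℂ (Module.End ℂ L)) (S : Module.End ℂ L) (y : Y) :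
    slab θ (S ⊗ₜ[ℂ] y) = θ S • y := by
  simp [slab]

theorem slab_lact (θ : Module.Dual ℂ (Module.End ℂ L))
    (t : Module.End ℂ L ⊗[ℂ] UniversalEnvelopingAlgebra ℂ L) (y : Y) :
    slab θ (lact Y t (1 ⊗ₜ y)) = uact Y (slice θ t) y := by
  induction t using TensorProduct.induction_on with
  | zero => simp
  | tmul S u => simp
  | add a b ha hb => simp only [map_add, LinearMap.add_apply, ha, hb]

/-- The subspace `End L ⊗ N`. -/
def tens (N : Submodule ℂ Y) : Submodule ℂ (Module.End ℂ L ⊗[ℂ] Y) :=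
  Submodule.span ℂ {w | ∃ S : Module.End ℂ L, ∃ y ∈ N, w = S ⊗ₜ y}

theorem tens_map (N N' : Submodule ℂ Y) (f : Module.End ℂ (Module.End ℂ L ⊗[ℂ] Y))
    (h : ∀ (S : Module.End ℂ L), ∀ y ∈ N, f (S ⊗ₜ y) ∈ tens (L := L) N')
    {w : Module.End ℂ L ⊗[ℂ] Y} (hw : w ∈ tens (L := L) N) : f w ∈ tens (L := L) N' := by
  induction hw using Submodule.span_induction with
  | zero => simp
  | add a b _ _ ha hb => rw [map_add]; exact add_mem ha hb
  | smul c a _ ha => rw [map_smul]; exact Submodule.smul_mem _ _ ha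
  | mem w hw => obtain ⟨S, y, hy, rfl⟩ := hw; exact h S y hy

theorem tmul_mem_tens {N : Submodule ℂ Y} (S : Module.End ℂ L) {y : Y} (hy : y ∈ N) :
    S ⊗ₜ[ℂ] y ∈ tens (L := L) N := Submodule.subset_span ⟨S, y, hy, rfl⟩

theorem ract_mem_tens {N : Submodule ℂ Y} (T : Module.End ℂ L) {w : Module.End ℂ L ⊗[ℂ] Y}
    (hw : w ∈ tens (L := L) N) : ract Y T w ∈ tens (L := L) N :=
  tens_map N N _ (fun S y hy ↦ tmul_mem_tens (S * T) hy) hw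

theorem lact_adU_mem_tens {N : Submodule ℂ Y} (x : L) {w : Module.End ℂ L ⊗[ℂ] Y}
    (hw : w ∈ tens (L := L) N) : lact Y (adU L x) w ∈ tens (L := L) N := by
  refine tens_map N N _ (fun S y hy ↦ ?_) hw
  rw [adU_apply, lact_tmul]
  exact tmul_mem_tens _ (by simpa using hy)

theorem lact_mem_tens (N : LieSubmodule ℂ L Y)
    (t : Module.End ℂ L ⊗[ℂ] UniversalEnvelopingAlgebra ℂ L) {w : Module.End ℂ L ⊗[ℂ] Y}
    (hw : w ∈ tens (L := L) N.toSubmodule) : lact Y t w ∈ tens (L := L) N.toSubmodule := by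
  refine tens_map _ _ _ (fun S y hy ↦ ?_) hw
  induction t using TensorProduct.induction_on with
  | zero => simp
  | tmul T u => exact tmul_mem_tens _ (uact_mem u N hy)
  | add a b ha hb => rw [map_add, LinearMap.add_apply]; exact add_mem ha hb

/-- Moving an element of the stabilizer of a line through the powers of the split Casimir. -/
theorem lact_ιU_splitCas_pow {x : L} {v : Y} {c : ℂ} (hx : ⁅x, v⁆ = c • v) (k : ℕ) :
    lact Y (ιU L x) (lact Y (splitCas L ^ k) (1 ⊗ₜ v)) =
      ract Y (toEnd ℂ L L x) (lact Y (splitCas L ^ k) (1 ⊗ₜ v)) +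
      c • lact Y (splitCas L ^ k) (1 ⊗ₜ v) -
      lact Y (adU L x) (lact Y (splitCas L ^ k) (1 ⊗ₜ v)) := by
  have h := coact_splitCas_pow x k
  rw [coact_ι_eq] at h
  have h2 := congr(lact Y $h (1 ⊗ₜ v))
  rw [map_mul, map_mul, Module.End.mul_apply, Module.End.mul_apply, map_add, LinearMap.add_apply,
    LinearMap.add_apply] at h2
  have h3 : lact Y (adU L x) ((1 : Module.End ℂ L) ⊗ₜ v) = ract Y (toEnd ℂ L L x) (1 ⊗ₜ v) := by
    rw [adU_apply, lact_tmul, ract_tmul, map_one, mul_one, one_mul]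
    rfl
  have h4 : lact Y (ιU L x) ((1 : Module.End ℂ L) ⊗ₜ v) = c • (1 ⊗ₜ v) := by
    rw [ιU_apply, lact_tmul, uact_ι, hx, one_mul, TensorProduct.tmul_smul]
  rw [h3, h4, map_add, map_smul, lact_ract] at h2
  rw [← h2, add_sub_cancel_left]

variable {H : LieSubalgebra ℂ L} [H.IsCartanSubalgebra]

/-- The operator which governs the lower order terms of the central characters. -/
def lowOp (b : (rootSystem H).Base) : Module.End ℂ L →ₗ[ℂ] Module.End ℂ L :=
  ∑ j, LinearMap.mulLeft ℂ (toEnd ℂ L L (LinearMap.BilinForm.dualBasis (traceForm ℂ H L)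
      (traceForm_cartan_nondegenerate ℂ L H) (Module.finBasis ℂ H) j : H)) ∘ₗ
    (LinearMap.mulRight ℂ (toEnd ℂ L L (Module.finBasis ℂ H j : H)) -
      LinearMap.mulLeft ℂ (toEnd ℂ L L (Module.finBasis ℂ H j : H))) +
  ∑ α : PosRoot b, LinearMap.mulLeft ℂ (toEnd ℂ L L (rootF α.1)) ∘ₗ
    (LinearMap.mulRight ℂ (toEnd ℂ L L (rootE α.1)) -
      LinearMap.mulLeft ℂ (toEnd ℂ L L (rootE α.1)))

/-- The leading coefficient of the `k`-th power of the split Casimir on a highest weight vector. -/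
def charOp (b : (rootSystem H).Base) (ν : Module.Dual ℂ H) : ℕ → Module.End ℂ L
  | 0 => 1
  | k + 1 => toEnd ℂ L L ((cartanEquivDual H).symm ν : H) * charOp b ν k +
      lowOp b (charOp b ν k)

variable {b : (rootSystem H).Base}

/-- Induction on `k`. Terms of the split Casimir element whose second leg is a negative root vector
land in the error space. A second leg in the Borel subalgebra is moved through the earlier powers by
invariance until it meets `v`; the price is multiplication by adjoint operators on the first factor,
recorded by `charOp`. -/
theorem lact_splitCas_pow_sub_mem {ν : Module.Dual ℂ H} {v : Y} (hs : IsSingular b v)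
    (hv : IsWeightVector H ν v) (k : ℕ) :
    lact Y (splitCas L ^ k) (1 ⊗ₜ v) - charOp b ν k ⊗ₜ v ∈
      tens (L := L) (negImage b (LieSubmodule.lieSpan ℂ L {v})) := by
  set N := LieSubmodule.lieSpan ℂ L {v}
  set P := fun k ↦ lact Y (splitCas L ^ k) ((1 : Module.End ℂ L) ⊗ₜ v) with hP
  induction k with
  | zero =>
    have h1 : lact Y 1 = 1 := (lact (L := L) Y).map_one'
    rw [pow_zero, h1, charOp, Module.End.one_apply, sub_self]
    exact zero_mem _
  | succ k ih =>
    have hPN : P k ∈ tens (L := L) N.toSubmodule :=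
      lact_mem_tens N _ (tmul_mem_tens _ (LieSubmodule.subset_lieSpan rfl))
    have hborel : ∀ (x y : L) (c : ℂ), ⁅x, v⁆ = c • v →
        lact Y (adU L y * ιU L x) (P k) - (toEnd ℂ L L y * (charOp b ν k * toEnd ℂ L L x +
          c • charOp b ν k - toEnd ℂ L L x * charOp b ν k)) ⊗ₜ v ∈
          tens (L := L) (negImage b N) := by
      intro x y c hx
      rw [map_mul, Module.End.mul_apply, lact_ιU_splitCas_pow hx]
      have h1 := sub_mem (add_mem (ract_mem_tens (toEnd ℂ L L x) ih) (Submodule.smul_mem _ c ih))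
        (lact_adU_mem_tens x ih)
      have h2 := lact_adU_mem_tens y h1
      convert h2 using 1
      simp only [map_sub, map_add, map_smul, ract_tmul, adU_apply, lact_tmul, map_one,
        Module.End.one_apply, mul_sub, mul_add, mul_smul_comm, TensorProduct.add_tmul,
        TensorProduct.sub_tmul, TensorProduct.smul_tmul', smul_sub]
      abel
    have hneg : ∀ (y : L) (α : PosRoot b), lact Y (adU L y * ιU L (rootF α.1)) (P k) ∈
        tens (L := L) (negImage b N) := by
      intro y α
      rw [map_mul, Module.End.mul_apply]
      refine lact_adU_mem_tens y (tens_map N.toSubmodule _ _ (fun S q hq ↦ ?_) hPN)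
      rw [ιU_apply, lact_tmul, uact_ι]
      exact tmul_mem_tens _ (Submodule.subset_span ⟨α, q, hq, rfl⟩)
    have hA : splitCas L = ∑ j, adU L (LinearMap.BilinForm.dualBasis (traceForm ℂ H L)
          (traceForm_cartan_nondegenerate ℂ L H) (Module.finBasis ℂ H) j : H) *
            ιU L (Module.finBasis ℂ H j : H) +
        ∑ α : PosRoot b, (adU L (rootF α.1) * ιU L (rootE α.1) +
          adU L (rootE α.1) * ιU L (rootF α.1)) := by
      rw [splitCas, ← killSum_flip, killSum_root b]
      rfl
    have hstep : P (k + 1) = lact Y (splitCas L) (P k) := by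
      simp only [hP, pow_succ', map_mul, Module.End.mul_apply]
    have hH : ∑ j, ν (Module.finBasis ℂ H j) • toEnd ℂ L L
        (LinearMap.BilinForm.dualBasis (traceForm ℂ H L)
          (traceForm_cartan_nondegenerate ℂ L H) (Module.finBasis ℂ H) j : H) =
        toEnd ℂ L L ((cartanEquivDual H).symm ν : H) := by
      have := sum_dualBasis_cartan (L := L) ((cartanEquivDual H).symm ν)
      conv_rhs => rw [← this]
      have e : ∀ x : H, toEnd ℂ L L (x : L) =
        ((toEnd ℂ L L : L →ₗ[ℂ] Module.End ℂ L) ∘ₗ H.toSubmodule.subtype) x := fun _ ↦ rfl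
      rw [e, map_sum]
      refine Finset.sum_congr rfl fun j _ ↦ ?_
      rw [map_smul, ← e]
      congr 1
      exact (traceForm_cartanEquivDual_symm ν _).symm
    change P (k + 1) - _ ∈ _
    rw [hstep, hA, map_add, LinearMap.add_apply, map_sum, map_sum, LinearMap.sum_apply,
      LinearMap.sum_apply, charOp, lowOp, ← hH]
    have h1 := Submodule.sum_mem _ (t := Finset.univ) fun j (_ : j ∈ Finset.univ) ↦
      hborel (Module.finBasis ℂ H j : H) (LinearMap.BilinForm.dualBasis (traceForm ℂ H L)
          (traceForm_cartan_nondegenerate ℂ L H) (Module.finBasis ℂ H) j : H) _ (hv _)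
    have h2 := Submodule.sum_mem _ (t := Finset.univ) fun α (_ : α ∈ Finset.univ) ↦
      add_mem (hborel (rootE α.1) (rootF α.1) 0 (by rw [hs α, zero_smul])) (hneg (rootE α.1) α)
    convert add_mem h1 h2 using 1
    simp only [LinearMap.add_apply, LinearMap.sum_apply, LinearMap.comp_apply, LinearMap.sub_apply,
      LinearMap.mulLeft_apply, LinearMap.mulRight_apply, zero_smul, add_zero, mul_add, mul_sub,
      TensorProduct.add_tmul, TensorProduct.sub_tmul, TensorProduct.sum_tmul, Finset.sum_mul,
      smul_mul_assoc, mul_smul_comm, map_add, Finset.sum_add_distrib, Finset.sum_sub_distrib]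
    abel

/-- A central element preserves the weight `ν`, whereas the error term lies in strictly lower
weights and so vanishes. This computes the central character. -/
theorem uact_zc_singular {ν : Module.Dual ℂ H} {v : Y} (hs : IsSingular b v)
    (hv : IsWeightVector H ν v) (k : ℕ) :
    uact Y (zc L k) v = LinearMap.trace ℂ L (charOp b ν k) • v := by
  have hmem : uact Y (zc L k) v - LinearMap.trace ℂ L (charOp b ν k) • v ∈
      negImage b (LieSubmodule.lieSpan ℂ L {v}) := by
    have h := lact_splitCas_pow_sub_mem hs hv k
    have h2 : slab (LinearMap.trace ℂ L) (lact Y (splitCas L ^ k) (1 ⊗ₜ v) -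
        charOp b ν k ⊗ₜ v) ∈ negImage b (LieSubmodule.lieSpan ℂ L {v}) := by
      generalize lact Y (splitCas L ^ k) (1 ⊗ₜ v) - charOp b ν k ⊗ₜ v = w at h
      induction h using Submodule.span_induction with
      | zero => simp
      | add a b _ _ ha hb => rw [map_add]; exact add_mem ha hb
      | smul c a _ ha => rw [map_smul]; exact Submodule.smul_mem _ _ ha
      | mem w hw =>
        obtain ⟨S, y, hy, rfl⟩ := hw
        rw [slab_tmul]
        exact Submodule.smul_mem _ _ hy
    rw [map_sub, slab_lact, slab_tmul] at h2
    exact h2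
  have hw : IsWeightVector H ν (uact Y (zc L k) v - LinearMap.trace ℂ L (charOp b ν k) • v) := by
    intro h
    rw [lie_sub, lie_smul, ← uact_zc_lie, hv h, map_smul, smul_sub, smul_comm (ν h)]
  exact sub_eq_zero.1 (hw.eq_zero_of_mem_lowerSpan (hs.negImage_le hv hmem))

end CentralElements

end AffineKM

namespace AffineKM

/-! ### Integrality of highest weights over the central characters -/

section Integrality

open LieAlgebra LieAlgebra.IsKilling LieModule MvPolynomial

variable {L : Type*} [LieRing L] [LieAlgebra ℂ L] [FiniteDimensional ℂ L] [IsKilling ℂ L]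
  (H : LieSubalgebra ℂ L) [H.IsCartanSubalgebra]

/-- The root lattice. -/
def rootLattice : AddSubgroup (Module.Dual ℂ H) := AddSubgroup.closure (Set.range (wt (H := H)))

variable {H}

theorem wt_mem_rootLattice (α : H.root) : wt α ∈ rootLattice H :=
  AddSubgroup.subset_closure ⟨α, rfl⟩

theorem isWeightVector_cartan (h : H) : IsWeightVector H 0 (h : L) := fun h' ↦ by
  rw [LinearMap.zero_apply, zero_smul]
  exact congrArg Subtype.val (trivial_lie_zero H H h' h)

theorem isWeightModule_self (b : (rootSystem H).Base) :
    IsWeightModule H L (rootLattice H : Set (Module.Dual ℂ H)) := by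
  rw [IsWeightModule, eq_top_iff]
  intro x _
  refine triangular_le b (fun h ↦ ?_) (fun α ↦ ?_) (fun α ↦ ?_) x
  · exact Submodule.subset_span ⟨0, zero_mem _, isWeightVector_cartan h⟩
  · exact Submodule.subset_span ⟨wt α.1, wt_mem_rootLattice _, lie_rootE α.1⟩
  · exact Submodule.subset_span ⟨-wt α.1, neg_mem (wt_mem_rootLattice _), lie_rootF α.1⟩

variable (b : (rootSystem H).Base)

/-- The linear polynomial attached to a weight; its variables stand for the values on the duals of
the simple roots. -/
def wtPoly (μ : Module.Dual ℂ H) : MvPolynomial b.support ℂ :=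
  ∑ j, C (b.toWeightBasis.repr μ j) * X j

/-- The evaluation of polynomials at a weight. -/
def wtEval (ν : Module.Dual ℂ H) : MvPolynomial b.support ℂ →ₐ[ℂ] ℂ :=
  aeval fun j ↦ ν ((cartanEquivDual H).symm (wt j.1))

theorem wtEval_wtPoly (ν μ : Module.Dual ℂ H) :
    wtEval b ν (wtPoly b μ) = μ ((cartanEquivDual H).symm ν) := by
  rw [cartanEquivDual_symm_comm]
  conv_rhs => rw [← b.toWeightBasis.sum_repr μ]
  rw [wtPoly, wtEval, map_sum, map_sum, map_sum]
  refine Finset.sum_congr rfl fun j _ ↦ ?_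
  rw [map_mul, aeval_X, map_smul, map_smul, smul_eq_mul, ← algebraMap_eq, AlgHom.commutes,
    Algebra.algebraMap_self_apply, RootPairing.Base.toWeightBasis_apply]
  rfl

theorem wtPoly_mem_degLT (μ : Module.Dual ℂ H) : wtPoly b μ ∈ degLT b.support 2 :=
  Submodule.sum_mem _ fun j _ ↦ C_mul_mem_degLT _
    (monomial_mem_degLT (by simp) 1)

theorem wtPoly_simple (j : b.support) : wtPoly b (wt j.1) = X j := by
  have : wt j.1 = b.toWeightBasis j := (b.toWeightBasis_apply j).symm
  classical
  rw [wtPoly, this, Module.Basis.repr_self, Finset.sum_eq_single j]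
  · simp
  · intro i _ hi
    simp [hi.symm]
  · simp

variable {d : ℕ} (e : Module.Basis (Fin d) ℂ L) (μ : Fin d → Module.Dual ℂ H)

/-- The polynomial family of the matrices of `charOp`. -/
def charPoly : ℕ → Matrix (Fin d) (Fin d) (MvPolynomial b.support ℂ)
  | 0 => 1
  | k + 1 => fun p q ↦ wtPoly b (μ p) * charPoly k p q +
      ∑ r, ∑ s, C (LinearMap.toMatrix e e (lowOp b (Matrix.toLin e e (Matrix.single r s 1))) p q) *
        charPoly k r s

variable {e μ}

theorem toMatrix_lowOp (T : Module.End ℂ L) (p q : Fin d) :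
    LinearMap.toMatrix e e (lowOp b T) p q = ∑ r, ∑ s,
      LinearMap.toMatrix e e (lowOp b (Matrix.toLin e e (Matrix.single r s 1))) p q *
        LinearMap.toMatrix e e T r s := by
  conv_lhs => rw [← Matrix.toLin_toMatrix e e T,
    Matrix.matrix_eq_sum_single (LinearMap.toMatrix e e T)]
  simp only [map_sum, Matrix.sum_apply]
  refine Finset.sum_congr rfl fun r _ ↦ Finset.sum_congr rfl fun s _ ↦ ?_
  have : Matrix.single r s (LinearMap.toMatrix e e T r s) =
      LinearMap.toMatrix e e T r s • Matrix.single r s (1 : ℂ) := by simp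
  rw [this, map_smul, map_smul, map_smul, Matrix.smul_apply, smul_eq_mul, mul_comm]

theorem wtEval_charPoly (he : ∀ i, IsWeightVector H (μ i) (e i)) (ν : Module.Dual ℂ H) (k : ℕ)
    (p q : Fin d) : wtEval b ν (charPoly b e μ k p q) =
      LinearMap.toMatrix e e (charOp b ν k) p q := by
  induction k generalizing p q with
  | zero =>
    rw [charPoly, charOp, LinearMap.toMatrix_one, Matrix.one_apply, Matrix.one_apply, apply_ite (wtEval b ν),
      map_one, map_zero]
  | succ k ih =>
    rw [charPoly, charOp, map_add, map_mul, map_sum, wtEval_wtPoly, ih, map_add, Matrix.add_apply,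
      toMatrix_lowOp, LinearMap.toMatrix_mul, Matrix.mul_apply]
    congr 1
    · have hdiag (j : Fin d) : LinearMap.toMatrix e e
          (toEnd ℂ L L ((cartanEquivDual H).symm ν : H)) p j =
            if j = p then μ p ((cartanEquivDual H).symm ν) else 0 := by
        rw [LinearMap.toMatrix_apply, toEnd_apply_apply, he j, map_smul, Finsupp.smul_apply,
          e.repr_self, Finsupp.single_apply]
        split
        · next h => rw [h, smul_eq_mul, mul_one]
        · rw [smul_zero]
      simp only [hdiag, ite_mul, zero_mul, Finset.sum_ite_eq',
        Finset.mem_univ, if_true]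
    · refine Finset.sum_congr rfl fun r _ ↦ ?_
      rw [map_sum]
      refine Finset.sum_congr rfl fun s _ ↦ ?_
      rw [map_mul, ih, ← algebraMap_eq, AlgHom.commutes]
      rfl

/-- In a weight basis the leading factor acts diagonally through the linear forms `(μ i, ν)`, and
`lowOp` does not raise the degree. The trace of `charOp` is therefore a power sum of these linear
forms up to lower degree. -/
theorem charPoly_sub_mem (k : ℕ) (p q : Fin d) :
    charPoly b e μ k p q - Matrix.diagonal (fun i ↦ wtPoly b (μ i) ^ k) p q ∈
      degLT b.support k := by
  induction k generalizing p q with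
  | zero => simp [charPoly, Matrix.one_apply, Matrix.diagonal_apply]
  | succ k ih =>
    have hd (p q : Fin d) (k : ℕ) : Matrix.diagonal (fun i ↦ wtPoly b (μ i) ^ k) p q ∈
        degLT b.support (k + 1) := by
      rw [Matrix.diagonal_apply]
      split
      · exact pow_mem_degLT (wtPoly_mem_degLT b _) k
      · exact zero_mem _
    have h1 := mul_mem_degLT (ih p q) (wtPoly_mem_degLT b (μ p))
    have h2 (r s : Fin d) : charPoly b e μ k r s ∈ degLT b.support (k + 1) := by
      have := add_mem (degLT_mono (Nat.le_succ k) (ih r s)) (hd r s k)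
      rwa [sub_add_cancel] at this
    have h3 : ∑ r, ∑ s, C (LinearMap.toMatrix e e (lowOp b
        (Matrix.toLin e e (Matrix.single r s 1))) p q) * charPoly b e μ k r s ∈
        degLT b.support (k + 1) :=
      Submodule.sum_mem _ fun r _ ↦ Submodule.sum_mem _ fun s _ ↦ C_mul_mem_degLT _ (h2 r s)
    convert add_mem h1 h3 using 1
    rw [charPoly, Matrix.diagonal_apply, Matrix.diagonal_apply]
    split
    · next h => rw [pow_succ]; ring
    · ring

/-- The coordinates `(ν, αᵢ)` are integral over the central characters: the matrices `T` do not
depend on `ν`, and after specialization they have a common eigenvector `r` with these coordinates as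
eigenvalues. -/
theorem exists_char_matrices [Nontrivial L] : ∃ (n : ℕ)
    (T : b.support → Matrix (Fin (n + 1)) (Fin (n + 1)) (MvPolynomial ℕ ℂ)),
    ∀ ν : Module.Dual ℂ H, ∃ r : Fin (n + 1) → ℂ, r 0 = 1 ∧
      ∀ i j, ν ((cartanEquivDual H).symm (wt i.1)) * r j = ∑ k,
        aeval (fun m ↦ LinearMap.trace ℂ L (charOp b ν m)) (T i j k) * r k := by
  obtain ⟨d, e, μ, he⟩ := (isWeightModule_self b).exists_basis
  obtain ⟨n, r, T, hr, hT⟩ := exists_matrix_of_powerSums (σ := b.support)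
    (l := fun i ↦ wtPoly b (μ i)) (ζ := fun k ↦ (charPoly b e μ k).trace)
    (fun i ↦ wtPoly_mem_degLT b _) (fun k ↦ by
      rw [Matrix.trace, ← Finset.sum_sub_distrib]
      refine Submodule.sum_mem _ fun i _ ↦ ?_
      simpa using charPoly_sub_mem b (e := e) (μ := μ) k i i) (fun j ↦ by
      -- Simple roots are weights of the adjoint representation, so every variable occurs among the
      -- linear forms whose perturbed power sums are used.
      have : wt j.1 ∈ Set.range μ := by
        by_contra h
        refine rootE_ne_zero j.1 ((show IsWeightVector H (wt j.1) (rootE j.1) from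
          lie_rootE j.1).eq_zero_of_notMem (Λ := Set.range μ) ?_ h)
        have htop : (⊤ : Submodule ℂ L) ≤
            Submodule.span ℂ {x : L | ∃ ν ∈ Set.range μ, IsWeightVector H ν x} := by
          rw [← e.span_eq]
          refine Submodule.span_mono ?_
          rintro _ ⟨i, rfl⟩
          exact ⟨μ i, ⟨i, rfl⟩, (he i).2⟩
        exact htop trivial
      obtain ⟨i, hi⟩ := this
      exact ⟨i, by rw [hi, wtPoly_simple]⟩)
  refine ⟨n, T, fun ν ↦ ⟨fun j ↦ wtEval b ν (r j), (congrArg _ hr).trans (map_one _), fun i j ↦ ?_⟩⟩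
  have h := congrArg (wtEval b ν) (hT i j)
  rw [map_mul, map_sum, wtEval, aeval_X] at h
  rw [wtEval, h]
  refine Finset.sum_congr rfl fun k _ ↦ ?_
  rw [map_mul]
  congr 1
  have h2 : (wtEval b ν).comp (aeval fun k ↦ (charPoly b e μ k).trace) =
      aeval (fun m ↦ LinearMap.trace ℂ L (charOp b ν m)) := by
    refine algHom_ext fun m ↦ ?_
    rw [AlgHom.comp_apply, aeval_X, aeval_X, Matrix.trace, map_sum,
      LinearMap.trace_eq_matrix_trace ℂ e, Matrix.trace]
    exact Finset.sum_congr rfl fun i _ ↦ wtEval_charPoly b (fun i ↦ (he i).2) ν m i i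
  exact congr($h2 (T i j k))

end Integrality

end AffineKM

namespace AffineKM

/-! ### The Casimir operator of a tensor product -/

section CasimirTensor

open LieAlgebra LieAlgebra.IsKilling LieModule Polynomial

variable {L : Type*} [LieRing L] [LieAlgebra ℂ L]
  {E Y : Type*} [AddCommGroup E] [Module ℂ E] [LieRingModule L E] [LieModule ℂ L E]
  [AddCommGroup Y] [Module ℂ Y] [LieRingModule L Y] [LieModule ℂ L Y]

variable (E) in
/-- The subspace `E ⊗ N` of `E ⊗ Y`. -/
def tensOf (N : Submodule ℂ Y) : Submodule ℂ (E ⊗[ℂ] Y) :=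
  Submodule.map₂ (TensorProduct.mk ℂ E Y) ⊤ N

theorem tmul_mem_tensOf {N : Submodule ℂ Y} (e : E) {y : Y} (hy : y ∈ N) :
    e ⊗ₜ[ℂ] y ∈ tensOf E N := Submodule.apply_mem_map₂ _ trivial hy

theorem tensOf_le {N : Submodule ℂ Y} {S : Submodule ℂ (E ⊗[ℂ] Y)} :
    tensOf E N ≤ S ↔ ∀ (e : E), ∀ y ∈ N, e ⊗ₜ[ℂ] y ∈ S := by
  rw [tensOf, Submodule.map₂_le]
  simp

theorem tensOf_top : tensOf E (⊤ : Submodule ℂ Y) = ⊤ :=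
  TensorProduct.map₂_mk_top_top_eq_top ..

theorem tensOf_bot : tensOf E (⊥ : Submodule ℂ Y) = ⊥ := by
  simp [tensOf]

theorem tact_mem_tensOf (N : LieSubmodule ℂ L Y)
    (t : Module.End ℂ E ⊗[ℂ] UniversalEnvelopingAlgebra ℂ L) {w : E ⊗[ℂ] Y}
    (hw : w ∈ tensOf E N.toSubmodule) : tact E Y t w ∈ tensOf E N.toSubmodule := by
  refine (tensOf_le (S := (tensOf E N.toSubmodule).comap (tact E Y t))).2 (fun e y hy ↦ ?_) hw
  rw [Submodule.mem_comap]
  induction t using TensorProduct.induction_on with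
  | zero => simp
  | tmul T u => exact tmul_mem_tensOf _ (uact_mem u N hy)
  | add a b ha hb => rw [map_add, LinearMap.add_apply]; exact add_mem ha hb

variable [FiniteDimensional ℂ L] [IsKilling ℂ L]

variable (L E) in
/-- The difference of the Casimir element, acting on tensor products `E ⊗ Y`, and its action on the
second factor. -/
def casDiffU : Module.End ℂ E ⊗[ℂ] UniversalEnvelopingAlgebra ℂ L :=
  coact E (casU L) - (1 : Module.End ℂ E) ⊗ₜ[ℂ] casU L

variable (L E Y) in
/-- The difference of the Casimir operator on `E ⊗ Y` and the Casimir operator on `Y`. -/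
def casDiff : Module.End ℂ (E ⊗[ℂ] Y) :=
  casimir (L := L) (E ⊗[ℂ] Y) - (casimir (L := L) Y).lTensor E

theorem tact_casDiffU : tact E Y (casDiffU L E) = casDiff L E Y := by
  rw [casDiffU, map_sub, tact_coact, uact_casU, casDiff]
  congr 1
  refine TensorProduct.ext' fun e y ↦ ?_
  rw [tact_tmul, uact_casU, LinearMap.lTensor_tmul, Module.End.one_apply]

theorem tact_casDiffU_pow (n : ℕ) : tact E Y (casDiffU L E ^ n) = casDiff L E Y ^ n := by
  induction n with
  | zero => rw [pow_zero, pow_zero]; exact (tact (L := L) E Y).map_one'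
  | succ n ih => rw [pow_succ, pow_succ, map_mul, ih, tact_casDiffU]

theorem casDiff_lie (x : L) (w : E ⊗[ℂ] Y) : casDiff L E Y ⁅x, w⁆ = ⁅x, casDiff L E Y w⁆ := by
  have h : (casimir (L := L) Y).lTensor E ⁅x, w⁆ = ⁅x, (casimir (L := L) Y).lTensor E w⁆ := by
    induction w using TensorProduct.induction_on with
    | zero => simp
    | add a b ha hb => rw [lie_add, map_add, map_add, lie_add, ha, hb]
    | tmul e y =>
      rw [TensorProduct.LieModule.lie_tmul_right, map_add, LinearMap.lTensor_tmul,
        LinearMap.lTensor_tmul, LinearMap.lTensor_tmul, casimir_lie,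
        TensorProduct.LieModule.lie_tmul_right]
  rw [casDiff, LinearMap.sub_apply, LinearMap.sub_apply, lie_sub, casimir_lie, h]

theorem aeval_casDiff_lie (p : ℂ[X]) (x : L) (w : E ⊗[ℂ] Y) :
    aeval (casDiff L E Y) p ⁅x, w⁆ = ⁅x, aeval (casDiff L E Y) p w⁆ := by
  induction p using Polynomial.induction_on with
  | C a => simp
  | add p q hp hq => rw [map_add, LinearMap.add_apply, LinearMap.add_apply, hp, hq, lie_add]
  | monomial n a h =>
    rw [pow_succ, ← mul_assoc, mul_comm, map_mul, aeval_X, Module.End.mul_apply, h,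
      Module.End.mul_apply, casDiff_lie]

/-- The kernel of a polynomial in `casDiff`. -/
def casDiffKer (p : ℂ[X]) : LieSubmodule ℂ L (E ⊗[ℂ] Y) where
  __ := LinearMap.ker (aeval (casDiff L E Y) p)
  lie_mem {x w} hw := by
    change aeval (casDiff L E Y) p ⁅x, w⁆ = 0
    have hw : aeval (casDiff L E Y) p w = 0 := hw
    rw [aeval_casDiff_lie, hw, lie_zero]

theorem mem_casDiffKer {p : ℂ[X]} {w : E ⊗[ℂ] Y} :
    w ∈ casDiffKer (L := L) p ↔ aeval (casDiff L E Y) p w = 0 := Iff.rfl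

theorem casDiffKer_mono {p q : ℂ[X]} (h : p ∣ q) :
    casDiffKer (L := L) (E := E) (Y := Y) p ≤ casDiffKer q := by
  obtain ⟨r, rfl⟩ := h
  intro w hw
  rw [mem_casDiffKer] at *
  rw [mul_comm, map_mul, Module.End.mul_apply, hw, map_zero]

variable (L) in
/-- Substitution of the central elements. -/
def centHom : MvPolynomial ℕ ℂ →ₐ[ℂ] UniversalEnvelopingAlgebra ℂ L :=
  (Subalgebra.center ℂ _).val.comp (MvPolynomial.aeval fun k ↦
    (⟨zc L k, Subalgebra.mem_center_iff.2 fun u ↦ (commute_zc k u).eq⟩ :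
      Subalgebra.center ℂ (UniversalEnvelopingAlgebra ℂ L)))

theorem centHom_X (k : ℕ) : centHom L (MvPolynomial.X k) = zc L k := by
  rw [centHom, AlgHom.comp_apply, MvPolynomial.aeval_X]
  rfl

theorem centHom_comm (a : MvPolynomial ℕ ℂ) (u : UniversalEnvelopingAlgebra ℂ L) :
    u * centHom L a = centHom L a * u :=
  Subalgebra.mem_center_iff.1 (Subtype.prop (MvPolynomial.aeval (R := ℂ) (fun k ↦
    (⟨zc L k, Subalgebra.mem_center_iff.2 fun u ↦ (commute_zc k u).eq⟩ :
      Subalgebra.center ℂ (UniversalEnvelopingAlgebra ℂ L))) a)) u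

variable (L E) in
/-- Substitution of the central elements in the second tensor factor. -/
def centE : MvPolynomial ℕ ℂ →ₐ[ℂ] Module.End ℂ E ⊗[ℂ] UniversalEnvelopingAlgebra ℂ L :=
  Algebra.TensorProduct.includeRight.comp (centHom L)

theorem centE_apply (a : MvPolynomial ℕ ℂ) :
    centE L E a = (1 : Module.End ℂ E) ⊗ₜ[ℂ] centHom L a := rfl

theorem centE_comm (a : MvPolynomial ℕ ℂ) (t : Module.End ℂ E ⊗[ℂ] UniversalEnvelopingAlgebra ℂ L) :
    centE L E a * t = t * centE L E a := by
  rw [centE_apply]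
  induction t using TensorProduct.induction_on with
  | zero => rw [mul_zero, zero_mul]
  | tmul T u =>
    rw [Algebra.TensorProduct.tmul_mul_tmul, Algebra.TensorProduct.tmul_mul_tmul, one_mul, mul_one,
      centHom_comm]
  | add a b ha hb => rw [mul_add, add_mul, ha, hb]

variable (L E) in
/-- Substitution of the central elements and of `casDiffU`. -/
def polyEv : (MvPolynomial ℕ ℂ)[X] →+* Module.End ℂ E ⊗[ℂ] UniversalEnvelopingAlgebra ℂ L :=
  eval₂RingHom' (centE L E).toRingHom (casDiffU L E) fun a ↦ centE_comm a _

theorem polyEv_monomial (n : ℕ) (a : MvPolynomial ℕ ℂ) :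
    polyEv L E (monomial n a) = centE L E a * casDiffU L E ^ n :=
  eval₂_monomial (centE L E).toRingHom (casDiffU L E)

theorem centHom_sub_mem {N N' : LieSubmodule ℂ L Y} {χ : ℕ → ℂ}
    (h : ∀ k, ∀ y ∈ N', uact Y (zc L k) y - χ k • y ∈ N) (a : MvPolynomial ℕ ℂ) {y : Y}
    (hy : y ∈ N') : uact Y (centHom L a) y - MvPolynomial.aeval χ a • y ∈ N := by
  induction a using MvPolynomial.induction_on generalizing y with
  | C c =>
    rw [← MvPolynomial.algebraMap_eq, AlgHom.commutes, AlgHom.commutes, AlgHom.commutes,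
      Module.algebraMap_end_apply]
    simp
  | add p q hp hq =>
    rw [map_add, map_add, map_add, LinearMap.add_apply, add_smul, add_sub_add_comm]
    exact add_mem (hp hy) (hq hy)
  | mul_X p k hp =>
    rw [map_mul, centHom_X, map_mul, map_mul, MvPolynomial.aeval_X, Module.End.mul_apply]
    have h1 := hp (uact_mem (zc L k) N' hy)
    have h2 := N.smul_mem (MvPolynomial.aeval χ p) (h k y hy)
    convert add_mem h1 h2 using 1
    rw [smul_sub, mul_smul]
    abel

/-- If the central elements act by scalars on a subquotient `N' / N` then a polynomial in the
central elements and in `casDiffU` acts on `E ⊗ N' / E ⊗ N` as a polynomial in `casDiff`. -/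
theorem polyEv_sub_mem {N N' : LieSubmodule ℂ L Y} {χ : ℕ → ℂ}
    (h : ∀ k, ∀ y ∈ N', uact Y (zc L k) y - χ k • y ∈ N) (p : (MvPolynomial ℕ ℂ)[X])
    {w : E ⊗[ℂ] Y} (hw : w ∈ tensOf E N'.toSubmodule) :
    tact E Y (polyEv L E p) w -
      aeval (casDiff L E Y) (p.map (MvPolynomial.aeval χ : MvPolynomial ℕ ℂ →ₐ[ℂ] ℂ).toRingHom) w ∈
        tensOf E N.toSubmodule := by
  induction p using Polynomial.induction_on' with
  | add p q hp hq =>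
    rw [map_add, map_add, LinearMap.add_apply, Polynomial.map_add, map_add, LinearMap.add_apply,
      add_sub_add_comm]
    exact add_mem hp hq
  | monomial n a =>
    rw [polyEv_monomial, Polynomial.map_monomial, aeval_monomial, map_mul, Module.End.mul_apply,
      Module.End.mul_apply, tact_casDiffU_pow]
    have hw' : (casDiff L E Y ^ n) w ∈ tensOf E N'.toSubmodule := by
      rw [← tact_casDiffU_pow]
      exact tact_mem_tensOf N' _ hw
    generalize (casDiff L E Y ^ n) w = w at hw'
    refine (tensOf_le (S := (tensOf E N.toSubmodule).comap (tact E Y (centE L E a) -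
      algebraMap ℂ (Module.End ℂ (E ⊗[ℂ] Y)) (MvPolynomial.aeval χ a)))).2 (fun e y hy ↦ ?_) hw'
    rw [Submodule.mem_comap, LinearMap.sub_apply, centE_apply, tact_tmul,
      Module.algebraMap_end_apply, Module.End.one_apply, ← TensorProduct.tmul_smul,
      ← TensorProduct.tmul_sub]
    exact tmul_mem_tensOf e (centHom_sub_mem h a hy)

variable {H : LieSubalgebra ℂ L} [H.IsCartanSubalgebra] {b : (rootSystem H).Base}

/-- The vectors `y` for which `E ⊗ y` lies in the generated submodule form a submodule, and `v` is
one of them. -/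
theorem lieSpan_tmul {ι : Type*} (e : Module.Basis ι ℂ E) (v : Y) (w : E ⊗[ℂ] Y)
    (hw : w ∈ tensOf E (LieSubmodule.lieSpan ℂ L {v}).toSubmodule) :
    w ∈ LieSubmodule.lieSpan ℂ L (Set.range fun i ↦ e i ⊗ₜ[ℂ] v) := by
  set N := LieSubmodule.lieSpan ℂ L (Set.range fun i ↦ e i ⊗ₜ[ℂ] v)
  let S : LieSubmodule ℂ L Y :=
    { carrier := {y | ∀ x : E, x ⊗ₜ[ℂ] y ∈ N}
      add_mem' := fun {y z} hy hz x ↦ by rw [TensorProduct.tmul_add]; exact add_mem (hy x) (hz x)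
      zero_mem' := fun x ↦ by simp
      smul_mem' := fun c y hy x ↦ by rw [TensorProduct.tmul_smul]; exact N.smul_mem c (hy x)
      lie_mem := fun {a y} hy x ↦ by
        have h1 := N.lie_mem (x := a) (hy x)
        rw [TensorProduct.LieModule.lie_tmul_right] at h1
        have := sub_mem h1 (hy ⁅a, x⁆)
        rwa [add_sub_cancel_left] at this }
  have hS : LieSubmodule.lieSpan ℂ L {v} ≤ S := by
    rw [LieSubmodule.lieSpan_le, Set.singleton_subset_iff]
    intro x
    have hx : x ∈ Submodule.span ℂ (Set.range e) := by rw [e.span_eq]; trivial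
    change x ∈ N.toSubmodule.comap ((TensorProduct.mk ℂ E Y).flip v)
    refine (Submodule.span_le.2 ?_) hx
    rintro _ ⟨i, rfl⟩
    exact LieSubmodule.subset_lieSpan ⟨i, rfl⟩
  exact (tensOf_le (S := N.toSubmodule)).2 (fun x y hy ↦ hS hy x) hw

/-- The eigenvalues of `casDiff` on the tensor product with a highest weight module. -/
theorem prod_casDiff_singular {d : ℕ} (e : Module.Basis (Fin d) ℂ E)
    (μ : Fin d → Module.Dual ℂ H) (he : ∀ i, IsWeightVector H (μ i) (e i))
    {ν : Module.Dual ℂ H} {v : Y} (hs : IsSingular b v) (hv : IsWeightVector H ν v)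
    {w : E ⊗[ℂ] Y} (hw : w ∈ tensOf E (LieSubmodule.lieSpan ℂ L {v}).toSubmodule) :
    aeval (casDiff L E Y) (∏ i, (X - C (casVal b (ν + μ i) - casVal b ν))) w = 0 := by
  classical
  -- The weights are arbitrary complex ones, but raising operators add a positive integer to the
  -- height, so its real part gives a usable order.
  let ht : Fin d → ℝ := fun i ↦ (μ i (htElt b)).re
  -- Descending induction on the height. Raising `e i ⊗ v` gives a combination of `e j ⊗ v` of
  -- greater height, already killed by the product `q` of the other factors. Modulo the kernel of
  -- `q` the vector is singular, so `casDiff` acts on it by the scalar of the remaining factor.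
  have key : ∀ i, e i ⊗ₜ[ℂ] v ∈ casDiffKer (L := L) (∏ j with ht i ≤ ht j,
      (X - C (casVal b (ν + μ j) - casVal b ν))) := by
    have hwf : WellFounded fun i j : Fin d ↦ ht j < ht i :=
      Finite.wellFounded_of_trans_of_irrefl (α := Fin d) (r := fun i j ↦ ht j < ht i)
    intro i
    induction i using hwf.induction with
    | _ i ih =>
    set q := ∏ j ∈ (Finset.univ.filter fun j ↦ ht i ≤ ht j).erase i,
      (X - C (casVal b (ν + μ j) - casVal b ν))
    have hq : ∏ j with ht i ≤ ht j, (X - C (casVal b (ν + μ j) - casVal b ν)) =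
        q * (X - C (casVal b (ν + μ i) - casVal b ν)) :=
      (Finset.prod_erase_mul _ _ (by simp)).symm
    have hbig : ∀ j, ht i < ht j → e j ⊗ₜ[ℂ] v ∈ casDiffKer (L := L) q := by
      intro j hj
      refine casDiffKer_mono (Finset.prod_dvd_prod_of_subset _ _ _ fun k hk ↦ ?_) (ih j hj)
      rw [Finset.mem_filter] at hk
      refine Finset.mem_erase.2 ⟨?_, Finset.mem_filter.2 ⟨Finset.mem_univ _, hj.le.trans hk.2⟩⟩
      rintro rfl
      exact absurd hk.2 (not_le.2 hj)
    have hE : ∀ α : PosRoot b, ⁅rootE α.1, e i ⊗ₜ[ℂ] v⁆ ∈ casDiffKer (L := L) q := by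
      intro α
      rw [TensorProduct.LieModule.lie_tmul_right, hs α, TensorProduct.tmul_zero, add_zero,
        ← e.sum_repr ⁅rootE α.1, e i⁆, TensorProduct.sum_tmul]
      refine sum_mem fun j _ ↦ ?_
      rw [← TensorProduct.smul_tmul']
      by_cases hj : ht i < ht j
      · exact (casDiffKer q).smul_mem _ (hbig j hj)
      · have h0 : e.repr ⁅rootE α.1, e i⁆ j = 0 := by
          by_contra h0
          have hwv := (he i).lie_rootE α.1
          have h1 := hwv (htElt b)
          have h2 : e.repr ⁅((htElt b : H) : L), ⁅rootE α.1, e i⁆⁆ j =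
              μ j (htElt b) * e.repr ⁅rootE α.1, e i⁆ j := by
            conv_lhs => rw [← e.sum_repr ⁅rootE α.1, e i⁆]
            rw [lie_sum, map_sum, Finset.sum_apply', Finset.sum_eq_single j]
            · rw [lie_smul, he j, smul_smul, map_smul, e.repr_self]
              simp [mul_comm]
            · intro k _ hk
              rw [lie_smul, he k, smul_smul, map_smul, e.repr_self]
              simp [hk]
            · simp
          rw [h1, map_smul, Finsupp.smul_apply, smul_eq_mul] at h2
          have h3 := mul_right_cancel₀ h0 h2
          rw [LinearMap.add_apply, wt_htElt] at h3
          refine hj ?_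
          have h4 := congrArg Complex.re h3
          rw [Complex.add_re, Complex.intCast_re] at h4
          have h5 : (0 : ℝ) < b.height α.1 := by exact_mod_cast α.height_pos
          change (μ i (htElt b)).re < (μ j (htElt b)).re
          linarith
        rw [h0, zero_smul]
        exact zero_mem _
    have hcas := casimir_sub_mem (casDiffKer (L := L) q) ((he i).tmul hv) hE
    rw [hq, mem_casDiffKer, map_mul, Module.End.mul_apply, map_sub, aeval_X, aeval_C,
      LinearMap.sub_apply, Module.algebraMap_end_apply, ← mem_casDiffKer]
    convert hcas using 1
    rw [casDiff, LinearMap.sub_apply, LinearMap.lTensor_tmul, hs.casimir hv,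
      TensorProduct.tmul_smul, sub_smul, add_comm ν]
    abel
  refine (mem_casDiffKer (L := L)).1 ((LieSubmodule.lieSpan_le.2 ?_) (lieSpan_tmul e v w hw))
  rintro _ ⟨i, rfl⟩
  exact casDiffKer_mono (Finset.prod_dvd_prod_of_subset _ _ _ (Finset.filter_subset _ _)) (key i)

end CasimirTensor

end AffineKM

namespace AffineKM

/-! ### The characteristic polynomials of the Casimir operator on tensor products -/

section LatticeBound

open LieAlgebra LieAlgebra.IsKilling LieModule
open scoped ComplexOrder

variable {L : Type*} [LieRing L] [LieAlgebra ℂ L] [FiniteDimensional ℂ L] [IsKilling ℂ L]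
  {H : LieSubalgebra ℂ L} [H.IsCartanSubalgebra] (b : (rootSystem H).Base)

theorem exists_real_wt (α β : H.root) : ∃ r : ℝ, wt α ((cartanEquivDual H).symm (wt β)) = r := by
  have h0 := normSq_pos β
  obtain ⟨r, hr⟩ : ∃ r : ℝ, wt β ((cartanEquivDual H).symm (wt β)) = r :=
    ⟨_, (Complex.ext rfl (by simpa using (Complex.lt_def.1 h0).2.symm))⟩
  have h : ∃ n : ℤ, wt α ((rootSystem H).coroot β) = n :=
    ⟨_, apply_coroot_eq_cast (β : Weight ℂ H L) (α : Weight ℂ H L)⟩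
  obtain ⟨n, hn⟩ := h
  refine ⟨r / 2 * n, ?_⟩
  rw [cartanEquivDual_symm_wt, map_smul, hr, hn]
  simp

theorem traceForm_eq_sum_root (x y : H) : traceForm ℂ H L x y = ∑ β : H.root, wt β x * wt β y := by
  have := congr($(restrict_killingForm_eq_sum (K := ℂ) (L := L) (H := H)) x y)
  rw [LinearMap.BilinForm.restrict_apply] at this
  change traceForm ℂ H L x y = _ at this
  rw [this, LinearMap.sum_apply, LinearMap.sum_apply, ← Finset.sum_coe_sort]
  rfl

theorem exists_int_repr {μ : Module.Dual ℂ H} (hμ : μ ∈ rootLattice H) :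
    ∀ i, ∃ n : ℤ, b.toWeightBasis.repr μ i = n := by
  induction hμ using AddSubgroup.closure_induction with
  | zero => exact fun i ↦ ⟨0, by simp⟩
  | add x y _ _ hx hy =>
    intro i
    obtain ⟨m, hm⟩ := hx i
    obtain ⟨n, hn⟩ := hy i
    exact ⟨m + n, by simp [hm, hn]⟩
  | neg x _ hx =>
    intro i
    obtain ⟨m, hm⟩ := hx i
    exact ⟨-m, by simp [hm]⟩
  | mem x hx =>
    classical
    obtain ⟨α, rfl⟩ := hx
    intro i
    obtain ⟨f, hf, -, h⟩ := b.exists_root_eq_sum_int α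
    have h' : wt α = ∑ j ∈ b.support, (f j : ℂ) • wt j := by
      simpa [Int.cast_smul_eq_zsmul] using h
    refine ⟨f i, ?_⟩
    have hb (j : b.support) : b.toWeightBasis.repr (wt j.1) i = if j = i then 1 else 0 := by
      rw [show wt j.1 = b.toWeightBasis j from (b.toWeightBasis_apply j).symm,
        Module.Basis.repr_self, Finsupp.single_apply]
    rw [h', ← Finset.sum_coe_sort, map_sum, Finset.sum_apply', Finset.sum_eq_single i]
    · rw [map_smul, Finsupp.smul_apply, hb, if_pos rfl, smul_eq_mul, mul_one]
    · intro j _ hj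
      rw [map_smul, Finsupp.smul_apply, hb, if_neg hj, smul_zero]
    · exact fun h ↦ absurd (Finset.mem_univ i) h

/-- The invariant form is `∑ β(x) β(y)` over the roots, hence positive definite on the real span of
the roots. Here `s` is the norm of `μ`, and the map `F` from coordinates to values on roots is
injective, so the coordinates are bounded by a multiple of `s`. -/
theorem exists_lattice_bound : ∃ K : ℝ, 0 ≤ K ∧ ∀ μ ∈ rootLattice H, ∃ s : ℝ, 0 ≤ s ∧
    μ ((cartanEquivDual H).symm μ) = (s : ℂ) ^ 2 ∧
      ∀ i, ‖b.toWeightBasis.repr μ i‖ ≤ K * s := by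
  classical
  choose r hr using exists_real_wt (H := H)
  let F : (b.support → ℝ) →ₗ[ℝ] (H.root → ℝ) :=
    Matrix.mulVecLin (Matrix.of fun β (i : b.support) ↦ r β i)
  have hF : ∀ (x : b.support → ℝ) (β : H.root),
      wt β ((cartanEquivDual H).symm (∑ i, (x i : ℂ) • wt i.1)) = (F x β : ℝ) := by
    intro x β
    rw [map_sum, map_sum]
    simp only [F, Matrix.mulVecLin_apply, Matrix.mulVec, dotProduct, Matrix.of_apply,
      Complex.ofReal_sum, Complex.ofReal_mul]
    refine Finset.sum_congr rfl fun i _ ↦ ?_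
    rw [map_smul, map_smul, hr, smul_eq_mul, mul_comm]
  have hker : F.ker = ⊥ := by
    rw [LinearMap.ker_eq_bot']
    intro x hx
    set μ := ∑ i, (x i : ℂ) • wt (i : b.support).1 with hμ
    have h0 : μ = 0 := by
      ext h
      rw [← traceForm_cartanEquivDual_symm μ h, traceForm_eq_sum_root, LinearMap.zero_apply]
      refine Finset.sum_eq_zero fun β _ ↦ ?_
      rw [hF, hx]
      simp
    have hli := b.toWeightBasis.linearIndependent
    rw [Fintype.linearIndependent_iff] at hli
    ext i
    have := hli (fun i ↦ (x i : ℂ)) (by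
      rw [← h0, hμ]
      exact Finset.sum_congr rfl fun j _ ↦ by rw [b.toWeightBasis_apply]; rfl) i
    exact_mod_cast this
  obtain ⟨K, hK0, hK⟩ := F.exists_antilipschitzWith hker
  refine ⟨K, K.2, fun μ hμ ↦ ?_⟩
  choose n hn using exists_int_repr b hμ
  let x : b.support → ℝ := fun i ↦ n i
  have hμx : μ = ∑ i, (x i : ℂ) • wt (i : b.support).1 := by
    conv_lhs => rw [← b.toWeightBasis.sum_repr μ]
    refine Finset.sum_congr rfl fun i _ ↦ ?_
    rw [hn, b.toWeightBasis_apply]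
    simp [x]
  have hsq : μ ((cartanEquivDual H).symm μ) = ((∑ β, F x β ^ 2 : ℝ) : ℂ) := by
    rw [← traceForm_cartanEquivDual_symm μ, traceForm_eq_sum_root, Complex.ofReal_sum]
    refine Finset.sum_congr rfl fun β _ ↦ ?_
    rw [hμx, hF]
    push_cast
    ring
  have hnn : 0 ≤ ∑ β, F x β ^ 2 := Finset.sum_nonneg fun β _ ↦ sq_nonneg _
  refine ⟨√(∑ β, F x β ^ 2), Real.sqrt_nonneg _, ?_, fun i ↦ ?_⟩
  · rw [hsq, ← Complex.ofReal_pow, Real.sq_sqrt hnn]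
  · have h1 : ‖x‖ ≤ K * ‖F x‖ := by
      simpa using hK.le_mul_dist x 0
    have h2 : ‖F x‖ ≤ √(∑ β, F x β ^ 2) := by
      refine (pi_norm_le_iff_of_nonneg (Real.sqrt_nonneg _)).2 fun β ↦ ?_
      refine Real.le_sqrt_of_sq_le ?_
      rw [Real.norm_eq_abs, sq_abs]
      exact Finset.single_le_sum (f := fun β ↦ F x β ^ 2) (fun β _ ↦ sq_nonneg _) (Finset.mem_univ β)
    have h3 : ‖b.toWeightBasis.repr μ i‖ = ‖x i‖ := by
      rw [hn]
      simp [x]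
    rw [h3]
    exact (norm_le_pi_norm x i).trans (h1.trans (mul_le_mul_of_nonneg_left h2 K.2))

end LatticeBound

/-! ### Eigenvalues of the Casimir difference and their distance to squares. -/

section CharPoly

open LieAlgebra LieAlgebra.IsKilling LieModule Polynomial

variable {L : Type*} [LieRing L] [LieAlgebra ℂ L] [FiniteDimensional ℂ L] [IsKilling ℂ L]
  {H : LieSubalgebra ℂ L} [H.IsCartanSubalgebra] (b : (rootSystem H).Base)

/-- The roots of the polynomial `q` are close to squares of real numbers. -/
def NearSquares (C : ℝ) (q : ℂ[X]) : Prop :=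
  q ≠ 0 ∧ ∀ d, q.IsRoot d → ∃ s : ℝ, 0 ≤ s ∧ ‖d - (s : ℂ) ^ 2‖ ≤ C * s

theorem NearSquares.mono {C C' : ℝ} (h : C ≤ C') {q : ℂ[X]} (hq : NearSquares C q) :
    NearSquares C' q :=
  ⟨hq.1, fun d hd ↦ let ⟨s, hs, h1⟩ := hq.2 d hd
    ⟨s, hs, h1.trans (mul_le_mul_of_nonneg_right h hs)⟩⟩

theorem NearSquares.mul {C : ℝ} {q q' : ℂ[X]} (hq : NearSquares C q) (hq' : NearSquares C q') :
    NearSquares C (q * q') := by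
  refine ⟨mul_ne_zero hq.1 hq'.1, fun d hd ↦ ?_⟩
  rcases root_mul.1 hd with h | h
  · exact hq.2 d h
  · exact hq'.2 d h

theorem nearSquares_one (C : ℝ) : NearSquares C 1 :=
  ⟨one_ne_zero, fun d hd ↦ by simp [IsRoot] at hd⟩

theorem nearSquares_prod {ι : Type*} (s : Finset ι) {C : ℝ} {q : ι → ℂ[X]}
    (h : ∀ i ∈ s, NearSquares C (q i)) : NearSquares C (∏ i ∈ s, q i) :=
  Finset.prod_induction _ _ (fun _ _ ↦ NearSquares.mul) (nearSquares_one C) h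

variable {n : ℕ} (T : b.support → Matrix (Fin (n + 1)) (Fin (n + 1)) (MvPolynomial ℕ ℂ))

/-- The matrix of multiplication by the eigenvalue of `casDiff` of weight `μ`. -/
def eigenMatrix (μ : Module.Dual ℂ H) : Matrix (Fin (n + 1)) (Fin (n + 1)) (MvPolynomial ℕ ℂ) :=
  (MvPolynomial.C (casVal b μ) : MvPolynomial ℕ ℂ) •
      (1 : Matrix (Fin (n + 1)) (Fin (n + 1)) (MvPolynomial ℕ ℂ)) +
    ∑ i, (MvPolynomial.C (2 * b.toWeightBasis.repr μ i) : MvPolynomial ℕ ℂ) • T i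

/-- The specialization of polynomials in the central elements. -/
abbrev spec (χ : ℕ → ℂ) : MvPolynomial ℕ ℂ →+* ℂ :=
  (MvPolynomial.aeval χ : MvPolynomial ℕ ℂ →ₐ[ℂ] ℂ).toRingHom

variable {b T}

theorem eigenMatrix_map_mulVec (χ : ℕ → ℂ) (μ : Module.Dual ℂ H) (r : Fin (n + 1) → ℂ) :
    ((eigenMatrix b T μ).map (spec χ)).mulVec r = casVal b μ • r +
      ∑ i, (2 * b.toWeightBasis.repr μ i) • ((T i).map (spec χ)).mulVec r := by
  have h : (eigenMatrix b T μ).map (spec χ) = casVal b μ • (1 : Matrix _ _ ℂ) +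
      ∑ i, (2 * b.toWeightBasis.repr μ i) • (T i).map (spec χ) := by
    ext p q
    simp only [eigenMatrix, Matrix.map_apply, Matrix.add_apply, Matrix.smul_apply, map_add,
      Matrix.sum_apply, map_sum, smul_eq_mul, map_mul, Matrix.one_apply]
    congr 1
    · split <;> simp
    · simp
  rw [h, Matrix.add_mulVec, Matrix.smul_mulVec, Matrix.one_mulVec, Matrix.sum_mulVec]
  simp only [Matrix.smul_mulVec]

theorem isRoot_charpoly_iff {m : ℕ} (A : Matrix (Fin m) (Fin m) ℂ) (d : ℂ) :
    A.charpoly.IsRoot d ↔ ∃ w, w ≠ 0 ∧ A.mulVec w = d • w := by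
  rw [IsRoot, Matrix.eval_charpoly, ← Matrix.exists_mulVec_eq_zero_iff]
  refine exists_congr fun w ↦ and_congr_right fun _ ↦ ?_
  rw [Matrix.sub_mulVec, sub_eq_zero, Matrix.scalar_apply, ← Matrix.smul_one_eq_diagonal,
    Matrix.smul_mulVec, Matrix.one_mulVec, eq_comm]

/-- This is `(μ, μ) + 2 (μ, ν + ρ)`, with the dependence on `ν` isolated in the coordinates `(ν,
αᵢ)` that the matrices `T` represent. -/
theorem casVal_add_sub (ν μ : Module.Dual ℂ H) : casVal b (ν + μ) - casVal b ν = casVal b μ +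
    ∑ i, 2 * b.toWeightBasis.repr μ i * ν ((cartanEquivDual H).symm (wt (i : b.support).1)) := by
  have h : ν ((cartanEquivDual H).symm μ) = ∑ i, b.toWeightBasis.repr μ i *
      ν ((cartanEquivDual H).symm (wt (i : b.support).1)) := by
    conv_lhs => rw [← b.toWeightBasis.sum_repr μ]
    rw [map_sum, map_sum]
    refine Finset.sum_congr rfl fun i _ ↦ ?_
    rw [map_smul, map_smul, b.toWeightBasis_apply]
    rfl
  simp only [mul_assoc]
  rw [← Finset.mul_sum, ← h, casVal_eq, casVal_eq, casVal_eq, map_add, map_add, map_add,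
    LinearMap.add_apply, LinearMap.add_apply, cartanEquivDual_symm_comm μ ν]
  ring

-- For an eigenvector `w` with eigenvalue `d`, the difference `(d - s²) w` is a combination of
-- vectors of size at most a constant times `‖w‖`. Its coefficients are the coordinates of `μ`,
-- which are at most `K s`. The constant depends on `χ` and `T` but not on `μ`, hence not on `E`
-- later.
open scoped Matrix.Norms.Operator in
theorem nearSquares_charpoly (χ : ℕ → ℂ) : ∃ C : ℝ, ∀ μ ∈ rootLattice H,
    NearSquares C ((eigenMatrix b T μ).charpoly.map (spec χ)) := by
  obtain ⟨K, hK, hb⟩ := exists_lattice_bound b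
  let c : b.support → ℝ := fun i ↦ ‖twoRho b ((cartanEquivDual H).symm (wt i.1))‖ +
    2 * ‖(T i).map (spec χ)‖
  refine ⟨∑ i, K * c i, fun μ hμ ↦ ⟨?_, fun d hd ↦ ?_⟩⟩
  · rw [← Matrix.charpoly_map]
    exact (Matrix.charpoly_monic _).ne_zero
  rw [← Matrix.charpoly_map] at hd
  obtain ⟨w, hw0, hw⟩ := (isRoot_charpoly_iff _ _).1 hd
  obtain ⟨s, hs, hs2, ha⟩ := hb μ hμ
  refine ⟨s, hs, ?_⟩
  rw [eigenMatrix_map_mulVec] at hw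
  have hrho : twoRho b ((cartanEquivDual H).symm μ) = ∑ i, b.toWeightBasis.repr μ i *
      twoRho b ((cartanEquivDual H).symm (wt (i : b.support).1)) := by
    conv_lhs => rw [← b.toWeightBasis.sum_repr μ]
    rw [map_sum, map_sum]
    refine Finset.sum_congr rfl fun i _ ↦ ?_
    rw [map_smul, map_smul, b.toWeightBasis_apply]
    rfl
  have key : (d - (s : ℂ) ^ 2) • w = ∑ i, b.toWeightBasis.repr μ i •
      (twoRho b ((cartanEquivDual H).symm (wt (i : b.support).1)) • w +
        (2 : ℂ) • ((T i).map (spec χ)).mulVec w) := by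
    rw [sub_smul, ← hw, casVal_eq, hs2, hrho, add_smul, Finset.sum_smul]
    simp only [smul_add, smul_smul, Finset.sum_add_distrib, mul_comm (2 : ℂ)]
    abel
  have hpos : 0 < ‖w‖ := norm_pos_iff.2 hw0
  refine le_of_mul_le_mul_right ?_ hpos
  rw [← norm_smul, key, Finset.sum_mul, Finset.sum_mul]
  refine (norm_sum_le _ _).trans (Finset.sum_le_sum fun i _ ↦ ?_)
  rw [norm_smul]
  have h1 : ‖twoRho b ((cartanEquivDual H).symm (wt (i : b.support).1)) • w +
        (2 : ℂ) • ((T i).map (spec χ)).mulVec w‖ ≤ c i * ‖w‖ := by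
    refine (norm_add_le _ _).trans ?_
    rw [norm_smul, norm_smul, add_mul]
    refine add_le_add le_rfl ?_
    have := Matrix.linfty_opNorm_mulVec ((T i).map (spec χ)) w
    have h2 : ‖(2 : ℂ)‖ = 2 := by simp
    rw [h2, mul_assoc]
    exact mul_le_mul_of_nonneg_left this (by norm_num)
  calc _ ≤ (K * s) * (c i * ‖w‖) :=
        mul_le_mul (ha i) h1 (norm_nonneg _) (mul_nonneg hK hs)
    _ = K * c i * s * ‖w‖ := by ring

universe u v

/-- The universal polynomial relation for the Casimir operator on tensor products. -/
theorem exists_casDiff_relation {L : Type u} [LieRing L] [LieAlgebra ℂ L] [FiniteDimensional ℂ L]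
    [IsKilling ℂ L] {H : LieSubalgebra ℂ L} [H.IsCartanSubalgebra] (b : (rootSystem H).Base)
    [Nontrivial L] : ∃ C : (ℕ → ℂ) → ℝ,
      ∀ (E : Type v) [AddCommGroup E] [Module ℂ E] [LieRingModule L E] [LieModule ℂ L E]
        [FiniteDimensional ℂ E], IsWeightModule H E (rootLattice H : Set (Module.Dual ℂ H)) →
        ∃ Q : (MvPolynomial ℕ ℂ)[X], polyEv L E Q = 0 ∧
          ∀ χ, NearSquares (C χ) (Q.map (spec χ)) := by
  obtain ⟨n, T, hT⟩ := exists_char_matrices b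
  choose C hC using nearSquares_charpoly (b := b) (T := T)
  refine ⟨C, fun E _ _ _ _ _ hE ↦ ?_⟩
  obtain ⟨d, e, μ, he⟩ := hE.exists_basis
  -- One characteristic polynomial for each weight in a weight basis of `E`. Its coefficients are
  -- polynomials in the central elements, so the product makes sense without any highest weight.
  refine ⟨∏ i, (eigenMatrix b T (μ i)).charpoly, ?_, fun χ ↦ ?_⟩
  -- By faithfulness the identity may be tested on finite dimensional modules with weights in the
  -- root lattice. These are generated by singular vectors, so it suffices to treat highest weight
  -- modules.
  · refine eq_zero_of_slice_eq_zero fun θ ↦ eq_zero_of_uact_eq_zero H (rootLattice H)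
      (isWeightModule_self b) _ fun Y _ _ _ _ _ hY ↦ uact_slice_eq_zero ?_ θ
    set t := polyEv L E (∏ i, (eigenMatrix b T (μ i)).charpoly) with ht
    have hv : ∀ (v : Y) (ν : Module.Dual ℂ H), IsSingular b v → IsWeightVector H ν v →
        ∀ w ∈ tensOf E (LieSubmodule.lieSpan ℂ L {v}).toSubmodule, tact E Y t w = 0 := by
      intro v ν hs hv w hw
      let χ : ℕ → ℂ := fun k ↦ LinearMap.trace ℂ L (charOp b ν k)
      have hz : ∀ k, ∀ y ∈ LieSubmodule.lieSpan ℂ L {v},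
          uact Y (zc L k) y - χ k • y ∈ (⊥ : LieSubmodule ℂ L Y) := by
        intro k y hy
        let S : LieSubmodule ℂ L Y :=
          { __ := LinearMap.eqLocus (uact Y (zc L k)) (χ k • LinearMap.id)
            lie_mem := fun {x y} hy ↦ by
              change uact Y (zc L k) ⁅x, y⁆ = χ k • ⁅x, y⁆
              have hy : uact Y (zc L k) y = χ k • y := hy
              rw [uact_zc_lie, hy, lie_smul] }
        have hS : LieSubmodule.lieSpan ℂ L {v} ≤ S := by
          rw [LieSubmodule.lieSpan_le, Set.singleton_subset_iff]
          exact uact_zc_singular hs hv k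
        have : uact Y (zc L k) y = χ k • y := hS hy
        rw [this, sub_self]
        exact zero_mem _
      have h1 := polyEv_sub_mem hz (∏ i, (eigenMatrix b T (μ i)).charpoly) hw
      rw [LieSubmodule.bot_toSubmodule, tensOf_bot, Submodule.mem_bot, sub_eq_zero, ← ht] at h1
      rw [h1]
      refine (casDiffKer_mono (L := L) ?_) (prod_casDiff_singular e μ (fun i ↦ (he i).2) hs hv hw)
      rw [Polynomial.map_prod]
      refine Finset.prod_dvd_prod_of_dvd _ _ fun i _ ↦ ?_
      rw [dvd_iff_isRoot]
      change ((eigenMatrix b T (μ i)).charpoly.map (spec χ)).IsRoot _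
      rw [← Matrix.charpoly_map, isRoot_charpoly_iff]
      obtain ⟨r, hr0, hr⟩ := hT ν
      -- The common eigenvector `r` of the specialized `T` shows that the eigenvalue of `casDiff` is
      -- a root of the specialized characteristic polynomial.
      refine ⟨r, fun h ↦ by rw [h] at hr0; simp at hr0, ?_⟩
      rw [eigenMatrix_map_mulVec, casVal_add_sub, add_smul, Finset.sum_smul]
      congr 1
      refine Finset.sum_congr rfl fun j _ ↦ ?_
      rw [mul_smul _ (ν _)]
      congr 1
      ext p
      rw [Pi.smul_apply, smul_eq_mul, hr j p]
      rfl
    let S : Submodule ℂ Y := ⨅ e : E, LinearMap.ker (tact E Y t ∘ₗ TensorProduct.mk ℂ E Y e)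
    have hle : (⨆ (v : {v : Y | ∃ ν, IsSingular b v ∧ IsWeightVector H ν v}),
        LieSubmodule.lieSpan ℂ L {v.1}).toSubmodule ≤ S := by
      rw [LieSubmodule.iSup_toSubmodule]
      refine iSup_le fun v y hy ↦ ?_
      obtain ⟨ν, hs, hw⟩ := v.2
      refine (Submodule.mem_iInf _).2 fun e ↦ ?_
      exact hv v.1 ν hs hw _ (tmul_mem_tensOf e hy)
    have htop : (⨆ (v : {v : Y | ∃ ν, IsSingular b v ∧ IsWeightVector H ν v}),
        LieSubmodule.lieSpan ℂ L {v.1}) = ⊤ := by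
      rw [eq_top_iff, ← lieSpan_singular_eq_top b hY, LieSubmodule.lieSpan_le]
      intro v hv
      exact le_iSup (fun v : {v : Y | ∃ ν, IsSingular b v ∧ IsWeightVector H ν v} ↦
        LieSubmodule.lieSpan ℂ L {v.1}) ⟨v, hv⟩ (LieSubmodule.subset_lieSpan rfl)
    rw [htop] at hle
    refine TensorProduct.ext' fun e y ↦ ?_
    exact (Submodule.mem_iInf _).1 (hle (x := y) trivial) e
  · rw [Polynomial.map_prod]
    exact nearSquares_prod _ fun i _ ↦ hC χ (μ i) (he i).1

/-- If the central elements act by scalars on the steps of a finite filtration of `M` then the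
Casimir difference on `E ⊗ M` satisfies polynomial equations with roots close to squares. -/
theorem exists_nearSquares_aeval {L : Type u} [LieRing L] [LieAlgebra ℂ L] [FiniteDimensional ℂ L]
    [IsKilling ℂ L] {H : LieSubalgebra ℂ L} [H.IsCartanSubalgebra] (b : (rootSystem H).Base)
    [Nontrivial L] {M : Type*} [AddCommGroup M] [Module ℂ M] [LieRingModule L M] [LieModule ℂ L M]
    {n : ℕ} (N : Fin (n + 1) → LieSubmodule ℂ L M) (h0 : N 0 = ⊥) (hn : N (Fin.last n) = ⊤)
    (hz : ∀ (i : Fin n) (k : ℕ), ∃ c : ℂ, ∀ m ∈ N i.succ,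
      uact M (zc L k) m - c • m ∈ N i.castSucc) :
    ∃ C : ℝ, 0 ≤ C ∧ ∀ (E : Type v) [AddCommGroup E] [Module ℂ E] [LieRingModule L E] [LieModule ℂ L E]
        [FiniteDimensional ℂ E], IsWeightModule H E (rootLattice H : Set (Module.Dual ℂ H)) →
        ∃ q : ℂ[X], NearSquares C q ∧ aeval (casDiff L E M) q = 0 := by
  obtain ⟨C, hC⟩ := exists_casDiff_relation.{u, v} b
  choose χ hχ using hz
  -- A single constant dominating those of all steps of the filtration.
  refine ⟨∑ i, |C (χ i)|, Finset.sum_nonneg fun _ _ ↦ abs_nonneg _, fun E _ _ _ _ _ hE ↦ ?_⟩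
  obtain ⟨Q, hQ, hQ'⟩ := hC E hE
  have key : ∀ i : Fin (n + 1), ∃ q : ℂ[X], NearSquares (∑ i, |C (χ i)|) q ∧
      ∀ w ∈ tensOf E (N i).toSubmodule, aeval (casDiff L E M) q w = 0 := by
    intro i
    induction i using Fin.induction with
    | zero =>
      refine ⟨1, nearSquares_one _, fun w hw ↦ ?_⟩
      rw [h0, LieSubmodule.bot_toSubmodule, tensOf_bot, Submodule.mem_bot] at hw
      rw [hw, map_zero]
    | succ i ih =>
      obtain ⟨q, hq, hqw⟩ := ih
      -- On the `i`-th step the universal relation specializes at `χ i` and sends `E ⊗ N i.succ`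
      -- into `E ⊗ N i.castSucc`; the polynomial found so far finishes.
      refine ⟨q * Q.map (spec (χ i)), hq.mul ((hQ' (χ i)).mono ((le_abs_self _).trans
        (Finset.single_le_sum (f := fun i ↦ |C (χ i)|) (fun _ _ ↦ abs_nonneg _)
          (Finset.mem_univ i)))), fun w hw ↦ ?_⟩
      have h1 := polyEv_sub_mem (fun k m hm ↦ hχ i k m hm) Q hw
      rw [hQ, map_zero, LinearMap.zero_apply, zero_sub, neg_mem_iff] at h1
      rw [map_mul, Module.End.mul_apply]
      exact hqw _ h1
  obtain ⟨q, hq, hqw⟩ := key (Fin.last n)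
  refine ⟨q, hq, LinearMap.ext fun w ↦ hqw w ?_⟩
  rw [hn, LieSubmodule.top_toSubmodule, tensOf_top]
  trivial

end CharPoly

end AffineKM

namespace AffineKM

/-! ### Semisimple modules over reductive Lie algebras -/

section Atoms

variable {F : Type*} [LieRing F] [LieAlgebra ℂ F]
  {X Y : Type*} [AddCommGroup X] [Module ℂ X] [LieRingModule F X] [LieModule ℂ F X]
  [AddCommGroup Y] [Module ℂ Y] [LieRingModule F Y] [LieModule ℂ F Y]

theorem isAtom_map (f : X →ₗ⁅ℂ,F⁆ Y) {A : LieSubmodule ℂ F X} (hA : IsAtom A) :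
    A.map f = ⊥ ∨ IsAtom (A.map f) := by
  by_cases h : A.map f = ⊥
  · exact Or.inl h
  · refine Or.inr ⟨h, fun B hB ↦ ?_⟩
    have hlt : A ⊓ B.comap f < A := by
      refine lt_of_le_of_ne inf_le_left fun h' ↦ hB.not_ge ?_
      rw [LieSubmodule.map_le_iff_le_comap]
      exact inf_eq_left.1 h'
    have h0 := hA.2 _ hlt
    rw [LieSubmodule.eq_bot_iff]
    intro y hy
    obtain ⟨x, hx, rfl⟩ := (LieSubmodule.mem_map _).1 (hB.le hy)
    have : x ∈ A ⊓ B.comap f := ⟨hx, hy⟩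
    rw [h0, LieSubmodule.mem_bot] at this
    rw [this, map_zero]

/-- A module which is the sum of its simple submodules of finite dimension. -/
def IsFinSemisimple (F X : Type*) [LieRing F] [LieAlgebra ℂ F] [AddCommGroup X] [Module ℂ X]
    [LieRingModule F X] [LieModule ℂ F X] : Prop :=
  sSup {A : LieSubmodule ℂ F X | IsAtom A ∧ FiniteDimensional ℂ A} = ⊤

theorem IsFinSemisimple.map_mem (h : IsFinSemisimple F X) (f : X →ₗ⁅ℂ,F⁆ Y) (x : X) :
    f x ∈ sSup {A : LieSubmodule ℂ F Y | IsAtom A ∧ FiniteDimensional ℂ A} := by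
  have h1 : (sSup {A : LieSubmodule ℂ F X | IsAtom A ∧ FiniteDimensional ℂ A}).map f ≤
      sSup {A : LieSubmodule ℂ F Y | IsAtom A ∧ FiniteDimensional ℂ A} := by
    rw [(LieSubmodule.gc_map_comap f).l_sSup]
    refine iSup₂_le fun A hA ↦ ?_
    rcases isAtom_map f hA.1 with h | h
    · rw [h]; exact bot_le
    · have := hA.2
      exact le_sSup ⟨h, inferInstanceAs
        (FiniteDimensional ℂ (A.toSubmodule.map (f : X →ₗ[ℂ] Y)))⟩
  have h' : sSup {A : LieSubmodule ℂ F X | IsAtom A ∧ FiniteDimensional ℂ A} = ⊤ := h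
  rw [h'] at h1
  exact h1 ((LieSubmodule.mem_map _).2 ⟨x, trivial, rfl⟩)

theorem IsFinSemisimple.complementedLattice (h : IsFinSemisimple F X) :
    ComplementedLattice (LieSubmodule ℂ F X) := by
  refine complementedLattice_of_sSup_atoms_eq_top ?_
  have h' : sSup {A : LieSubmodule ℂ F X | IsAtom A ∧ FiniteDimensional ℂ A} = ⊤ := h
  rw [eq_top_iff, ← h']
  exact sSup_le_sSup fun A hA ↦ hA.1

theorem isFinSemisimple_of_complementedLattice [FiniteDimensional ℂ X]
    [ComplementedLattice (LieSubmodule ℂ F X)] : IsFinSemisimple F X := by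
  have := isAtomistic_of_complementedLattice (α := LieSubmodule ℂ F X)
  rw [IsFinSemisimple, eq_top_iff, ← sSup_atoms_eq_top]
  exact sSup_le_sSup fun A hA ↦ ⟨hA, inferInstance⟩

theorem isIrreducible_of_isAtom {A : LieSubmodule ℂ F X} (hA : IsAtom A) :
    LieModule.IsIrreducible ℂ F A := by
  have : Nontrivial A := by
    rw [LieSubmodule.nontrivial_iff_ne_bot]
    exact hA.1
  refine { eq_bot_or_eq_top := fun N ↦ ?_ }
  have hle : N.map A.incl ≤ A := by
    rintro _ ⟨x, -, rfl⟩
    exact x.2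
  rcases hA.le_iff.1 hle with h | h
  · left
    rw [LieSubmodule.eq_bot_iff]
    intro x hx
    have : A.incl x ∈ N.map A.incl := (LieSubmodule.mem_map _).2 ⟨x, hx, rfl⟩
    rw [h, LieSubmodule.mem_bot] at this
    exact Subtype.ext this
  · right
    rw [eq_top_iff]
    intro x _
    have hx : (x : X) ∈ N.map A.incl := by rw [h]; exact x.2
    obtain ⟨y, hy, hyx⟩ := (LieSubmodule.mem_map _).1 hx
    have : y = x := Subtype.ext hyx
    rwa [← this]

theorem isAtom_of_isIrreducible {N : LieSubmodule ℂ F X} [LieModule.IsIrreducible ℂ F N] :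
    IsAtom N := by
  have h : IsAtom (⊤ : LieSubmodule ℂ F N) := isAtom_top
  have h2 : (⊤ : LieSubmodule ℂ F N).map N.incl = N := by
    rw [LieSubmodule.map_incl_top]
  rcases isAtom_map N.incl h with h1 | h1
  · exfalso
    refine h.1 (LieSubmodule.eq_bot_iff _ |>.2 fun x hx ↦ ?_)
    have : N.incl x ∈ (⊤ : LieSubmodule ℂ F N).map N.incl := (LieSubmodule.mem_map _).2 ⟨x, hx, rfl⟩
    rw [h1, LieSubmodule.mem_bot] at this
    exact Subtype.ext this
  · rwa [h2] at h1

end Atoms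

/-! ### Weight vectors for a semisimple algebra extended by a central ideal. -/

section Toral

open LieAlgebra LieAlgebra.IsKilling LieModule

variable {F S : Type*} [LieRing F] [LieAlgebra ℂ F] [LieRing S] [LieAlgebra ℂ S]

/-- The Lie algebra `F` is the direct sum of `S` and of a central ideal. -/
structure IsSplit (i : S →ₗ⁅ℂ⁆ F) (p : F →ₗ⁅ℂ⁆ S) : Prop where
  proj_incl : ∀ s, p (i s) = s
  central : ∀ x y : F, ⁅x - i (p x), y⁆ = 0

variable {i : S →ₗ⁅ℂ⁆ F} {p : F →ₗ⁅ℂ⁆ S} (H : LieSubalgebra ℂ S)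

theorem IsSplit.lie_eq (hp : IsSplit i p) (x y : F) : ⁅x, y⁆ = ⁅i (p x), y⁆ := by
  have := hp.central x y
  rwa [sub_lie, sub_eq_zero] at this

theorem IsSplit.isLieAbelian_comap (hp : IsSplit i p) [IsLieAbelian H] :
    IsLieAbelian (H.comap p) := by
  refine ⟨fun x y ↦ Subtype.ext ?_⟩
  change ⁅(x : F), (y : F)⁆ = 0
  rw [hp.lie_eq, ← lie_skew, hp.lie_eq, ← LieHom.map_lie]
  have := congrArg Subtype.val (trivial_lie_zero H H ⟨p y, y.2⟩ ⟨p x, x.2⟩)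
  change ⁅p y, p x⁆ = 0 at this
  rw [this, map_zero, neg_zero]

variable (p) in
/-- The projection of the extended Cartan subalgebra. -/
def comapProj : H.comap p →ₗ[ℂ] H where
  toFun t := ⟨p t, t.2⟩
  map_add' s t := Subtype.ext (map_add p (s : F) t)
  map_smul' c t := Subtype.ext (map_smul p c (t : F))

variable [FiniteDimensional ℂ S] [IsKilling ℂ S]

theorem IsSplit.isWeightModule_comap_self (hp : IsSplit i p) [H.IsCartanSubalgebra] :
    IsWeightModule (H.comap p) F (((⊤ : AddSubgroup (Module.Dual ℂ (H.comap p))) : Set _)) := by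
  obtain ⟨b⟩ := RootPairing.nonempty_base (rootSystem H)
  rw [IsWeightModule, eq_top_iff]
  intro x _
  rw [← sub_add_cancel x (i (p x))]
  refine add_mem (Submodule.subset_span ⟨0, trivial, fun t ↦ ?_⟩) ?_
  · rw [← lie_skew, hp.central, neg_zero, LinearMap.zero_apply, zero_smul]
  · have hx : p x ∈ Submodule.span ℂ {e : S | ∃ μ ∈ (rootLattice H : Set (Module.Dual ℂ H)),
        IsWeightVector H μ e} := by
      rw [isWeightModule_self b]
      trivial
    generalize p x = s at hx
    induction hx using Submodule.span_induction with
    | zero => simp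
    | add s t _ _ hs ht => rw [map_add]; exact add_mem hs ht
    | smul c s _ hs => rw [map_smul]; exact Submodule.smul_mem _ _ hs
    | mem s hs =>
      obtain ⟨μ, -, hs⟩ := hs
      refine Submodule.subset_span ⟨μ ∘ₗ comapProj p H, trivial, fun t ↦ ?_⟩
      rw [hp.lie_eq, ← LieHom.map_lie]
      have := hs (comapProj p H t)
      change ⁅p (t : F), s⁆ = _ at this
      rw [this, map_smul]
      rfl

variable {X : Type*} [AddCommGroup X] [Module ℂ X] [LieRingModule F X] [LieModule ℂ F X]

/-- Simple modules of finite dimension are spanned by weight vectors. -/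
theorem IsSplit.isWeightModule_of_isIrreducible (hp : IsSplit i p) [FiniteDimensional ℂ F]
    [H.IsCartanSubalgebra] [LieModule.IsIrreducible ℂ F X] [FiniteDimensional ℂ X] :
    IsWeightModule (H.comap p) X (((⊤ : AddSubgroup (Module.Dual ℂ (H.comap p))) : Set _)) := by
  set T := H.comap p
  have : IsLieAbelian T := hp.isLieAbelian_comap H
  have hnt : Nontrivial X := by
    have : Nontrivial (LieSubmodule ℂ F X) := inferInstance
    exact (LieSubmodule.nontrivial_iff ℂ F X).1 this
  obtain ⟨χ, hχ⟩ := exists_nontrivial_weightSpace_of_isSolvable ℂ T X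
  obtain ⟨x, hx⟩ := exists_ne (0 : weightSpace X χ)
  have hxw : ∀ t : T, ⁅(t : F), (x : X)⁆ = χ t • (x : X) := fun t ↦
    (mem_weightSpace (⇑χ) (x : X)).1 x.2 t
  -- The span of the weight vectors is a submodule, since the Lie algebra is itself spanned by
  -- weight vectors. It is nonzero because an abelian algebra has a common eigenvector in finite
  -- dimension; simplicity does the rest.
  let N : Submodule ℂ X := Submodule.span ℂ {x : X |
    ∃ μ ∈ ((⊤ : AddSubgroup (Module.Dual ℂ T)) : Set _), IsWeightVector T μ x}
  let N' : LieSubmodule ℂ F X :=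
    { __ := N
      lie_mem := fun {a y} hy ↦ by
        change ⁅a, y⁆ ∈ N
        replace hy : y ∈ N := hy
        have ha : a ∈ Submodule.span ℂ {x : F | ∃ μ ∈ ((⊤ : AddSubgroup (Module.Dual ℂ T)) : Set _),
            IsWeightVector T μ x} := by
          rw [hp.isWeightModule_comap_self H]
          trivial
        induction ha using Submodule.span_induction with
        | zero => simp
        | add a b _ _ ha hb => rw [add_lie]; exact add_mem ha hb
        | smul c a _ ha => rw [smul_lie]; exact Submodule.smul_mem _ _ ha
        | mem a ha =>
          obtain ⟨μ, -, ha⟩ := ha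
          induction hy using Submodule.span_induction with
          | zero => simp
          | add a b _ _ ha hb => rw [lie_add]; exact add_mem ha hb
          | smul c a _ ha => rw [lie_smul]; exact Submodule.smul_mem _ _ ha
          | mem y hy =>
            obtain ⟨ν, -, hy⟩ := hy
            refine Submodule.subset_span ⟨μ + ν, trivial, fun t ↦ ?_⟩
            rw [leibniz_lie, ha, hy, smul_lie, lie_smul, LinearMap.add_apply, add_smul] }
  rcases eq_bot_or_eq_top N' with h | h
  · exfalso
    have : (x : X) ∈ N' := Submodule.subset_span ⟨χ, trivial, hxw⟩
    rw [h, LieSubmodule.mem_bot] at this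
    exact hx (Subtype.ext this)
  · exact congrArg LieSubmodule.toSubmodule h

variable (p) in
/-- The submodule on which the centre acts through the weight `χ`. -/
def centralPart (χ : Module.Dual ℂ (H.comap p)) : LieSubmodule ℂ F X where
  carrier := {y | ∀ t : H.comap p, p t = 0 → (∀ x : F, ⁅(t : F), x⁆ = 0) → ⁅(t : F), y⁆ = χ t • y}
  add_mem' {y z} hy hz t h h' := by rw [lie_add, hy t h h', hz t h h', smul_add]
  zero_mem' := fun t _ _ ↦ by rw [lie_zero, smul_zero]
  smul_mem' := fun c y hy t h h' ↦ by rw [lie_smul, hy t h h', smul_comm]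
  lie_mem {a y} hy t h h' := by
    rw [leibniz_lie, h', zero_lie, zero_add, hy t h h', lie_smul]

variable {H} in
theorem IsWeightVector.mem_centralPart {χ : Module.Dual ℂ (H.comap p)} {x : X}
    (hx : IsWeightVector (H.comap p) χ x) : x ∈ centralPart p H (X := X) χ := fun t _ _ ↦ hx t

theorem span_weight_submodule {L : Type*} [LieRing L] [LieAlgebra ℂ L] {T : LieSubalgebra ℂ L}
    {X : Type*} [AddCommGroup X] [Module ℂ X] [LieRingModule L X] [LieModule ℂ L X]
    {Λ : Set (Module.Dual ℂ T)}
    (hX : IsWeightModule T X Λ) (N : Submodule ℂ X) (hN : ∀ t : T, ∀ y ∈ N, ⁅(t : L), y⁆ ∈ N) :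
    N ≤ Submodule.span ℂ {x | x ∈ N ∧ ∃ μ ∈ Λ, IsWeightVector T μ x} := by
  intro y hy
  have hy' : y ∈ Submodule.span ℂ {e : X | ∃ μ ∈ Λ, IsWeightVector T μ e} := by
    rw [hX]; trivial
  obtain ⟨s, x, h1, h2, rfl⟩ := exists_weight_sum hy'
  have := weight_component_mem hN s x (fun μ _ ↦ h2 μ) hy
  exact Submodule.sum_mem _ fun μ hμ ↦ Submodule.subset_span ⟨this μ hμ, μ, h1 μ hμ, h2 μ⟩

/-- Modules of finite dimension spanned by weight vectors are semisimple. -/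
theorem IsSplit.isFinSemisimple (hp : IsSplit i p) [FiniteDimensional ℂ X] [H.IsCartanSubalgebra]
    (hX : IsWeightModule (H.comap p) X (((⊤ : AddSubgroup (Module.Dual ℂ (H.comap p))) : Set _))) :
    IsFinSemisimple F X := by
  obtain ⟨b⟩ := RootPairing.nonempty_base (rootSystem H)
  set T := H.comap p
  -- On this part the central summand acts by scalars, so the submodules over `F` and over `S` are
  -- the same and complete reducibility over the semisimple `S` applies. Every weight vector lies in
  -- one of these parts.
  have key : ∀ χ : Module.Dual ℂ T,
      IsFinSemisimple F (centralPart p H (X := X) χ) := by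
    intro χ
    set N := centralPart p H (X := X) χ
    have hcen : ∀ (x : F) (y : N), ⁅x - i (p x), y⁆ ∈ ℂ ∙ y := by
      intro x y
      have h0 : p (x - i (p x)) = 0 := by rw [map_sub, hp.proj_incl, sub_self]
      let t : T := ⟨x - i (p x), by
        change p (x - i (p x)) ∈ H
        rw [h0]; exact zero_mem _⟩
      refine Submodule.mem_span_singleton.2 ⟨χ t, Subtype.ext ?_⟩
      exact (y.2 t h0 (hp.central x)).symm
    let e : LieSubmodule ℂ S (Pullback i N) ≃o LieSubmodule ℂ F N :=
      { toFun := fun Q ↦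
          { __ := Q.toSubmodule
            lie_mem := fun {x y} hy ↦ by
              have h1 : ⁅x, y⁆ = ⁅i (p x), y⁆ + ⁅x - i (p x), y⁆ := by rw [sub_lie]; abel
              rw [h1]
              refine Q.toSubmodule.add_mem (Q.lie_mem (x := p x) hy) ?_
              obtain ⟨c, hc⟩ := Submodule.mem_span_singleton.1 (hcen x y)
              rw [← hc]
              exact Q.toSubmodule.smul_mem c hy }
        invFun := fun Q ↦
          { __ := Q.toSubmodule
            lie_mem := fun {x y} hy ↦ Q.lie_mem (x := i x) hy }
        left_inv := fun Q ↦ rfl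
        right_inv := fun Q ↦ rfl
        map_rel_iff' := Iff.rfl }
    have hfin : FiniteDimensional ℂ (Pullback i N) := inferInstanceAs (FiniteDimensional ℂ N)
    have hw : IsWeightModule H (Pullback i N) (Set.univ : Set (Module.Dual ℂ H)) := by
      rw [IsWeightModule, eq_top_iff]
      have h1 := span_weight_submodule hX N.toSubmodule (fun t y hy ↦ N.lie_mem hy)
      intro y _
      have h2 : ∀ x ∈ Submodule.span ℂ {x | x ∈ N.toSubmodule ∧
          ∃ μ ∈ ((⊤ : AddSubgroup (Module.Dual ℂ T)) : Set _), IsWeightVector T μ x},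
          ∃ z ∈ Submodule.span ℂ {e : Pullback i N | ∃ μ ∈ Set.univ, IsWeightVector H μ e},
            (z : N).1 = x := by
        intro x hx
        induction hx using Submodule.span_induction with
        | zero => exact ⟨0, zero_mem _, rfl⟩
        | add x y _ _ hx hy =>
          obtain ⟨z, hz, rfl⟩ := hx
          obtain ⟨w, hw, rfl⟩ := hy
          exact ⟨z + w, add_mem hz hw, rfl⟩
        | smul c x _ hx =>
          obtain ⟨z, hz, rfl⟩ := hx
          exact ⟨c • z, Submodule.smul_mem _ _ hz, rfl⟩
        | mem x hx =>
          obtain ⟨hx, μ, -, hxμ⟩ := hx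
          let j : H →ₗ[ℂ] T :=
            { toFun := fun h ↦ ⟨i h, by
                change p (i h) ∈ H
                rw [hp.proj_incl]; exact h.2⟩
              map_add' := fun a b ↦ Subtype.ext (map_add i (a : S) b)
              map_smul' := fun c a ↦ Subtype.ext (map_smul i c (a : S)) }
          refine ⟨(⟨x, hx⟩ : N), Submodule.subset_span ⟨μ ∘ₗ j, trivial, fun h ↦ Subtype.ext ?_⟩, rfl⟩
          exact hxμ (j h)
      obtain ⟨z, hz, hzy⟩ := h2 _ (h1 y.2)
      have : z = y := Subtype.ext hzy
      rwa [this] at hz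
    have hS := IsWeightModule.sSup_atoms_eq_top b hw
    have := complementedLattice_of_sSup_atoms_eq_top hS
    have := e.complementedLattice
    exact isFinSemisimple_of_complementedLattice
  rw [IsFinSemisimple, eq_top_iff, ← LieSubmodule.toSubmodule_le_toSubmodule, LieSubmodule.top_toSubmodule, ← hX,
    Submodule.span_le]
  rintro x ⟨χ, -, hx⟩
  exact (key χ).map_mem (centralPart p H (X := X) χ).incl ⟨x, hx.mem_centralPart⟩

end Toral

/-! ### Splitting of reductive Lie algebras and semisimplicity of tensor products. -/

section Reductive

open LieAlgebra LieModule

variable {F : Type*} [LieRing F] [LieAlgebra ℂ F] [FiniteDimensional ℂ F]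

/-- A Lie algebra whose adjoint representation is semisimple is the sum of its centre and of a
semisimple ideal. -/
theorem exists_split_of_complementedLattice [ComplementedLattice (LieIdeal ℂ F)] :
    ∃ (S : LieIdeal ℂ F) (p : F →ₗ⁅ℂ⁆ S), IsKilling ℂ S ∧ IsSplit S.incl p := by
  obtain ⟨S, hS⟩ := exists_isCompl (center ℂ F)
  have hS' : IsCompl S.toSubmodule (center ℂ F).toSubmodule :=
    LieSubmodule.isCompl_toSubmodule.2 hS.symm
  let q : F →ₗ[ℂ] S := Submodule.projectionOnto _ _ hS'
  have hq : ∀ x, x - q x ∈ center ℂ F := by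
    intro x
    have : q (x - q x) = 0 := by
      rw [map_sub, sub_eq_zero]
      exact (Submodule.projectionOnto_apply_left hS' (q x)).symm
    exact (Submodule.projectionOnto_apply_eq_zero_iff hS').1 this
  have hcen : ∀ z ∈ center ℂ F, ∀ y : F, ⁅z, y⁆ = 0 := by
    intro z hz y
    rw [← lie_skew, (mem_maxTrivSubmodule ℂ F F z).1 hz y, neg_zero]
  -- Brackets ignore central components, so the projection along the centre is a homomorphism of Lie
  -- algebras.
  have hsplit : ∀ x y : F, ⁅x, y⁆ = ⁅(q x : F), (q y : F)⁆ := by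
    intro x y
    have h1 := hcen _ (hq x) y
    have h2 := (mem_maxTrivSubmodule ℂ F F _).1 (hq y) (q x)
    rw [sub_lie, sub_eq_zero] at h1
    rw [lie_sub, sub_eq_zero] at h2
    rw [h1, h2]
  let p : F →ₗ⁅ℂ⁆ S :=
    { __ := q
      map_lie' := fun {x y} ↦ by
        change q ⁅x, y⁆ = ⁅q x, q y⁆
        rw [hsplit x y]
        exact Submodule.projectionOnto_apply_left hS' ⁅q x, q y⁆ }
  refine ⟨S, p, ?_, fun s ↦ Submodule.projectionOnto_apply_left hS' s, fun x ↦ hcen _ (hq x)⟩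
  have : HasTrivialRadical ℂ S := by
    rw [hasTrivialRadical_iff_no_abelian_ideals]
    intro I hI
    let J : LieIdeal ℂ F :=
      { __ := I.toSubmodule.map S.toSubmodule.subtype
        lie_mem := by
          rintro x _ ⟨y, hy, rfl⟩
          refine ⟨⁅q x, y⁆, I.lie_mem hy, ?_⟩
          change ⁅(q x : F), (y : F)⁆ = ⁅x, (y : F)⁆
          have := hcen _ (hq x) y
          rw [sub_lie, sub_eq_zero] at this
          exact this.symm }
    obtain ⟨J', hJ⟩ := exists_isCompl J
    rw [LieSubmodule.eq_bot_iff]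
    intro y hy
    have hyJ : (y : F) ∈ J := ⟨y, hy, rfl⟩
    -- An abelian ideal of `S` is an ideal `J` of `F`. It commutes with itself and with a
    -- complementary ideal, so it is central; and `S` meets the centre trivially.
    have hyc : (y : F) ∈ center ℂ F := by
      rw [mem_maxTrivSubmodule]
      intro x
      have hx : x ∈ J ⊔ J' := by rw [hJ.sup_eq_top]; trivial
      obtain ⟨a, ha, c, hc, rfl⟩ := (LieSubmodule.mem_sup _ _ _).1 hx
      obtain ⟨a, ha, rfl⟩ := ha
      have h1 : ⁅(a : F), (y : F)⁆ = 0 := by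
        have := congrArg Subtype.val (trivial_lie_zero I I ⟨a, ha⟩ ⟨y, hy⟩)
        exact congrArg Subtype.val this
      have h2 : ⁅c, (y : F)⁆ ∈ J ⊓ J' := by
        refine ⟨J.lie_mem hyJ, ?_⟩
        rw [← lie_skew]
        exact neg_mem (J'.lie_mem hc)
      rw [hJ.inf_eq_bot, LieSubmodule.mem_bot] at h2
      rw [add_lie, h2, add_zero]
      exact h1
    have : (y : F) ∈ center ℂ F ⊓ S := ⟨hyc, y.2⟩
    rw [hS.inf_eq_bot, LieSubmodule.mem_bot] at this
    exact Subtype.ext this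
  infer_instance

variable {X E : Type*} [AddCommGroup X] [Module ℂ X] [LieRingModule F X] [LieModule ℂ F X]
  [AddCommGroup E] [Module ℂ E] [LieRingModule F E] [LieModule ℂ F E]

/-- Tensor products of semisimple modules over reductive Lie algebras are semisimple. -/
theorem IsFinSemisimple.tensor [ComplementedLattice (LieIdeal ℂ F)] [FiniteDimensional ℂ E]
    (hE : IsFinSemisimple F E) (hX : IsFinSemisimple F X) : IsFinSemisimple F (E ⊗[ℂ] X) := by
  obtain ⟨S, p, hS, hp⟩ := exists_split_of_complementedLattice (F := F)
  obtain ⟨x, hx⟩ := exists_isCartanSubalgebra_engel (K := ℂ) (L := S)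
  set H := LieSubalgebra.engel ℂ x
  set T := H.comap p
  -- Weight vectors span `E` and every simple finite dimensional submodule of `X`, hence also their
  -- tensor products, and finite dimensional modules spanned by weight vectors are semisimple.
  have hEw : IsWeightModule T E ((⊤ : AddSubgroup (Module.Dual ℂ T)) : Set _) := by
    rw [IsWeightModule, eq_top_iff]
    have h1 : sSup {A : LieSubmodule ℂ F E | IsAtom A ∧ FiniteDimensional ℂ A} = ⊤ := hE
    rw [← LieSubmodule.top_toSubmodule (R := ℂ) (L := F), ← h1, LieSubmodule.sSup_toSubmodule]
    refine sSup_le ?_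
    rintro _ ⟨A, ⟨hA, hAf⟩, rfl⟩ e he
    have := isIrreducible_of_isAtom hA
    have hAw : (⟨e, he⟩ : A) ∈ Submodule.span ℂ {x : A |
        ∃ μ ∈ ((⊤ : AddSubgroup (Module.Dual ℂ T)) : Set _), IsWeightVector T μ x} := by
      rw [hp.isWeightModule_of_isIrreducible H]
      trivial
    have h2 := Submodule.mem_map_of_mem (f := A.toSubmodule.subtype) hAw
    rw [Submodule.map_span] at h2
    refine Submodule.span_mono ?_ h2
    rintro _ ⟨a, ⟨μ, hμ, ha⟩, rfl⟩
    exact ⟨μ, hμ, fun t ↦ congrArg Subtype.val (ha t)⟩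
  have key : ∀ (e : E) (A : LieSubmodule ℂ F X), IsAtom A → FiniteDimensional ℂ A → ∀ x ∈ A,
      e ⊗ₜ[ℂ] x ∈ sSup {A : LieSubmodule ℂ F (E ⊗[ℂ] X) | IsAtom A ∧ FiniteDimensional ℂ A} := by
    intro e A hA hAf x hx
    have := isIrreducible_of_isAtom hA
    have hT := hp.isFinSemisimple H (hEw.tensor (hp.isWeightModule_of_isIrreducible H (X := A)))
    exact hT.map_mem (TensorProduct.LieModule.map LieModuleHom.id A.incl) (e ⊗ₜ ⟨x, hx⟩)
  rw [IsFinSemisimple, eq_top_iff]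
  intro w _
  induction w using TensorProduct.induction_on with
  | zero => exact zero_mem _
  | add a b ha hb => exact add_mem (ha trivial) (hb trivial)
  | tmul e x =>
    let N : Submodule ℂ X := (sSup {A : LieSubmodule ℂ F (E ⊗[ℂ] X) |
      IsAtom A ∧ FiniteDimensional ℂ A}).toSubmodule.comap (TensorProduct.mk ℂ E X e)
    have hN : (⊤ : Submodule ℂ X) ≤ N := by
      have h1 : sSup {A : LieSubmodule ℂ F X | IsAtom A ∧ FiniteDimensional ℂ A} = ⊤ := hX
      rw [← LieSubmodule.top_toSubmodule (R := ℂ) (L := F), ← h1, LieSubmodule.sSup_toSubmodule]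
      refine sSup_le ?_
      rintro _ ⟨A, hA, rfl⟩ x hx
      exact key e A hA.1 hA.2 x hx
    exact hN (x := x) trivial

/-- A subalgebra which is reductive in a Lie algebra is itself a semisimple module. -/
theorem IsReductiveIn.complementedLattice {L : Type*} [LieRing L] [LieAlgebra ℂ L]
    {F : LieSubalgebra ℂ L} (h : IsReductiveIn F) : ComplementedLattice (LieIdeal ℂ F) := by
  refine ⟨fun I ↦ ?_⟩
  obtain ⟨B, hB⟩ := h.exists_isCompl (LieSubmodule.map F.incl' I)
  refine ⟨B.comap F.incl', ?_⟩
  rw [isCompl_iff, disjoint_iff, codisjoint_iff, LieSubmodule.eq_bot_iff, eq_top_iff]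
  constructor
  · rintro x ⟨hx, hx'⟩
    have : (x : L) ∈ LieSubmodule.map F.incl' I ⊓ B := ⟨(LieSubmodule.mem_map _).2 ⟨x, hx, rfl⟩, hx'⟩
    rw [hB.inf_eq_bot, LieSubmodule.mem_bot] at this
    exact Subtype.ext this
  · intro x _
    have hx : (x : L) ∈ LieSubmodule.map F.incl' I ⊔ B := by rw [hB.sup_eq_top]; trivial
    obtain ⟨a, ha, c, hc, hac⟩ := (LieSubmodule.mem_sup _ _ _).1 hx
    obtain ⟨a, ha', rfl⟩ := (LieSubmodule.mem_map _).1 ha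
    refine (LieSubmodule.mem_sup _ _ _).2 ⟨a, ha', x - a, ?_, add_sub_cancel _ _⟩
    change (x : L) - (a : L) ∈ B
    rw [← hac]
    change (a : L) + c - (a : L) ∈ B
    rwa [add_sub_cancel_left]

end Reductive

end AffineKM

namespace AffineKM

/-! ### Homomorphisms of semisimple modules -/

section Homs

variable {F : Type*} [LieRing F] [LieAlgebra ℂ F]
  {X : Type*} [AddCommGroup X] [Module ℂ X] [LieRingModule F X] [LieModule ℂ F X]

/-- The projection on `N` along a complement `N'`. -/
def lieProj {N N' : LieSubmodule ℂ F X} (h : IsCompl N N') : X →ₗ⁅ℂ,F⁆ N where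
  __ := Submodule.projectionOnto _ _ (LieSubmodule.isCompl_toSubmodule.2 h)
  map_lie' := by
    intro a x
    let q : X →ₗ[ℂ] N := Submodule.projectionOnto _ _ (LieSubmodule.isCompl_toSubmodule.2 h)
    change q ⁅a, x⁆ = ⁅a, q x⁆
    have h1 : q (x - q x) = 0 := by
      rw [map_sub, sub_eq_zero]
      exact (Submodule.projectionOnto_apply_left _ (q x)).symm
    have h2 : x - q x ∈ N' := (Submodule.projectionOnto_apply_eq_zero_iff _).1 h1
    have h3 : q ⁅a, x - (q x : X)⁆ = 0 :=
      (Submodule.projectionOnto_apply_eq_zero_iff _).2 (N'.lie_mem h2)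
    rw [lie_sub, map_sub, sub_eq_zero] at h3
    rw [h3]
    exact Submodule.projectionOnto_apply_left _ (⁅a, q x⁆ : N)

theorem lieProj_of_mem {N N' : LieSubmodule ℂ F X} (h : IsCompl N N') {x : X} (hx : x ∈ N) :
    (lieProj h x : X) = x :=
  congrArg Subtype.val
    (Submodule.projectionOnto_apply_left (LieSubmodule.isCompl_toSubmodule.2 h) ⟨x, hx⟩)

theorem lieProj_eq_zero {N N' : LieSubmodule ℂ F X} (h : IsCompl N N') {x : X} :
    lieProj h x = 0 ↔ x ∈ N' :=
  Submodule.projectionOnto_apply_eq_zero_iff (LieSubmodule.isCompl_toSubmodule.2 h)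

/-- Endomorphisms of semisimple modules are von Neumann regular. -/
theorem exists_regular [ComplementedLattice (LieSubmodule ℂ F X)] (ψ : X →ₗ⁅ℂ,F⁆ X) :
    ∃ χ : X →ₗ⁅ℂ,F⁆ X, ∀ x, ψ (χ (ψ x)) = ψ x := by
  -- The endomorphism sought projects onto the range of `ψ` and then inverts `ψ` on a complement of
  -- its kernel.
  obtain ⟨A, hA⟩ := exists_isCompl ψ.ker
  obtain ⟨R, hR⟩ := exists_isCompl ψ.range
  have hinj : Function.Injective ((ψ : X →ₗ[ℂ] X) ∘ₗ A.toSubmodule.subtype) := by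
    rw [← LinearMap.ker_eq_bot, LinearMap.ker_eq_bot']
    intro a ha
    have : (a : X) ∈ ψ.ker ⊓ A := ⟨ha, a.2⟩
    rw [hA.inf_eq_bot, LieSubmodule.mem_bot] at this
    exact Subtype.ext this
  have hsurj : ∀ r : ψ.range, ∃ a : A, ψ a = (r : X) := by
    rintro ⟨r, hr⟩
    obtain ⟨x, rfl⟩ := (LieModuleHom.mem_range _ _).1 hr
    have hx : x ∈ ψ.ker ⊔ A := by rw [hA.sup_eq_top]; trivial
    obtain ⟨k, hk, a, ha, rfl⟩ := (LieSubmodule.mem_sup _ _ _).1 hx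
    refine ⟨⟨a, ha⟩, ?_⟩
    change ψ a = ψ (k + a)
    rw [map_add, show ψ k = 0 from hk, zero_add]
  choose g hg using hsurj
  have hg' : ∀ (r : ψ.range) (a : A), ψ (a : X) = (r : X) → g r = a := fun r a h ↦
    hinj ((hg r).trans h.symm)
  let G : ψ.range →ₗ⁅ℂ,F⁆ X :=
    { toFun := fun r : ψ.range ↦ (g r : X)
      map_add' := fun r s ↦ congrArg Subtype.val (hg' (r + s) (g r + g s) (by
        change ψ ((g r : X) + g s) = (r : X) + s
        rw [map_add, hg, hg]))
      map_smul' := fun c r ↦ congrArg Subtype.val (hg' (c • r) (c • g r) (by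
        change ψ (c • (g r : X)) = c • (r : X)
        rw [map_smul, hg]))
      map_lie' := fun {a r} ↦ congrArg Subtype.val (hg' ⁅a, r⁆ ⁅a, g r⁆ (by
        change ψ ⁅a, (g r : X)⁆ = ⁅a, (r : X)⁆
        rw [LieModuleHom.map_lie, hg])) }
  refine ⟨G.comp (lieProj hR), fun x ↦ ?_⟩
  change ψ (g (lieProj hR (ψ x)) : X) = ψ x
  rw [hg, lieProj_of_mem hR ((LieModuleHom.mem_range _ _).2 ⟨x, rfl⟩)]

/-- A fully invariant submodule of a semisimple module is a direct factor for all
endomorphisms. -/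
theorem lieProj_comm [ComplementedLattice (LieSubmodule ℂ F X)] {S S' : LieSubmodule ℂ F X}
    (h : IsCompl S S') (hS : ∀ φ : X →ₗ⁅ℂ,F⁆ X, ∀ x ∈ S, φ x ∈ S) (φ : X →ₗ⁅ℂ,F⁆ X) (x : X) :
    (lieProj h (φ x) : X) = φ (lieProj h x) := by
  have hx : x - lieProj h x ∈ S' := by
    rw [← lieProj_eq_zero h, map_sub, sub_eq_zero]
    exact Subtype.ext (lieProj_of_mem h (lieProj h x).2).symm
  -- With `P` the projection on `S`, the endomorphism `ψ = P φ (1 - P)` kills `S`. By regularity `ψ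
  -- = ψ χ ψ`, but `χ ψ` takes values in the fully invariant `S`, so `ψ = 0`.
  have key : ∀ y ∈ S', lieProj h (φ y) = 0 := by
    intro y hy
    let P : X →ₗ⁅ℂ,F⁆ X := S.incl.comp (lieProj h)
    let ψ : X →ₗ⁅ℂ,F⁆ X := P.comp (φ.comp (LieModuleHom.id - P))
    have hψ : ∀ z, ψ z = (lieProj h (φ (z - lieProj h z)) : X) := fun z ↦ rfl
    obtain ⟨χ, hχ⟩ := exists_regular ψ
    have h1 : ψ y = (lieProj h (φ y) : X) := by
      rw [hψ, (lieProj_eq_zero h).2 hy]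
      simp
    have h2 : ψ (χ (ψ y)) = 0 := by
      have h3 : χ (ψ y) ∈ S := hS χ _ (by rw [hψ]; exact (lieProj h _).2)
      rw [hψ, lieProj_of_mem h h3]
      simp
    rw [hχ, h1] at h2
    exact Subtype.ext h2
  have h4 := key _ hx
  rw [map_sub, map_sub, sub_eq_zero] at h4
  rw [h4, lieProj_of_mem h (hS φ _ (lieProj h x).2)]

open LinearMap Module in
/-- Bicommutant property: if the homomorphic images of a submodule of finite dimension stay in a
subspace of finite dimension, then a locally finite space `W` of functionals contains the locally
finite functionals which vanish on the annihilator of `W`. -/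
theorem mem_of_vanish [ComplementedLattice (LieSubmodule ℂ F X)]
    (hfin : ∀ C : LieSubmodule ℂ F X, FiniteDimensional ℂ C → ∃ T : Submodule ℂ X,
      FiniteDimensional ℂ T ∧ ∀ φ : X →ₗ⁅ℂ,F⁆ X, ∀ c ∈ C, φ c ∈ T)
    (W : Submodule ℂ (Dual ℂ X))
    (hW : ∀ w ∈ W, ∃ W' ≤ W, FiniteDimensional ℂ W' ∧ w ∈ W' ∧
      ∀ a : F, ∀ w ∈ W', w ∘ₗ LieModule.toEnd ℂ F X a ∈ W')
    (V : Submodule ℂ (Dual ℂ X)) [FiniteDimensional ℂ V]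
    (hV : ∀ a : F, ∀ v ∈ V, v ∘ₗ LieModule.toEnd ℂ F X a ∈ V)
    {η : Dual ℂ X} (hη : η ∈ V) (hv : ∀ x, (∀ w ∈ W, w x = 0) → η x = 0) : η ∈ W := by
  have orth : ∀ U : Submodule ℂ (Dual ℂ X),
      (∀ a : F, ∀ v ∈ U, v ∘ₗ LieModule.toEnd ℂ F X a ∈ U) →
      ∃ N : LieSubmodule ℂ F X, N.toSubmodule = U.dualCoannihilator := by
    intro U hU
    refine ⟨{ __ := U.dualCoannihilator, lie_mem := fun {a x} hx ↦ ?_ }, rfl⟩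
    replace hx : x ∈ U.dualCoannihilator := hx
    change ⁅a, x⁆ ∈ U.dualCoannihilator
    rw [Submodule.mem_dualCoannihilator] at hx ⊢
    intro v hv
    exact hx _ (hU a v hv)
  obtain ⟨K₀, hK₀⟩ := orth V hV
  -- A complement of the annihilator of `V` embeds in the dual of `V`, so it is finite dimensional.
  obtain ⟨C, hC⟩ := exists_isCompl K₀
  have hCfin : FiniteDimensional ℂ C := by
    let f : C →ₗ[ℂ] Dual ℂ V := (Dual.eval ℂ X ∘ₗ C.toSubmodule.subtype).compr₂ 
      (LinearMap.id) |>.compl₂ V.subtype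
    refine FiniteDimensional.of_injective f ?_
    rw [← LinearMap.ker_eq_bot, LinearMap.ker_eq_bot']
    intro c hc
    have : (c : X) ∈ K₀ ⊓ C := by
      refine ⟨?_, c.2⟩
      change (c : X) ∈ K₀.toSubmodule
      rw [hK₀, Submodule.mem_dualCoannihilator]
      intro v hv
      exact LinearMap.congr_fun hc ⟨v, hv⟩
    rw [hC.inf_eq_bot, LieSubmodule.mem_bot] at this
    exact Subtype.ext this
  obtain ⟨T, hT, hCT⟩ := hfin C hCfin
  -- The sum of all homomorphic images of `C` is fully invariant and still finite dimensional, so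
  -- the projection on it commutes with every endomorphism. This reduces the claim to linear algebra
  -- in finite dimension.
  let S : LieSubmodule ℂ F X := ⨆ φ : X →ₗ⁅ℂ,F⁆ X, C.map φ
  have hST : S.toSubmodule ≤ T := by
    rw [LieSubmodule.iSup_toSubmodule]
    refine iSup_le fun φ ↦ ?_
    rintro _ ⟨c, hc, rfl⟩
    exact hCT φ c hc
  have hSfin : FiniteDimensional ℂ S := Submodule.finiteDimensional_of_le hST
  have hSinv : ∀ φ : X →ₗ⁅ℂ,F⁆ X, ∀ x ∈ S, φ x ∈ S := by
    intro φ
    have : S ≤ S.comap φ := by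
      refine iSup_le fun ψ ↦ ?_
      intro x hx
      obtain ⟨c, hc, rfl⟩ := (LieSubmodule.mem_map _).1 hx
      refine LieSubmodule.mem_comap.2 ?_
      exact (le_iSup (fun φ : X →ₗ⁅ℂ,F⁆ X ↦ C.map φ) (φ.comp ψ))
        ((LieSubmodule.mem_map _).2 ⟨c, hc, rfl⟩)
    exact fun x hx ↦ this hx
  have hCS : C ≤ S := fun c hc ↦
    (le_iSup (fun φ : X →ₗ⁅ℂ,F⁆ X ↦ C.map φ) LieModuleHom.id)
      ((LieSubmodule.mem_map _).2 ⟨c, hc, rfl⟩)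
  obtain ⟨S', hS'⟩ := exists_isCompl S
  -- The projection on `C` along `K₀` commutes with the projection on `S` and has image in `S`; so
  -- an element and its projection on `S` differ by an element of `K₀`, where `η` vanishes.
  have hηP : ∀ x, η x = η (lieProj hS' x) := by
    intro x
    have h1 := lieProj_comm hS' hSinv (C.incl.comp (lieProj hC.symm)) x
    change (lieProj hS' (lieProj hC.symm x : X) : X) = (lieProj hC.symm (lieProj hS' x : X) : X) at h1
    rw [lieProj_of_mem hS' (hCS (lieProj hC.symm x).2)] at h1
    have h2 : x - lieProj hS' x ∈ K₀ := by
      rw [← lieProj_eq_zero hC.symm, map_sub, sub_eq_zero]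
      exact Subtype.ext h1
    change _ ∈ K₀.toSubmodule at h2
    rw [hK₀, Submodule.mem_dualCoannihilator] at h2
    have := h2 η hη
    rwa [map_sub, sub_eq_zero] at this
  -- On the finite dimensional `S` the double annihilator of the restrictions of `W` is the space of
  -- these restrictions itself, so `η` agrees there with some `w`.
  obtain ⟨w, hw, hwη⟩ : ∃ w ∈ W, ∀ s ∈ S, w s = η s := by
    have : η ∘ₗ S.toSubmodule.subtype ∈ W.map (LinearMap.lcomp ℂ ℂ S.toSubmodule.subtype) := by
      rw [← Subspace.dualCoannihilator_dualAnnihilator_eq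
        (W := W.map (LinearMap.lcomp ℂ ℂ S.toSubmodule.subtype)), Submodule.mem_dualAnnihilator]
      intro s hs
      rw [Submodule.mem_dualCoannihilator] at hs
      exact hv s fun w hw ↦ hs _ (Submodule.mem_map_of_mem hw)
    obtain ⟨w, hw, h⟩ := this
    exact ⟨w, hw, fun s hs ↦ LinearMap.congr_fun h ⟨s, hs⟩⟩
  obtain ⟨W', hW'W, hW'fin, hwW', hW'⟩ := hW w hw
  obtain ⟨K₁, hK₁⟩ := orth W' hW'
  obtain ⟨A, hA⟩ := exists_isCompl K₁
  refine hW'W ?_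
  rw [← Subspace.dualCoannihilator_dualAnnihilator_eq (W := W'), Submodule.mem_dualAnnihilator]
  intro k hk
  rw [← hK₁] at hk
  -- Now `η` is `w` composed with the projection on `S`. That projection preserves the annihilator
  -- of the finite dimensional `W'` containing `w`, so `η` lies in the double annihilator of `W'`,
  -- which is `W'`.
  rw [hηP, ← hwη _ (lieProj hS' k).2]
  have h1 := lieProj_comm hS' hSinv (K₁.incl.comp (lieProj hA)) k
  change (lieProj hS' (lieProj hA k : X) : X) = (lieProj hA (lieProj hS' k : X) : X) at h1
  rw [lieProj_of_mem hA hk] at h1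
  have h2 : (lieProj hS' k : X) ∈ K₁.toSubmodule := by
    rw [h1]
    exact (lieProj hA _).2
  rw [hK₁, Submodule.mem_dualCoannihilator] at h2
  exact h2 w hwW'

end Homs

/-! ### Finite multiplicities bound the images of finite dimensional modules. -/

section FiniteMultiplicity

variable {F : Type*} [LieRing F] [LieAlgebra ℂ F]
  {M : Type*} [AddCommGroup M] [Module ℂ M] [LieRingModule F M] [LieModule ℂ F M]

/-- Induction on the dimension of `C`. A nonzero map to a simple module either kills a simple
submodule `A` of `C` and factors through `C ⧸ A`, or identifies `A` with its target; the second case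
concerns finitely many members of `S` by hypothesis. -/
theorem finite_setOf_hom_ne_zero {S : Set (LieSubmodule ℂ F M)}
    (hS : ∀ N ∈ S, LieModule.IsIrreducible ℂ F N)
    (hfin : ∀ N ∈ S, {N' ∈ S | Nonempty (N' ≃ₗ⁅ℂ,F⁆ N)}.Finite) (n : ℕ) :
    ∀ (C : Type*) [AddCommGroup C] [Module ℂ C] [LieRingModule F C] [LieModule ℂ F C]
      [FiniteDimensional ℂ C], Module.finrank ℂ C ≤ n →
      {N ∈ S | ∃ φ : C →ₗ⁅ℂ,F⁆ N, φ ≠ 0}.Finite := by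
  induction n with
  | zero =>
    intro C _ _ _ _ _ hC
    convert Set.finite_empty
    rw [Set.eq_empty_iff_forall_notMem]
    rintro N ⟨-, φ, hφ⟩
    have : Subsingleton C := Module.finrank_zero_iff.1 (Nat.le_zero.1 hC)
    exact hφ (LieModuleHom.ext fun c ↦ by rw [Subsingleton.elim c 0, map_zero, map_zero])
  | succ n ih =>
    intro C _ _ _ _ _ hC
    rcases subsingleton_or_nontrivial C with h | h
    · exact ih C (by rw [Module.finrank_zero_of_subsingleton]; omega)
    have : Nontrivial (LieSubmodule ℂ F C) := (LieSubmodule.nontrivial_iff ℂ F C).2 h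
    obtain ⟨A, hA, -⟩ := (eq_bot_or_exists_atom_le (⊤ : LieSubmodule ℂ F C)).resolve_left top_ne_bot
    have hAirr := isIrreducible_of_isAtom hA
    have hrank : Module.finrank ℂ (C ⧸ A) ≤ n := by
      have h1 : Module.finrank ℂ (C ⧸ A) + Module.finrank ℂ A = Module.finrank ℂ C :=
        Submodule.finrank_quotient_add_finrank A.toSubmodule
      have h2 : 0 < Module.finrank ℂ A := by
        have := (LieSubmodule.nontrivial_iff_ne_bot (N := A)).2 hA.1
        exact Module.finrank_pos
      omega
    have h2 : {N ∈ S | Nonempty (N ≃ₗ⁅ℂ,F⁆ A)}.Finite := by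
      by_cases hN : ∃ N ∈ S, Nonempty (N ≃ₗ⁅ℂ,F⁆ A)
      · obtain ⟨N, hN, ⟨e⟩⟩ := hN
        refine (hfin N hN).subset ?_
        rintro N' ⟨h, ⟨e'⟩⟩
        exact ⟨h, ⟨e'.trans e.symm⟩⟩
      · convert Set.finite_empty
        rw [Set.eq_empty_iff_forall_notMem]
        rintro N ⟨h, h'⟩
        exact hN ⟨N, h, h'⟩
    refine ((ih (C ⧸ A) hrank).union h2).subset ?_
    rintro N ⟨hN, φ, hφ⟩
    by_cases hφA : A ≤ φ.ker
    · left
      let ψ : C ⧸ A →ₗ⁅ℂ,F⁆ N :=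
        { __ := A.toSubmodule.liftQ (φ : C →ₗ[ℂ] N) hφA
          map_lie' := by
            intro a x
            obtain ⟨x, rfl⟩ := Submodule.Quotient.mk_surjective _ x
            exact φ.map_lie a x }
      refine ⟨hN, ψ, fun h ↦ hφ (LieModuleHom.ext fun c ↦ ?_)⟩
      exact LieModuleHom.congr_fun h (LieSubmodule.Quotient.mk c)
    · right
      have := hS N hN
      let ψ : A →ₗ⁅ℂ,F⁆ N := φ.comp A.incl
      have hker : ψ.ker = ⊥ := by
        refine (IsSimpleOrder.eq_bot_or_eq_top ψ.ker).resolve_right fun h ↦ hφA fun a ha ↦ ?_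
        have : (⟨a, ha⟩ : A) ∈ ψ.ker := by rw [h]; trivial
        exact this
      have hran : ψ.range = ⊤ := by
        refine (IsSimpleOrder.eq_bot_or_eq_top ψ.range).resolve_left fun h ↦ hφA fun a ha ↦ ?_
        have : ψ ⟨a, ha⟩ ∈ ψ.range := (LieModuleHom.mem_range _ _).2 ⟨_, rfl⟩
        rw [h, LieSubmodule.mem_bot] at this
        exact this
      have hb : Function.Bijective (ψ : A →ₗ[ℂ] N) := by
        refine ⟨LinearMap.ker_eq_bot.1 ?_, LinearMap.range_eq_top.1 ?_⟩
        · exact congrArg LieSubmodule.toSubmodule hker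
        · rw [eq_top_iff]
          intro x _
          have : x ∈ ψ.range := by rw [hran]; trivial
          exact (LieModuleHom.mem_range _ _).1 this
      let e := LinearEquiv.ofBijective (ψ : A →ₗ[ℂ] N) hb
      exact ⟨hN, ⟨LieModuleEquiv.symm { e with map_lie' := fun {a x} ↦ ψ.map_lie a x }⟩⟩

/-- The images of a module of finite dimension in a module with finite multiplicities. -/
theorem exists_finite_hom_range {S : Set (LieSubmodule ℂ F M)}
    (hind : sSupIndep S) (htop : sSup S = ⊤)
    (hS : ∀ N ∈ S, LieModule.IsIrreducible ℂ F N ∧ FiniteDimensional ℂ N)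
    (hfin : ∀ N ∈ S, {N' ∈ S | Nonempty (N' ≃ₗ⁅ℂ,F⁆ N)}.Finite)
    (C : Type*) [AddCommGroup C] [Module ℂ C] [LieRingModule F C] [LieModule ℂ F C]
    [FiniteDimensional ℂ C] :
    ∃ T : Submodule ℂ M, FiniteDimensional ℂ T ∧ ∀ φ : C →ₗ⁅ℂ,F⁆ M, ∀ c, φ c ∈ T := by
  set S₀ := {N ∈ S | ∃ φ : C →ₗ⁅ℂ,F⁆ N, φ ≠ 0}
  have hS₀ : S₀.Finite := finite_setOf_hom_ne_zero (fun N hN ↦ (hS N hN).1) hfin _ C le_rfl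
  have hcompl : ∀ N ∈ S, IsCompl N (sSup (S \ {N})) := by
    intro N hN
    refine ⟨hind hN, codisjoint_iff.2 ?_⟩
    rw [← sSup_insert, Set.insert_sdiff_singleton, Set.insert_eq_of_mem hN, htop]
  refine ⟨(sSup S₀).toSubmodule, ?_, fun φ c ↦ ?_⟩
  · rw [LieSubmodule.sSup_toSubmodule]
    have h1 : {x | ∃ s ∈ S₀, s.toSubmodule = x} = LieSubmodule.toSubmodule '' S₀ := rfl
    rw [h1, sSup_image, iSup_subtype']
    have := hS₀.to_subtype
    have : ∀ N : S₀, FiniteDimensional ℂ (N : LieSubmodule ℂ F M).toSubmodule :=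
      fun N ↦ (hS N N.2.1).2
    infer_instance
  -- Outside the finite set `S₀` every component of `φ` vanishes.
  · have h1 : ∀ N ∈ S \ S₀, φ c ∈ sSup (S \ {N}) := by
      rintro N ⟨hN, hN₀⟩
      rw [← lieProj_eq_zero (hcompl N hN)]
      by_contra h
      exact hN₀ ⟨hN, (lieProj (hcompl N hN)).comp φ, fun h' ↦ h (LieModuleHom.congr_fun h' c)⟩
    have h2 : ∃ A : Set (LieSubmodule ℂ F M), A.Finite ∧ A ⊆ S ∧ φ c ∈ sSup A := by
      have hc : φ c ∈ sSup S := by rw [htop]; trivial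
      change φ c ∈ (sSup S).toSubmodule at hc
      rw [LieSubmodule.sSup_toSubmodule_eq_iSup, iSup_subtype', Submodule.mem_iSup_iff_exists_finset] at hc
      obtain ⟨s, hs⟩ := hc
      refine ⟨Subtype.val '' (s : Set S), (s.finite_toSet.image _), ?_, ?_⟩
      · rintro _ ⟨N, -, rfl⟩
        exact N.2
      · refine (iSup₂_le (a := (sSup (Subtype.val '' (s : Set S))).toSubmodule) fun N hN ↦ ?_) hs
        exact (LieSubmodule.toSubmodule_le_toSubmodule _ _).2 (le_sSup ⟨N, hN, rfl⟩)
    obtain ⟨A, hA, hAS, hcA⟩ := h2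
    -- An element lies in a finite sum of members of `S`; the superfluous ones are removed one at a
    -- time, using independence and the modular law.
    have key : ∀ A : Set (LieSubmodule ℂ F M), A.Finite → A ⊆ S \ S₀ →
        ∀ B ⊆ S, φ c ∈ sSup (B ∪ A) → φ c ∈ sSup B := by
      intro A hA
      induction A, hA using Set.Finite.induction_on with
      | empty => intro _ B _ h; rwa [Set.union_empty] at h
      | @insert N A hNA _ ih =>
        intro hAS B hBS h
        rw [Set.insert_subset_iff] at hAS
        by_cases hNB : N ∈ B
        · refine ih hAS.2 B hBS ?_
          rwa [Set.union_insert, Set.insert_eq_of_mem (Set.mem_union_left A hNB)] at h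
        refine ih hAS.2 B hBS ?_
        rw [Set.union_insert, sSup_insert] at h
        have hle : sSup (B ∪ A) ≤ sSup (S \ {N}) := by
          refine sSup_le_sSup fun N' hN' ↦ ?_
          rcases hN' with hN' | hN'
          · exact ⟨hBS hN', fun h ↦ hNB (by rwa [← Set.mem_singleton_iff.1 h])⟩
          · exact ⟨(hAS.2 hN').1, fun h ↦ hNA (by rwa [← Set.mem_singleton_iff.1 h])⟩
        have h3 : φ c ∈ (sSup (B ∪ A) ⊔ N) ⊓ sSup (S \ {N}) := ⟨by rwa [sup_comm], h1 N hAS.1⟩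
        rwa [sup_inf_assoc_of_le _ hle, (hind hAS.1.1).eq_bot, sup_bot_eq] at h3
    have hA' : sSup ((A ∩ S₀) ∪ (A \ S₀)) = sSup A := by rw [Set.inter_union_sdiff]
    have := key (A \ S₀) hA.sdiff (fun N hN ↦ ⟨hAS hN.1, hN.2⟩) (A ∩ S₀)
      (fun N hN ↦ hAS hN.1) (by rwa [hA'])
    have hle : sSup (A ∩ S₀) ≤ sSup S₀ := sSup_le_sSup Set.inter_subset_right
    exact hle this

end FiniteMultiplicity

end AffineKM

namespace AffineKM

/-! ### Locally finite functionals -/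

section Separation

open Module

variable {X : Type*} [AddCommGroup X] [Module ℂ X]

/-- Subspaces of functionals which are locally finite under the operators in `A` are determined by
their annihilators, among the locally finite functionals. -/
def IsLocSep (A : Set (Module.End ℂ X)) : Prop :=
  ∀ W : Submodule ℂ (Dual ℂ X),
    (∀ w ∈ W, ∃ W' ≤ W, FiniteDimensional ℂ W' ∧ w ∈ W' ∧ ∀ T ∈ A, ∀ w ∈ W', w ∘ₗ T ∈ W') →
    ∀ V : Submodule ℂ (Dual ℂ X), FiniteDimensional ℂ V → (∀ T ∈ A, ∀ v ∈ V, v ∘ₗ T ∈ V) →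
    ∀ η ∈ V, (∀ x, (∀ w ∈ W, w x = 0) → η x = 0) → η ∈ W

theorem IsLocSep.mono {A A' : Set (Module.End ℂ X)} (h : IsLocSep A) (hA : A ⊆ A') :
    IsLocSep A' := fun W hW V hV hV' η hη hv ↦
  h W (fun w hw ↦ by
    obtain ⟨W', h1, h2, h3, h4⟩ := hW w hw
    exact ⟨W', h1, h2, h3, fun T hT ↦ h4 T (hA hT)⟩) V hV (fun T hT ↦ hV' T (hA hT)) η hη hv

/-- A direct sum of simple modules of finite dimension with finite multiplicities. -/
def IsFinMult (F M : Type*) [LieRing F] [LieAlgebra ℂ F] [AddCommGroup M] [Module ℂ M]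
    [LieRingModule F M] [LieModule ℂ F M] : Prop :=
  ∃ S : Set (LieSubmodule ℂ F M), sSupIndep S ∧ sSup S = ⊤ ∧
    (∀ N ∈ S, LieModule.IsIrreducible ℂ F N ∧ FiniteDimensional ℂ N) ∧
    ∀ N ∈ S, {N' ∈ S | Nonempty (N' ≃ₗ⁅ℂ,F⁆ N)}.Finite

variable {F : Type*} [LieRing F] [LieAlgebra ℂ F]
  {M : Type*} [AddCommGroup M] [Module ℂ M] [LieRingModule F M] [LieModule ℂ F M]
  {E : Type*} [AddCommGroup E] [Module ℂ E] [LieRingModule F E] [LieModule ℂ F E]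

theorem IsFinMult.isFinSemisimple (h : IsFinMult F M) : IsFinSemisimple F M := by
  obtain ⟨S, -, htop, hS, -⟩ := h
  rw [IsFinSemisimple, eq_top_iff, ← htop]
  refine sSup_le_sSup fun N hN ↦ ?_
  have := (hS N hN).1
  exact ⟨isAtom_of_isIrreducible, (hS N hN).2⟩

theorem IsFinMult.exists_finite (h : IsFinMult F M) (C : Type*) [AddCommGroup C] [Module ℂ C]
    [LieRingModule F C] [LieModule ℂ F C] [FiniteDimensional ℂ C] :
    ∃ T : Submodule ℂ M, FiniteDimensional ℂ T ∧ ∀ φ : C →ₗ⁅ℂ,F⁆ M, ∀ c, φ c ∈ T := by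
  obtain ⟨S, hind, htop, hS, hfin⟩ := h
  exact exists_finite_hom_range hind htop hS hfin C

theorem IsFinMult.isLocSep (h : IsFinMult F M) :
    IsLocSep (Set.range (LieModule.toEnd ℂ F M)) := by
  intro W hW V hV hV' η hη hv
  have := h.isFinSemisimple.complementedLattice
  refine mem_of_vanish (fun C hC ↦ ?_) W (fun w hw ↦ ?_) V (fun a ↦ hV' _ ⟨a, rfl⟩) hη hv
  · obtain ⟨T, hT, h⟩ := h.exists_finite C
    exact ⟨T, hT, fun φ c hc ↦ h (φ.comp C.incl) ⟨c, hc⟩⟩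
  · obtain ⟨W', h1, h2, h3, h4⟩ := hW w hw
    exact ⟨W', h1, h2, h3, fun a ↦ h4 _ ⟨a, rfl⟩⟩

/-- Contraction of the first factor with a functional. -/
def contract (ξ : Dual ℂ E) : E ⊗[ℂ] M →ₗ[ℂ] M :=
  (TensorProduct.lid ℂ M).toLinearMap ∘ₗ ξ.rTensor M

theorem contract_tmul (ξ : Dual ℂ E) (e : E) (m : M) : contract ξ (e ⊗ₜ[ℂ] m) = ξ e • m := by
  simp [contract]

theorem contract_lie (a : F) (ξ : Dual ℂ E) (w : E ⊗[ℂ] M) :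
    contract ⁅a, ξ⁆ w + contract ξ ⁅a, w⁆ = ⁅a, contract ξ w⁆ := by
  induction w using TensorProduct.induction_on with
  | zero => simp
  | add x y hx hy => rw [lie_add, map_add, map_add, map_add, lie_add, ← hx, ← hy]; abel
  | tmul e m =>
    rw [TensorProduct.LieModule.lie_tmul_right, map_add, contract_tmul, contract_tmul,
      contract_tmul, contract_tmul, Module.Dual.lie_apply, lie_smul, neg_smul]
    abel

theorem sum_tmul_contract {ι : Type*} [Fintype ι] (e : Basis ι ℂ E) (w : E ⊗[ℂ] M) :
    ∑ i, e i ⊗ₜ[ℂ] contract (e.coord i) w = w := by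
  induction w using TensorProduct.induction_on with
  | zero => simp
  | add x y hx hy =>
    simp only [map_add, TensorProduct.tmul_add, Finset.sum_add_distrib]
    rw [hx, hy]
  | tmul x m =>
    simp only [contract_tmul, TensorProduct.tmul_smul]
    simp only [TensorProduct.smul_tmul']
    rw [← TensorProduct.sum_tmul]
    congr 1
    exact e.sum_repr x

/-- By adjunction a homomorphism from `C` to `E ⊗ M` is one from `E* ⊗ C` to `M`. The images of the
latter lie in a fixed finite dimensional `T`, hence those of the former lie in `E ⊗ T`. -/
theorem IsFinMult.exists_finite_tensor [FiniteDimensional ℂ E] (h : IsFinMult F M) (C : Type*)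
    [AddCommGroup C] [Module ℂ C] [LieRingModule F C] [LieModule ℂ F C] [FiniteDimensional ℂ C] :
    ∃ T : Submodule ℂ (E ⊗[ℂ] M), FiniteDimensional ℂ T ∧
      ∀ φ : C →ₗ⁅ℂ,F⁆ E ⊗[ℂ] M, ∀ c, φ c ∈ T := by
  obtain ⟨T, hT, h⟩ := h.exists_finite (Dual ℂ E ⊗[ℂ] C)
  refine ⟨tensOf E T, ?_, fun φ c ↦ ?_⟩
  · exact Module.Finite.iff_fg.2
      ((Module.finite_def.1 inferInstance).map₂ _ (Module.Finite.iff_fg.1 hT))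
  · let β : Dual ℂ E →ₗ[ℂ] C →ₗ[ℂ] M := LinearMap.mk₂ ℂ (fun ξ c ↦ contract ξ (φ c))
      (fun ξ ξ' c ↦ by simp [contract, LinearMap.rTensor_add])
      (fun r ξ c ↦ by simp [contract, LinearMap.rTensor_smul])
      (fun ξ c c' ↦ by simp)
      (fun r ξ c ↦ by simp)
    have hβ : ∀ (a : F) ξ c, β ⁅a, ξ⁆ c + β ξ ⁅a, c⁆ = ⁅a, β ξ c⁆ := by
      intro a ξ c
      change contract ⁅a, ξ⁆ (φ c) + contract ξ (φ ⁅a, c⁆) = ⁅a, contract ξ (φ c)⁆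
      rw [LieModuleHom.map_lie, contract_lie]
    let ψ : Dual ℂ E ⊗[ℂ] C →ₗ⁅ℂ,F⁆ M :=
      { __ := TensorProduct.lift β
        map_lie' := by
          intro a w
          change TensorProduct.lift β ⁅a, w⁆ = ⁅a, TensorProduct.lift β w⁆
          induction w using TensorProduct.induction_on with
          | zero => simp
          | add x y hx hy => rw [lie_add, map_add, map_add, lie_add, hx, hy]
          | tmul ξ c =>
            rw [TensorProduct.LieModule.lie_tmul_right, map_add, TensorProduct.lift.tmul,
              TensorProduct.lift.tmul, TensorProduct.lift.tmul, hβ] }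
    rw [← sum_tmul_contract (finBasis ℂ E) (φ c)]
    refine Submodule.sum_mem _ fun i _ ↦ tmul_mem_tensOf _ ?_
    have := h ψ ((finBasis ℂ E).coord i ⊗ₜ c)
    change TensorProduct.lift β ((finBasis ℂ E).coord i ⊗ₜ c) ∈ T at this
    rwa [TensorProduct.lift.tmul] at this

theorem IsFinMult.isLocSep_tensor [FiniteDimensional ℂ F] [ComplementedLattice (LieIdeal ℂ F)]
    [FiniteDimensional ℂ E] (hE : IsFinSemisimple F E) (h : IsFinMult F M) :
    IsLocSep (Set.range (LieModule.toEnd ℂ F (E ⊗[ℂ] M))) := by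
  intro W hW V hV hV' η hη hv
  have := (hE.tensor h.isFinSemisimple).complementedLattice
  refine mem_of_vanish (fun C hC ↦ ?_) W (fun w hw ↦ ?_) V (fun a ↦ hV' _ ⟨a, rfl⟩) hη hv
  · obtain ⟨T, hT, h⟩ := h.exists_finite_tensor (E := E) C
    exact ⟨T, hT, fun φ c hc ↦ h (φ.comp C.incl) ⟨c, hc⟩⟩
  · obtain ⟨W', h1, h2, h3, h4⟩ := hW w hw
    exact ⟨W', h1, h2, h3, fun a ↦ h4 _ ⟨a, rfl⟩⟩

end Separation

/-! ### The dual of locally finite functionals and its chain conditions. -/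

section FinDual

open Module

variable {L : Type*} [LieRing L] [LieAlgebra ℂ L] [FiniteDimensional ℂ L] (f : LieSubalgebra ℂ L)
  (X : Type*) [AddCommGroup X] [Module ℂ X] [LieRingModule L X] [LieModule ℂ L X]

/-- The functionals which are locally finite under `f`. -/
def finDual : LieSubmodule ℂ L (Dual ℂ X) where
  carrier := {η | ∃ W : Submodule ℂ (Dual ℂ X), FiniteDimensional ℂ W ∧ η ∈ W ∧
    ∀ x ∈ f, ∀ w ∈ W, ⁅x, w⁆ ∈ W}
  add_mem' := by
    rintro η ξ ⟨W, _, hη, hW⟩ ⟨W', _, hξ, hW'⟩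
    refine ⟨W ⊔ W', inferInstance, Submodule.add_mem_sup hη hξ, fun x hx w hw ↦ ?_⟩
    obtain ⟨a, ha, b, hb, rfl⟩ := Submodule.mem_sup.1 hw
    rw [lie_add]
    exact Submodule.add_mem_sup (hW x hx a ha) (hW' x hx b hb)
  zero_mem' := ⟨⊥, inferInstance, zero_mem _, fun x _ w hw ↦ by
    rw [Submodule.mem_bot] at hw ⊢
    rw [hw, lie_zero]⟩
  smul_mem' := by
    rintro c η ⟨W, hfin, hη, hW⟩
    exact ⟨W, hfin, Submodule.smul_mem _ c hη, hW⟩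
  lie_mem := by
    rintro y η ⟨W, hfin, hη, hW⟩
    let g : L →ₗ[ℂ] Dual ℂ X →ₗ[ℂ] Dual ℂ X := (LieModule.toEnd ℂ L (Dual ℂ X) : L →ₗ[ℂ] _)
    refine ⟨Submodule.map₂ g ⊤ W, ?_, Submodule.apply_mem_map₂ g Submodule.mem_top hη, ?_⟩
    · exact Module.Finite.iff_fg.2
        ((Module.finite_def.1 inferInstance).map₂ g (Module.Finite.iff_fg.1 hfin))
    · intro a ha w hw
      refine (Submodule.map₂_le (r := (Submodule.map₂ g ⊤ W).comap
        (LieModule.toEnd ℂ L (Dual ℂ X) a))).2 ?_ hw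
      intro z _ w hw
      change ⁅a, ⁅z, w⁆⁆ ∈ Submodule.map₂ g ⊤ W
      rw [leibniz_lie]
      exact add_mem (Submodule.apply_mem_map₂ g (Submodule.mem_top (x := ⁅a, z⁆)) hw)
        (Submodule.apply_mem_map₂ g (Submodule.mem_top (x := z)) (hW a ha w hw))

variable {f X}

theorem mem_finDual {η : Dual ℂ X} : η ∈ finDual f X ↔
    ∃ W : Submodule ℂ (Dual ℂ X), FiniteDimensional ℂ W ∧ η ∈ W ∧ ∀ x ∈ f, ∀ w ∈ W, ⁅x, w⁆ ∈ W :=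
  Iff.rfl

/-- The annihilator of a module of functionals. -/
def orth (W : LieSubmodule ℂ L (finDual f X)) : LieSubmodule ℂ L X where
  carrier := {x | ∀ w ∈ W, (w : Dual ℂ X) x = 0}
  add_mem' {x y} hx hy w hw := by rw [map_add, hx w hw, hy w hw, add_zero]
  zero_mem' w _ := map_zero _
  smul_mem' c x hx w hw := by rw [map_smul, hx w hw, smul_zero]
  lie_mem {a x} hx w hw := by
    have := hx ⁅a, w⁆ (W.lie_mem hw)
    rwa [LieSubmodule.coe_bracket, Module.Dual.lie_apply, neg_eq_zero] at this

theorem comp_toEnd (a : L) (w : Dual ℂ X) : w ∘ₗ LieModule.toEnd ℂ L X a = -⁅a, w⁆ := by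
  ext x
  rw [LinearMap.neg_apply, Module.Dual.lie_apply, neg_neg]
  rfl

/-- Nested modules of locally finite functionals with equal annihilators coincide by the separation
property. Chain conditions on `X` thus pass, reversed, to its locally finite dual. -/
theorem orth_strictAnti (h : IsLocSep (LieModule.toEnd ℂ L X '' f)) :
    StrictAnti (orth (f := f) (X := X)) := by
  intro W W' hlt
  refine lt_of_le_of_ne (fun x hx w hw ↦ hx w (hlt.le hw)) fun heq ↦ hlt.not_ge fun η hη ↦ ?_
  have hη' := mem_finDual.1 η.2
  obtain ⟨V, hV, hηV, hVf⟩ := hη'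
  have key : (η : Dual ℂ X) ∈ W.toSubmodule.map (finDual f X).toSubmodule.subtype := by
    refine h _ ?_ V hV ?_ η hηV ?_
    · rintro _ ⟨w, hw, rfl⟩
      obtain ⟨U, hU, hwU, hUf⟩ := mem_finDual.1 w.2
      refine ⟨W.toSubmodule.map (finDual f X).toSubmodule.subtype ⊓ U, inf_le_left, inferInstance,
        ⟨⟨w, hw, rfl⟩, hwU⟩, ?_⟩
      rintro _ ⟨a, ha, rfl⟩ _ ⟨⟨u, hu, rfl⟩, huU⟩
      rw [comp_toEnd]
      exact neg_mem ⟨⟨(⁅a, (show finDual f X from u)⁆ : finDual f X), W.lie_mem hu, rfl⟩, hUf a ha _ huU⟩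
    · rintro _ ⟨a, ha, rfl⟩ v hv
      rw [comp_toEnd]
      exact neg_mem (hVf a ha v hv)
    · intro x hx
      have : x ∈ orth W := fun w hw ↦ hx w ⟨w, hw, rfl⟩
      rw [← heq] at this
      exact this η hη
  obtain ⟨w, hw, hwη⟩ := key
  have : w = η := Subtype.ext hwη
  rwa [← this]

theorem wellFoundedLT_finDual (h : IsLocSep (LieModule.toEnd ℂ L X '' f))
    [WellFoundedGT (LieSubmodule ℂ L X)] : WellFoundedLT (LieSubmodule ℂ L (finDual f X)) :=
  (orth_strictAnti h).wellFoundedLT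

theorem wellFoundedGT_finDual (h : IsLocSep (LieModule.toEnd ℂ L X '' f))
    [WellFoundedLT (LieSubmodule ℂ L X)] : WellFoundedGT (LieSubmodule ℂ L (finDual f X)) :=
  (orth_strictAnti h).wellFoundedGT

variable {E : Type*} [AddCommGroup E] [Module ℂ E] [LieRingModule L E] [LieModule ℂ L E]
  [FiniteDimensional ℂ E]

variable (f X E) in
/-- The pairing of `E* ⊗ X^d` with `E ⊗ X`. -/
def dualTensor : Dual ℂ E ⊗[ℂ] finDual f X →ₗ⁅ℂ,L⁆ Dual ℂ (E ⊗[ℂ] X) where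
  __ := TensorProduct.dualDistrib ℂ E X ∘ₗ ((finDual f X).incl : finDual f X →ₗ[ℂ] Dual ℂ X).lTensor (Dual ℂ E)
  map_lie' := by
    intro a w
    change (TensorProduct.dualDistrib ℂ E X ∘ₗ
      ((finDual f X).incl : finDual f X →ₗ[ℂ] Dual ℂ X).lTensor (Dual ℂ E)) ⁅a, w⁆ = ⁅a, (TensorProduct.dualDistrib
        ℂ E X ∘ₗ ((finDual f X).incl : finDual f X →ₗ[ℂ] Dual ℂ X).lTensor (Dual ℂ E)) w⁆
    induction w using TensorProduct.induction_on with
    | zero => simp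
    | add x y hx hy => rw [lie_add, map_add, map_add, lie_add, hx, hy]
    | tmul ξ η =>
      refine TensorProduct.ext' fun e x ↦ ?_
      rw [Module.Dual.lie_apply, TensorProduct.LieModule.lie_tmul_right,
        TensorProduct.LieModule.lie_tmul_right, map_add, map_add, LinearMap.add_apply]
      change -ξ ⁅a, e⁆ * (η : Dual ℂ X) x + ξ e * -(η : Dual ℂ X) ⁅a, x⁆ =
        -(ξ ⁅a, e⁆ * (η : Dual ℂ X) x + ξ e * (η : Dual ℂ X) ⁅a, x⁆)
      ring

theorem dualTensor_tmul (ξ : Dual ℂ E) (η : finDual f X) (e : E) (x : X) :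
    dualTensor f X E (ξ ⊗ₜ η) (e ⊗ₜ x) = ξ e * (η : Dual ℂ X) x := rfl

/-- Expand `η` along a basis of `E`. Its slices are locally finite, since the slices of all members
of a stable finite dimensional space span a stable finite dimensional space. -/
theorem exists_dualTensor_eq {η : Dual ℂ (E ⊗[ℂ] X)} (hη : η ∈ finDual f (E ⊗[ℂ] X)) :
    ∃ w, dualTensor f X E w = η := by
  obtain ⟨W, hW, hηW, hWf⟩ := mem_finDual.1 hη
  let g : E →ₗ[ℂ] Dual ℂ (E ⊗[ℂ] X) →ₗ[ℂ] Dual ℂ X :=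
    LinearMap.mk₂ ℂ (fun e w ↦ w ∘ₗ TensorProduct.mk ℂ E X e)
      (fun e e' w ↦ by ext; simp) (fun r e w ↦ by ext; simp)
      (fun e w w' ↦ by ext; simp) (fun r e w ↦ by ext; simp)
  have hg : ∀ e w x, g e w x = w (e ⊗ₜ x) := fun e w x ↦ rfl
  have hlie : ∀ (a : L) e w, ⁅a, g e w⁆ = g e ⁅a, w⁆ + g ⁅a, e⁆ w := by
    intro a e w
    ext x
    rw [Module.Dual.lie_apply, LinearMap.add_apply, hg, hg, hg, Module.Dual.lie_apply,
      TensorProduct.LieModule.lie_tmul_right, map_add]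
    ring
  have hmem : ∀ e, g e η ∈ finDual f X := by
    intro e
    refine ⟨Submodule.map₂ g ⊤ W, ?_, Submodule.apply_mem_map₂ g Submodule.mem_top hηW, ?_⟩
    · exact Module.Finite.iff_fg.2
        ((Module.finite_def.1 inferInstance).map₂ g (Module.Finite.iff_fg.1 hW))
    · intro a ha w hw
      refine (Submodule.map₂_le (r := (Submodule.map₂ g ⊤ W).comap
        (LieModule.toEnd ℂ L (Dual ℂ X) a))).2 ?_ hw
      intro e _ w hw
      change ⁅a, g e w⁆ ∈ Submodule.map₂ g ⊤ W
      rw [hlie]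
      exact add_mem (Submodule.apply_mem_map₂ g trivial (hWf a ha w hw))
        (Submodule.apply_mem_map₂ g trivial hw)
  refine ⟨∑ i, (finBasis ℂ E).coord i ⊗ₜ ⟨g (finBasis ℂ E i) η, hmem _⟩, ?_⟩
  refine TensorProduct.ext' fun e x ↦ ?_
  rw [map_sum, LinearMap.sum_apply]
  simp only [dualTensor_tmul, hg]
  conv_rhs => rw [← (finBasis ℂ E).sum_repr e, TensorProduct.sum_tmul, map_sum]
  refine Finset.sum_congr rfl fun i _ ↦ ?_
  rw [← TensorProduct.smul_tmul', map_smul]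
  rfl

/-- The locally finite dual of `E ⊗ X` lies in the image of `E* ⊗ X^d`, which is Noetherian as a
tensor product of a finite dimensional and a Noetherian module. -/
theorem wellFoundedGT_finDual_tensor [WellFoundedGT (LieSubmodule ℂ L (finDual f X))] :
    WellFoundedGT (LieSubmodule ℂ L (finDual f (E ⊗[ℂ] X))) := by
  have := wellFoundedGT_tensor (L := L) (Y := finDual f X) (Dual ℂ E)
  let g : LieSubmodule ℂ L (finDual f (E ⊗[ℂ] X)) →
      LieSubmodule ℂ L (Dual ℂ E ⊗[ℂ] finDual f X) :=
    fun W ↦ (W.map (finDual f (E ⊗[ℂ] X)).incl).comap (dualTensor f X E)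
  have hg : StrictMono g := by
    intro W W' hlt
    refine lt_of_le_of_ne ((LieSubmodule.gc_map_comap _).monotone_u (LieSubmodule.map_mono hlt.le)) fun heq ↦
      hlt.not_ge fun η hη ↦ ?_
    obtain ⟨w, hw⟩ := exists_dualTensor_eq η.2
    have h1 : w ∈ g W' := by
      refine LieSubmodule.mem_comap.2 ?_
      rw [hw]
      exact (LieSubmodule.mem_map _).2 ⟨η, hη, rfl⟩
    rw [← heq] at h1
    have h2 := LieSubmodule.mem_comap.1 h1
    rw [hw] at h2
    obtain ⟨ζ, hζ, h⟩ := (LieSubmodule.mem_map _).1 h2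
    have : ζ = η := Subtype.ext h
    rwa [← this]
  exact hg.wellFoundedGT

end FinDual

end AffineKM

namespace AffineKM

/-! ### Modules of finite length -/

section Length

/-- The set records which steps of the composition series are seen by `W`. Two comparable elements
with the same record agree below each step, by the modular law. Subsets of a finite set satisfy both
chain conditions. -/
theorem strictMono_of_covBy {α : Type*} [Lattice α] [BoundedOrder α] [IsModularLattice α] {n : ℕ}
    (N : Fin (n + 1) → α) (h0 : N 0 = ⊥) (hn : N (Fin.last n) = ⊤)
    (hN : ∀ i : Fin n, N i.castSucc ⋖ N i.succ) :
    StrictMono fun W ↦ {i : Fin n | (W ⊓ N i.succ) ⊔ N i.castSucc = N i.succ} := by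
  have hdich : ∀ W i, (W ⊓ N (Fin.succ i)) ⊔ N (Fin.castSucc i) = N i.castSucc ∨
      (W ⊓ N (Fin.succ i)) ⊔ N (Fin.castSucc i) = N i.succ := fun W i ↦
    (hN i).eq_or_eq le_sup_right (sup_le inf_le_right (hN i).le)
  intro W W' hlt
  have hle : {i : Fin n | (W ⊓ N i.succ) ⊔ N i.castSucc = N i.succ} ⊆
      {i : Fin n | (W' ⊓ N i.succ) ⊔ N i.castSucc = N i.succ} := by
    intro i hi
    refine le_antisymm (sup_le inf_le_right (hN i).le) ?_
    conv_lhs => rw [← (show _ = _ from hi)]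
    exact sup_le_sup_right (inf_le_inf_right _ hlt.le) _
  refine lt_of_le_of_ne hle fun heq ↦ hlt.not_ge ?_
  have key : ∀ i : Fin (n + 1), W' ⊓ N i ≤ W := by
    intro i
    induction i using Fin.induction with
    | zero => rw [h0, inf_bot_eq]; exact bot_le
    | succ i ih =>
      have h1 : (W' ⊓ N i.succ) ⊔ N i.castSucc ≤ (W ⊓ N i.succ) ⊔ N i.castSucc := by
        have : i ∈ {i : Fin n | (W ⊓ N i.succ) ⊔ N i.castSucc = N i.succ} ↔
          i ∈ {i : Fin n | (W' ⊓ N i.succ) ⊔ N i.castSucc = N i.succ} := by rw [show {i : Fin n | (W ⊓ N i.succ) ⊔ N i.castSucc = N i.succ} = _ from heq]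
        rcases hdich W' i with h | h
        · rw [h]; exact le_sup_right
        · rw [h]; exact (this.2 h).ge
      have h2 : (W' ⊓ N i.succ) ⊓ N i.castSucc ≤ (W ⊓ N i.succ) ⊓ N i.castSucc := by
        refine le_inf (le_inf ?_ (inf_le_left.trans inf_le_right)) inf_le_right
        exact (inf_le_inf_right _ inf_le_left).trans ih
      have := eq_of_le_of_inf_le_of_sup_le (inf_le_inf_right (N i.succ) hlt.le) h2 h1
      rw [← this]
      exact inf_le_left
  have := key (Fin.last n)
  rwa [hn, inf_top_eq] at this

variable {L V : Type*} [LieRing L] [LieAlgebra ℂ L] [AddCommGroup V] [Module ℂ V]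
  [LieRingModule L V] [LieModule ℂ L V]

theorem HasFiniteLength.wellFoundedLT (h : HasFiniteLength L V) :
    WellFoundedLT (LieSubmodule ℂ L V) := by
  obtain ⟨n, N, h0, hn, hN⟩ := h
  exact (strictMono_of_covBy N h0 hn hN).wellFoundedLT

theorem HasFiniteLength.wellFoundedGT (h : HasFiniteLength L V) :
    WellFoundedGT (LieSubmodule ℂ L V) := by
  obtain ⟨n, N, h0, hn, hN⟩ := h
  exact (strictMono_of_covBy N h0 hn hN).wellFoundedGT

theorem hasFiniteLength_of_wellFounded [WellFoundedLT (LieSubmodule ℂ L V)]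
    [WellFoundedGT (LieSubmodule ℂ L V)] : HasFiniteLength L V := by
  obtain ⟨a, h0, n, hn, h⟩ := exists_covBy_seq_of_wellFoundedLT_wellFoundedGT
    (LieSubmodule ℂ L V)
  exact ⟨n, fun i ↦ a i, isMin_iff_eq_bot.1 h0, isMax_iff_eq_top.1 hn, fun i ↦ h i i.2⟩

end Length

/-! ### Scalars on composition factors, and chain conditions for duals of tensor products. -/

section Central

variable {L : Type*} [LieRing L] [LieAlgebra ℂ L] {f : LieSubalgebra ℂ L}
  {M : Type*} [AddCommGroup M] [Module ℂ M] [LieRingModule L M] [LieModule ℂ L M]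

theorem mem_sSup_exists_finite {F : Type*} [LieRing F] [LieAlgebra ℂ F] {M : Type*} [AddCommGroup M]
    [Module ℂ M] [LieRingModule F M] [LieModule ℂ F M] {S : Set (LieSubmodule ℂ F M)}
    (hS : ∀ N ∈ S, FiniteDimensional ℂ N) {m : M} (hm : m ∈ sSup S) :
    ∃ C : LieSubmodule ℂ F M, FiniteDimensional ℂ C ∧ m ∈ C := by
  change m ∈ (sSup S).toSubmodule at hm
  rw [LieSubmodule.sSup_toSubmodule_eq_iSup, iSup_subtype'] at hm
  induction hm using Submodule.iSup_induction' with
  | mem N m hm => exact ⟨N, hS N N.2, hm⟩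
  | zero => exact ⟨⊥, inferInstanceAs (FiniteDimensional ℂ (⊥ : Submodule ℂ M)), zero_mem _⟩
  | add x y _ _ hx hy =>
    obtain ⟨C, _, hC⟩ := hx
    obtain ⟨C', _, hC'⟩ := hy
    refine ⟨C ⊔ C', ?_, add_mem ((le_sup_left : C ≤ C ⊔ C') hC) ((le_sup_right : C' ≤ C ⊔ C') hC')⟩
    have : FiniteDimensional ℂ (C.toSubmodule ⊔ C'.toSubmodule : Submodule ℂ M) := inferInstance
    rwa [← LieSubmodule.sup_toSubmodule] at this

/-- Endomorphisms act on the composition factors through scalars, if the multiplicities over a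
subalgebra are finite. -/
theorem IsFinMult.exists_scalar (h : IsFinMult f M) {N N' : LieSubmodule ℂ L M} (hN : N ⋖ N')
    (z : M →ₗ⁅ℂ,L⁆ M) (hzN : ∀ m ∈ N, z m ∈ N) (hzN' : ∀ m ∈ N', z m ∈ N') :
    ∃ c : ℂ, ∀ m ∈ N', z m - c • m ∈ N := by
  obtain ⟨m, hm', hm⟩ := SetLike.exists_of_lt hN.lt
  let N'f : LieSubmodule ℂ f M := { __ := N'.toSubmodule, lie_mem := fun {a x} hx ↦ N'.lie_mem hx }
  obtain ⟨C₀, hC₀, hmC₀⟩ : ∃ C : LieSubmodule ℂ f M, FiniteDimensional ℂ C ∧ m ∈ C := by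
    obtain ⟨S, -, htop, hS, -⟩ := h
    exact mem_sSup_exists_finite (fun N hN ↦ (hS N hN).2) (by rw [htop]; trivial)
  set C := C₀ ⊓ N'f
  have hC : FiniteDimensional ℂ C :=
    Submodule.finiteDimensional_of_le (show C.toSubmodule ≤ C₀.toSubmodule from inf_le_left)
  obtain ⟨T, hT, hφT⟩ := h.exists_finite C
  -- The span of the images in `N'` of a finite dimensional `C` containing `m` is finite dimensional
  -- by finite multiplicity, stable under `z`, and not contained in `N`. So `z` has an eigenvalue on
  -- the quotient of `X` by its part in `N`, which replaces a countable dimension argument in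
  -- Schur's lemma.
  let X : Submodule ℂ M :=
    Submodule.span ℂ {x | ∃ (φ : C →ₗ⁅ℂ,f⁆ M) (c : C), (∀ c, φ c ∈ N') ∧ φ c = x}
  have hX : FiniteDimensional ℂ X := by
    refine Submodule.finiteDimensional_of_le (S₂ := T) (Submodule.span_le.2 ?_)
    rintro _ ⟨φ, c, -, rfl⟩
    exact hφT φ c
  have hXN' : X ≤ N'.toSubmodule := by
    refine Submodule.span_le.2 ?_
    rintro _ ⟨φ, c, hφ, rfl⟩
    exact hφ c
  have hmX : m ∈ X := Submodule.subset_span ⟨C.incl, ⟨m, hmC₀, hm'⟩, fun c ↦ c.2.2, rfl⟩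
  have hzX : ∀ x ∈ X, z x ∈ X := by
    intro x hx
    induction hx using Submodule.span_induction with
    | zero => rw [map_zero]; exact zero_mem _
    | add x y _ _ hx hy => rw [map_add]; exact add_mem hx hy
    | smul c x _ hx => rw [map_smul]; exact Submodule.smul_mem _ _ hx
    | mem x hx =>
      obtain ⟨φ, c, hφ, rfl⟩ := hx
      let zf : M →ₗ⁅ℂ,f⁆ M := { __ := (z : M →ₗ[ℂ] M), map_lie' := fun {a x} ↦ z.map_lie (a : L) x }
      exact Submodule.subset_span ⟨zf.comp φ, c, fun c ↦ hzN' _ (hφ c), rfl⟩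
  let Z : X →ₗ[ℂ] X := (z : M →ₗ[ℂ] M).restrict hzX
  let P : Submodule ℂ X := N.toSubmodule.comap X.subtype
  let Zq : (X ⧸ P) →ₗ[ℂ] (X ⧸ P) := P.mapQ P Z (fun x hx ↦ hzN _ hx)
  have hnt : Nontrivial (X ⧸ P) := by
    refine ⟨P.mkQ ⟨m, hmX⟩, 0, fun h ↦ hm ?_⟩
    exact (Submodule.Quotient.mk_eq_zero P).1 h
  obtain ⟨c, hc⟩ := Module.End.exists_eigenvalue Zq
  obtain ⟨x, hx, hx0⟩ := hc.exists_hasEigenvector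
  rw [Module.End.mem_eigenspace_iff] at hx
  obtain ⟨x, rfl⟩ := P.mkQ_surjective x
  have hxN : (x : M) ∉ N := fun h ↦ hx0 ((Submodule.Quotient.mk_eq_zero P).2 h)
  have hxc : z x - c • (x : M) ∈ N := by
    have : P.mkQ (Z x - c • x) = 0 := by
      rw [map_sub, map_smul, sub_eq_zero]
      exact hx
    exact (Submodule.Quotient.mk_eq_zero P).1 this
  -- The elements of `N'` on which `z` is `c` modulo `N` form a submodule strictly larger than `N`,
  -- hence all of `N'` as there is nothing in between.
  let Q : LieSubmodule ℂ L M :=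
    { __ := (N.toSubmodule.comap ((z : M →ₗ[ℂ] M) - c • LinearMap.id)) ⊓ N'.toSubmodule
      lie_mem := fun {a m} hm ↦ by
        obtain ⟨h1, h2⟩ := hm
        refine ⟨?_, N'.lie_mem h2⟩
        change z ⁅a, m⁆ - c • ⁅a, m⁆ ∈ N
        rw [LieModuleHom.map_lie, ← lie_smul, ← lie_sub]
        exact N.lie_mem h1 }
  have hQ : Q = N' := by
    refine ((hN.eq_or_eq (c := Q) (fun m hm ↦ ⟨?_, hN.le hm⟩) (fun m hm ↦ hm.2))).resolve_left ?_
    · exact N.sub_mem (hzN m hm) (N.smul_mem c hm)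
    · intro h
      exact hxN (by rw [← h]; exact ⟨hxc, hXN' x.2⟩)
  refine ⟨c, fun m hm ↦ ?_⟩
  rw [← hQ] at hm
  exact hm.1

open LieAlgebra in
theorem IsFinMult.exists_central_scalar [FiniteDimensional ℂ L] [IsKilling ℂ L]
    (h : IsFinMult f M) {N N' : LieSubmodule ℂ L M} (hN : N ⋖ N') (k : ℕ) :
    ∃ c : ℂ, ∀ m ∈ N', uact M (zc L k) m - c • m ∈ N :=
  h.exists_scalar hN { __ := uact M (zc L k), map_lie' := fun {x y} ↦ uact_zc_lie k x y }
    (fun _ hm ↦ uact_mem _ N hm) (fun _ hm ↦ uact_mem _ N' hm)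

variable {E : Type*} [AddCommGroup E] [Module ℂ E] [LieRingModule L E] [LieModule ℂ L E]

theorem IsFinMult.isLocSep_image (h : IsFinMult f M) :
    IsLocSep (LieModule.toEnd ℂ L M '' f) := by
  refine h.isLocSep.mono ?_
  rintro _ ⟨a, rfl⟩
  exact ⟨a, a.2, rfl⟩

theorem IsFinMult.isLocSep_image_tensor [FiniteDimensional ℂ L] (hf : IsReductiveIn f)
    [FiniteDimensional ℂ E] (hE : IsFinSemisimple f E) (h : IsFinMult f M) :
    IsLocSep (LieModule.toEnd ℂ L (E ⊗[ℂ] M) '' f) := by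
  have := hf.complementedLattice
  have h1 := h.isLocSep_tensor hE
  refine h1.mono ?_
  rintro _ ⟨a, rfl⟩
  refine ⟨a, a.2, ?_⟩
  refine TensorProduct.ext' fun e m ↦ ?_
  exact (TensorProduct.LieModule.lie_tmul_right (a : L) e m).trans
    (TensorProduct.LieModule.lie_tmul_right a e m).symm

/-- The descending condition comes from `E ⊗ M` being Noetherian. For the ascending one the dual of
`M`, which is Noetherian because `M` is Artinian, is tensored with `E*`. -/
theorem wellFounded_finDual_tensor [FiniteDimensional ℂ L] (hf : IsReductiveIn f)
    [FiniteDimensional ℂ E] (hE : IsFinSemisimple f E) (h : IsFinMult f M)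
    (hM : HasFiniteLength L M) :
    WellFoundedLT (LieSubmodule ℂ L (finDual f (E ⊗[ℂ] M))) ∧
      WellFoundedGT (LieSubmodule ℂ L (finDual f (E ⊗[ℂ] M))) := by
  have := hM.wellFoundedGT
  have := hM.wellFoundedLT
  have := wellFoundedGT_tensor (L := L) (Y := M) E
  have := wellFoundedGT_finDual h.isLocSep_image
  exact ⟨wellFoundedLT_finDual (h.isLocSep_image_tensor hf hE), wellFoundedGT_finDual_tensor⟩

theorem IsFinSemisimple.tensor_of_isReductiveIn [FiniteDimensional ℂ L] (hf : IsReductiveIn f)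
    [FiniteDimensional ℂ E] (hE : IsFinSemisimple f E) (hM : IsFinSemisimple f M)
    {X : Type*} [AddCommGroup X] [Module ℂ X] [LieRingModule L X] [LieModule ℂ L X]
    (e : E ⊗[ℂ] M →ₗ⁅ℂ,L⁆ X) (he : Function.Surjective e) : IsFinSemisimple f X := by
  have := hf.complementedLattice
  have h := hE.tensor hM
  rw [IsFinSemisimple, eq_top_iff]
  intro x _
  obtain ⟨w, rfl⟩ := he x
  refine h.map_mem { __ := (e : E ⊗[ℂ] M →ₗ[ℂ] X), map_lie' := fun {a w} ↦ ?_ } w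
  change e ⁅a, w⁆ = ⁅(a : L), e w⁆
  rw [← LieModuleHom.map_lie]
  congr 1

end Central

end AffineKM

namespace AffineKM

/-! ### The Sugawara operators -/

section CasimirAdjoint

open LieAlgebra LieAlgebra.IsKilling LieModule

variable {L : Type*} [LieRing L] [LieAlgebra ℂ L] [FiniteDimensional ℂ L] [IsKilling ℂ L]

theorem killSum_trace (T : Module.End ℂ L) :
    killSum ((killingForm ℂ L).flip ∘ₗ T) = LinearMap.trace ℂ L T := by
  set x := Module.finBasis ℂ L
  rw [LinearMap.trace_eq_matrix_trace ℂ x, Matrix.trace, killSum]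
  refine Finset.sum_congr rfl fun i _ ↦ ?_
  rw [Matrix.diag_apply, LinearMap.toMatrix_apply]
  change killingForm ℂ L (LinearMap.BilinForm.dualBasis (killingForm ℂ L)
    (IsKilling.killingForm_nondegenerate ℂ L) x i) (T (x i)) = _
  have h : killingForm ℂ L (LinearMap.BilinForm.dualBasis (killingForm ℂ L)
      (IsKilling.killingForm_nondegenerate ℂ L) x i) = x.coord i := by
    refine x.ext fun j ↦ ?_
    have := LinearMap.BilinForm.apply_dualBasis_left
      (IsKilling.killingForm_nondegenerate ℂ L) x i j
    rw [this, Module.Basis.coord_apply, Module.Basis.repr_self, Finsupp.single_apply]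
  rw [h]
  rfl

/-- The Casimir operator of the adjoint representation is the identity. -/
theorem casimir_self (y : L) : casimir (L := L) L y = y := by
  have hK : ∀ a x z : L, killingForm ℂ L ⁅a, x⁆ z = -killingForm ℂ L x ⁅a, z⁆ := fun a x z ↦
    LieModule.traceForm_lieInvariant ℂ L L a x z
  have key : ∀ z, killingForm ℂ L (casimir (L := L) L y) z = killingForm ℂ L y z := by
    intro z
    have h1 : killingForm ℂ L (casimir (L := L) L y) z = killSum ((mulMap
        (toEnd ℂ L L : L →ₗ[ℂ] Module.End ℂ L) (toEnd ℂ L L : L →ₗ[ℂ] Module.End ℂ L)).compr₂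
        ((killingForm ℂ L).flip z ∘ₗ LinearMap.applyₗ y)) :=
      map_killSum ((killingForm ℂ L).flip z ∘ₗ LinearMap.applyₗ y) _
    -- The Killing form is the trace of `ad y ad z`, and a trace is a contraction with the canonical
    -- tensor; invariance then matches this contraction with the Casimir operator.
    have h2 : killingForm ℂ L y z = killSum ((killingForm ℂ L).flip ∘ₗ (ad ℂ L y * ad ℂ L z)) := by
      rw [killSum_trace]
      rfl
    rw [h1, h2]
    congr 1
    ext a a'
    change killingForm ℂ L ⁅a, ⁅a', y⁆⁆ z = killingForm ℂ L a' ⁅y, ⁅z, a⁆⁆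
    rw [hK, ← lie_skew a' y, map_neg, LinearMap.neg_apply, neg_neg, hK, ← lie_skew a z, lie_neg,
      map_neg, neg_neg]
  have h := IsKilling.killingForm_nondegenerate ℂ L
  refine sub_eq_zero.1 (h.1 _ fun z ↦ ?_)
  rw [map_sub, LinearMap.sub_apply, key, sub_self]

end CasimirAdjoint

/-! ### Truncated Sugawara operators and their commutators with the modes `x t`. -/

section Sugawara

open LieAlgebra LieModule

variable {𝔤 : Type*} [LieRing 𝔤] [LieAlgebra ℂ 𝔤] (B : InvForm 𝔤)
  (V : Type*) [AddCommGroup V] [Module ℂ V] [LieRingModule (Affine B) V] [LieModule ℂ (Affine B) V]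

/-- The operators `x tⁿ`. -/
def curEnd (n : ℤ) : 𝔤 →ₗ[ℂ] Module.End ℂ V :=
  (toEnd ℂ (Affine B) V : Affine B →ₗ[ℂ] Module.End ℂ V) ∘ₗ Affine.cur B n

variable {V}

theorem curEnd_apply (n : ℤ) (x : 𝔤) (v : V) : curEnd B V n x v = ⁅Affine.cur B n x, v⁆ := rfl

variable {B} {k : ℂ}

theorem curEnd_mul (hk : ∀ v : V, ⁅Affine.K B, v⁆ = k • v) (n m : ℤ) (x y : 𝔤) :
    curEnd B V n x * curEnd B V m y = curEnd B V m y * curEnd B V n x + curEnd B V (n + m) ⁅x, y⁆ +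
      (if n = -m then (n : ℂ) * B.form x y * k else 0) • 1 := by
  ext v
  change ⁅Affine.cur B n x, ⁅Affine.cur B m y, v⁆⁆ = ⁅Affine.cur B m y, ⁅Affine.cur B n x, v⁆⁆ +
    ⁅Affine.cur B (n + m) ⁅x, y⁆, v⁆ + (if n = -m then (n : ℂ) * B.form x y * k else 0) • v
  rw [leibniz_lie, Affine.lie_cur_cur, add_lie, smul_lie, hk, smul_smul]
  split_ifs
  · abel
  · rw [zero_mul]; abel

variable [FiniteDimensional ℂ 𝔤] [IsKilling ℂ 𝔤]

variable (B V) in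
/-- The operators `∑ xₐ t⁻ʲ x'ₐ tʲ`. -/
def sug (j : ℕ) : Module.End ℂ V := killSum (mulMap (curEnd B V (-j)) (curEnd B V j))

variable (B V) in
/-- The remainders `∑ xₐ t⁻ʲ [x, x'ₐ] tʲ⁺¹`. -/
def sugRem (j : ℕ) (x : 𝔤) : Module.End ℂ V :=
  killSum (mulMap (curEnd B V (-j)) (curEnd B V (j + 1) ∘ₗ ad ℂ 𝔤 x))

theorem killSum_mulMap_ad {A : Type*} [Ring A] [Algebra ℂ A] (f g : 𝔤 →ₗ[ℂ] A) (x : 𝔤) :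
    killSum (mulMap (f ∘ₗ ad ℂ 𝔤 x) g) = -killSum (mulMap f (g ∘ₗ ad ℂ 𝔤 x)) :=
  eq_neg_of_add_eq_zero_left (killSum_lie x (mulMap f g))

theorem killSum_mulMap_add_left {A : Type*} [Ring A] [Algebra ℂ A] (f f' g : 𝔤 →ₗ[ℂ] A) :
    killSum (mulMap (f + f') g) = killSum (mulMap f g) + killSum (mulMap f' g) := by
  rw [← killSum_add]
  congr 1
  ext
  simp [add_mul]

theorem killSum_form_smul {A : Type*} [Ring A] [Algebra ℂ A] (g : 𝔤 →ₗ[ℂ] A) (x : 𝔤) :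
    killSum (mulMap ((killingForm ℂ 𝔤 x).smulRight (1 : A)) g) = g x := by
  conv_rhs => rw [← killSum_basis x, map_sum]
  simp [killSum]

/-- Two defects appear. Moving the positive mode of one of them to the right produces the Casimir
operator of the adjoint representation, that is, the identity: the source of the summand `1` in `2 c
k + 1`. -/
theorem curEnd_sug_zero (hk : ∀ v : V, ⁅Affine.K B, v⁆ = k • v) (x : 𝔤) :
    curEnd B V 1 x * sug B V 0 = sug B V 0 * curEnd B V 1 x + (2 : ℂ) • sugRem B V 0 x +
      curEnd B V 1 x := by
  have h := killSum_mulMap_commutator (curEnd B V 0) (curEnd B V 0) (curEnd B V 1 x) 0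
    (curEnd B V 1 ∘ₗ ad ℂ 𝔤 x) (curEnd B V 1 ∘ₗ ad ℂ 𝔤 x)
    (fun y ↦ by rw [curEnd_mul hk]; simp) (fun y ↦ by rw [curEnd_mul hk]; simp)
  have h1 : killSum (mulMap (curEnd B V 1 ∘ₗ ad ℂ 𝔤 x) (curEnd B V 0)) =
      killSum (mulMap (curEnd B V 0) (curEnd B V 1 ∘ₗ ad ℂ 𝔤 x)) + curEnd B V 1 x := by
    have h2 : killSum (mulMap (curEnd B V 0) (curEnd B V 1 ∘ₗ ad ℂ 𝔤 x)) =
        killSum (mulMap (curEnd B V 1 ∘ₗ ad ℂ 𝔤 x) (curEnd B V 0)).flip +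
        killSum ((toEnd ℂ 𝔤 𝔤 : 𝔤 →ₗ[ℂ] Module.End ℂ 𝔤).compl₂ (ad ℂ 𝔤 x) |>.compr₂
          (curEnd B V 1)) := by
      rw [← killSum_add]
      congr 1
      ext y z : 2
      change curEnd B V 0 y * curEnd B V 1 ⁅x, z⁆ =
        curEnd B V 1 ⁅x, z⁆ * curEnd B V 0 y + curEnd B V 1 ⁅y, ⁅x, z⁆⁆
      rw [curEnd_mul hk]
      simp
    have h3 : killSum ((toEnd ℂ 𝔤 𝔤 : 𝔤 →ₗ[ℂ] Module.End ℂ 𝔤).compl₂ (ad ℂ 𝔤 x) |>.compr₂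
          (curEnd B V 1)) = - curEnd B V 1 x := by
      rw [← map_killSum]
      conv_rhs => rw [← casimir_self x, ← map_neg]
      congr 1
      have : casimir (L := 𝔤) 𝔤 x = _ := map_killSum (LinearMap.applyₗ x) _
      rw [this, ← neg_one_smul ℂ, ← killSum_smul]
      congr 1
      ext y z
      change ⁅y, ⁅x, z⁆⁆ = (-1 : ℂ) • ⁅y, ⁅z, x⁆⁆
      rw [neg_one_smul, ← lie_skew z x, lie_neg, neg_neg]
    rw [killSum_flip, h3] at h2
    rw [h2]
    abel
  rw [h1] at h
  have e0 : sug B V 0 = killSum (mulMap (curEnd B V 0) (curEnd B V 0)) := by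
    rw [sug, Nat.cast_zero, neg_zero]
  have e1 : sugRem B V 0 x = killSum (mulMap (curEnd B V 0) (curEnd B V 1 ∘ₗ ad ℂ 𝔤 x)) := by
    rw [sugRem, Nat.cast_zero, neg_zero, zero_add]
  rw [e0, e1, h, two_smul]
  abel

/-- The defects are the remainders of index `j + 1` and `j`, with opposite signs, so that they
telescope. The central term occurs only when `x t` meets `t⁻¹`, that is, for `j = 0`. -/
theorem curEnd_sug_succ (hk : ∀ v : V, ⁅Affine.K B, v⁆ = k • v) {c : ℂ}
    (hB : B.form = c • killingForm ℂ 𝔤) (j : ℕ) (x : 𝔤) :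
    curEnd B V 1 x * sug B V (j + 1) = sug B V (j + 1) * curEnd B V 1 x + sugRem B V (j + 1) x -
      sugRem B V j x + (if j = 0 then c * k else 0) • curEnd B V 1 x := by
  have h := killSum_mulMap_commutator (curEnd B V (-(j + 1 : ℕ))) (curEnd B V (j + 1 : ℕ))
    (curEnd B V 1 x) 0
    (curEnd B V (-j) ∘ₗ ad ℂ 𝔤 x + (if j = 0 then c * k else 0) •
      (killingForm ℂ 𝔤 x).smulRight (1 : Module.End ℂ V))
    (curEnd B V ((j + 1 : ℕ) + 1) ∘ₗ ad ℂ 𝔤 x)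
    (fun y ↦ by
      rw [curEnd_mul hk, show (1 : ℤ) + -((j + 1 : ℕ) : ℤ) = -j by push_cast; ring, hB]
      by_cases hj : j = 0
      · subst hj
        simp [smul_smul, add_assoc, mul_right_comm c]
      · rw [if_neg (by push_cast; omega), if_neg hj]
        simp)
    (fun y ↦ by
      rw [curEnd_mul hk, if_neg (by push_cast; omega), add_comm (1 : ℤ)]
      simp)
  rw [killSum_mulMap_add_left, killSum_mulMap_ad] at h
  have h1 : killSum (mulMap ((if j = 0 then c * k else 0) •
      (killingForm ℂ 𝔤 x).smulRight (1 : Module.End ℂ V)) (curEnd B V (j + 1 : ℕ))) =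
      (if j = 0 then c * k else 0) • curEnd B V 1 x := by
    by_cases hj : j = 0
    · subst hj
      rw [if_pos rfl, zero_add, Nat.cast_one, ← killSum_form_smul (curEnd B V 1) x, ← killSum_smul]
      congr 1
    · rw [if_neg hj, zero_smul, zero_smul]
      simp [killSum]
  rw [h1] at h
  change curEnd B V 1 x * sug B V (j + 1) = sug B V (j + 1) * curEnd B V 1 x +
    (-sugRem B V j x + _) + sugRem B V (j + 1) x at h
  rw [h]
  abel

variable (B V) in
/-- The truncated Sugawara operators. -/
def sugSum (n : ℕ) : Module.End ℂ V := sug B V 0 + (2 : ℂ) • ∑ j ∈ Finset.range n, sug B V (j + 1)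

theorem sugSum_succ (n : ℕ) : sugSum B V (n + 1) = sugSum B V n + (2 : ℂ) • sug B V (n + 1) := by
  rw [sugSum, sugSum, Finset.sum_range_succ, smul_add, add_assoc]

/-- Telescoping leaves a single remainder, whose index exceeds the order of the vectors it will be
applied to. -/
theorem curEnd_sugSum (hk : ∀ v : V, ⁅Affine.K B, v⁆ = k • v) {c : ℂ}
    (hB : B.form = c • killingForm ℂ 𝔤) (n : ℕ) (x : 𝔤) :
    curEnd B V 1 x * sugSum B V (n + 1) = sugSum B V (n + 1) * curEnd B V 1 x +
      (2 : ℂ) • sugRem B V (n + 1) x + (2 * c * k + 1) • curEnd B V 1 x := by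
  induction n with
  | zero =>
    rw [sugSum_succ, sugSum, Finset.sum_range_zero, smul_zero, add_zero, mul_add, curEnd_sug_zero hk,
      mul_smul_comm, curEnd_sug_succ hk hB, if_pos rfl, add_mul, smul_mul_assoc]
    module
  | succ n ih =>
    rw [sugSum_succ, mul_add, ih, mul_smul_comm, curEnd_sug_succ hk hB, if_neg (by omega), add_mul,
      smul_mul_assoc]
    module

end Sugawara

end AffineKM

namespace AffineKM

/-! ### Smooth vectors and jets of functionals -/

section Annihilated

open LieAlgebra LieModule

variable {𝔤 : Type*} [LieRing 𝔤] [LieAlgebra ℂ 𝔤] [FiniteDimensional ℂ 𝔤] [IsSimple ℂ 𝔤]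
  {B : InvForm 𝔤} {V : Type*} [AddCommGroup V] [Module ℂ V] [LieRingModule (Affine B) V]
  [LieModule ℂ (Affine B) V]

/-- A mode of degree `-j` raises the order by at most `j`: commuting with `x t` lowers either `j` or
the order, whence the double induction. -/
theorem cur_neg_mem_annih (j m : ℕ) (x : 𝔤) {v : V} (hv : v ∈ annih B V m) :
    ⁅Affine.cur B (-j) x, v⁆ ∈ annih B V (m + j) := by
  induction j generalizing m x v with
  | zero =>
    induction m generalizing x v with
    | zero =>
      rw [annih_zero, Submodule.mem_bot] at hv
      rw [hv, lie_zero]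
      exact zero_mem _
    | succ m ih =>
      refine mem_annih_succ B fun a ↦ ?_
      have ha := lie_mem_annih B le_rfl a hv
      rw [leibniz_lie, Affine.lie_cur_cur, if_neg (by simp), zero_smul, add_zero]
      refine add_mem ?_ (ih x ha)
      simpa using lie_mem_annih B le_rfl ⁅a, x⁆ hv
  | succ j ihj =>
    induction m generalizing x v with
    | zero =>
      rw [annih_zero, Submodule.mem_bot] at hv
      rw [hv, lie_zero]
      exact zero_mem _
    | succ m ih =>
      change _ ∈ annih B V ((m + 1 + j) + 1)
      refine mem_annih_succ B fun a ↦ ?_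
      have ha := lie_mem_annih B le_rfl a hv
      rw [leibniz_lie, Affine.lie_cur_cur, add_lie, smul_lie]
      refine add_mem (add_mem ?_ (Submodule.smul_mem _ _ ?_)) ?_
      · have e : (1 : ℤ) + -((j + 1 : ℕ) : ℤ) = -(j : ℤ) := by push_cast; ring
        rw [e]
        exact annih_mono B (by omega) (ihj (m + 1) _ hv)
      · exact annih_mono B (by omega) (lie_K_mem_annih B _ hv)
      · exact annih_mono B (by omega) (ih x ha)

theorem cur_one_mem_annih {n : ℕ} (x : 𝔤) {v : V} (hv : v ∈ annih B V (n + 1)) :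
    ⁅Affine.cur B 1 x, v⁆ ∈ annih B V n := lie_mem_annih B le_rfl x hv

theorem cur_eq_zero_of_mem_annih {n j : ℕ} (hj : 1 ≤ j) (hn : n ≤ j) (x : 𝔤) {v : V}
    (hv : v ∈ annih B V n) : ⁅Affine.cur B j x, v⁆ = 0 := by
  have h := lie_mem_annih B hj x (N := 0) (annih_mono B (by omega : n ≤ 0 + j) hv)
  rwa [annih_zero, Submodule.mem_bot] at h

theorem killSum_apply_mem {f g : 𝔤 →ₗ[ℂ] Module.End ℂ V} (S : Submodule ℂ V) {v : V}
    (h : ∀ x y, f x (g y v) ∈ S) : killSum (mulMap f g) v ∈ S := by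
  have := map_killSum (LinearMap.applyₗ v : Module.End ℂ V →ₗ[ℂ] V) (mulMap f g)
  rw [LinearMap.applyₗ_apply_apply] at this
  rw [this]
  exact killSum_mem _ _ h

theorem sug_mem_annih (n j : ℕ) {v : V} (hv : v ∈ annih B V n) : sug B V j v ∈ annih B V n := by
  refine killSum_apply_mem _ fun x y ↦ ?_
  change ⁅Affine.cur B (-j) x, ⁅Affine.cur B j y, v⁆⁆ ∈ _
  rcases Nat.eq_zero_or_pos j with rfl | hj
  · exact cur_neg_mem_annih 0 n x (cur_neg_mem_annih 0 n y hv)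
  · rcases le_total n j with h | h
    · rw [cur_eq_zero_of_mem_annih hj h y hv, lie_zero]
      exact zero_mem _
    · obtain ⟨m, rfl⟩ := Nat.exists_eq_add_of_le' h
      exact cur_neg_mem_annih j m x (lie_mem_annih B hj y hv)

theorem sug_mem (W : LieSubmodule ℂ (Affine B) V) (j : ℕ) {v : V} (hv : v ∈ W) :
    sug B V j v ∈ W :=
  killSum_apply_mem W.toSubmodule fun _ _ ↦ W.lie_mem (W.lie_mem hv)

/-- The positive mode acts first and lowers the order, so the vector enters `W`, which is stable
under the negative mode that follows. -/
theorem sug_succ_mem {W W' : LieSubmodule ℂ (Affine B) V} {n : ℕ}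
    (hW : ∀ v ∈ W', v ∈ annih B V n → v ∈ W) (j : ℕ) {v : V} (hv : v ∈ W')
    (hvn : v ∈ annih B V (n + 1)) : sug B V (j + 1) v ∈ W := by
  refine killSum_apply_mem W.toSubmodule fun x y ↦ W.lie_mem (hW _ (W'.lie_mem hv) ?_)
  exact lie_mem_annih B (by omega) y (annih_mono B (by omega) hvn)

theorem sug_eq_zero {n j : ℕ} (h : n ≤ j) (hj : 1 ≤ j) {v : V} (hv : v ∈ annih B V n) :
    sug B V j v = 0 := by
  rw [← Submodule.mem_bot ℂ]
  refine killSum_apply_mem _ fun x y ↦ ?_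
  change ⁅Affine.cur B (-j) x, ⁅Affine.cur B j y, v⁆⁆ ∈ _
  rw [cur_eq_zero_of_mem_annih hj h y hv, lie_zero]
  exact zero_mem _

theorem sugSum_mem_annih (n j : ℕ) {v : V} (hv : v ∈ annih B V n) :
    sugSum B V j v ∈ annih B V n := by
  rw [sugSum, LinearMap.add_apply, LinearMap.smul_apply, LinearMap.sum_apply]
  exact add_mem (sug_mem_annih _ _ hv)
    (Submodule.smul_mem _ _ (Submodule.sum_mem _ fun _ _ ↦ sug_mem_annih _ _ hv))

/-- On vectors of order `n + 2` the remainder vanishes, and the last summand of the truncation dies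
once `x t` has been applied. Truncation and order thus drop together. -/
theorem cur_sugSum {k : ℂ} (hk : ∀ v : V, ⁅Affine.K B, v⁆ = k • v) {c : ℂ}
    (hB : B.form = c • killingForm ℂ 𝔤) (n : ℕ) (x : 𝔤) {v : V} (hv : v ∈ annih B V (n + 2)) :
    ⁅Affine.cur B 1 x, sugSum B V (n + 1) v⁆ =
      sugSum B V n ⁅Affine.cur B 1 x, v⁆ + (2 * c * k + 1) • ⁅Affine.cur B 1 x, v⁆ := by
  have h := LinearMap.congr_fun (curEnd_sugSum hk hB n x) v
  have h1 : sugRem B V (n + 1) x v = 0 := by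
    rw [← Submodule.mem_bot ℂ]
    refine killSum_apply_mem _ fun y z ↦ ?_
    have : curEnd B V ((n + 1 : ℕ) + 1) ⁅x, z⁆ v = 0 :=
      cur_eq_zero_of_mem_annih (j := n + 2) (by omega) le_rfl ⁅x, z⁆ hv
    rw [LinearMap.comp_apply, ad_apply, this, map_zero]
    exact zero_mem _
  have h2 : sug B V (n + 1) ⁅Affine.cur B 1 x, v⁆ = 0 :=
    sug_eq_zero le_rfl (by omega) (lie_mem_annih B le_rfl x hv)
  simp only [Module.End.mul_apply, LinearMap.add_apply, LinearMap.smul_apply, curEnd_apply, h1,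
    smul_zero, add_zero] at h
  rw [h, sugSum_succ, LinearMap.add_apply, LinearMap.smul_apply, h2, smul_zero, add_zero]

end Annihilated

/-! ### Jets of functionals. -/

section Jets

open LieAlgebra LieAlgebra.IsKilling LieModule Module

theorem isFinSemisimple_of_finrank_eq_one {F X : Type*} [LieRing F] [LieAlgebra ℂ F]
    [AddCommGroup X] [Module ℂ X] [LieRingModule F X] [LieModule ℂ F X]
    (h : finrank ℂ X = 1) : IsFinSemisimple F X := by
  have hfin : FiniteDimensional ℂ X := Module.finite_of_finrank_eq_succ h
  have hnt : Nontrivial X := Module.nontrivial_of_finrank_pos (R := ℂ) (by omega)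
  have hnt : Nontrivial (LieSubmodule ℂ F X) := (LieSubmodule.nontrivial_iff ℂ F X).2 hnt
  refine top_le_iff.1 (le_sSup ⟨⟨top_ne_bot, fun N hN ↦ ?_⟩, inferInstance⟩)
  have h1 : finrank ℂ N.toSubmodule < finrank ℂ X := Submodule.finrank_lt fun h ↦
    hN.ne (LieSubmodule.toSubmodule_injective h)
  rw [h, Nat.lt_one_iff, Submodule.finrank_eq_zero] at h1
  exact LieSubmodule.toSubmodule_injective h1

universe u

variable {𝔤 : Type u} [LieRing 𝔤] [LieAlgebra ℂ 𝔤] [FiniteDimensional ℂ 𝔤] [IsSimple ℂ 𝔤]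
  {B : InvForm 𝔤} {V : Type*} [AddCommGroup V] [Module ℂ V] [LieRingModule (Affine B) V]
  [LieModule ℂ (Affine B) V]
  {M : Type*} [AddCommGroup M] [Module ℂ M] [LieRingModule 𝔤 M] [LieModule ℂ 𝔤 M]
  {E : Type*} [AddCommGroup E] [Module ℂ E] [LieRingModule 𝔤 E] [LieModule ℂ 𝔤 E]

/-- The Casimir operator is its own transpose: the two signs cancel, and the reversal of the factors
is absorbed by the symmetry of the canonical tensor. -/
theorem map_sug_zero {Y : Type*} [AddCommGroup Y] [Module ℂ Y] [LieRingModule 𝔤 Y]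
    [LieModule ℂ 𝔤 Y] (Φ : V →ₗ[ℂ] Dual ℂ Y)
    (hΦ : ∀ (y : 𝔤) v, Φ ⁅Affine.cur B 0 y, v⁆ = ⁅y, Φ v⁆) (v : V) (w : Y) :
    Φ (sug B V 0 v) w = Φ v (casimir (L := 𝔤) Y w) := by
  have h1 := map_killSum (LinearMap.applyₗ w ∘ₗ Φ ∘ₗ LinearMap.applyₗ v)
    (mulMap (curEnd B V (-(0 : ℕ))) (curEnd B V (0 : ℕ)))
  have h2 := map_killSum (Φ v ∘ₗ LinearMap.applyₗ w) (mulMap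
    (toEnd ℂ 𝔤 Y : 𝔤 →ₗ[ℂ] Module.End ℂ Y) (toEnd ℂ 𝔤 Y : 𝔤 →ₗ[ℂ] Module.End ℂ Y))
  refine h1.trans (Eq.trans ?_ h2.symm)
  rw [← killSum_flip]
  congr 1
  ext x y
  change Φ ⁅Affine.cur B 0 y, ⁅Affine.cur B 0 x, v⁆⁆ w = Φ v ⁅x, ⁅y, w⁆⁆
  rw [hΦ, hΦ, Dual.lie_apply, Dual.lie_apply, neg_neg]

variable (B) in
/-- The jet of next order. -/
def jetSucc (Φ : V →ₗ[ℂ] Dual ℂ (E ⊗[ℂ] M)) : V →ₗ[ℂ] Dual ℂ ((𝔤 ⊗[ℂ] E) ⊗[ℂ] M) where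
  toFun v := TensorProduct.lift (Φ ∘ₗ (curEnd B V 1).flip v) ∘ₗ
    (TensorProduct.assoc ℂ 𝔤 E M).toLinearMap
  map_add' v w := by
    refine TensorProduct.ext_threefold fun x e m ↦ ?_
    simp
  map_smul' c v := by
    refine TensorProduct.ext_threefold fun x e m ↦ ?_
    simp

theorem jetSucc_tmul (Φ : V →ₗ[ℂ] Dual ℂ (E ⊗[ℂ] M)) (v : V) (x : 𝔤) (e : E) (m : M) :
    jetSucc B Φ v ((x ⊗ₜ e) ⊗ₜ m) = Φ ⁅Affine.cur B 1 x, v⁆ (e ⊗ₜ m) := rfl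

variable {H : LieSubalgebra ℂ 𝔤} [H.IsCartanSubalgebra] {f : LieSubalgebra ℂ 𝔤}

/-- The properties of the jets of order `n`. -/
structure IsJet (B : InvForm 𝔤) (H f : LieSubalgebra ℂ 𝔤) [H.IsCartanSubalgebra] (s : ℂ) (n : ℕ)
    (Φ : V →ₗ[ℂ] Dual ℂ (E ⊗[ℂ] M)) [LieRingModule (Affine B) V] [LieModule ℂ (Affine B) V] :
    Prop where
  finite : FiniteDimensional ℂ E
  isWeightModule : IsWeightModule H E (rootLattice H : Set (Dual ℂ H))
  isFinSemisimple : IsFinSemisimple f E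
  map_lie : ∀ (y : 𝔤) v, Φ ⁅Affine.cur B 0 y, v⁆ = ⁅y, Φ v⁆
  map_eq_zero : ∀ v ∈ annih B V n, Φ v = 0
  mem_annih : ∀ v ∈ annih B V (n + 1), Φ v = 0 → v ∈ annih B V n
  -- Up to the shift `n s`, the Sugawara operator acts on jets of order `n` only through the factor
  -- `M`.
  map_sugSum : ∀ v ∈ annih B V (n + 1), ∀ w, Φ (sugSum B V n v - (n * s) • v) w =
    Φ v ((casimir (L := 𝔤) M).lTensor E w)

theorem isJet_zero {E₀ : Type*} [AddCommGroup E₀] [Module ℂ E₀] [LieRingModule 𝔤 E₀]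
    [LieModule ℂ 𝔤 E₀] (ξ : E₀ ≃ₗ[ℂ] ℂ) (htriv : ∀ (y : 𝔤) (e : E₀), ⁅y, e⁆ = 0) (s : ℂ)
    (ε : V →ₗ[ℂ] Dual ℂ M) (hε : ∀ (y : 𝔤) v, ε ⁅Affine.cur B 0 y, v⁆ = ⁅y, ε v⁆)
    (hε0 : ∀ v ∈ annih B V 1, ε v = 0 → v = 0) :
    IsJet B H f s 0 ((LinearMap.lcomp ℂ ℂ (contract (M := M) ξ.toLinearMap)) ∘ₗ ε) := by
  have hΦ : ∀ v e m, ((LinearMap.lcomp ℂ ℂ (contract (M := M) ξ.toLinearMap)) ∘ₗ ε) v (e ⊗ₜ m) =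
      ξ e * ε v m := by
    intro v e m
    rw [LinearMap.comp_apply, LinearMap.lcomp_apply, contract_tmul, map_smul]
    rfl
  refine ⟨ξ.symm.finiteDimensional, ?_, ?_, ?_, ?_, ?_, ?_⟩
  · rw [IsWeightModule, eq_top_iff]
    intro e _
    refine Submodule.subset_span ⟨0, zero_mem _, fun h ↦ ?_⟩
    rw [htriv, LinearMap.zero_apply, zero_smul]
  · refine isFinSemisimple_of_finrank_eq_one ?_
    rw [ξ.finrank_eq, Module.finrank_self]
  · intro y v
    refine TensorProduct.ext' fun e m ↦ ?_
    rw [hΦ, hε, Dual.lie_apply, Dual.lie_apply, TensorProduct.LieModule.lie_tmul_right, htriv,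
      TensorProduct.zero_tmul, zero_add, hΦ, mul_neg]
  · intro v hv
    rw [annih_zero, Submodule.mem_bot] at hv
    rw [hv, map_zero]
  · intro v hv h
    rw [hε0 v hv]
    · exact zero_mem _
    · ext m
      have := LinearMap.congr_fun h (ξ.symm 1 ⊗ₜ m)
      rwa [hΦ, LinearEquiv.apply_symm_apply, one_mul] at this
  · intro v _ w
    induction w using TensorProduct.induction_on with
    | zero => simp
    | add x y hx hy => rw [map_add, map_add, map_add, hx, hy]
    | tmul e m =>
      rw [LinearMap.lTensor_tmul, hΦ, hΦ, sugSum, Finset.sum_range_zero, smul_zero, add_zero,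
        Nat.cast_zero, zero_mul, zero_smul, sub_zero, map_sug_zero ε hε]

/-- Everything is inherited through one application of `x t`, which lowers the order by one and
shifts the Sugawara operator by `s = 2 c k + 1`; hence the multiple `n s` after `n` applications. -/
theorem IsJet.succ (b : (rootSystem H).Base) (hf : IsReductiveIn f) {k : ℂ}
    (hk : ∀ v : V, ⁅Affine.K B, v⁆ = k • v) {c : ℂ}
    (hB : B.form = c • killingForm ℂ 𝔤) {n : ℕ} {Φ : V →ₗ[ℂ] Dual ℂ (E ⊗[ℂ] M)}
    (h : IsJet B H f (2 * c * k + 1) n Φ) :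
    IsJet B H f (2 * c * k + 1) (n + 1) (jetSucc B Φ) := by
  have := h.finite
  have hself : IsFinSemisimple f 𝔤 := by
    have : ComplementedLattice (LieSubmodule ℂ f 𝔤) := hf
    exact isFinSemisimple_of_complementedLattice
  refine ⟨inferInstance, (isWeightModule_self b).tensor h.isWeightModule,
    hself.tensor_of_isReductiveIn hf h.isFinSemisimple LieModuleHom.id Function.surjective_id,
    ?_, ?_, ?_, ?_⟩
  · intro y v
    refine TensorProduct.ext_threefold fun x e m ↦ ?_
    rw [jetSucc_tmul, Dual.lie_apply, TensorProduct.LieModule.lie_tmul_right,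
      TensorProduct.LieModule.lie_tmul_right, TensorProduct.add_tmul, map_add, map_add,
      jetSucc_tmul, jetSucc_tmul, jetSucc_tmul, leibniz_lie, Affine.lie_cur_cur,
      if_neg (by norm_num), zero_smul, add_zero, map_add, h.map_lie, LinearMap.add_apply,
      Dual.lie_apply, TensorProduct.LieModule.lie_tmul_right, map_add, add_zero, ← lie_skew y x,
      map_neg, neg_lie, map_neg, LinearMap.neg_apply]
    ring
  · intro v hv
    refine TensorProduct.ext_threefold fun x e m ↦ ?_
    rw [jetSucc_tmul, h.map_eq_zero _ (cur_one_mem_annih x hv)]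
    rfl
  · intro v hv hv0
    refine mem_annih_succ B fun x ↦ h.mem_annih _ (cur_one_mem_annih x hv) ?_
    refine TensorProduct.ext' fun e m ↦ ?_
    rw [← jetSucc_tmul, hv0]
    rfl
  · intro v hv w
    induction w using TensorProduct.induction_on with
    | zero => simp
    | add x y hx hy => rw [map_add, map_add, map_add, hx, hy]
    | tmul w m =>
      induction w using TensorProduct.induction_on with
      | zero => simp
      | add x y hx hy => rw [TensorProduct.add_tmul, map_add, map_add, map_add, hx, hy]
      | tmul x e =>
        rw [LinearMap.lTensor_tmul, jetSucc_tmul, jetSucc_tmul, lie_sub, lie_smul,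
          cur_sugSum hk hB n x hv]
        have := h.map_sugSum _ (cur_one_mem_annih x hv) (e ⊗ₜ m)
        rw [LinearMap.lTensor_tmul] at this
        rw [← this]
        congr 2
        push_cast
        module

end Jets

end AffineKM

namespace AffineKM

/-! ### Finite length of smooth modules -/

section Jets

open LieAlgebra LieAlgebra.IsKilling LieModule Module Polynomial

universe u

variable {𝔤 : Type u} [LieRing 𝔤] [LieAlgebra ℂ 𝔤] [FiniteDimensional ℂ 𝔤] [IsSimple ℂ 𝔤]
  {B : InvForm 𝔤} {V : Type*} [AddCommGroup V] [Module ℂ V] [LieRingModule (Affine B) V]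
  [LieModule ℂ (Affine B) V]
  {M : Type*} [AddCommGroup M] [Module ℂ M] [LieRingModule 𝔤 M] [LieModule ℂ 𝔤 M]
  {E : Type*} [AddCommGroup E] [Module ℂ E] [LieRingModule 𝔤 E] [LieModule ℂ 𝔤 E]
  {H : LieSubalgebra ℂ 𝔤} [H.IsCartanSubalgebra] {f : LieSubalgebra ℂ 𝔤}

variable (B V) in
/-- The operator on smooth vectors which corresponds to `casDiff` on jets of order `n`. -/
def jetOp (s : ℂ) (n : ℕ) : Module.End ℂ V := sug B V 0 - sugSum B V n + (n * s) • 1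

theorem jetOp_mem_annih (s : ℂ) (n j : ℕ) {v : V} (hv : v ∈ annih B V j) :
    jetOp B V s n v ∈ annih B V j :=
  add_mem (sub_mem (sug_mem_annih _ _ hv) (sugSum_mem_annih _ _ hv)) (Submodule.smul_mem _ _ hv)

theorem IsJet.map_jetOp {s : ℂ} {n : ℕ} {Φ : V →ₗ[ℂ] Dual ℂ (E ⊗[ℂ] M)}
    (h : IsJet B H f s n Φ) {v : V} (hv : v ∈ annih B V (n + 1)) (w : E ⊗[ℂ] M) :
    Φ (jetOp B V s n v) w = Φ v (casDiff 𝔤 E M w) := by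
  have e : jetOp B V s n v = sug B V 0 v - (sugSum B V n v - (n * s) • v) := by
    rw [jetOp, LinearMap.add_apply, LinearMap.sub_apply, LinearMap.smul_apply, Module.End.one_apply]
    abel
  rw [e, map_sub, LinearMap.sub_apply, map_sug_zero Φ h.map_lie, h.map_sugSum v hv, casDiff,
    LinearMap.sub_apply, map_sub]

theorem IsJet.aeval_jetOp {s : ℂ} {n : ℕ} {Φ : V →ₗ[ℂ] Dual ℂ (E ⊗[ℂ] M)}
    (h : IsJet B H f s n Φ) (p : ℂ[X]) {v : V} (hv : v ∈ annih B V (n + 1)) :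
    aeval (jetOp B V s n) p v ∈ annih B V (n + 1) ∧
      ∀ w, Φ (aeval (jetOp B V s n) p v) w = Φ v (aeval (casDiff 𝔤 E M) p w) := by
  induction p using Polynomial.induction_on generalizing v with
  | C a =>
    refine ⟨?_, fun w ↦ ?_⟩
    · rw [aeval_C]
      exact Submodule.smul_mem _ a hv
    · rw [aeval_C, aeval_C]
      change Φ (a • v) w = Φ v (a • w)
      rw [map_smul, map_smul]
      rfl
  | add p q hp hq =>
    refine ⟨?_, fun w ↦ ?_⟩
    · rw [map_add, LinearMap.add_apply]
      exact add_mem (hp hv).1 (hq hv).1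
    · rw [map_add, LinearMap.add_apply, map_add, LinearMap.add_apply, (hp hv).2, (hq hv).2, map_add,
        LinearMap.add_apply, map_add]
  | monomial m a ih =>
    have e : ∀ {A : Type _} [Ring A] [Algebra ℂ A] (T : A),
        aeval T (C a * X ^ (m + 1)) = aeval T (C a * X ^ m) * T := by
      intro A _ _ T
      rw [pow_succ, ← mul_assoc, map_mul, aeval_X]
    have e' : ∀ T : Module.End ℂ (E ⊗[ℂ] M),
        aeval T (C a * X ^ (m + 1)) = T * aeval T (C a * X ^ m) := by
      intro T
      rw [pow_succ, ← mul_assoc, mul_comm, map_mul, aeval_X]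
    have h1 := ih (jetOp_mem_annih s n (n + 1) hv)
    refine ⟨?_, fun w ↦ ?_⟩
    · rw [e, Module.End.mul_apply]
      exact h1.1
    · rw [e, Module.End.mul_apply, h1.2, h.map_jetOp hv, e', Module.End.mul_apply]

/-- On jets, a polynomial in `jetOp` is the transpose of the same polynomial in `casDiff`; an
annihilating polynomial therefore lowers the order. -/
theorem IsJet.aeval_mem {s : ℂ} {n : ℕ} {Φ : V →ₗ[ℂ] Dual ℂ (E ⊗[ℂ] M)}
    (h : IsJet B H f s n Φ) {p : ℂ[X]} (hp : aeval (casDiff 𝔤 E M) p = 0) {v : V}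
    (hv : v ∈ annih B V (n + 1)) : aeval (jetOp B V s n) p v ∈ annih B V n := by
  obtain ⟨h1, h2⟩ := h.aeval_jetOp p hv
  refine h.mem_annih _ h1 (LinearMap.ext fun w ↦ ?_)
  rw [h2, hp, LinearMap.zero_apply, map_zero, LinearMap.zero_apply]

/-- Modulo a submodule which contains the vectors of lower order, the operator is a scalar. -/
theorem aeval_jetOp_sub_mem {W W' : LieSubmodule ℂ (Affine B) V} {n : ℕ}
    (hW : ∀ v ∈ W', v ∈ annih B V n → v ∈ W) (s : ℂ) (p : ℂ[X]) {v : V} (hv : v ∈ W')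
    (hvn : v ∈ annih B V (n + 1)) :
    aeval (jetOp B V s n) p v - p.eval (n * s) • v ∈ W := by
  -- The zero modes cancel in `jetOp`, leaving `n s` and operators that begin with a positive mode
  -- and so map into `W`.
  have key : ∀ v ∈ W', v ∈ annih B V (n + 1) → jetOp B V s n v - (n * s) • v ∈ W := by
    intro v hv hvn
    have e : jetOp B V s n v - (n * s) • v =
        -((2 : ℂ) • ∑ j ∈ Finset.range n, sug B V (j + 1) v) := by
      simp only [jetOp, sugSum, LinearMap.add_apply, LinearMap.sub_apply, LinearMap.smul_apply,
        Module.End.one_apply, LinearMap.sum_apply]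
      abel
    rw [e]
    exact neg_mem (W.smul_mem _ (sum_mem fun j _ ↦ sug_succ_mem hW j hv hvn))
  have stab : ∀ v ∈ W, jetOp B V s n v ∈ W := by
    intro v hv
    rw [jetOp, sugSum]
    simp only [LinearMap.add_apply, LinearMap.sub_apply, LinearMap.smul_apply,
        Module.End.one_apply, LinearMap.sum_apply]
    exact add_mem (sub_mem (sug_mem W 0 hv) (add_mem (sug_mem W 0 hv)
      (W.smul_mem _ (sum_mem fun j _ ↦ sug_mem W _ hv)))) (W.smul_mem _ hv)
  induction p using Polynomial.induction_on with
  | C a =>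
    rw [aeval_C, eval_C]
    change a • v - a • v ∈ W
    rw [sub_self]
    exact zero_mem _
  | add p q hp hq =>
    rw [map_add, LinearMap.add_apply, eval_add, add_smul, add_sub_add_comm]
    exact add_mem hp hq
  | monomial m a ih =>
    have e : aeval (jetOp B V s n) (C a * X ^ (m + 1)) v =
        jetOp B V s n (aeval (jetOp B V s n) (C a * X ^ m) v) := by
      rw [pow_succ, ← mul_assoc, mul_comm, map_mul, aeval_X, Module.End.mul_apply]
    rw [e, pow_succ, ← mul_assoc, eval_mul, eval_X]
    set u := aeval (jetOp B V s n) (C a * X ^ m) v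
    set r := eval (n * s) (C a * X ^ m)
    have h1 := stab _ ih
    have h2 := W.smul_mem r (key v hv hvn)
    have h3 := add_mem h1 h2
    rw [map_sub, map_smul] at h3
    convert h3 using 1
    module

variable (B H f) in
/-- The submodule of jets of the elements of order `n` of `W`. -/
def jetImage {s : ℂ} {n : ℕ} {Φ : V →ₗ[ℂ] Dual ℂ (E ⊗[ℂ] M)} (h : IsJet B H f s n Φ)
    (W : LieSubmodule ℂ (Affine B) V) : LieSubmodule ℂ 𝔤 (finDual f (E ⊗[ℂ] M)) where
  carrier := {ζ | ∃ v ∈ W, v ∈ annih B V (n + 1) ∧ Φ v = ζ}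
  add_mem' := by
    rintro _ _ ⟨v, hv, hvn, hvζ⟩ ⟨w, hw, hwn, hwζ⟩
    exact ⟨v + w, add_mem hv hw, add_mem hvn hwn, by rw [map_add, hvζ, hwζ]; rfl⟩
  zero_mem' := ⟨0, zero_mem _, zero_mem _, map_zero _⟩
  smul_mem' := by
    rintro c _ ⟨v, hv, hvn, hvζ⟩
    exact ⟨c • v, W.smul_mem c hv, Submodule.smul_mem _ c hvn, by rw [map_smul, hvζ]; rfl⟩
  lie_mem := by
    rintro y _ ⟨v, hv, hvn, hvζ⟩
    exact ⟨⁅Affine.cur B 0 y, v⁆, W.lie_mem hv, cur_neg_mem_annih 0 (n + 1) y hvn, by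
      rw [h.map_lie, hvζ]; rfl⟩

theorem jetImage_mono {s : ℂ} {n : ℕ} {Φ : V →ₗ[ℂ] Dual ℂ (E ⊗[ℂ] M)} (h : IsJet B H f s n Φ) :
    Monotone (jetImage B H f h) := by
  rintro W W' hle _ ⟨v, hv, h⟩
  exact ⟨v, hle hv, h⟩

theorem IsJet.mem_finDual {s : ℂ} {n : ℕ} {Φ : V →ₗ[ℂ] Dual ℂ (E ⊗[ℂ] M)} (h : IsJet B H f s n Φ)
    (hfin : ∀ v : V, ∃ U : Submodule ℂ V, FiniteDimensional ℂ U ∧ v ∈ U ∧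
      ∀ x ∈ f, ∀ u ∈ U, ⁅Affine.cur B 0 x, u⁆ ∈ U) (v : V) : Φ v ∈ finDual f (E ⊗[ℂ] M) := by
  obtain ⟨U, hU, hv, hUf⟩ := hfin v
  refine ⟨U.map Φ, inferInstance, Submodule.mem_map_of_mem hv, ?_⟩
  rintro x hx _ ⟨u, hu, rfl⟩
  exact ⟨⁅Affine.cur B 0 x, u⁆, hUf x hx u hu, h.map_lie x u⟩

theorem mem_sup_of_jetImage_eq {s : ℂ} {n : ℕ} {Φ : V →ₗ[ℂ] Dual ℂ (E ⊗[ℂ] M)}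
    (h : IsJet B H f s n Φ)
    (hfin : ∀ v : V, ∃ U : Submodule ℂ V, FiniteDimensional ℂ U ∧ v ∈ U ∧
      ∀ x ∈ f, ∀ u ∈ U, ⁅Affine.cur B 0 x, u⁆ ∈ U)
    {W W' : LieSubmodule ℂ (Affine B) V} (hWW' : jetImage B H f h W = jetImage B H f h W')
    {v : V} (hv : v ∈ W') (hvn : v ∈ annih B V (n + 1)) : ∃ w ∈ W, v - w ∈ annih B V n := by
  have h1 : (⟨Φ v, h.mem_finDual hfin v⟩ : finDual f (E ⊗[ℂ] M)) ∈ jetImage B H f h W' :=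
    ⟨v, hv, hvn, rfl⟩
  rw [← hWW'] at h1
  obtain ⟨w, hw, hwn, hwv⟩ := h1
  refine ⟨w, hw, h.mem_annih _ (sub_mem hvn hwn) ?_⟩
  rw [map_sub, hwv, sub_self]

theorem exists_isJet (b : (rootSystem H).Base) (hf : IsReductiveIn f) {k : ℂ}
    (hk : ∀ v : V, ⁅Affine.K B, v⁆ = k • v) {c : ℂ} (hB : B.form = c • killingForm ℂ 𝔤)
    (ε : V →ₗ[ℂ] Dual ℂ M) (hε : ∀ (y : 𝔤) v, ε ⁅Affine.cur B 0 y, v⁆ = ⁅y, ε v⁆)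
    (hε0 : ∀ v ∈ annih B V 1, ε v = 0 → v = 0) (n : ℕ) :
    ∃ (E : Type u) (_ : AddCommGroup E) (_ : Module ℂ E) (_ : LieRingModule 𝔤 E)
      (_ : LieModule ℂ 𝔤 E) (Φ : V →ₗ[ℂ] Dual ℂ (E ⊗[ℂ] M)),
      IsJet B H f (2 * c * k + 1) n Φ := by
  induction n with
  | zero =>
    exact ⟨TrivialLieModule ℂ 𝔤 (ULift.{u} ℂ), inferInstance, inferInstance, inferInstance,
      inferInstance, _, isJet_zero ((TrivialLieModule.equiv ℂ 𝔤 (ULift.{u} ℂ)).trans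
        ULift.moduleEquiv) (fun y e ↦ trivial_lie_zero _ _ y e) _ ε hε hε0⟩
  | succ n ih =>
    obtain ⟨E, _, _, _, _, Φ, h⟩ := ih
    exact ⟨𝔤 ⊗[ℂ] E, inferInstance, inferInstance, inferInstance, inferInstance, _,
      h.succ b hf hk hB⟩

end Jets

end AffineKM

namespace AffineKM

/-! ### Only finitely many layers matter. -/

section FiniteLength

open LieAlgebra LieAlgebra.IsKilling LieModule Module Polynomial

/-- The numbers `n s`, for `s` not a nonnegative real number, are far from squares. -/
theorem NearSquares.exists_eval_ne_zero {C : ℝ} (hC : 0 ≤ C) {s : ℂ}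
    (hs : ∀ r : ℝ, 0 ≤ r → s ≠ r) :
    ∃ n₀ : ℕ, ∀ n ≥ n₀, ∀ q : ℂ[X], NearSquares C q → q.eval (n * s) ≠ 0 := by
  -- The ray through `s` leaves the nonnegative half-line at a positive angle: `δ` is `-s` for
  -- negative real `s` and `|Im s|` otherwise.
  obtain ⟨δ, hδ, h⟩ : ∃ δ : ℝ, 0 < δ ∧ ∀ μ y : ℝ, 0 ≤ μ → 0 ≤ y → δ * μ ≤ ‖μ * s - y‖ := by
    by_cases him : s.im = 0
    · have hre : s.re < 0 := by
        by_contra hre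
        exact hs s.re (not_lt.1 hre) (Complex.ext rfl (by simp [him]))
      refine ⟨-s.re, by linarith, fun μ y hμ hy ↦ ?_⟩
      have h1 := Complex.abs_re_le_norm (μ * s - y)
      have h2 : (μ * s - y : ℂ).re = μ * s.re - y := by simp
      rw [h2] at h1
      have h3 := neg_abs_le (μ * s.re - y)
      linarith
    · refine ⟨|s.im|, abs_pos.2 him, fun μ y hμ hy ↦ ?_⟩
      have h1 := Complex.abs_im_le_norm (μ * s - y)
      have h2 : (μ * s - y : ℂ).im = μ * s.im := by simp
      rw [h2, abs_mul, abs_of_nonneg hμ] at h1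
      linarith
  -- If `n s` is a root near `x²`, then `δ n ≤ C x` and `x² ≤ C x + n ‖s‖`. Together these give `x ≤
  -- S`, so `n` is at most `C S / δ`.
  set S := C * (1 + ‖s‖ / δ)
  obtain ⟨n₀, hn₀⟩ := exists_nat_gt (C * S / δ)
  refine ⟨n₀, fun n hn q hq h0 ↦ ?_⟩
  obtain ⟨x, hx, hxn⟩ := hq.2 _ h0
  have h1 := h n (x ^ 2) (Nat.cast_nonneg n) (sq_nonneg x)
  have h2 : ‖((n : ℝ) * s - (x ^ 2 : ℝ) : ℂ)‖ ≤ C * x := by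
    simpa using hxn
  have h3 : δ * n ≤ C * x := h1.trans h2
  have h4 : x ^ 2 ≤ C * x + n * ‖s‖ := by
    have h5 : ‖((x ^ 2 : ℝ) : ℂ)‖ ≤ ‖((n : ℝ) * s - (x ^ 2 : ℝ) : ℂ)‖ + ‖((n : ℝ) * s : ℂ)‖ := by
      have := norm_sub_le ((n : ℝ) * s : ℂ) ((n : ℝ) * s - (x ^ 2 : ℝ) : ℂ)
      rw [sub_sub_cancel] at this
      linarith
    rw [Complex.norm_real, norm_mul, Complex.norm_real, Real.norm_of_nonneg (sq_nonneg x),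
      Real.norm_of_nonneg (Nat.cast_nonneg n)] at h5
    linarith
  have h6 : n * ‖s‖ ≤ C * x * (‖s‖ / δ) := by
    have : (n : ℝ) ≤ C * x / δ := by rw [le_div_iff₀ hδ]; linarith
    calc n * ‖s‖ ≤ C * x / δ * ‖s‖ := by gcongr
      _ = _ := by ring
  have h7 : x ≤ S := by
    rcases hx.eq_or_lt with rfl | hx
    · positivity
    · refine le_of_mul_le_mul_right ?_ hx
      calc x * x = x ^ 2 := by ring
        _ ≤ C * x + C * x * (‖s‖ / δ) := by linarith
        _ = S * x := by ring
  have h8 : (n₀ : ℝ) ≤ n := by exact_mod_cast hn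
  have h9 : C * S / δ < n := by linarith
  rw [div_lt_iff₀ hδ] at h9
  have : C * x ≤ C * S := by gcongr
  linarith

universe u

variable {𝔤 : Type u} [LieRing 𝔤] [LieAlgebra ℂ 𝔤] [FiniteDimensional ℂ 𝔤] [IsSimple ℂ 𝔤]
  {B : InvForm 𝔤} {V : Type*} [AddCommGroup V] [Module ℂ V] [LieRingModule (Affine B) V]
  [LieModule ℂ (Affine B) V]
  {M : Type*} [AddCommGroup M] [Module ℂ M] [LieRingModule 𝔤 M] [LieModule ℂ 𝔤 M]
  {H : LieSubalgebra ℂ 𝔤} [H.IsCartanSubalgebra] {f : LieSubalgebra ℂ 𝔤}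

/-- The smooth part of a locally `f`-finite module of level `k` has finite length, provided that its
vectors of order one are functionals on an admissible module. -/
theorem hasFiniteLength_smoothPart (b : (rootSystem H).Base) (hf : IsReductiveIn f) {k : ℂ}
    (hk : ∀ v : V, ⁅Affine.K B, v⁆ = k • v) {c : ℂ} (hB : B.form = c • killingForm ℂ 𝔤)
    (hs : ∀ r : ℝ, 0 ≤ r → 2 * c * k + 1 ≠ r)
    (ε : V →ₗ[ℂ] Dual ℂ M) (hε : ∀ (y : 𝔤) v, ε ⁅Affine.cur B 0 y, v⁆ = ⁅y, ε v⁆)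
    (hε0 : ∀ v ∈ annih B V 1, ε v = 0 → v = 0)
    (hfin : ∀ v : V, ∃ U : Submodule ℂ V, FiniteDimensional ℂ U ∧ v ∈ U ∧
      ∀ x ∈ f, ∀ u ∈ U, ⁅Affine.cur B 0 x, u⁆ ∈ U)
    (hM : HasFiniteLength 𝔤 M) (hmult : IsFinMult f M) :
    HasFiniteLength (Affine B) (smoothPart B V) := by
  set s := 2 * c * k + 1
  have hnt : Nontrivial 𝔤 := by
    obtain ⟨x, y, hxy⟩ : ∃ x y : 𝔤, ⁅x, y⁆ ≠ 0 := by
      by_contra! h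
      exact IsSimple.non_abelian (R := ℂ) (L := 𝔤) ⟨h⟩
    exact ⟨_, _, hxy⟩
  choose E i1 i2 i3 i4 Φ h using exists_isJet (H := H) b hf hk hB ε hε hε0
  obtain ⟨C, hC, hq⟩ : ∃ C : ℝ, 0 ≤ C ∧ ∀ (E : Type u) [AddCommGroup E] [Module ℂ E]
      [LieRingModule 𝔤 E] [LieModule ℂ 𝔤 E] [FiniteDimensional ℂ E],
      IsWeightModule H E (rootLattice H : Set (Module.Dual ℂ H)) →
        ∃ q : ℂ[X], NearSquares C q ∧ aeval (casDiff 𝔤 E M) q = 0 := by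
    obtain ⟨n, N, h0, hn, hN⟩ := hM
    exact exists_nearSquares_aeval b N h0 hn fun i k ↦ hmult.exists_central_scalar (hN i) k
  obtain ⟨n₀, hn₀⟩ := NearSquares.exists_eval_ne_zero hC hs
  -- Induction on the order: below `n₀` the equality of jets moves a vector of `W'` into `W` modulo
  -- lower order, and from `n₀` on no information on jets is needed.
  have key : ∀ W W' : LieSubmodule ℂ (Affine B) V, W ≤ W' →
      (∀ n < n₀, jetImage B H f (h n) W = jetImage B H f (h n) W') →
      ∀ n, ∀ v ∈ W', v ∈ annih B V n → v ∈ W := by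
    intro W W' hle hW n
    induction n with
    | zero =>
      intro v _ hv
      rw [annih_zero, Submodule.mem_bot] at hv
      rw [hv]
      exact zero_mem _
    | succ n ih =>
      intro v hv hvn
      rcases lt_or_ge n n₀ with hlt | hge
      · obtain ⟨w, hw, hvw⟩ := mem_sup_of_jetImage_eq (h n) hfin (hW n hlt) hv hvn
        have := ih _ (sub_mem hv (hle hw)) hvw
        have h2 := add_mem this hw
        rwa [sub_add_cancel] at h2
      · have := (h n).finite
        obtain ⟨q, hqC, hq0⟩ := hq (E n) (h n).isWeightModule
        have h1 := (h n).aeval_mem hq0 hvn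
        -- Taking both submodules equal to `W'` makes the hypothesis on lower order vectors empty,
        -- and the comparison shows that `q(jetOp) v` stays in `W'`.
        have h2 : aeval (jetOp B V s n) q v ∈ W' := by
          have := aeval_jetOp_sub_mem (W := W') (W' := W') (n := n) (fun v hv _ ↦ hv) s q hv hvn
          have := add_mem this (W'.smul_mem (q.eval (n * s)) hv)
          rwa [sub_add_cancel] at this
        -- `q(jetOp) v` has lower order, so it is in `W` by induction; it is also `q(n s) v` modulo
        -- `W`, and `q(n s)` is not zero.
        have h3 := sub_mem (ih _ h2 h1) (aeval_jetOp_sub_mem ih s q hv hvn)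
        rw [sub_sub_cancel] at h3
        have h4 := W.smul_mem (q.eval (n * s))⁻¹ h3
        rwa [smul_smul, inv_mul_cancel₀ (hn₀ n hge q hqC), one_smul] at h4
  -- The finitely many jet images determine a submodule among those containing it, so both chain
  -- conditions are pulled back from a finite product.
  let g : LieSubmodule ℂ (Affine B) (smoothPart B V) →
      ∀ n : Fin n₀, LieSubmodule ℂ 𝔤 (finDual f (E n ⊗[ℂ] M)) :=
    fun W n ↦ jetImage B H f (h n) (W.map (smoothPart B V).incl)
  have hg : StrictMono g := by
    intro W W' hlt
    refine lt_of_le_of_ne (fun n ↦ jetImage_mono (h n) (LieSubmodule.map_mono hlt.le)) fun heq ↦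
      hlt.not_ge fun v hv ↦ ?_
    obtain ⟨n, -, hn⟩ := v.2
    have h1 := key _ _ (LieSubmodule.map_mono hlt.le) (fun n hn ↦ congrFun heq ⟨n, hn⟩) n v
      ((LieSubmodule.mem_map _).2 ⟨v, hv, rfl⟩) hn
    obtain ⟨w, hw, hwv⟩ := (LieSubmodule.mem_map _).1 h1
    have : w = v := Subtype.ext hwv
    rwa [← this]
  have hwf := fun n ↦ by
    have := (h n).finite
    exact wellFounded_finDual_tensor hf (h n).isFinSemisimple hmult hM
  have h1 : WellFoundedLT (LieSubmodule ℂ (Affine B) (smoothPart B V)) := by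
    have : ∀ n : Fin n₀, WellFoundedLT (LieSubmodule ℂ 𝔤 (finDual f (E n ⊗[ℂ] M))) :=
      fun n ↦ (hwf n).1
    exact hg.wellFoundedLT
  have h2 : WellFoundedGT (LieSubmodule ℂ (Affine B) (smoothPart B V)) := by
    have : ∀ n : Fin n₀, WellFoundedGT (LieSubmodule ℂ 𝔤 (finDual f (E n ⊗[ℂ] M))) :=
      fun n ↦ (hwf n).2
    have h3 : WellFoundedLT (∀ n : Fin n₀, (LieSubmodule ℂ 𝔤 (finDual f (E n ⊗[ℂ] M)))ᵒᵈ) :=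
      Pi.wellFoundedLT
    have h4 : WellFoundedGT (∀ n : Fin n₀, LieSubmodule ℂ 𝔤 (finDual f (E n ⊗[ℂ] M))) := ⟨h3.wf⟩
    exact hg.wellFoundedGT
  exact hasFiniteLength_of_wellFounded

end FiniteLength

end AffineKM

namespace AffineKM

/-! ### The dual Coxeter number -/

section Coxeter

open LieAlgebra LieAlgebra.IsKilling LieModule
open scoped ComplexOrder

variable {L : Type*} [LieRing L] [LieAlgebra ℂ L] [FiniteDimensional ℂ L] [IsSimple ℂ L]
  {H : LieSubalgebra ℂ L} [H.IsCartanSubalgebra] {b : (rootSystem H).Base} {θ : H.root}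

/-- A nonzero bracket would have weight `θ + α`, which would be zero or a root; heights exclude
both. -/
theorem IsHighestRoot.isSingular (hθ : IsHighestRoot b θ) : IsSingular b (rootE θ) := by
  intro α
  by_contra h0
  have hw : IsWeightVector H (wt θ + wt α.1) ⁅rootE α.1, rootE θ⁆ :=
    IsWeightVector.lie_rootE (lie_rootE θ) α.1
  have hmem : wt θ + wt α.1 ∈ insert 0 (Set.range fun β : H.root ↦ wt β) := by
    by_contra hn
    refine h0 (hw.eq_zero_of_notMem ?_ hn)
    refine triangular_le b (fun h ↦ ?_) (fun β ↦ ?_) (fun β ↦ ?_) _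
    · exact Submodule.subset_span ⟨0, Set.mem_insert _ _, isWeightVector_cartan h⟩
    · exact Submodule.subset_span ⟨wt β.1, Set.mem_insert_of_mem _ ⟨_, rfl⟩, lie_rootE β.1⟩
    · obtain ⟨γ, hγ⟩ := exists_neg_root β.1
      refine Submodule.subset_span ⟨wt γ, Set.mem_insert_of_mem _ ⟨_, rfl⟩, fun h ↦ ?_⟩
      rw [lie_rootF]
      congr 1
      exact (congrFun hγ h).symm
  have h1 := hθ α.1
  have h2 := α.height_pos
  rcases hmem with h | ⟨β, h⟩
  · have := congr($h (htElt b))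
    rw [LinearMap.add_apply, wt_htElt, wt_htElt, LinearMap.zero_apply] at this
    norm_cast at this
    omega
  · have := congr($h (htElt b))
    have h3 := hθ β
    change wt β (htElt b) = _ at this
    rw [LinearMap.add_apply, wt_htElt, wt_htElt, wt_htElt] at this
    norm_cast at this
    omega

/-- All roots are obtained from the highest root by subtracting simple roots. -/
theorem IsHighestRoot.sub_mem_posCone (hθ : IsHighestRoot b θ) (α : H.root) :
    ∃ β ∈ posCone b, wt θ = wt α + β := by
  have htop : LieSubmodule.lieSpan ℂ L {rootE θ} = ⊤ := by
    refine (IsSimple.eq_bot_or_eq_top (R := ℂ) (LieSubmodule.lieSpan ℂ L {rootE θ})).resolve_left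
      fun h ↦ rootE_ne_zero θ ?_
    have h1 : rootE θ ∈ LieSubmodule.lieSpan ℂ L {rootE θ} := LieSubmodule.subset_lieSpan rfl
    rwa [h, LieSubmodule.mem_bot] at h1
  have h1 := hθ.isSingular.lieSpan_le_lower (lie_rootE θ)
  rw [htop] at h1
  have h2 : rootE α ∈ Submodule.span ℂ {e : L | ∃ μ ∈ {μ | ∃ β ∈ posCone b, μ = wt θ - β},
      IsWeightVector H μ e} := by
    refine (sup_le ?_ ?_ : _ ≤ Submodule.span ℂ {e : L |
      ∃ μ ∈ {μ | ∃ β ∈ posCone b, μ = wt θ - β}, IsWeightVector H μ e})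
      (h1 (show rootE α ∈ (⊤ : LieSubmodule ℂ L L) from trivial))
    · rw [Submodule.span_singleton_le_iff_mem]
      exact Submodule.subset_span ⟨wt θ, ⟨0, zero_mem _, (sub_zero _).symm⟩, lie_rootE θ⟩
    · refine Submodule.span_mono ?_
      rintro x ⟨μ, ⟨β, hβ, -, h⟩, hx⟩
      exact ⟨μ, ⟨β, hβ, h⟩, hx⟩
  by_contra! hn
  refine rootE_ne_zero α (IsWeightVector.eq_zero_of_notMem (lie_rootE α) h2 ?_)
  rintro ⟨β, hβ, h⟩
  exact hn β hβ (by rw [h, sub_add_cancel])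

theorem wt_reflectionPerm (α β : H.root) : wt ((rootSystem H).reflectionPerm β α) =
    wt α - wt α ((rootSystem H).coroot β) • wt β := by
  have h := (rootSystem H).root_reflectionPerm β α
  rw [RootPairing.reflection_apply] at h
  exact h

theorem normSq_reflectionPerm (α β : H.root) :
    wt ((rootSystem H).reflectionPerm β α)
      ((cartanEquivDual H).symm (wt ((rootSystem H).reflectionPerm β α))) =
    wt α ((cartanEquivDual H).symm (wt α)) := by
  have h1 : wt α ((cartanEquivDual H).symm (wt β)) =
      wt β ((cartanEquivDual H).symm (wt β)) / 2 * wt α ((rootSystem H).coroot β) := by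
    conv_lhs => rw [cartanEquivDual_symm_wt β, map_smul, smul_eq_mul]
  rw [wt_reflectionPerm, map_sub, map_smul, LinearMap.sub_apply, LinearMap.smul_apply, map_sub,
    map_sub, map_smul, map_smul, cartanEquivDual_symm_comm (wt β) (wt α), h1]
  simp only [smul_eq_mul]
  ring

/-- Among the roots of the same length as `α` take `γ` of greatest height. Simple reflections cannot
raise it, so it is dominant, and with `β = θ - γ` in the positive cone `(θ, θ) - (γ, γ) = (γ, β) +
(θ, β)` is nonnegative. -/
theorem normSq_le (hθ : IsHighestRoot b θ) (α : H.root) :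
    wt α ((cartanEquivDual H).symm (wt α)) ≤ wt θ ((cartanEquivDual H).symm (wt θ)) := by
  have hne : Nonempty {γ : H.root // wt γ ((cartanEquivDual H).symm (wt γ)) =
      wt α ((cartanEquivDual H).symm (wt α))} := ⟨⟨α, rfl⟩⟩
  obtain ⟨⟨γ, hγ⟩, hmax⟩ := Finite.exists_max
    (α := {γ : H.root // wt γ ((cartanEquivDual H).symm (wt γ)) =
      wt α ((cartanEquivDual H).symm (wt α))})
    (fun γ ↦ b.height γ.1)
  have hdom : IsDominant b (wt γ) := by
    intro β hβ
    have h1 : b.height ((rootSystem H).reflectionPerm β γ) ≤ b.height γ :=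
      hmax ⟨(rootSystem H).reflectionPerm β γ, by rw [normSq_reflectionPerm, hγ]⟩
    have h2 := congr($(wt_reflectionPerm γ β) (htElt b))
    rw [LinearMap.sub_apply, LinearMap.smul_apply, wt_htElt, wt_htElt, wt_htElt,
      RootPairing.Base.height_one_of_mem_support hβ, Int.cast_one, smul_eq_mul, mul_one] at h2
    have h3 : wt γ ((rootSystem H).coroot β) =
        ((b.height γ - b.height ((rootSystem H).reflectionPerm β γ) : ℤ) : ℂ) := by
      push_cast
      rw [h2]
      ring
    rw [h3]
    exact_mod_cast sub_nonneg.2 h1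
  have hdomθ : IsDominant b (wt θ) := hθ.isSingular.isDominant (lie_rootE θ) (rootE_ne_zero θ)
  obtain ⟨β, hβ, h⟩ := hθ.sub_mem_posCone γ
  have h1 := add_nonneg (hdom.nonneg hβ) (hdomθ.nonneg hβ)
  rw [← hγ, ← sub_nonneg]
  convert h1 using 1
  have hβ' : β = wt θ - wt γ := by rw [h, add_sub_cancel_left]
  rw [hβ', map_sub, map_sub, map_sub, cartanEquivDual_symm_comm (wt γ) (wt θ)]
  ring

theorem killingLongNormSq_eq (hθ : IsHighestRoot b θ) :
    (killingLongNormSq H : ℂ) = wt θ ((cartanEquivDual H).symm (wt θ)) := by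
  have h1 : killingLongNormSq H = killingNormSq H θ := by
    have hne : Nonempty H.root := ⟨θ⟩
    refine le_antisymm (ciSup_le fun α ↦ ?_) (le_ciSup (Set.finite_range _).bddAbove θ)
    exact (Complex.le_def.1 (normSq_le hθ α)).1
  rw [h1]
  refine Complex.ext rfl ?_
  rw [Complex.ofReal_im]
  exact (Complex.lt_def.1 (normSq_pos θ)).2

theorem killingLongNormSq_pos (hθ : IsHighestRoot b θ) : 0 < killingLongNormSq H := by
  have := normSq_pos θ
  rw [← killingLongNormSq_eq hθ] at this
  exact_mod_cast this

theorem twoRho_coroot_eq (b : (rootSystem H).Base) (α : H.root) :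
    twoRho b ((rootSystem H).coroot α) = 2 * b.flip.height α := by
  obtain ⟨f, -, -, hf⟩ := b.flip.exists_root_eq_sum_int α
  rw [b.flip.height_eq_sum hf]
  have hf' : (rootSystem H).coroot α = ∑ j ∈ b.support, f j • (rootSystem H).coroot j := hf
  rw [hf', map_sum, Int.cast_sum, Finset.mul_sum]
  refine Finset.sum_congr rfl fun j hj ↦ ?_
  rw [map_zsmul, twoRho_coroot b hj, zsmul_eq_mul, mul_comm]

/-- The dual Coxeter number is the inverse of the squared length of the long roots with respect to
the Killing form. -/
theorem killingLongNormSq_mul_dualCoxeterNumber (hθ : IsHighestRoot b θ) :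
    (killingLongNormSq H : ℂ) * dualCoxeterNumber b θ = 1 := by
  -- The Casimir operator of the adjoint representation is the identity, and on the highest root
  -- vector it is `(θ, θ) + (2ρ, θ) = (θ, θ) (1 + ⟨ρ, θ^∨⟩)`.
  have h1 := hθ.isSingular.casimir (lie_rootE θ)
  rw [casimir_self] at h1
  have h2 : casVal b (wt θ) = 1 := by
    have h3 : (casVal b (wt θ) - 1) • rootE θ = 0 := by rw [sub_smul, ← h1, one_smul, sub_self]
    exact sub_eq_zero.1 ((smul_eq_zero.1 h3).resolve_right (rootE_ne_zero θ))
  have h4 : twoRho b ((cartanEquivDual H).symm (wt θ)) =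
      wt θ ((cartanEquivDual H).symm (wt θ)) / 2 * (2 * b.flip.height θ) := by
    conv_lhs => rw [cartanEquivDual_symm_wt θ, map_smul, smul_eq_mul, twoRho_coroot_eq]
  rw [casVal_eq, h4] at h2
  rw [killingLongNormSq_eq hθ, dualCoxeterNumber, ← h2]
  push_cast
  ring

end Coxeter

end AffineKM

namespace AffineKM

/-! ### Induced modules and their duals -/

section InducedModule

open LieAlgebra Module

variable {𝔤 : Type*} [LieRing 𝔤] [LieAlgebra ℂ 𝔤] (B : InvForm 𝔤)
  (M : Type*) [AddCommGroup M] [Module ℂ M] [LieRingModule (Current 𝔤) M]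
  [LieModule ℂ (Current 𝔤) M] (k : ℂ)

/-- The embedding of `M` in the induced module. -/
def Induced.of : M →ₗ[ℂ] Induced B M k where
  toFun m := (inducedRelations B M k).mkQ (1 ⊗ₜ m)
  map_add' m m' := by
    rw [TensorProduct.tmul_add, map_add]
    rfl
  map_smul' c m := by
    rw [TensorProduct.tmul_smul]
    rfl

variable {B M k}

theorem Induced.lie_of (y : Current 𝔤) (z : ℂ) (m : M) :
    ⁅Current.toAffine B y + z • Affine.K B, Induced.of B M k m⁆ =
      Induced.of B M k (⁅y, m⁆ + (z * k) • m) := by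
  refine (Submodule.Quotient.eq _).2 (Submodule.subset_span ⟨1, y, z, m, ?_⟩)
  beta_reduce
  rw [one_mul, TensorProduct.smul_tmul', smul_eq_mul, mul_one]

theorem Induced.eq_top_of_mem (N : LieSubmodule ℂ (Affine B) (Induced B M k))
    (hN : ∀ m, Induced.of B M k m ∈ N) (v : Induced B M k) : v ∈ N := by
  have key : ∀ (u : UAffine B), ∀ x ∈ N, u • x ∈ N := by
    intro u
    induction u using env_induction with
    | algebraMap r => intro x hx; rw [algebraMap_smul]; exact N.smul_mem r hx
    | ι y => intro x hx; exact N.lie_mem (x := y) hx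
    | mul a b ha hb => intro x hx; rw [mul_smul]; exact ha _ (hb x hx)
    | add a b ha hb => intro x hx; rw [add_smul]; exact add_mem (ha x hx) (hb x hx)
  obtain ⟨w, rfl⟩ := Submodule.mkQ_surjective _ v
  induction w using TensorProduct.induction_on with
  | zero => rw [map_zero]; exact zero_mem _
  | add x y hx hy => rw [map_add]; exact add_mem hx hy
  | tmul u m =>
    have : (inducedRelations B M k).mkQ (u ⊗ₜ m) = u • Induced.of B M k m := by
      change _ = u • (inducedRelations B M k).mkQ (1 ⊗ₜ m)
      rw [← map_smul, TensorProduct.smul_tmul', smul_eq_mul, mul_one]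
    rw [this]
    exact key u _ (hN m)

theorem Induced.lie_K (v : Induced B M k) : ⁅Affine.K B, v⁆ = k • v := by
  let N : LieSubmodule ℂ (Affine B) (Induced B M k) :=
    { carrier := {v | ⁅Affine.K B, v⁆ = k • v}
      add_mem' := fun {v w} hv hw ↦ by
        change ⁅Affine.K B, v + w⁆ = k • (v + w)
        rw [lie_add, smul_add, show ⁅Affine.K B, v⁆ = _ from hv, show ⁅Affine.K B, w⁆ = _ from hw]
      zero_mem' := by
        change ⁅Affine.K B, (0 : Induced B M k)⁆ = k • 0
        rw [lie_zero, smul_zero]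
      smul_mem' := fun c v hv ↦ by
        change ⁅Affine.K B, c • v⁆ = k • c • v
        rw [lie_smul, show ⁅Affine.K B, v⁆ = _ from hv, smul_comm]
      lie_mem := fun {y v} hv ↦ by
        change ⁅Affine.K B, ⁅y, v⁆⁆ = k • ⁅y, v⁆
        rw [leibniz_lie, ← lie_skew, Affine.lie_K, neg_zero, zero_lie, zero_add,
          show ⁅Affine.K B, v⁆ = _ from hv, lie_smul] }
  refine Induced.eq_top_of_mem N (fun m ↦ ?_) v
  have := Induced.lie_of (B := B) (k := k) 0 1 m
  rw [map_zero, zero_add, one_smul, zero_lie, zero_add, one_mul, map_smul] at this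
  exact this

theorem Current.toAffine_const (y : 𝔤) : Current.toAffine B (Current.const 𝔤 y) = Affine.cur B 0 y :=
  Current.toAffine_monomial B 0 y

theorem Induced.lie_cur_zero (y : 𝔤) (m : M) :
    ⁅Affine.cur B 0 y, Induced.of B M k m⁆ = Induced.of B M k ⁅Current.const 𝔤 y, m⁆ := by
  have := Induced.lie_of (B := B) (k := k) (Current.const 𝔤 y) 0 m
  rwa [zero_smul, add_zero, zero_mul, zero_smul, add_zero, Current.toAffine_const] at this

/-- The induced module is generated from `M` by the negative modes. -/
theorem Induced.eq_zero_of_vanish (η : Dual ℂ (Induced B M k))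
    (h0 : ∀ m, η (Induced.of B M k m) = 0)
    (hn : ∀ (j : ℕ) (x : 𝔤) v, 1 ≤ j → η ⁅Affine.cur B (-j) x, v⁆ = 0) : η = 0 := by
  let n : Submodule ℂ (Affine B) := Submodule.span ℂ {y | ∃ (j : ℕ) (x : 𝔤), 1 ≤ j ∧
    Affine.cur B (-j) x = y}
  let p : Submodule ℂ (Affine B) := LinearMap.range (Current.toAffine B) ⊔ (ℂ ∙ Affine.K B)
  have hnp : n ⊔ p = ⊤ := by
    rw [eq_top_iff]
    intro y _
    induction y using Affine.induction with
    | hcur m x =>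
      obtain ⟨j, rfl | rfl⟩ := m.eq_nat_or_neg
      · exact Submodule.mem_sup_right (Submodule.mem_sup_left ⟨_, Current.toAffine_monomial B j x⟩)
      · rcases Nat.eq_zero_or_pos j with rfl | hj
        · exact Submodule.mem_sup_right (Submodule.mem_sup_left ⟨_, Current.toAffine_monomial B 0 x⟩)
        · exact Submodule.mem_sup_left (Submodule.subset_span ⟨j, x, hj, rfl⟩)
    | hK c =>
      exact Submodule.mem_sup_right (Submodule.mem_sup_right
        (Submodule.smul_mem _ c (Submodule.mem_span_singleton_self _)))
    | hadd y z hy hz => exact add_mem (hy trivial) (hz trivial)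
  -- The negative modes are one half and `𝔤[t] ⊕ ℂ K` is the other, which stabilizes the image of
  -- `M`. The kernel of `η` contains everything the negative modes produce, hence it is stable under
  -- them.
  have h := lieSpan_le_of_triangular hnp (M₀ := LinearMap.range (Induced.of B M k))
    (S := LinearMap.ker η) ?_ ?_ ?_
  · ext v
    refine h (Induced.eq_top_of_mem _ (fun m ↦ LieSubmodule.subset_lieSpan
      (LinearMap.mem_range_self _ m)) v)
  · rintro x hx _ ⟨m, rfl⟩
    obtain ⟨_, ⟨y, rfl⟩, _, hz, rfl⟩ := Submodule.mem_sup.1 hx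
    obtain ⟨z, rfl⟩ := Submodule.mem_span_singleton.1 hz
    exact ⟨_, (Induced.lie_of y z m).symm⟩
  · rintro _ ⟨m, rfl⟩
    exact h0 m
  · intro x hx v _
    rw [LinearMap.mem_ker]
    induction hx using Submodule.span_induction with
    | zero => rw [zero_lie, map_zero]
    | add x y _ _ hx hy => rw [add_lie, map_add, hx, hy, add_zero]
    | smul c x _ hx => rw [smul_lie, map_smul, hx, smul_zero]
    | mem x hx =>
      obtain ⟨j, x, hj, rfl⟩ := hx
      exact hn j x v hj

end InducedModule

/-! ### The twisted restricted dual as a space of functionals. -/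

section DualInduced

open LieAlgebra Module

variable {𝔤 : Type*} [LieRing 𝔤] [LieAlgebra ℂ 𝔤] [FiniteDimensional ℂ 𝔤] {B : InvForm 𝔤}
  {𝔣 : LieSubalgebra ℂ 𝔤} {I : Type*} [AddCommGroup I] [Module ℂ I] [LieRingModule (Affine B) I]
  [LieModule ℂ (Affine B) I]

/-- The functional given by an element of the twisted restricted dual. -/
def toFunctional : Pullback (Affine.sharp B) (restrictedDual B 𝔣 I) →ₗ[ℂ] Dual ℂ I :=
  (restrictedDual B 𝔣 I).toSubmodule.subtype

theorem toFunctional_injective : Function.Injective (toFunctional (B := B) (𝔣 := 𝔣) (I := I)) :=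
  Subtype.val_injective

theorem toFunctional_lie (y : Affine B) (η : Pullback (Affine.sharp B) (restrictedDual B 𝔣 I)) :
    toFunctional ⁅y, η⁆ = ⁅Affine.sharp B y, toFunctional η⁆ := rfl

theorem sharp_cur_zero (y : 𝔤) : Affine.sharp B (Affine.cur B 0 y) = Affine.cur B 0 y := by
  rw [Affine.sharp_cur, zpow_zero, one_smul, neg_zero]

theorem exists_finite_stable (η : Pullback (Affine.sharp B) (restrictedDual B 𝔣 I)) :
    ∃ U : Submodule ℂ (Pullback (Affine.sharp B) (restrictedDual B 𝔣 I)),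
      FiniteDimensional ℂ U ∧ η ∈ U ∧ ∀ x ∈ 𝔣, ∀ u ∈ U, ⁅Affine.cur B 0 x, u⁆ ∈ U := by
  obtain ⟨W, hW, hηW, hWf⟩ := (show restrictedDual B 𝔣 I from η).2
  refine ⟨W.comap toFunctional, ?_, hηW, fun x hx u hu ↦ ?_⟩
  · refine FiniteDimensional.of_injective
      (toFunctional.restrict (p := W.comap toFunctional) (q := W) fun u hu ↦ hu) fun u v h ↦ ?_
    exact Subtype.ext (toFunctional_injective (congrArg (fun w : W ↦ (w : Dual ℂ I)) h))
  · rw [Submodule.mem_comap, toFunctional_lie, sharp_cur_zero]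
    exact hWf x hx _ hu

end DualInduced

/-! ### Verification of the finiteness criterion for the dual of an induced module. -/

section Main

open LieAlgebra Module

universe u

variable {𝔤 : Type u} [LieRing 𝔤] [LieAlgebra ℂ 𝔤] [FiniteDimensional ℂ 𝔤] [IsSimple ℂ 𝔤]
  {B : InvForm 𝔤} {𝔣 : LieSubalgebra ℂ 𝔤} {H : LieSubalgebra ℂ 𝔤} [H.IsCartanSubalgebra]
  {M : Type*} [AddCommGroup M] [Module ℂ M] [LieRingModule (Current 𝔤) M]
  [LieModule ℂ (Current 𝔤) M] {k : ℂ}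

variable (B 𝔣 M k) in
/-- Restriction of functionals on the induced module to `M`. -/
def restrictOf : Pullback (Affine.sharp B) (restrictedDual B 𝔣 (Induced B M k)) →ₗ[ℂ]
    Dual ℂ (Pullback (Current.const 𝔤) M) :=
  LinearMap.lcomp ℂ ℂ (Induced.of B M k) ∘ₗ toFunctional

/-- The criterion for smooth parts is applied with restriction of functionals to `M` as jet of order
zero. Three points need checking: the level, equivariance, and injectivity on `V(1)`. -/
theorem hasFiniteLength_dualModule (b : (IsKilling.rootSystem H).Base) (hf : IsReductiveIn 𝔣)
    {c : ℂ} (hB : B.form = c • killingForm ℂ 𝔤) (hs : ∀ r : ℝ, 0 ≤ r → 2 * c * k + 1 ≠ r)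
    (hM : IsAdmissible 𝔣 (Pullback (Current.const 𝔤) M)) :
    HasFiniteLength (Affine B) (DualModule B 𝔣 (Induced B M k)) := by
  refine hasFiniteLength_smoothPart b hf (fun η ↦ ?_) hB hs (restrictOf B 𝔣 M k) (fun y η ↦ ?_)
    (fun η hη h0 ↦ ?_) exists_finite_stable hM.1 hM.2
  · refine toFunctional_injective (LinearMap.ext fun v ↦ ?_)
    -- The sign of `♯` on `K` cancels that of the dual action, so the level `k` of the induced
    -- module is preserved.
    rw [toFunctional_lie, Affine.sharp_K, Dual.lie_apply, neg_lie, map_neg, neg_neg, Induced.lie_K,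
      map_smul, map_smul]
    rfl
  · refine LinearMap.ext fun m ↦ ?_
    change toFunctional ⁅Affine.cur B 0 y, η⁆ (Induced.of B M k m) =
      -toFunctional η (Induced.of B M k ⁅Current.const 𝔤 y, (show M from m)⁆)
    rw [toFunctional_lie, sharp_cur_zero, Dual.lie_apply]
    exact congrArg (fun v ↦ -toFunctional η v) (Induced.lie_cur_zero (M := M) y m)
  · refine toFunctional_injective ?_
    rw [map_zero]
    refine Induced.eq_zero_of_vanish _ (fun m ↦ LinearMap.congr_fun h0 m) fun j x v hj ↦ ?_
    -- A vector of order one is killed by all positive modes. After the twist this says that the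
    -- functional vanishes on the image of every negative mode, so it is determined by its values on
    -- `M`.
    have h1 := congrArg toFunctional (cur_eq_zero_of_mem_annih hj hj x hη)
    rw [toFunctional_lie, map_zero, Affine.sharp_cur] at h1
    have h2 := LinearMap.congr_fun h1 v
    rw [Dual.lie_apply, smul_lie, map_smul, LinearMap.zero_apply, neg_eq_zero] at h2
    exact (smul_eq_zero.1 h2).resolve_left (zpow_ne_zero _ (by norm_num))

end Main

end AffineKM

end

open AffineKM

theorem proposition4p10 {𝔤 : Type*} [LieRing 𝔤] [LieAlgebra ℂ 𝔤] [FiniteDimensional ℂ 𝔤]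
    [LieAlgebra.IsSimple ℂ 𝔤]
    (H : LieSubalgebra ℂ 𝔤) [H.IsCartanSubalgebra]
    (b : (LieAlgebra.IsKilling.rootSystem H).Base) (θ : H.root) (hθ : IsHighestRoot b θ)
    (𝔣 : LieSubalgebra ℂ 𝔤) (h𝔣 : IsReductiveIn 𝔣)
    (κ : ℂ) (hκ : ∀ r : ℝ, 0 ≤ r → κ ≠ (r : ℂ))
    (M : Type*) [AddCommGroup M] [Module ℂ M] [LieRingModule (Current 𝔤) M]
    [LieModule ℂ (Current 𝔤) M]
    (hM : IsAdmissible 𝔣 (Pullback (Current.const 𝔤) M)) :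
    HasFiniteLength (Affine (normalizedForm H))
      (DualModule (normalizedForm H) 𝔣
        (Induced (normalizedForm H) M (κ - dualCoxeterNumber b θ))) := by
  have hN := killingLongNormSq_mul_dualCoxeterNumber hθ
  have hpos := killingLongNormSq_pos hθ
  refine hasFiniteLength_dualModule b h𝔣 (c := ((killingLongNormSq H / 2 : ℝ) : ℂ)) rfl
    (fun r hr h ↦ ?_) hM
  -- With `N = killingLongNormSq H`, `c = N / 2` and `N h^∨ = 1`, one has `2 c (κ - h^∨) + 1 = N κ`.
  -- A nonnegative real value `r` would give `κ = r / N`.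
  refine hκ (r / killingLongNormSq H) (by positivity) ?_
  have hne : (killingLongNormSq H : ℂ) ≠ 0 := by exact_mod_cast hpos.ne'
  push_cast at h ⊢
  rw [eq_div_iff hne, ← h]
  linear_combination hN
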